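/- **Setting.** On the torus $\mathbb T=[0,2\pi]^2$ put $\mathbb Z^2_0=\mathbb Z^2\setminus\{0\}$, $k^\perp=(-k^{(2)},k^{(1)})$ and $h_k(\xi)=\frac1{2\pi}\frac{k^\perp}{|k|}e^{ik\cdot\xi}$ for $k\in\mathbb Z^2_0$. For $r\in\mathbb R$ let $\mathcal H^r$ be the space of (formal) series $v=\sum_{k\in\mathbb Z^2_0}v_kh_k$ with $v_{-k}=-\overline{v_k}$ and $\|v\|_{\mathcal H^r}^2=\sum_k|k|^{2r}|v_k|^2<\infty$; let $\langle f,g\rangle=\sum_kf_k\overline{g_k}$ be the duality bracket of $\mathcal H^{-r}$ and $\mathcal H^{r}$. Let $A=\Delta$, i.e. $(Av)_k=-|k|^2v_k$, and let $B(u,v)=P[(u\cdot\nabla)v]$ ($P$ the projection onto divergence free fields), i.e. $$B_k(u,v)=i\sum_{h\in\mathbb Z^2_0,\,h\ne k}\gamma_{h,k}u_hv_{k-h},\qquad \gamma_{h,k}=\frac1{2\pi}\frac{(h^\perp\cdot k)\,((k-h)\cdot k)}{|h||k-h||k|}.$$ Let $\mathbb Z^2_+=\{k\in\mathbb Z^2_0:k^{(1)}>0\}\cup\{k\in\mathbb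 Z^2_0:k^{(1)}=0,\ k^{(2)}>0\}$. On a complete probability space $(\Omega,\mathbb F,\mathbb P)$ let $w^H(t)=\sum_{k\in\mathbb Z^2_0}b_k^H(t)h_k$, $t\in\mathbb R$, be an $\mathcal H^0$-cylindrical fractional Brownian motion: $\{\Re b^H_k,\Im b^H_k\}_{k\in\mathbb Z^2_+}$ are independent standard real fractional Brownian motions on $\mathbb R$ with Hurst parameter $H$ (centered Gaussian processes with a.s. continuous paths and covariance $\frac12(|t|^{2H}+|s|^{2H}-|t-s|^{2H})$) and $b^H_{-k}=-\overline{b^H_k}$ for $k\in\mathbb Z^2_+$. Let $$z(t)=\int_{-\infty}^te^{(t-s)A}dw^H(s),\qquad\text{i.e.}\qquad z_k(t)=\int_{-\infty}^te^{-|k|^2(t-s)}\,db^H_k(s),$$ be the stationary Stokes process (improper pathwise Riemann–Stieltjes integrals, which exist for all $k$ and $t$, $\mathbb P$-a.s.). **Theorem (Global existence).** Let $\frac12<H<1$, $0<\sigma<2(H-\frac12)$ and $T>0$. For every $v_0\in\mathcal H^\sigma$ there is a process $u$ with $\mathbb P$-a.a. paths in $C([0,T];\mathcal H^\sigma)\cap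 L^2(0,T;\mathcal H^{1+\sigma})$ and $u(0)=v_0-z(0)$ which is a weak solution of $$\frac{du}{dt}=Au-B(u,u)-B(u,z)-B(z,u)-B(z,z),$$ that is, $\mathbb P$-a.s., for all $\varphi\in\mathcal H^1$ and $t\in[0,T]$ all terms of the following identity are well defined and $$\langle u(t)-u(0),\varphi\rangle-\int_0^t\langle Au,\varphi\rangle ds-\int_0^t\langle B(u,\varphi),u\rangle ds-\int_0^t\langle B(u,\varphi),z\rangle ds-\int_0^t\langle B(z,\varphi),u\rangle ds=-\int_0^t\langle B(z,z),\varphi\rangle ds .$$ Consequently the process $v=z+u$ has $\mathbb P$-a.a. paths in $C([0,T];\mathcal H^\sigma)$, satisfies $v(0)=v_0$, and is a weak solution of the stochastic Navier–Stokes equation $dv=Av\,dt-B(v,v)\,dt+dw^H$, that is, $\mathbb P$-a.s., for all $\varphi\in\mathcal H^{2-\sigma}$ and $t\in[0,T]$ all terms of the following identity are well defined and $$\langle v(t)-v_0,\varphi\rangle-\int_0^t\langle Av,\varphi\rangle ds-\int_0^t\langle B(v,\varphi),v\rangle ds=\langle w^H(t),\varphi\rangle .$$ -/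

import Mathlib

open MeasureTheory ProbabilityTheory Filter Topology
open scoped ENNReal ComplexConjugate

noncomputable section

namespace FracNS

/-! ### Fourier indices and the spaces `H^r` -/

/-- The index set `ℤ² \ {0}`. -/
abbrev Idx : Type := {k : ℤ × ℤ // k ≠ 0}

/-- The index `-k`. -/
def Idx.opp (k : Idx) : Idx := ⟨-k.1, neg_ne_zero.mpr k.2⟩

/-- The half plane `ℤ²_+` of the indices `k` with `k₁ > 0`, or `k₁ = 0` and `k₂ > 0`. -/
def Idx.IsPlus (k : Idx) : Prop := 0 < k.1.1 ∨ (k.1.1 = 0 ∧ 0 < k.1.2)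

/-- The Euclidean scalar product on `ℤ²`, with real values. -/
def dot (h k : ℤ × ℤ) : ℝ := (h.1 : ℝ) * k.1 + (h.2 : ℝ) * k.2

/-- The rotated vector `k^⊥ = (-k₂, k₁)`. -/
def perp (k : ℤ × ℤ) : ℤ × ℤ := (-k.2, k.1)

/-- The Euclidean length `|k|`. -/
def len (k : ℤ × ℤ) : ℝ := Real.sqrt (dot k k)

/-- The family of coefficients `(v_k)`, `k ∈ ℤ² \ {0}`, of a (formal) Fourier series
`v = ∑ v_k h_k`, `h_k(ξ) = (2π)⁻¹ (k^⊥ / |k|) exp(i k · ξ)`, that is of a zero mean divergence free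
periodic vector distribution on the torus `[0,2π]²`. -/
abbrev Coeff : Type := Idx → ℂ

/-- The squared norm `‖v‖²_{H^r} = ∑ |k|^{2r} |v_k|²`, with values in `[0,∞]`. -/
def normSq (r : ℝ) (v : Coeff) : ℝ≥0∞ :=
  ∑' k : Idx, ENNReal.ofReal (len k.1 ^ (2 * r) * ‖v k‖ ^ 2)

/-- `v ∈ H^r`: the vector field is real (`v_{-k} = - conj v_k`, since `h_{-k} = - conj h_k`) and its
`H^r` norm is finite. -/
def MemH (r : ℝ) (v : Coeff) : Prop :=
  (∀ k : Idx, v k.opp = -conj (v k)) ∧ normSq r v < ∞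

/-- `f ∈ C([0,T]; H^r)`. -/
def ContPath (r T : ℝ) (f : ℝ → Coeff) : Prop :=
  (∀ t ∈ Set.Icc 0 T, MemH r (f t)) ∧
    ∀ t ∈ Set.Icc 0 T, Tendsto (fun s => normSq r (f s - f t)) (𝓝[Set.Icc 0 T] t) (𝓝 0)

/-- The path `f`, whose coefficients are measurable in time on `[0,T]`, is in `L²(0,T; H^r)`. -/
def L2Path (r T : ℝ) (f : ℝ → Coeff) : Prop :=
  (∀ k : Idx, AEMeasurable (fun t => f t k) (volume.restrict (Set.Icc 0 T))) ∧
  (∀ᵐ t ∂(volume.restrict (Set.Icc 0 T)), MemH r (f t)) ∧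
    ∫⁻ t in Set.Icc 0 T, normSq r (f t) < ∞

/-! ### The duality bracket, the Stokes operator and the bilinear term -/

/-- The series that defines the bracket `⟨f, g⟩` converges. -/
def BracketConv (f g : Coeff) : Prop := Summable fun k : Idx => f k * conj (g k)

/-- The duality bracket `⟨f, g⟩ = ∑ f_k conj g_k` between `H^{-r}` and `H^r`. -/
def bracket (f g : Coeff) : ℂ := ∑' k : Idx, f k * conj (g k)

/-- The Stokes operator `A = Δ`, with `A h_k = -|k|² h_k`. -/
def stokesA (v : Coeff) : Coeff := fun k => -((len k.1 ^ 2 : ℝ) : ℂ) * v k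

/-- The coefficient `γ_{h,k} = (2π)⁻¹ (h^⊥ · k) ((k - h) · k) / (|h| |k - h| |k|)`. -/
def gam (h k : ℤ × ℤ) : ℝ :=
  1 / (2 * Real.pi) * (dot (perp h) k * dot (k - h) k / (len h * len (k - h) * len k))

/-- The index `k - h` for `h ≠ k`. -/
def Idx.diff (k : Idx) (h : {h : Idx // h ≠ k}) : Idx :=
  ⟨k.1 - h.1.1, sub_ne_zero.mpr fun e => h.2 (Subtype.ext e.symm)⟩

/-- The general term of the series of the `k`-th coefficient of `B(u,v)`. -/
def bilTerm (u v : Coeff) (k : Idx) (h : {h : Idx // h ≠ k}) : ℂ :=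
  (gam h.1.1 k.1 : ℂ) * u h.1 * v (k.diff h)

/-- All the series of the coefficients of `B(u,v)` converge. -/
def BilConv (u v : Coeff) : Prop := ∀ k : Idx, Summable (bilTerm u v k)

/-- The bilinear term `B(u,v) = P[(u · ∇) v]`, with coefficients
`B_k(u,v) = i ∑_{h ≠ 0, k} γ_{h,k} u_h v_{k-h}`. -/
def bil (u v : Coeff) : Coeff := fun k => Complex.I * ∑' h : {h : Idx // h ≠ k}, bilTerm u v k h

/-- The trilinear expression `⟨B(u,v), w⟩` is well defined. -/
def TriConv (u v w : Coeff) : Prop := BilConv u v ∧ BracketConv (bil u v) w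

/-! ### The cylindrical fractional Brownian motion -/

/-- `X` is a standard real fractional Brownian motion on `ℝ` with Hurst parameter `H`. -/
structure IsFBM {Ω : Type*} [MeasurableSpace Ω] (H : ℝ) (X : ℝ → Ω → ℝ) (P : Measure Ω) : Prop where
  gaussian : IsGaussianProcess X P
  centered : ∀ t, ∫ ω, X t ω ∂P = 0
  covariance : ∀ s t,
    cov[X s, X t; P] = (1 / 2) * (|s| ^ (2 * H) + |t| ^ (2 * H) - |s - t| ^ (2 * H))
  continuous : ∀ᵐ ω ∂P, Continuous fun t => X t ω

/-- The real and the imaginary parts of the `b_k`, `k ∈ ℤ²_+`, as one family of real processes,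
each seen as a random path. -/
def realParts {Ω : Type*} (b : Idx → ℝ → Ω → ℂ) (p : {k : Idx // k.IsPlus} × Bool) :
    Ω → ℝ → ℝ :=
  fun ω t => if p.2 then (b p.1.1 t ω).re else (b p.1.1 t ω).im

/-- `(b_k)` are the coefficients of an `H^0`-cylindrical fractional Brownian motion
`w^H(t) = ∑ b_k(t) h_k`: the real and imaginary parts of `b_k`, `k ∈ ℤ²_+`, are i.i.d. standard
real fractional Brownian motions, and `b_{-k} = - conj b_k`, so that `w^H` is real. -/
structure IsCylFBM {Ω : Type*} [MeasurableSpace Ω] (H : ℝ) (b : Idx → ℝ → Ω → ℂ)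
    (P : Measure Ω) : Prop where
  fbm : ∀ p : {k : Idx // k.IsPlus} × Bool, IsFBM H (fun t ω => realParts b p ω t) P
  indep : iIndepFun (realParts b) P
  reflect : ∀ k : Idx, k.IsPlus → ∀ t ω, b k.opp t ω = -conj (b k t ω)

/-- The noise `w^H(t)` as a family of coefficients. -/
def noise {Ω : Type*} (b : Idx → ℝ → Ω → ℂ) (t : ℝ) (ω : Ω) : Coeff := fun k => b k t ω

/-! ### The stationary Stokes process -/

/-- `I` is the Riemann–Stieltjes integral `∫_a^c f dg`: the limit of the Riemann–Stieltjes sums over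
tagged partitions `a = p 0 ≤ ξ 0 ≤ p 1 ≤ ... ≤ p n = c` as the mesh tends to zero. -/
def HasRSIntegral (f : ℝ → ℝ) (g : ℝ → ℂ) (a c : ℝ) (I : ℂ) : Prop :=
  ∀ ε > 0, ∃ δ > 0, ∀ (n : ℕ) (p ξ : ℕ → ℝ), p 0 = a → p n = c →
    (∀ i < n, p i ≤ ξ i ∧ ξ i ≤ p (i + 1) ∧ p (i + 1) - p i < δ) →
    ‖(∑ i ∈ Finset.range n, (f (ξ i) : ℂ) * (g (p (i + 1)) - g (p i))) - I‖ ≤ ε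

/-- `I` is the improper Riemann–Stieltjes integral `∫_{-∞}^t f dg`. -/
def HasRSIntegralFromBot (f : ℝ → ℝ) (g : ℝ → ℂ) (t : ℝ) (I : ℂ) : Prop :=
  ∃ J : ℝ → ℂ, (∀ a ≤ t, HasRSIntegral f g a t (J a)) ∧ Tendsto J atBot (𝓝 I)

/-- `I` is the convolution integral `∫_{-∞}^t exp(-lam (t-s)) dg(s)`. -/
def HasExpConv (lam : ℝ) (g : ℝ → ℂ) (t : ℝ) (I : ℂ) : Prop :=
  HasRSIntegralFromBot (fun s => Real.exp (-lam * (t - s))) g t I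

open Classical in
/-- The value of `∫_{-∞}^t exp(-lam (t-s)) dg(s)` (zero if the integral does not exist). -/
def expConv (lam : ℝ) (g : ℝ → ℂ) (t : ℝ) : ℂ :=
  if h : ∃ I, HasExpConv lam g t I then h.choose else 0

/-- The stationary Stokes process `z(t) = ∫_{-∞}^t e^{(t-s)A} dw^H(s)`, with coefficients
`z_k(t) = ∫_{-∞}^t exp(-|k|² (t-s)) db_k(s)`. -/
def stokesZ {Ω : Type*} (b : Idx → ℝ → Ω → ℂ) (t : ℝ) (ω : Ω) : Coeff :=
  fun k => expConv (len k.1 ^ 2) (fun s => b k s ω) t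

/-! ### Weak solutions -/

/-- The path `u` is a weak solution on `[0,T]` of
`du/dt = A u - B(u,u) - B(u,z) - B(z,u) - B(z,z)`: for every `φ ∈ H^1` all terms of the following
identity are well defined, and it holds for every `t ∈ [0,T]`. The terms in `u` are integrated by
parts through `⟨B(a,c),φ⟩ = -⟨B(a,φ),c⟩`. -/
def IsWeakSolAux (T : ℝ) (z u : ℝ → Coeff) : Prop :=
  ∀ φ : Coeff, MemH 1 φ →
    (∀ᵐ s ∂(volume.restrict (Set.Icc 0 T)),
      BracketConv (stokesA (u s)) φ ∧ TriConv (u s) φ (u s) ∧ TriConv (u s) φ (z s) ∧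
      TriConv (z s) φ (u s) ∧ TriConv (z s) (z s) φ) ∧
    IntervalIntegrable (fun s => bracket (stokesA (u s)) φ) volume 0 T ∧
    IntervalIntegrable (fun s => bracket (bil (u s) φ) (u s)) volume 0 T ∧
    IntervalIntegrable (fun s => bracket (bil (u s) φ) (z s)) volume 0 T ∧
    IntervalIntegrable (fun s => bracket (bil (z s) φ) (u s)) volume 0 T ∧
    IntervalIntegrable (fun s => bracket (bil (z s) (z s)) φ) volume 0 T ∧
    ∀ t ∈ Set.Icc 0 T,
      BracketConv (u t - u 0) φ ∧
      bracket (u t - u 0) φ - (∫ s in (0 : ℝ)..t, bracket (stokesA (u s)) φ)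
          - (∫ s in (0 : ℝ)..t, bracket (bil (u s) φ) (u s))
          - (∫ s in (0 : ℝ)..t, bracket (bil (u s) φ) (z s))
          - (∫ s in (0 : ℝ)..t, bracket (bil (z s) φ) (u s))
        = -∫ s in (0 : ℝ)..t, bracket (bil (z s) (z s)) φ

/-- The path `v` is a weak solution on `[0,T]` of `dv = A v dt - B(v,v) dt + dw`, tested against
all `φ ∈ H^{2-σ}`: all terms of the identity are well defined, and it holds for every
`t ∈ [0,T]`. -/
def IsWeakSolNS (σ T : ℝ) (w v : ℝ → Coeff) : Prop :=
  ∀ φ : Coeff, MemH (2 - σ) φ →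
    (∀ s ∈ Set.Icc 0 T, BracketConv (stokesA (v s)) φ ∧ TriConv (v s) φ (v s)) ∧
    IntervalIntegrable (fun s => bracket (stokesA (v s)) φ) volume 0 T ∧
    IntervalIntegrable (fun s => bracket (bil (v s) φ) (v s)) volume 0 T ∧
    ∀ t ∈ Set.Icc 0 T,
      BracketConv (v t - v 0) φ ∧ BracketConv (w t) φ ∧
      bracket (v t - v 0) φ - (∫ s in (0 : ℝ)..t, bracket (stokesA (v s)) φ)
          - (∫ s in (0 : ℝ)..t, bracket (bil (v s) φ) (v s))
        = bracket (w t) φ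

end FracNS

end

open MeasureTheory ProbabilityTheory Filter Topology
open scoped ENNReal ComplexConjugate

noncomputable section

namespace FracNS

/-! ### Lattice geometry -/

/-! Subtracting the Stokes process removes the noise: u = v − z solves a Navier–Stokes equation
whose coefficients depend on z, and that equation is solved path by path. Probability enters only
through the regularity of z and of B(z,z).

Product estimates. In dimension two a product lies in ℓ² as soon as the two factors share one
derivative in total, each having a positive part of it (`conv_sq_le`). Since |γ_{h,k}| ≤ |k|, this
gives every bound on B that is needed (`normSq_bil_le`). The sign change of γ under the involution
(h, l, k) ↦ (h, −k, −l) of the triads is incompressibility, and yields ⟨B(a,c),φ⟩ = −⟨B(a,φ),c⟩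
(`bracket_bil_antisymm`).

A priori bounds. Testing the Galerkin system with u cancels B(u+z,u). What remains is linear in u
apart from the forcing B(z,z), so Gronwall bounds u in L^∞(H^0) ∩ L²(H^1) (`galerkin_energy`). The
H^σ estimate then has the Gronwall rate ‖u‖²_0 ‖u‖²_1, which is integrable by the first bound; it
therefore closes without smallness on all of [0,T] (`galerkin_bound`).

Convergence. Since σ < 2H − 1 is strict, z keeps 2ε spare derivatives, and the nonlinear term keeps
ε. Cutting the modes outside a box of size N thus costs N^{−2ε}, and `galerkin_diff` makes the
approximations Cauchy uniformly on [0,T] in H^σ. There is no compactness argument and no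
subsequence, so measurability in ω passes to the limit. The approximations themselves are measurable
because they come from Picard iterates of a truncated field; the energy bound is uniform in the
truncation, which is then removed (`exists_galerkin`).

Regularity of z. Weighted p-th moments of dyadic increments and chaining give, with β = α − 2/p < H,
a global Hölder bound with quadratic growth and random constants κ_k. The integral ∫ e^{−λ(t−s)} dg
is, by parts, an absolutely convergent integral of increments of g (`hasExpConv_convPath`), of size
λ^{−β}. With λ = |k|² this reads |z_k| ≤ C κ_k |k|^{−2β} on [0,T], and uniform moments of κ_k put z
in H^ρ for ρ + 1 < 2β. To keep all later steps free of exceptional sets, the noise is replaced by a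
version with these properties at every ω (`IsCylFBM.exists_isTame`).

The quadratic term. For H close to 1/2, z has too few derivatives for the product estimate to
control B(z,z). Independence replaces it: for fixed k the products z_h z_{k−h} are pairwise
orthogonal up to the exchange of h and k−h, because among four indices of two different such pairs
one is unmatched up to sign (`exists_unmatched`). Hence E|B_k(z,z)|² ≤ C |k|² Σ_h |h|^{−4β}
|k−h|^{−4β}, and B(z,z) lies almost surely in L²(0,T; H^{r−1}) for 0 ≤ r ≤ 1 with r + 1 < 2β
(`IsTame.ae_lintegral_normSq_bil_ne_top`); r = σ + ε is used.

Weak forms. The limit solves the integrated equation coefficient by coefficient. Pairing with φ,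
exchanging sum and integral, and integrating B by parts gives the auxiliary weak form. Each z_k
solves dz = −|k|² z dt + db exactly, so adding z gives the weak form for v. -/

lemma dot_self_nonneg (k : ℤ × ℤ) : 0 ≤ dot k k := by
  unfold dot; nlinarith [sq_nonneg (k.1 : ℝ), sq_nonneg (k.2 : ℝ)]

lemma len_nonneg (k : ℤ × ℤ) : 0 ≤ len k := Real.sqrt_nonneg _

lemma len_sq (k : ℤ × ℤ) : len k ^ 2 = dot k k := Real.sq_sqrt (dot_self_nonneg k)

lemma len_sq_eq (k : ℤ × ℤ) : len k ^ 2 = (k.1 : ℝ) ^ 2 + (k.2 : ℝ) ^ 2 := by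
  rw [len_sq]; unfold dot; ring

/-- Replaces the isotropic weight by a product of one-dimensional weights, so that lattice sums
become squares of sums over ℕ. -/
lemma max_one_mul_max_one_le (k : Idx) :
    max 1 |(k.1.1 : ℝ)| * max 1 |(k.1.2 : ℝ)| ≤ len k.1 ^ 2 := by
  rw [len_sq_eq]
  obtain ⟨⟨x, y⟩, hk⟩ := k
  have h1 : ∀ n : ℤ, n = 0 ∨ (1 : ℝ) ≤ |(n : ℝ)| := fun n => by
    rcases eq_or_ne n 0 with h | h
    · exact Or.inl h
    · right; exact_mod_cast Int.one_le_abs h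
  simp only
  rw [← sq_abs (x : ℝ), ← sq_abs (y : ℝ)]
  rcases h1 x with hx | hx <;> rcases h1 y with hy | hy
  · exact absurd (by simp [hx, hy]) hk
  · rw [max_eq_right hy]; simp only [hx, Int.cast_zero, abs_zero, zero_le_one, max_eq_left]; nlinarith
  · rw [max_eq_right hx]; simp only [hy, Int.cast_zero, abs_zero, zero_le_one, max_eq_left]; nlinarith
  · rw [max_eq_right hx, max_eq_right hy]
    nlinarith [sq_nonneg (|(x : ℝ)| - |(y : ℝ)|)]

lemma one_le_len (k : Idx) : 1 ≤ len k.1 := by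
  have h := max_one_mul_max_one_le k
  have h2 : (1 : ℝ) ≤ max 1 |(k.1.1 : ℝ)| * max 1 |(k.1.2 : ℝ)| :=
    one_le_mul_of_one_le_of_one_le (le_max_left _ _) (le_max_left _ _)
  nlinarith [len_nonneg k.1]

lemma len_pos (k : Idx) : 0 < len k.1 := lt_of_lt_of_le one_pos (one_le_len k)

lemma len_neg (k : ℤ × ℤ) : len (-k) = len k := by
  unfold len dot; simp

lemma len_opp (k : Idx) : len k.opp.1 = len k.1 := len_neg _

lemma len_perp (k : ℤ × ℤ) : len (perp k) = len k := by
  unfold len dot perp; congr 1; push_cast; ring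

lemma abs_dot_le (h k : ℤ × ℤ) : |dot h k| ≤ len h * len k := by
  apply abs_le_of_sq_le_sq _ (mul_nonneg (len_nonneg _) (len_nonneg _))
  rw [mul_pow, len_sq_eq, len_sq_eq]; unfold dot
  nlinarith [sq_nonneg ((h.1 : ℝ) * k.2 - h.2 * k.1)]

lemma dot_perp_sub (h k : ℤ × ℤ) : dot (perp h) (k - h) = dot (perp h) k := by
  unfold dot perp; simp; ring

lemma len_le_add (h k : ℤ × ℤ) : len k ≤ len h + len (k - h) := by
  apply le_of_sq_le_sq _ (add_nonneg (len_nonneg _) (len_nonneg _))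
  have h1 := (abs_le.1 (abs_dot_le h (k - h))).2
  have : len k ^ 2 = len h ^ 2 + 2 * dot h (k - h) + len (k - h) ^ 2 := by
    simp only [len_sq_eq, dot, Prod.fst_sub, Prod.snd_sub]; push_cast; ring
  rw [this]; nlinarith

lemma inv_two_pi_le : 1 / (2 * Real.pi) ≤ 1 := by
  rw [div_le_one (by positivity)]; nlinarith [Real.pi_gt_three]

/-- Cauchy–Schwarz in both scalar products leaves the derivative on the output mode: B is the
divergence of a product. -/
lemma abs_gam_le (h k : ℤ × ℤ) : |gam h k| ≤ len k := by
  unfold gam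
  have h1 : |dot (perp h) k| ≤ len h * len k := by simpa [len_perp] using abs_dot_le (perp h) k
  have h2 := abs_dot_le (k - h) k
  have hh := len_nonneg h; have hk := len_nonneg k; have hl := len_nonneg (k - h)
  rw [abs_mul, abs_of_nonneg (show (0 : ℝ) ≤ 1 / (2 * Real.pi) by positivity), abs_div, abs_mul,
    abs_of_nonneg (show 0 ≤ len h * len (k - h) * len k by positivity)]
  refine (mul_le_of_le_one_left (by positivity) inv_two_pi_le).trans ?_
  apply div_le_of_le_mul₀ (by positivity) hk
  calc _ ≤ (len h * len k) * (len (k - h) * len k) := by gcongr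
    _ = _ := by ring

/-- Since h^⊥ · h = 0, the factor h^⊥ · k equals h^⊥ · (k−h), so the derivative can also be put on
the second argument of B. -/
lemma abs_gam_le' (h k : ℤ × ℤ) : |gam h k| ≤ len (k - h) := by
  unfold gam
  have h1 : |dot (perp h) k| ≤ len h * len (k - h) := by
    rw [← dot_perp_sub]; simpa [len_perp] using abs_dot_le (perp h) (k - h)
  have h2 := abs_dot_le (k - h) k
  have hh := len_nonneg h; have hk := len_nonneg k; have hl := len_nonneg (k - h)
  rw [abs_mul, abs_of_nonneg (show (0 : ℝ) ≤ 1 / (2 * Real.pi) by positivity), abs_div, abs_mul,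
    abs_of_nonneg (show 0 ≤ len h * len (k - h) * len k by positivity)]
  refine (mul_le_of_le_one_left (by positivity) inv_two_pi_le).trans ?_
  apply div_le_of_le_mul₀ (by positivity) hl
  calc _ ≤ (len h * len (k - h)) * (len (k - h) * len k) := by gcongr
    _ = _ := by ring

/-! ### Lattice sums -/

lemma tsum_int_natAbs_le (F : ℕ → ℝ≥0∞) : ∑' n : ℤ, F n.natAbs ≤ 2 * ∑' n, F n := by
  have h : HasSum (fun n : ℤ => F n.natAbs) (∑' n : ℕ, F n + ∑' n : ℕ, F (n + 1)) := by
    apply HasSum.of_nat_of_neg_add_one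
    · simpa using ENNReal.summable.hasSum
    · have : ∀ n : ℕ, F (Int.natAbs (-((n : ℤ) + 1))) = F (n + 1) := fun n => by congr 1
      simp only [this]; exact ENNReal.summable.hasSum
  rw [h.tsum_eq, two_mul]
  exact add_le_add le_rfl (ENNReal.tsum_comp_le_tsum_of_injective (add_left_injective 1) F)

lemma sum_range_max_rpow_le {a : ℝ} (ha0 : 0 < a) (ha : a < 1) (N : ℕ) :
    ∑ n ∈ Finset.range (N + 1), (max 1 (n : ℝ)) ^ (-a) ≤ 1 + (N : ℝ) ^ (1 - a) / (1 - a) := by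
  have h1a : 0 < 1 - a := by linarith
  induction N with
  | zero => simp [Real.zero_rpow h1a.ne']
  | succ N ih =>
    rw [Finset.sum_range_succ]
    have hN : (0 : ℝ) < ((N + 1 : ℕ) : ℝ) := by positivity
    have hN1 : (1 : ℝ) ≤ ((N + 1 : ℕ) : ℝ) := by push_cast; linarith [(Nat.cast_nonneg N : (0 : ℝ) ≤ N)]
    rw [max_eq_right hN1]
    set x : ℝ := ((N + 1 : ℕ) : ℝ) with hx
    have hNx : (N : ℝ) = x * (1 + -(1 / x)) := by rw [hx]; push_cast; field_simp; ring
    -- Bernoulli for the concave power: the increment of n^{1−a}/(1−a) from N to N+1 is at least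
    -- (N+1)^{−a}, a discrete comparison with the integral.
    have hb := rpow_one_add_le_one_add_mul_self (s := -(1 / x)) (p := 1 - a)
      (by rw [neg_le_neg_iff, div_le_one hN]; exact hN1) h1a.le (by linarith)
    have h3 : (N : ℝ) ^ (1 - a) ≤ x ^ (1 - a) - (1 - a) * x ^ (-a) := by
      have h0 : 0 ≤ 1 + -(1 / x) := by
        have := (div_le_one hN).2 hN1; linarith
      rw [hNx, Real.mul_rpow hN.le h0]
      have h4 : x ^ (1 - a) = x * x ^ (-a) := by
        rw [show (1 - a) = 1 + -a by ring, Real.rpow_add hN, Real.rpow_one]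
      calc x ^ (1 - a) * (1 + -(1 / x)) ^ (1 - a)
          ≤ x ^ (1 - a) * (1 + (1 - a) * -(1 / x)) := by gcongr
        _ = _ := by rw [h4]; field_simp; ring
    have : x ^ (-a) ≤ (x ^ (1 - a) - (N : ℝ) ^ (1 - a)) / (1 - a) := by
      rw [le_div_iff₀ h1a]; linarith
    rw [sub_div] at this
    linarith

lemma tsum_idx_le_sq (F : ℕ → ℝ≥0∞) (G : Idx → ℝ≥0∞)
    (h : ∀ k : Idx, G k ≤ F k.1.1.natAbs * F k.1.2.natAbs) :
    ∑' k, G k ≤ (2 * ∑' n, F n) ^ 2 := by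
  calc ∑' k, G k ≤ ∑' k : Idx, (fun p : ℤ × ℤ => F p.1.natAbs * F p.2.natAbs) k.1 :=
        ENNReal.tsum_le_tsum h
    _ ≤ ∑' p : ℤ × ℤ, F p.1.natAbs * F p.2.natAbs :=
        ENNReal.tsum_comp_le_tsum_of_injective Subtype.val_injective _
    _ = (∑' n : ℤ, F n.natAbs) * ∑' n : ℤ, F n.natAbs := by
        rw [ENNReal.tsum_prod (f := fun a b : ℤ => F a.natAbs * F b.natAbs)]
        simp_rw [ENNReal.tsum_mul_left, ENNReal.tsum_mul_right]
    _ ≤ _ := by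
        rw [sq]; exact mul_le_mul' (tsum_int_natAbs_le F) (tsum_int_natAbs_le F)

lemma len_rpow_le (k : Idx) {a : ℝ} (ha : 0 ≤ a) :
    len k.1 ^ (-(2 * a)) ≤
      (max 1 (k.1.1.natAbs : ℝ)) ^ (-a) * (max 1 (k.1.2.natAbs : ℝ)) ^ (-a) := by
  rw [← Real.mul_rpow (by positivity) (by positivity), show -(2 * a) = 2 * (-a) by ring,
    Real.rpow_mul (len_nonneg _)]
  apply Real.rpow_le_rpow_of_nonpos (by positivity) _ (by linarith)
  have := max_one_mul_max_one_le k
  simpa [Nat.cast_natAbs] using this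

/-- On |k| ≤ R both coordinates are at most R, and the weight is dominated by a product; each
one-dimensional sum is of order R^{1−a}. This growth rate is what makes the product estimate
critical. -/
lemma exists_tsum_len_le {a : ℝ} (ha0 : 0 < a) (ha : a < 1) :
    ∃ C : ℝ≥0∞, C ≠ ∞ ∧ ∀ R : ℝ, 1 ≤ R →
      ∑' k : Idx, (if len k.1 ≤ R then ENNReal.ofReal (len k.1 ^ (-(2 * a))) else 0) ≤
        C * ENNReal.ofReal (R ^ (2 * (1 - a))) := by
  have h1a : 0 < 1 - a := by linarith
  refine ⟨(2 * ENNReal.ofReal (1 + 1 / (1 - a))) ^ 2, by finiteness, fun R hR => ?_⟩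
  let F : ℕ → ℝ≥0∞ := fun n => if (n : ℝ) ≤ R then ENNReal.ofReal ((max 1 (n : ℝ)) ^ (-a)) else 0
  have hF : ∑' n, F n ≤ ENNReal.ofReal ((1 + 1 / (1 - a)) * R ^ (1 - a)) := by
    rw [tsum_eq_sum (s := Finset.range (⌊R⌋₊ + 1))]
    · calc ∑ n ∈ Finset.range (⌊R⌋₊ + 1), F n
          ≤ ∑ n ∈ Finset.range (⌊R⌋₊ + 1), ENNReal.ofReal ((max 1 (n : ℝ)) ^ (-a)) := by
            gcongr with n _; simp only [F]; split_ifs <;> simp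
        _ = ENNReal.ofReal (∑ n ∈ Finset.range (⌊R⌋₊ + 1), (max 1 (n : ℝ)) ^ (-a)) := by
            rw [ENNReal.ofReal_sum_of_nonneg]; intros; positivity
        _ ≤ _ := by
            apply ENNReal.ofReal_le_ofReal
            refine (sum_range_max_rpow_le ha0 ha _).trans ?_
            have h1 : (⌊R⌋₊ : ℝ) ^ (1 - a) ≤ R ^ (1 - a) :=
              Real.rpow_le_rpow (by positivity) (Nat.floor_le (by linarith)) h1a.le
            have h2 : 1 ≤ R ^ (1 - a) := Real.one_le_rpow hR h1a.le
            have h3 : (⌊R⌋₊ : ℝ) ^ (1 - a) / (1 - a) ≤ R ^ (1 - a) / (1 - a) := by gcongr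
            calc _ ≤ R ^ (1 - a) + R ^ (1 - a) / (1 - a) := by linarith
              _ = _ := by ring
    · intro n hn
      simp only [Finset.mem_range, not_lt] at hn
      have : R < n := (Nat.floor_lt (by linarith)).1 (by omega)
      simp [F, not_le.2 this]
  have key := tsum_idx_le_sq F
    (fun k => if len k.1 ≤ R then ENNReal.ofReal (len k.1 ^ (-(2 * a))) else 0) (fun k => ?_)
  · refine key.trans ((pow_le_pow_left' (mul_le_mul_right hF 2) 2).trans (le_of_eq ?_))
    rw [ENNReal.ofReal_mul (by positivity), ← mul_assoc, mul_pow, ← ENNReal.ofReal_pow (by positivity),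
      ← Real.rpow_natCast, ← Real.rpow_mul (by linarith)]
    congr 3; push_cast; ring
  · by_cases h : len k.1 ≤ R
    · have e1 : (k.1.1.natAbs : ℝ) ≤ R := by
        refine le_trans ?_ h
        rw [Nat.cast_natAbs, Int.cast_abs]
        apply abs_le_of_sq_le_sq _ (len_nonneg _); rw [len_sq_eq]; nlinarith [sq_nonneg (k.1.2 : ℝ)]
      have e2 : (k.1.2.natAbs : ℝ) ≤ R := by
        refine le_trans ?_ h
        rw [Nat.cast_natAbs, Int.cast_abs]
        apply abs_le_of_sq_le_sq _ (len_nonneg _); rw [len_sq_eq]; nlinarith [sq_nonneg (k.1.1 : ℝ)]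
      simp only [h, F, e1, e2, if_true]
      rw [← ENNReal.ofReal_mul (by positivity)]
      exact ENNReal.ofReal_le_ofReal (len_rpow_le k ha0.le)
    · simp [h]

lemma tsum_len_ne_top {s : ℝ} (hs : 1 < s) :
    ∑' k : Idx, ENNReal.ofReal (len k.1 ^ (-(2 * s))) ≠ ∞ := by
  let F : ℕ → ℝ≥0∞ := fun n => ENNReal.ofReal ((max 1 (n : ℝ)) ^ (-s))
  have hF : ∑' n, F n ≠ ∞ := by
    have hsum : Summable fun n : ℕ => (max 1 (n : ℝ)) ^ (-s) := by
      rw [← summable_nat_add_iff 1]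
      have := (summable_nat_add_iff 1).2 (Real.summable_nat_rpow.2 (show -s < -1 by linarith))
      refine this.congr fun n => ?_
      rw [max_eq_right]; push_cast; linarith [(Nat.cast_nonneg n : (0 : ℝ) ≤ n)]
    exact hsum.tsum_ofReal_ne_top
  refine ne_top_of_le_ne_top (by finiteness) (tsum_idx_le_sq F _ fun k => ?_)
  rw [← ENNReal.ofReal_mul (by positivity)]
  exact ENNReal.ofReal_le_ofReal (len_rpow_le k (by linarith))

/-! ### Convolution estimates -/

/-- The weight `|k|^{2r}` as an extended nonnegative number. -/
def wt (r : ℝ) (k : Idx) : ℝ≥0∞ := ENNReal.ofReal (len k.1 ^ (2 * r))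

/-- The weighted square sum `∑ |k|^{2r} U_k²`. -/
def nE (r : ℝ) (U : Idx → ℝ≥0∞) : ℝ≥0∞ := ∑' k, wt r k * U k ^ 2

/-- The moduli of a family of coefficients. -/
def modl (v : Coeff) : Idx → ℝ≥0∞ := fun k => ‖v k‖ₑ

/-- The convolution of two families of extended nonnegative numbers, without the zero mode. -/
def conv (U V : Idx → ℝ≥0∞) (k : Idx) : ℝ≥0∞ :=
  ∑' h : {h : Idx // h ≠ k}, U h.1 * V (k.diff h)

lemma tsum_mul_sq_le {ι : Type*} (f g : ι → ℝ≥0∞) :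
    (∑' i, f i * g i) ^ 2 ≤ (∑' i, f i ^ 2) * ∑' i, g i ^ 2 := by
  let _ : MeasurableSpace ι := ⊤
  have h := ENNReal.lintegral_mul_le_Lp_mul_Lq (Measure.count : Measure ι)
    Real.HolderConjugate.two_two (f := f) (g := g) (measurable_from_top.aemeasurable)
    (measurable_from_top.aemeasurable)
  rw [lintegral_count' measurable_from_top, lintegral_count' measurable_from_top,
    lintegral_count' measurable_from_top] at h
  simp only [Pi.mul_apply, ENNReal.rpow_two] at h
  calc _ ≤ ((∑' i, f i ^ 2) ^ (1 / 2 : ℝ) * (∑' i, g i ^ 2) ^ (1 / 2 : ℝ)) ^ 2 := by gcongr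
    _ = _ := by
      rw [mul_pow, ← ENNReal.rpow_two, ← ENNReal.rpow_two, ← ENNReal.rpow_mul, ← ENNReal.rpow_mul]
      norm_num

lemma add_sq_le_two_mul (x y : ℝ≥0∞) : (x + y) ^ 2 ≤ 2 * (x ^ 2 + y ^ 2) := by
  have h := ENNReal.rpow_add_le_mul_rpow_add_rpow x y (p := 2) (by norm_num)
  norm_num at h
  simpa [ENNReal.rpow_two] using h

lemma wt_ne_top (r : ℝ) (k : Idx) : wt r k ≠ ∞ := ENNReal.ofReal_ne_top

lemma wt_zero (k : Idx) : wt 0 k = 1 := by simp [wt]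

lemma wt_add (r s : ℝ) (k : Idx) : wt (r + s) k = wt r k * wt s k := by
  unfold wt
  rw [← ENNReal.ofReal_mul (Real.rpow_nonneg (len_nonneg _) _), ← Real.rpow_add (len_pos k)]
  ring_nf

lemma wt_neg_mul (r : ℝ) (k : Idx) : wt (-r) k * wt r k = 1 := by
  rw [← wt_add]; simp [wt_zero]

lemma wt_half_sq (r : ℝ) (k : Idx) : wt (r / 2) k ^ 2 = wt r k := by
  rw [sq, ← wt_add]; congr 1; ring

lemma wt_mono {r s : ℝ} (h : r ≤ s) (k : Idx) : wt r k ≤ wt s k :=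
  ENNReal.ofReal_le_ofReal (Real.rpow_le_rpow_of_exponent_le (one_le_len k) (by linarith))

lemma nE_mono {r s : ℝ} (h : r ≤ s) (U : Idx → ℝ≥0∞) : nE r U ≤ nE s U :=
  ENNReal.tsum_le_tsum fun k => mul_le_mul_left (wt_mono h k) _

lemma normSq_eq_nE (r : ℝ) (v : Coeff) : normSq r v = nE r (modl v) := by
  unfold normSq nE
  congr 1; ext k
  rw [ENNReal.ofReal_mul (Real.rpow_nonneg (len_nonneg _) _), wt, modl,
    ENNReal.ofReal_pow (norm_nonneg _), ofReal_norm]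

lemma normSq_mono {r s : ℝ} (h : r ≤ s) (v : Coeff) : normSq r v ≤ normSq s v := by
  rw [normSq_eq_nE, normSq_eq_nE]; exact nE_mono h _

/-- The index set of the triads `h + (k - h) = k`. -/
abbrev Triad : Type := Σ k : Idx, {h : Idx // h ≠ k}

lemma Idx.diff_val (k : Idx) (h : {h : Idx // h ≠ k}) : (k.diff h).1 = k.1 - h.1.1 := rfl

/-- The pair of wave vectors `(h, k - h)` of a triad. -/
def Triad.pair (p : Triad) : Idx × Idx := (p.2.1, p.1.diff p.2)

lemma Triad.pair_injective : Function.Injective Triad.pair := by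
  rintro ⟨k, h, hk⟩ ⟨k', h', hk'⟩ e
  simp only [Triad.pair, Prod.mk.injEq] at e
  obtain ⟨rfl, e2⟩ := e
  have : k.1 = k'.1 := by
    have := congrArg Subtype.val e2
    simp only [Idx.diff_val] at this
    exact sub_left_injective this
  obtain rfl := Subtype.ext this
  rfl

/-- A triad is determined by its two inputs (h, k−h). Pairs that sum to zero are missed, hence only
an inequality. -/
lemma tsum_triad_le (F : Idx → Idx → ℝ≥0∞) :
    ∑' k : Idx, ∑' h : {h : Idx // h ≠ k}, F h.1 (k.diff h) ≤ ∑' l, ∑' h, F h l := by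
  rw [ENNReal.tsum_comm, ← ENNReal.tsum_prod,
    ← ENNReal.tsum_sigma' (fun p : Triad => F p.2.1 (p.1.diff p.2))]
  exact ENNReal.tsum_comp_le_tsum_of_injective Triad.pair_injective (fun p => F p.1 p.2)

/-- Cauchy–Schwarz with weight |h|^{2a} on U extracts ‖U‖_a. After exchanging the sums, the other
factor collects Σ_{|h| ≤ |l|} |h|^{−2a} ≤ C |l|^{2(1−a)} in front of V_l², which is exactly
‖V‖_{1−a}. -/
lemma conv_low_sq_le {a : ℝ} (ha0 : 0 < a) (ha : a < 1) :
    ∃ C : ℝ≥0∞, C ≠ ∞ ∧ ∀ U V : Idx → ℝ≥0∞,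
      ∑' k : Idx, (∑' h : {h : Idx // h ≠ k},
        if len h.1.1 ≤ len (k.diff h).1 then U h.1 * V (k.diff h) else 0) ^ 2 ≤
        C * (nE a U * nE (1 - a) V) := by
  obtain ⟨C, hC, hCle⟩ := exists_tsum_len_le ha0 ha
  refine ⟨C, hC, fun U V => ?_⟩
  have h1 : ∀ k : Idx, (∑' h : {h : Idx // h ≠ k},
      if len h.1.1 ≤ len (k.diff h).1 then U h.1 * V (k.diff h) else 0) ^ 2 ≤
      nE a U * ∑' h : {h : Idx // h ≠ k},
        if len h.1.1 ≤ len (k.diff h).1 then wt (-a) h.1 * V (k.diff h) ^ 2 else 0 := by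
    intro k
    have e : ∀ h : {h : Idx // h ≠ k},
        (if len h.1.1 ≤ len (k.diff h).1 then U h.1 * V (k.diff h) else 0) =
        (wt (a / 2) h.1 * U h.1) *
          (if len h.1.1 ≤ len (k.diff h).1 then wt (-(a / 2)) h.1 * V (k.diff h) else 0) := by
      intro h
      split_ifs
      · have := wt_neg_mul (a / 2) h.1
        calc U h.1 * V (k.diff h) = (wt (-(a / 2)) h.1 * wt (a / 2) h.1) * (U h.1 * V (k.diff h)) := by
              rw [this, one_mul]
          _ = _ := by ring
      · simp
    simp_rw [e]
    refine (tsum_mul_sq_le _ _).trans ?_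
    refine mul_le_mul' ?_ (le_of_eq ?_)
    · simp_rw [mul_pow, wt_half_sq]
      exact ENNReal.tsum_comp_le_tsum_of_injective Subtype.val_injective (fun h => wt a h * U h ^ 2)
    · congr 1; ext h
      split_ifs
      · rw [mul_pow, ← neg_div, wt_half_sq]
      · simp
  calc _ ≤ ∑' k : Idx, nE a U * ∑' h : {h : Idx // h ≠ k},
        (if len h.1.1 ≤ len (k.diff h).1 then wt (-a) h.1 * V (k.diff h) ^ 2 else 0) :=
        ENNReal.tsum_le_tsum h1
    _ = nE a U * ∑' k : Idx, ∑' h : {h : Idx // h ≠ k},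
        (if len h.1.1 ≤ len (k.diff h).1 then wt (-a) h.1 * V (k.diff h) ^ 2 else 0) :=
        ENNReal.tsum_mul_left
    _ ≤ nE a U * ∑' l : Idx, ∑' h : Idx,
        (if len h.1 ≤ len l.1 then wt (-a) h * V l ^ 2 else 0) := by
        refine mul_le_mul' le_rfl ?_
        exact tsum_triad_le (fun h l => if len h.1 ≤ len l.1 then wt (-a) h * V l ^ 2 else 0)
    _ ≤ nE a U * ∑' l : Idx, C * (wt (1 - a) l * V l ^ 2) := by
        refine mul_le_mul' le_rfl (ENNReal.tsum_le_tsum fun l => ?_)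
        have e : ∀ h : Idx, (if len h.1 ≤ len l.1 then wt (-a) h * V l ^ 2 else 0) =
          (if len h.1 ≤ len l.1 then ENNReal.ofReal (len h.1 ^ (-(2 * a))) else 0) * V l ^ 2 := by
          intro h
          simp only [ite_mul, zero_mul, wt, mul_neg]
        simp_rw [e]
        rw [ENNReal.tsum_mul_right, ← mul_assoc]
        exact mul_le_mul' (hCle _ (one_le_len l)) le_rfl
    _ = _ := by rw [ENNReal.tsum_mul_left]; unfold nE; ring

/-- The reflection `h ↦ k - h` of the modes that interact to give `k`. -/
def reflEquiv (k : Idx) : {h : Idx // h ≠ k} ≃ {h : Idx // h ≠ k} where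
  toFun h := ⟨k.diff h, fun e => h.1.2 (by
    have := congrArg Subtype.val e; simpa [Idx.diff_val] using this)⟩
  invFun h := ⟨k.diff h, fun e => h.1.2 (by
    have := congrArg Subtype.val e; simpa [Idx.diff_val] using this)⟩
  left_inv h := by apply Subtype.ext; apply Subtype.ext; simp [Idx.diff_val]
  right_inv h := by apply Subtype.ext; apply Subtype.ext; simp [Idx.diff_val]

lemma reflEquiv_coe (k : Idx) (h : {h : Idx // h ≠ k}) : (reflEquiv k h).1 = k.diff h := rfl

lemma diff_reflEquiv (k : Idx) (h : {h : Idx // h ≠ k}) : k.diff (reflEquiv k h) = h.1 := by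
  apply Subtype.ext; simp [Idx.diff_val, reflEquiv_coe]

/-- The critical product estimate `‖U * V‖_{ℓ²} ≤ C ‖U‖_a ‖V‖_{1-a}`. -/
lemma conv_sq_le {a : ℝ} (ha0 : 0 < a) (ha : a < 1) :
    ∃ C : ℝ≥0∞, C ≠ ∞ ∧ ∀ U V : Idx → ℝ≥0∞,
      ∑' k : Idx, conv U V k ^ 2 ≤ C * (nE a U * nE (1 - a) V) := by
  obtain ⟨C₁, hC₁, h₁⟩ := conv_low_sq_le ha0 ha
  obtain ⟨C₂, hC₂, h₂⟩ := conv_low_sq_le (a := 1 - a) (by linarith) (by linarith)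
  refine ⟨2 * (C₁ + C₂), by finiteness, fun U V => ?_⟩
  -- The reflection h ↦ k−h turns the terms with |h| > |k−h| into low-frequency terms of V * U, to
  -- which the low estimate applies with exponent 1−a.
  have hk : ∀ k : Idx, conv U V k ^ 2 ≤
      2 * ((∑' h : {h : Idx // h ≠ k},
        if len h.1.1 ≤ len (k.diff h).1 then U h.1 * V (k.diff h) else 0) ^ 2 +
      (∑' h : {h : Idx // h ≠ k},
        if len h.1.1 ≤ len (k.diff h).1 then V h.1 * U (k.diff h) else 0) ^ 2) := by
    intro k
    refine le_trans ?_ (add_sq_le_two_mul _ _)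
    gcongr
    rw [← (reflEquiv k).tsum_eq (fun h : {h : Idx // h ≠ k} =>
      if len h.1.1 ≤ len (k.diff h).1 then V h.1 * U (k.diff h) else 0), ← ENNReal.tsum_add]
    refine ENNReal.tsum_le_tsum fun h => ?_
    rw [diff_reflEquiv, reflEquiv_coe]
    rcases le_total (len h.1.1) (len (k.diff h).1) with hl | hl
    · simp [hl]
    · simp only [hl, if_true]; rw [mul_comm]; exact le_add_self
  calc _ ≤ _ := ENNReal.tsum_le_tsum hk
    _ ≤ 2 * (C₁ * (nE a U * nE (1 - a) V) + C₂ * (nE (1 - a) V * nE (1 - (1 - a)) U)) := by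
      rw [ENNReal.tsum_mul_left, ENNReal.tsum_add]
      gcongr
      · exact h₁ U V
      · exact h₂ V U
    _ = _ := by rw [show 1 - (1 - a) = a by ring]; ring

/-! ### Estimates of the bilinear term -/

lemma enorm_bilTerm_le (u v : Coeff) (k : Idx) (h : {h : Idx // h ≠ k}) :
    ‖bilTerm u v k h‖ₑ ≤ ENNReal.ofReal (len k.1) * (modl u h.1 * modl v (k.diff h)) := by
  unfold bilTerm modl
  rw [enorm_mul, enorm_mul, mul_assoc]
  gcongr
  rw [← ofReal_norm, Complex.norm_real]
  exact ENNReal.ofReal_le_ofReal (abs_gam_le _ _)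

lemma tsum_enorm_bilTerm_le (u v : Coeff) (k : Idx) :
    ∑' h, ‖bilTerm u v k h‖ₑ ≤ ENNReal.ofReal (len k.1) * conv (modl u) (modl v) k := by
  unfold conv
  rw [← ENNReal.tsum_mul_left]
  exact ENNReal.tsum_le_tsum fun h => enorm_bilTerm_le u v k h

lemma enorm_bil_le_tsum (u v : Coeff) (k : Idx) : ‖bil u v k‖ₑ ≤ ∑' h, ‖bilTerm u v k h‖ₑ := by
  unfold bil
  rw [enorm_mul, ← ofReal_norm Complex.I, Complex.norm_I, ENNReal.ofReal_one, one_mul]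
  exact enorm_tsum_le_tsum_enorm

lemma enorm_bil_le (u v : Coeff) (k : Idx) :
    ‖bil u v k‖ₑ ≤ ENNReal.ofReal (len k.1) * conv (modl u) (modl v) k :=
  (enorm_bil_le_tsum u v k).trans (tsum_enorm_bilTerm_le u v k)

lemma wt_one (k : Idx) : wt 1 k = ENNReal.ofReal (len k.1) ^ 2 := by
  rw [wt, ← ENNReal.ofReal_pow (len_nonneg _), ← Real.rpow_natCast]; norm_num

/-- The triangle inequality and the subadditivity of x ↦ x^r; the latter is why the estimates are
limited to r ≤ 1. -/
lemma wt_half_le (k : Idx) (h : {h : Idx // h ≠ k}) {r : ℝ} (hr0 : 0 ≤ r) (hr1 : r ≤ 1) :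
    wt (r / 2) k ≤ wt (r / 2) h.1 + wt (r / 2) (k.diff h) := by
  unfold wt
  rw [← ENNReal.ofReal_add (Real.rpow_nonneg (len_nonneg _) _) (Real.rpow_nonneg (len_nonneg _) _)]
  apply ENNReal.ofReal_le_ofReal
  rw [show 2 * (r / 2) = r by ring]
  exact (Real.rpow_le_rpow (len_nonneg _) (len_le_add h.1.1 k.1) hr0).trans
    (Real.rpow_add_le_add_rpow (len_nonneg _) (len_nonneg _) hr0 hr1)

lemma nE_wt_mul (r s : ℝ) (U : Idx → ℝ≥0∞) : nE s (fun k => wt (r / 2) k * U k) = nE (r + s) U := by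
  unfold nE
  congr 1; ext k
  rw [mul_pow, wt_half_sq, wt_add]; ring

/-- A fractional Leibniz rule: the weight falls on either factor, and the critical estimate is used
with independent exponents a and a' in the two cases, which gives the freedom exploited for the
mixed terms. -/
lemma tsum_wt_conv_sq_le {r a a' : ℝ} (hr0 : 0 ≤ r) (hr1 : r ≤ 1) (ha0 : 0 < a) (ha : a < 1)
    (ha0' : 0 < a') (ha' : a' < 1) :
    ∃ C : ℝ≥0∞, C ≠ ∞ ∧ ∀ U V : Idx → ℝ≥0∞, ∑' k : Idx, wt r k * conv U V k ^ 2 ≤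
      C * (nE (r + a) U * nE (1 - a) V + nE a' U * nE (r + (1 - a')) V) := by
  obtain ⟨C₁, hC₁, h₁⟩ := conv_sq_le ha0 ha
  obtain ⟨C₂, hC₂, h₂⟩ := conv_sq_le ha0' ha'
  refine ⟨2 * (C₁ + C₂), by finiteness, fun U V => ?_⟩
  have hk : ∀ k, wt r k * conv U V k ^ 2 ≤ 2 * (conv (fun k => wt (r / 2) k * U k) V k ^ 2 +
      conv U (fun k => wt (r / 2) k * V k) k ^ 2) := by
    intro k
    refine le_trans ?_ (add_sq_le_two_mul _ _)
    rw [← wt_half_sq, ← mul_pow]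
    gcongr
    unfold conv
    rw [← ENNReal.tsum_mul_left, ← ENNReal.tsum_add]
    refine ENNReal.tsum_le_tsum fun h => ?_
    calc _ ≤ (wt (r / 2) h.1 + wt (r / 2) (k.diff h)) * (U h.1 * V (k.diff h)) := by
          gcongr; exact wt_half_le k h hr0 hr1
      _ = _ := by ring
  calc _ ≤ _ := ENNReal.tsum_le_tsum hk
    _ ≤ 2 * (C₁ * (nE (r + a) U * nE (1 - a) V) + C₂ * (nE a' U * nE (r + (1 - a')) V)) := by
      rw [ENNReal.tsum_mul_left, ENNReal.tsum_add]
      gcongr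
      · refine (h₁ _ _).trans (le_of_eq ?_); rw [nE_wt_mul]
      · refine (h₂ _ _).trans (le_of_eq ?_); rw [nE_wt_mul]
    _ ≤ 2 * ((C₁ + C₂) * (nE (r + a) U * nE (1 - a) V) +
        (C₁ + C₂) * (nE a' U * nE (r + (1 - a')) V)) := by
      gcongr
      · exact le_self_add
      · exact le_add_self
    _ = _ := by ring

lemma normSq_bil_le_conv (r : ℝ) (u v : Coeff) :
    normSq (r - 1) (bil u v) ≤ ∑' k : Idx, wt r k * conv (modl u) (modl v) k ^ 2 := by
  rw [normSq_eq_nE]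
  refine ENNReal.tsum_le_tsum fun k => ?_
  calc wt (r - 1) k * modl (bil u v) k ^ 2
      ≤ wt (r - 1) k * (ENNReal.ofReal (len k.1) * conv (modl u) (modl v) k) ^ 2 := by
        gcongr; exact enorm_bil_le u v k
    _ = _ := by
        rw [mul_pow, ← wt_one, ← mul_assoc, ← wt_add]; congr 2; ring

/-- `‖B(u,v)‖²_{r-1} ≤ C (‖u‖²_{r+a} ‖v‖²_{1-a} + ‖u‖²_{a'} ‖v‖²_{r+1-a'})`. -/
lemma normSq_bil_le {r a a' : ℝ} (hr0 : 0 ≤ r) (hr1 : r ≤ 1) (ha0 : 0 < a) (ha : a < 1)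
    (ha0' : 0 < a') (ha' : a' < 1) :
    ∃ C : ℝ≥0∞, C ≠ ∞ ∧ ∀ u v : Coeff, normSq (r - 1) (bil u v) ≤
      C * (normSq (r + a) u * normSq (1 - a) v + normSq a' u * normSq (r + (1 - a')) v) := by
  obtain ⟨C, hC, h⟩ := tsum_wt_conv_sq_le hr0 hr1 ha0 ha ha0' ha'
  refine ⟨C, hC, fun u v => (normSq_bil_le_conv r u v).trans ?_⟩
  simpa only [normSq_eq_nE] using h (modl u) (modl v)

/-- A single coefficient of the convolution needs only square summability. Hence every coefficient
of B(u,v) converges absolutely, and depends continuously on the arguments, already in H^0. -/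
lemma conv_sq_le_normSq_zero (u v : Coeff) (k : Idx) :
    conv (modl u) (modl v) k ^ 2 ≤ normSq 0 u * normSq 0 v := by
  refine (tsum_mul_sq_le _ _).trans ?_
  rw [← (reflEquiv k).tsum_eq (fun h => modl v (k.diff h) ^ 2)]
  simp only [diff_reflEquiv, normSq_eq_nE, nE, wt_zero, one_mul]
  exact mul_le_mul'
    (ENNReal.tsum_comp_le_tsum_of_injective Subtype.val_injective (fun h => modl u h ^ 2))
    (ENNReal.tsum_comp_le_tsum_of_injective Subtype.val_injective (fun h => modl v h ^ 2))

lemma summable_of_tsum_enorm_ne_top {ι : Type*} {f : ι → ℂ} (h : ∑' i, ‖f i‖ₑ ≠ ∞) : Summable f :=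
  (tsum_enorm_ne_top_iff_summable_norm.1 h).of_norm

lemma bilConv_of_normSq {u v : Coeff} (hu : normSq 0 u ≠ ∞) (hv : normSq 0 v ≠ ∞) :
    BilConv u v := by
  intro k
  apply summable_of_tsum_enorm_ne_top
  refine ne_top_of_le_ne_top ?_ (tsum_enorm_bilTerm_le u v k)
  have : conv (modl u) (modl v) k ≠ ∞ := by
    have h := ne_top_of_le_ne_top (ENNReal.mul_ne_top hu hv) (conv_sq_le_normSq_zero u v k)
    exact fun e => h (by simp [e])
  finiteness

/-! ### The trilinear form -/

/-- The reality condition `v_{-k} = - conj v_k`. -/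
def IsReal (v : Coeff) : Prop := ∀ k : Idx, v k.opp = -conj (v k)

/-- The general term of the trilinear form `⟨B(a,c), φ⟩`, up to the factor `i`. -/
def triTerm (a c φ : Coeff) (p : Triad) : ℂ := bilTerm a c p.1 p.2 * conj (φ p.1)

/-- The sum of the absolute values of the terms of `⟨B(a,c), φ⟩`. -/
def absTri (a c φ : Coeff) : ℝ≥0∞ := ∑' p, ‖triTerm a c φ p‖ₑ

/-- The involution `(h, l, k) ↦ (h, -k, -l)` of the triads `h + l = k`. -/
def Triad.flip (p : Triad) : Triad :=
  ⟨(p.1.diff p.2).opp, p.2.1, fun e => p.1.2 (by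
    have := congrArg Subtype.val e
    simp only [Idx.opp, Idx.diff_val, neg_sub] at this
    exact sub_eq_self.1 this.symm)⟩

lemma Triad.flip_diff (p : Triad) : p.flip.1.diff p.flip.2 = p.1.opp := by
  apply Subtype.ext; simp [Triad.flip, Idx.diff_val, Idx.opp]

lemma Idx.opp_opp (k : Idx) : k.opp.opp = k := by apply Subtype.ext; simp [Idx.opp]

lemma Triad.flip_flip (p : Triad) : p.flip.flip = p := by
  apply Triad.pair_injective
  simp only [Triad.pair, Triad.flip_diff]
  exact Prod.ext rfl (Idx.opp_opp _)

/-- The involution of the triads as an equivalence. -/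
def Triad.flipEquiv : Triad ≃ Triad := ⟨Triad.flip, Triad.flip, Triad.flip_flip, Triad.flip_flip⟩

/-- The factor h^⊥ · k changes sign while the second scalar product and the product of the lengths
are unchanged. This is the Fourier form of div u = 0. -/
lemma gam_flip (h k : ℤ × ℤ) : gam h (-(k - h)) = -gam h k := by
  have e1 : -(k - h) - h = -k := by abel
  have e2 : dot (perp h) (-(k - h)) = -dot (perp h) k := by
    rw [← dot_perp_sub h k]; unfold dot; simp; ring
  have e3 : dot (-k) (-(k - h)) = dot (k - h) k := by unfold dot; simp; ring
  unfold gam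
  rw [e1, e2, e3, len_neg, len_neg]; ring

/-- The reality condition moves the conjugation from the output field to the input field when the
modes are reversed; the two minus signs cancel and that of γ stays. -/
lemma triTerm_flip (a : Coeff) {c φ : Coeff} (hc : IsReal c) (hφ : IsReal φ) (p : Triad) :
    triTerm a c φ p.flip = -triTerm a φ c p := by
  unfold triTerm bilTerm
  rw [Triad.flip_diff, hc]
  have e : φ p.flip.1 = -conj (φ (p.1.diff p.2)) := hφ _
  have e2 : gam p.flip.2.1.1 p.flip.1.1 = -gam p.2.1.1 p.1.1 := gam_flip _ _
  have e3 : p.flip.2.1 = p.2.1 := rfl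
  rw [e, e2, e3]
  simp; ring

lemma absTri_comm (a : Coeff) {c φ : Coeff} (hc : IsReal c) (hφ : IsReal φ) :
    absTri a c φ = absTri a φ c := by
  unfold absTri
  rw [← Triad.flipEquiv.tsum_eq]
  congr 1; ext p
  change ‖triTerm a c φ p.flip‖ₑ = _
  rw [triTerm_flip a hc hφ, enorm_neg]

lemma tsum_triTerm_antisymm (a : Coeff) {c φ : Coeff} (hc : IsReal c) (hφ : IsReal φ) :
    ∑' p, triTerm a c φ p = -∑' p, triTerm a φ c p := by
  rw [← Triad.flipEquiv.tsum_eq, ← tsum_neg]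
  congr 1; ext p
  exact triTerm_flip a hc hφ p

lemma absTri_eq (a c φ : Coeff) :
    absTri a c φ = ∑' k, (∑' h, ‖bilTerm a c k h‖ₑ) * modl φ k := by
  unfold absTri
  rw [ENNReal.tsum_sigma']
  congr 1; ext k
  rw [← ENNReal.tsum_mul_right]
  simp [triTerm, modl, enorm_mul]

lemma bracketConv_of_absTri {a c φ : Coeff} (h : absTri a c φ ≠ ∞) : BracketConv (bil a c) φ := by
  apply summable_of_tsum_enorm_ne_top
  refine ne_top_of_le_ne_top h ?_
  rw [absTri_eq]
  refine ENNReal.tsum_le_tsum fun k => ?_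
  rw [enorm_mul, RCLike.enorm_conj]
  exact mul_le_mul' (enorm_bil_le_tsum a c k) le_rfl

lemma bracket_bil_eq {a c φ : Coeff} (h : absTri a c φ ≠ ∞) :
    bracket (bil a c) φ = Complex.I * ∑' p, triTerm a c φ p := by
  have hs : Summable (triTerm a c φ) := summable_of_tsum_enorm_ne_top h
  rw [hs.tsum_sigma, ← tsum_mul_left]
  unfold bracket bil
  congr 1; ext k
  rw [mul_assoc, ← tsum_mul_right]
  rfl

/-- Integration by parts: `⟨B(a,c), φ⟩ = -⟨B(a,φ), c⟩`. -/
lemma bracket_bil_antisymm {a c φ : Coeff} (hc : IsReal c) (hφ : IsReal φ)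
    (h : absTri a c φ ≠ ∞) : bracket (bil a c) φ = -bracket (bil a φ) c := by
  rw [bracket_bil_eq h, bracket_bil_eq (by rwa [← absTri_comm a hc hφ]),
    tsum_triTerm_antisymm a hc hφ, mul_neg]

lemma bracket_bil_self {a c : Coeff} (hc : IsReal c) (h : absTri a c c ≠ ∞) :
    bracket (bil a c) c = 0 := self_eq_neg.1 (bracket_bil_antisymm hc hc h)

lemma absTri_le_tsum_conv (a c φ : Coeff) :
    absTri a c φ ≤
      ∑' k, (ENNReal.ofReal (len k.1) * modl φ k) * conv (modl a) (modl c) k := by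
  rw [absTri_eq]
  refine ENNReal.tsum_le_tsum fun k => ?_
  calc _ ≤ (ENNReal.ofReal (len k.1) * conv (modl a) (modl c) k) * modl φ k := by
        gcongr; exact tsum_enorm_bilTerm_le a c k
    _ = _ := by ring

lemma absTri_sq_le_conv (a c φ : Coeff) :
    absTri a c φ ^ 2 ≤ normSq 1 φ * ∑' k, conv (modl a) (modl c) k ^ 2 := by
  calc _ ≤ _ := pow_le_pow_left' (absTri_le_tsum_conv a c φ) 2
    _ ≤ _ := tsum_mul_sq_le _ _
    _ = _ := by
      congr 1
      rw [normSq_eq_nE]; unfold nE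
      simp_rw [mul_pow, ← wt_one]

lemma absTri_sq_le {s : ℝ} (hs0 : 0 < s) (hs : s < 1) :
    ∃ C : ℝ≥0∞, C ≠ ∞ ∧ ∀ a c φ : Coeff,
      absTri a c φ ^ 2 ≤ C * (normSq 1 φ * normSq s a * normSq (1 - s) c) := by
  obtain ⟨C, hC, h⟩ := conv_sq_le hs0 hs
  refine ⟨C, hC, fun a c φ => (absTri_sq_le_conv a c φ).trans ?_⟩
  calc _ ≤ normSq 1 φ * (C * (nE s (modl a) * nE (1 - s) (modl c))) := by gcongr; exact h _ _
    _ = _ := by rw [normSq_eq_nE s, normSq_eq_nE (1 - s)]; ring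

/-- The form `⟨B(a,c), φ⟩` is bounded by the product of the norms of `a` in `H^s`, of `c` in `H^0`,
and of `φ` in `H^{2-s}`. -/
lemma absTri_sq_le_smooth {s : ℝ} (hs0 : 0 < s) (hs : s < 1) :
    ∃ C : ℝ≥0∞, C ≠ ∞ ∧ ∀ a c φ : Coeff, IsReal c → IsReal φ →
      absTri a c φ ^ 2 ≤ C * (normSq s a * normSq 0 c * normSq (2 - s) φ) := by
  obtain ⟨C, hC, h⟩ := conv_sq_le hs0 hs
  refine ⟨C, hC, fun a c φ hc hφ => ?_⟩
  -- The derivative must fall on φ, as c has none to spare: c becomes the tested field and |γ_{h,k}|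
  -- ≤ |k−h| charges φ.
  rw [absTri_comm a hc hφ]
  have h1 : absTri a φ c ≤ ∑' k, modl c k *
      conv (modl a) (fun k => wt (1 / 2) k * modl φ k) k := by
    rw [absTri_eq]
    refine ENNReal.tsum_le_tsum fun k => ?_
    rw [mul_comm]
    refine mul_le_mul' le_rfl (ENNReal.tsum_le_tsum fun h => ?_)
    unfold bilTerm modl
    rw [enorm_mul, enorm_mul]
    have : ‖(gam h.1.1 k.1 : ℂ)‖ₑ ≤ wt (1 / 2) (k.diff h) := by
      rw [← ofReal_norm, Complex.norm_real, wt]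
      apply ENNReal.ofReal_le_ofReal
      simpa [Idx.diff_val] using abs_gam_le' h.1.1 k.1
    calc _ ≤ wt (1 / 2) (k.diff h) * ‖a h.1‖ₑ * ‖φ (k.diff h)‖ₑ := by gcongr
      _ = _ := by ring
  calc _ ≤ _ := pow_le_pow_left' h1 2
    _ ≤ _ := tsum_mul_sq_le _ _
    _ ≤ normSq 0 c * (C * (nE s (modl a) * nE (1 - s) (fun k => wt (1 / 2) k * modl φ k))) := by
      refine mul_le_mul' (le_of_eq ?_) (h _ _)
      simp [normSq_eq_nE, nE, wt_zero]
    _ = _ := by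
      rw [nE_wt_mul, normSq_eq_nE s, normSq_eq_nE (2 - s), show (1 : ℝ) + (1 - s) = 2 - s by ring]
      ring

/-! ### Brackets and algebra of the bilinear term -/

lemma tsum_enorm_mul_sq_le (r : ℝ) (f g : Coeff) :
    (∑' k, ‖f k‖ₑ * ‖g k‖ₑ) ^ 2 ≤ normSq (-r) f * normSq r g := by
  have e : ∀ k, ‖f k‖ₑ * ‖g k‖ₑ = (wt (-r / 2) k * ‖f k‖ₑ) * (wt (r / 2) k * ‖g k‖ₑ) := fun k => by
    have := wt_neg_mul (r / 2) k
    rw [← neg_div] at this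
    calc ‖f k‖ₑ * ‖g k‖ₑ = (wt (-r / 2) k * wt (r / 2) k) * (‖f k‖ₑ * ‖g k‖ₑ) := by
          rw [this, one_mul]
      _ = _ := by ring
  simp_rw [e]
  refine (tsum_mul_sq_le _ _).trans (le_of_eq ?_)
  simp only [normSq_eq_nE, nE, modl, mul_pow, wt_half_sq]

lemma bracketConv_of_normSq (r : ℝ) {f g : Coeff} (hf : normSq (-r) f ≠ ∞) (hg : normSq r g ≠ ∞) :
    BracketConv f g := by
  apply summable_of_tsum_enorm_ne_top
  simp only [enorm_mul, RCLike.enorm_conj]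
  have h := ne_top_of_le_ne_top (ENNReal.mul_ne_top hf hg) (tsum_enorm_mul_sq_le r f g)
  exact fun e => h (by simp [e])

lemma normSq_add_le (r : ℝ) (u v : Coeff) : normSq r (u + v) ≤ 2 * (normSq r u + normSq r v) := by
  simp only [normSq_eq_nE, nE]
  rw [← ENNReal.tsum_add, ← ENNReal.tsum_mul_left]
  refine ENNReal.tsum_le_tsum fun k => ?_
  calc _ ≤ wt r k * (2 * (modl u k ^ 2 + modl v k ^ 2)) := by
        gcongr
        exact (pow_le_pow_left' (enorm_add_le (u k) (v k)) 2).trans (add_sq_le_two_mul _ _)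
    _ = _ := by ring

lemma normSq_neg (r : ℝ) (u : Coeff) : normSq r (-u) = normSq r u := by
  simp [normSq]

lemma normSq_sub_le (r : ℝ) (u v : Coeff) : normSq r (u - v) ≤ 2 * (normSq r u + normSq r v) := by
  rw [sub_eq_add_neg]; simpa [normSq_neg] using normSq_add_le r u (-v)

lemma normSq_add_ne_top {r : ℝ} {u v : Coeff} (hu : normSq r u ≠ ∞) (hv : normSq r v ≠ ∞) :
    normSq r (u + v) ≠ ∞ := ne_top_of_le_ne_top (by finiteness) (normSq_add_le r u v)

lemma bilTerm_add_left (u u' v : Coeff) (k : Idx) (h : {h : Idx // h ≠ k}) :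
    bilTerm (u + u') v k h = bilTerm u v k h + bilTerm u' v k h := by
  simp only [bilTerm, Pi.add_apply]; ring

lemma bilTerm_add_right (u v v' : Coeff) (k : Idx) (h : {h : Idx // h ≠ k}) :
    bilTerm u (v + v') k h = bilTerm u v k h + bilTerm u v' k h := by
  simp only [bilTerm, Pi.add_apply]; ring

lemma bil_add_left {u u' v : Coeff} (h : BilConv u v) (h' : BilConv u' v) :
    bil (u + u') v = bil u v + bil u' v := by
  ext k
  simp only [bil, bilTerm_add_left, Pi.add_apply]
  rw [(h k).tsum_add (h' k), mul_add]

lemma bil_add_right {u v v' : Coeff} (h : BilConv u v) (h' : BilConv u v') :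
    bil u (v + v') = bil u v + bil u v' := by
  ext k
  simp only [bil, bilTerm_add_right, Pi.add_apply]
  rw [(h k).tsum_add (h' k), mul_add]

lemma enorm_bil_sq_le (u v : Coeff) (k : Idx) :
    ‖bil u v k‖ₑ ^ 2 ≤ wt 1 k * (normSq 0 u * normSq 0 v) := by
  refine (pow_le_pow_left' (enorm_bil_le u v k) 2).trans ?_
  rw [mul_pow, ← wt_one]
  exact mul_le_mul' le_rfl (conv_sq_le_normSq_zero u v k)

lemma bil_add_add {u z : Coeff} (hu : normSq 0 u ≠ ∞) (hz : normSq 0 z ≠ ∞) :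
    bil (u + z) (u + z) = bil u u + bil u z + bil z u + bil z z := by
  have hs := normSq_add_ne_top hu hz
  rw [bil_add_left (bilConv_of_normSq hu hs) (bilConv_of_normSq hz hs),
    bil_add_right (bilConv_of_normSq hu hu) (bilConv_of_normSq hu hz),
    bil_add_right (bilConv_of_normSq hz hu) (bilConv_of_normSq hz hz)]
  abel

lemma bil_sub_bil {a c : Coeff} (ha : normSq 0 a ≠ ∞) (hc : normSq 0 c ≠ ∞) :
    bil a a - bil c c = bil (a - c) a + bil c (a - c) := by
  have hs : normSq 0 (a - c) ≠ ∞ := ne_top_of_le_ne_top (by finiteness) (normSq_sub_le 0 a c)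
  have e : a = c + (a - c) := by abel
  have h1 : bil a a = bil c a + bil (a - c) a := by
    conv_lhs => rw [show bil a a = bil (c + (a - c)) a by rw [← e]]
    exact bil_add_left (bilConv_of_normSq hc ha) (bilConv_of_normSq hs ha)
  have h2 : bil c a = bil c c + bil c (a - c) := by
    conv_lhs => rw [e]
    exact bil_add_right (bilConv_of_normSq hc hc) (bilConv_of_normSq hc hs)
  rw [h1, h2]; abel

lemma IsReal.add {u v : Coeff} (hu : IsReal u) (hv : IsReal v) : IsReal (u + v) := fun k => by
  simp only [Pi.add_apply, hu k, hv k, map_add]; ring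

lemma IsReal.sub {u v : Coeff} (hu : IsReal u) (hv : IsReal v) : IsReal (u - v) := fun k => by
  simp only [Pi.sub_apply, hu k, hv k, map_sub]; ring

/-- The bilinear term preserves the reality condition. -/
lemma IsReal.bil {u v : Coeff} (hu : IsReal u) (hv : IsReal v) : IsReal (bil u v) := by
  intro k
  have hne : ∀ h : {h : Idx // h ≠ k}, h.1.opp ≠ k.opp := fun h e =>
    h.2 (by rw [← Idx.opp_opp h.1, e, Idx.opp_opp])
  let e : {h : Idx // h ≠ k} ≃ {h : Idx // h ≠ k.opp} :=
    { toFun := fun h => ⟨h.1.opp, hne h⟩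
      invFun := fun h => ⟨h.1.opp, fun e => h.2 (by simpa [Idx.opp_opp] using congrArg Idx.opp e)⟩
      left_inv := fun h => Subtype.ext (Idx.opp_opp _)
      right_inv := fun h => Subtype.ext (Idx.opp_opp _) }
  unfold FracNS.bil
  rw [map_mul, Complex.conj_I, neg_mul, neg_neg, ← e.tsum_eq, Complex.conj_tsum]
  congr 2; ext h
  have hd : k.opp.diff (e h) = (k.diff h).opp := by
    apply Subtype.ext
    change -k.1 - -h.1.1 = -(k.1 - h.1.1)
    abel
  have hg : gam (e h).1.1 k.opp.1 = gam h.1.1 k.1 := by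
    change gam (-h.1.1) (-k.1) = _
    unfold gam
    rw [show -k.1 - -h.1.1 = -(k.1 - h.1.1) by abel, len_neg, len_neg, len_neg]
    congr 2
    have h1 : dot (perp (-h.1.1)) (-k.1) = dot (perp h.1.1) k.1 := by unfold dot perp; simp
    have h2 : dot (-(k.1 - h.1.1)) (-k.1) = dot (k.1 - h.1.1) k.1 := by unfold dot; simp; ring
    rw [h1, h2]
  unfold bilTerm
  rw [hd, hv, hg]
  have : u (e h).1 = -conj (u h.1) := hu _
  rw [this]
  simp

/-! ### Continuity of the bilinear term along continuous paths -/

/-- The path `f`, defined on the whole real line, is continuous with values in `H^r`. -/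
def HCont (r : ℝ) (f : ℝ → Coeff) : Prop :=
  (∀ t, normSq r (f t) ≠ ∞) ∧ ∀ t, Tendsto (fun s => normSq r (f s - f t)) (𝓝 t) (𝓝 0)

lemma HCont.mono {r s : ℝ} (h : r ≤ s) {f : ℝ → Coeff} (hf : HCont s f) : HCont r f :=
  ⟨fun t => ne_top_of_le_ne_top (hf.1 t) (normSq_mono h _), fun t =>
    tendsto_of_tendsto_of_tendsto_of_le_of_le tendsto_const_nhds (hf.2 t) (fun _ => zero_le)
      (fun _ => normSq_mono h _)⟩

lemma HCont.add {r : ℝ} {f g : ℝ → Coeff} (hf : HCont r f) (hg : HCont r g) :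
    HCont r (fun t => f t + g t) := by
  refine ⟨fun t => normSq_add_ne_top (hf.1 t) (hg.1 t), fun t => ?_⟩
  have h : Tendsto (fun s => 2 * (normSq r (f s - f t) + normSq r (g s - g t))) (𝓝 t) (𝓝 0) := by
    have := ENNReal.Tendsto.const_mul (a := 2) ((hf.2 t).add (hg.2 t)) (Or.inr (by simp))
    simpa using this
  refine tendsto_of_tendsto_of_tendsto_of_le_of_le tendsto_const_nhds h (fun _ => zero_le)
    (fun s => ?_)
  have e : f s + g s - (f t + g t) = (f s - f t) + (g s - g t) := by abel
  simp only [e]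
  exact normSq_add_le _ _ _

lemma tendsto_of_enorm_sq {α : Type*} {l : Filter α} {f : α → ℂ} {y : ℂ}
    (h : Tendsto (fun s => ‖f s - y‖ₑ ^ 2) l (𝓝 0)) : Tendsto f l (𝓝 y) := by
  rw [tendsto_iff_edist_tendsto_0]
  have h2 := h.ennrpow_const (1 / 2)
  simp only [← ENNReal.rpow_two, ← ENNReal.rpow_mul] at h2
  norm_num at h2
  simpa [edist_eq_enorm_sub] using h2

lemma enorm_sq_le_normSq_zero (u : Coeff) (k : Idx) : ‖u k‖ₑ ^ 2 ≤ normSq 0 u := by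
  rw [normSq_eq_nE, nE]
  simp only [wt_zero, one_mul]
  exact ENNReal.le_tsum k

lemma HCont.continuous_apply {f : ℝ → Coeff} (hf : HCont 0 f) (k : Idx) :
    Continuous fun t => f t k := by
  rw [continuous_iff_continuousAt]
  intro t
  apply tendsto_of_enorm_sq
  exact tendsto_of_tendsto_of_tendsto_of_le_of_le tendsto_const_nhds (hf.2 t) (fun _ => zero_le)
    (fun s => enorm_sq_le_normSq_zero (f s - f t) k)

lemma bil_sub_bil' {a a' c c' : Coeff} (ha : normSq 0 a ≠ ∞) (hc : normSq 0 c ≠ ∞)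
    (ha' : normSq 0 a' ≠ ∞) (hc' : normSq 0 c' ≠ ∞) :
    bil a c - bil a' c' = bil (a - a') c + bil a' (c - c') := by
  have hs : normSq 0 (a - a') ≠ ∞ := ne_top_of_le_ne_top (by finiteness) (normSq_sub_le 0 a a')
  have ht : normSq 0 (c - c') ≠ ∞ := ne_top_of_le_ne_top (by finiteness) (normSq_sub_le 0 c c')
  have h1 : bil a c = bil a' c + bil (a - a') c := by
    rw [← bil_add_left (bilConv_of_normSq ha' hc) (bilConv_of_normSq hs hc)]
    congr 1; abel
  have h2 : bil a' c = bil a' c' + bil a' (c - c') := by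
    rw [← bil_add_right (bilConv_of_normSq ha' hc') (bilConv_of_normSq ha' ht)]
    congr 1; abel
  rw [h1, h2]; abel

lemma enorm_bil_sub_bil_sq_le {a a' c c' : Coeff} (ha : normSq 0 a ≠ ∞) (hc : normSq 0 c ≠ ∞)
    (ha' : normSq 0 a' ≠ ∞) (hc' : normSq 0 c' ≠ ∞) (k : Idx) :
    ‖bil a c k - bil a' c' k‖ₑ ^ 2 ≤
      2 * wt 1 k * (normSq 0 (a - a') * normSq 0 c + normSq 0 a' * normSq 0 (c - c')) := by
  rw [← Pi.sub_apply, bil_sub_bil' ha hc ha' hc', Pi.add_apply]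
  refine ((pow_le_pow_left' (enorm_add_le _ _) 2).trans (add_sq_le_two_mul _ _)).trans ?_
  calc _ ≤ 2 * (wt 1 k * (normSq 0 (a - a') * normSq 0 c) +
        wt 1 k * (normSq 0 a' * normSq 0 (c - c'))) := by
        gcongr <;> exact enorm_bil_sq_le _ _ _
    _ = _ := by ring

/-- The claim concerns one coefficient at a time, so the lost derivative is only the fixed factor
|k| and continuity in H^0 suffices. -/
lemma HCont.continuous_bil {a c : ℝ → Coeff} (ha : HCont 0 a) (hc : HCont 0 c) (k : Idx) :
    Continuous fun t => bil (a t) (c t) k := by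
  rw [continuous_iff_continuousAt]
  intro t
  apply tendsto_of_enorm_sq
  have h : Tendsto (fun s => 2 * wt 1 k * (normSq 0 (a s - a t) *
      (2 * (normSq 0 (c s - c t) + normSq 0 (c t))) + normSq 0 (a t) * normSq 0 (c s - c t)))
      (𝓝 t) (𝓝 (2 * wt 1 k * (0 * (2 * (0 + normSq 0 (c t))) + normSq 0 (a t) * 0))) := by
    have hct := hc.1 t
    have hat := ha.1 t
    have h2w : 2 * wt 1 k ≠ ∞ := by have := wt_ne_top 1 k; finiteness
    refine ENNReal.Tendsto.const_mul ?_ (Or.inr h2w)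
    refine Tendsto.add ?_ ?_
    · refine ENNReal.Tendsto.mul (ha.2 t) (Or.inr ?_) ?_ (Or.inr (by simp))
      · simp only [zero_add]; finiteness
      · exact ENNReal.Tendsto.const_mul ((hc.2 t).add tendsto_const_nhds) (Or.inr (by simp))
    · exact ENNReal.Tendsto.const_mul (hc.2 t) (Or.inr hat)
  simp only [zero_mul, mul_zero, add_zero] at h
  refine tendsto_of_tendsto_of_tendsto_of_le_of_le tendsto_const_nhds h (fun _ => zero_le)
    (fun s => ?_)
  refine (enorm_bil_sub_bil_sq_le (ha.1 s) (hc.1 s) (ha.1 t) (hc.1 t) k).trans ?_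
  gcongr
  have e : c s = (c s - c t) + c t := by abel
  conv_lhs => rw [e]
  exact normSq_add_le _ _ _

/-! ### Finite sums -/

/-- The partial sum over `K` of the square of the `H^r` norm. -/
def fsum (K : Finset Idx) (r : ℝ) (u : Coeff) : ℝ := ∑ k ∈ K, len k.1 ^ (2 * r) * ‖u k‖ ^ 2

lemma fsum_nonneg (K : Finset Idx) (r : ℝ) (u : Coeff) : 0 ≤ fsum K r u :=
  Finset.sum_nonneg fun _ _ => mul_nonneg (Real.rpow_nonneg (len_nonneg _) _) (sq_nonneg _)

lemma ofReal_fsum (K : Finset Idx) (r : ℝ) (u : Coeff) :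
    ENNReal.ofReal (fsum K r u) = ∑ k ∈ K, ENNReal.ofReal (len k.1 ^ (2 * r) * ‖u k‖ ^ 2) :=
  ENNReal.ofReal_sum_of_nonneg fun _ _ =>
    mul_nonneg (Real.rpow_nonneg (len_nonneg _) _) (sq_nonneg _)

lemma ofReal_fsum_le (K : Finset Idx) (r : ℝ) (u : Coeff) :
    ENNReal.ofReal (fsum K r u) ≤ normSq r u := by
  rw [ofReal_fsum]; exact ENNReal.sum_le_tsum K

lemma normSq_eq_fsum {K : Finset Idx} {u : Coeff} (hu : ∀ k ∉ K, u k = 0) (r : ℝ) :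
    normSq r u = ENNReal.ofReal (fsum K r u) := by
  rw [ofReal_fsum]
  exact tsum_eq_sum fun k hk => by simp [hu k hk]

lemma fsum_mono {r s : ℝ} (h : r ≤ s) (K : Finset Idx) (u : Coeff) : fsum K r u ≤ fsum K s u :=
  Finset.sum_le_sum fun k _ => mul_le_mul_of_nonneg_right
    (Real.rpow_le_rpow_of_exponent_le (one_le_len k) (by linarith)) (sq_nonneg _)

lemma fsum_add_le (K : Finset Idx) (r : ℝ) (u v : Coeff) :
    fsum K r (u + v) ≤ 2 * (fsum K r u + fsum K r v) := by
  unfold fsum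
  rw [← Finset.sum_add_distrib, Finset.mul_sum]
  refine Finset.sum_le_sum fun k _ => ?_
  have h1 : ‖(u + v) k‖ ^ 2 ≤ 2 * (‖u k‖ ^ 2 + ‖v k‖ ^ 2) := by
    have := norm_add_le (u k) (v k)
    rw [Pi.add_apply]
    nlinarith [sq_nonneg (‖u k‖ - ‖v k‖), norm_nonneg (u k + v k)]
  have := mul_le_mul_of_nonneg_left h1 (Real.rpow_nonneg (len_nonneg k.1) (2 * r))
  linarith

lemma fsum_neg (K : Finset Idx) (r : ℝ) (u : Coeff) : fsum K r (-u) = fsum K r u := by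
  simp [fsum]

/-- Cauchy–Schwarz: r + 1/2 is the midpoint of r and r + 1. This lets the dissipation pay for the
half derivatives produced by B(u,u). -/
lemma fsum_half_sq_le (K : Finset Idx) (r : ℝ) (u : Coeff) :
    fsum K (r + 1 / 2) u ^ 2 ≤ fsum K r u * fsum K (r + 1) u := by
  have h := Finset.sum_mul_sq_le_sq_mul_sq K (fun k => len k.1 ^ r * ‖u k‖)
    (fun k => len k.1 ^ (r + 1) * ‖u k‖)
  have e : ∀ (s : ℝ) (k : Idx), (len k.1 ^ s * ‖u k‖) ^ 2 = len k.1 ^ (2 * s) * ‖u k‖ ^ 2 := by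
    intro s k
    rw [mul_pow, ← Real.rpow_natCast, ← Real.rpow_mul (len_nonneg _)]
    congr 2; push_cast; ring
  have e2 : ∀ k : Idx, (len k.1 ^ r * ‖u k‖) * (len k.1 ^ (r + 1) * ‖u k‖) =
      len k.1 ^ (2 * (r + 1 / 2)) * ‖u k‖ ^ 2 := by
    intro k
    have h3 : len k.1 ^ (2 * (r + 1 / 2)) = len k.1 ^ r * len k.1 ^ (r + 1) := by
      rw [← Real.rpow_add (len_pos k)]; ring_nf
    rw [h3]; ring
  simp only [e, e2] at h
  exact h

/-- Above a threshold X the highest power absorbs x^{2s} with the small constant η; below it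
x^{2(s−r)} is bounded by X^{2(s−r)}. -/
lemma exists_rpow_interp {r s q : ℝ} (hrs : r < s) (hsq : s < q) {η : ℝ} (hη : 0 < η) :
    ∃ C : ℝ, 0 ≤ C ∧ ∀ x : ℝ, 1 ≤ x → x ^ (2 * s) ≤ η * x ^ (2 * q) + C * x ^ (2 * r) := by
  set X : ℝ := max 1 (η ^ (-(1 / (2 * (q - s))))) with hX
  have hX1 : 1 ≤ X := le_max_left _ _
  refine ⟨X ^ (2 * (s - r)), by positivity, fun x hx => ?_⟩
  have hx0 : 0 < x := by linarith
  rcases le_total x X with h | h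
  · have h1 : x ^ (2 * (s - r)) ≤ X ^ (2 * (s - r)) :=
      Real.rpow_le_rpow hx0.le h (by linarith)
    have h2 : x ^ (2 * s) = x ^ (2 * (s - r)) * x ^ (2 * r) := by
      rw [← Real.rpow_add hx0]; ring_nf
    have : 0 ≤ η * x ^ (2 * q) := by positivity
    rw [h2]
    have : x ^ (2 * (s - r)) * x ^ (2 * r) ≤ X ^ (2 * (s - r)) * x ^ (2 * r) := by gcongr
    linarith
  · have h1 : η⁻¹ ≤ x ^ (2 * (q - s)) := by
      have h3 : η ^ (-(1 / (2 * (q - s)))) ≤ x := (le_max_right _ _).trans h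
      have h4 := Real.rpow_le_rpow (by positivity) h3 (show 0 ≤ 2 * (q - s) by linarith)
      rw [← Real.rpow_mul hη.le, neg_mul, one_div,
        inv_mul_cancel₀ (by linarith), Real.rpow_neg_one] at h4
      exact h4
    have h2 : x ^ (2 * q) = x ^ (2 * (q - s)) * x ^ (2 * s) := by
      rw [← Real.rpow_add hx0]; ring_nf
    have h5 : x ^ (2 * s) ≤ η * x ^ (2 * q) := by
      rw [h2]
      have : 1 ≤ η * x ^ (2 * (q - s)) := by
        have := mul_le_mul_of_nonneg_left h1 hη.le
        rwa [mul_inv_cancel₀ hη.ne'] at this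
      nlinarith [Real.rpow_pos_of_pos hx0 (2 * s)]
    have : 0 ≤ X ^ (2 * (s - r)) * x ^ (2 * r) := by positivity
    linarith

lemma exists_fsum_interp {r s q : ℝ} (hrs : r < s) (hsq : s < q) {η : ℝ} (hη : 0 < η) :
    ∃ C : ℝ, 0 ≤ C ∧ ∀ (K : Finset Idx) (u : Coeff),
      fsum K s u ≤ η * fsum K q u + C * fsum K r u := by
  obtain ⟨C, hC, h⟩ := exists_rpow_interp hrs hsq hη
  refine ⟨C, hC, fun K u => ?_⟩
  unfold fsum
  rw [Finset.mul_sum, Finset.mul_sum, ← Finset.sum_add_distrib]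
  refine Finset.sum_le_sum fun k _ => ?_
  have := mul_le_mul_of_nonneg_right (h _ (one_le_len k)) (sq_nonneg ‖u k‖)
  linarith

/-! ### Gronwall's lemma and the energy identity -/

/-- Gronwall's lemma for `y' + D ≤ α y + β`, with control of the integral of `D`. -/
lemma gronwall_dissipation {y D α β : ℝ → ℝ} {T : ℝ} (hy : Continuous y) (hD : Continuous D)
    (hα : Continuous α) (hβ : Continuous β) (hD0 : ∀ t, 0 ≤ D t) (hα0 : ∀ t, 0 ≤ α t)
    (hβ0 : ∀ t, 0 ≤ β t)
    (hy' : ∀ t ∈ Set.Ioo 0 T, ∃ y', HasDerivAt y y' t ∧ y' + D t ≤ α t * y t + β t)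
    {t : ℝ} (ht : t ∈ Set.Icc 0 T) :
    y t + ∫ s in (0 : ℝ)..t, D s ≤
      Real.exp (∫ s in (0 : ℝ)..t, α s) * (y 0 + ∫ s in (0 : ℝ)..t, β s) := by
  set A : ℝ → ℝ := fun t => ∫ s in (0 : ℝ)..t, α s with hA
  have hA' : ∀ t, HasDerivAt A (α t) t := fun t => hα.integral_hasStrictDerivAt 0 t |>.hasDerivAt
  have hAc : Continuous A := continuous_iff_continuousAt.2 fun t => (hA' t).continuousAt
  have hE : Continuous fun t => Real.exp (-A t) := by fun_prop
  -- The discounted energy plus the accumulated discounted D − β: the assumed inequality says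
  -- precisely that Φ decreases.
  set Φ : ℝ → ℝ := fun t => Real.exp (-A t) * y t +
    ∫ s in (0 : ℝ)..t, Real.exp (-A s) * (D s - β s) with hΦ
  have hint : Continuous fun s => Real.exp (-A s) * (D s - β s) := by fun_prop
  have hI : ∀ t, HasDerivAt (fun t => ∫ s in (0 : ℝ)..t, Real.exp (-A s) * (D s - β s))
      (Real.exp (-A t) * (D t - β t)) t := fun t =>
    hint.integral_hasStrictDerivAt 0 t |>.hasDerivAt
  have hanti : AntitoneOn Φ (Set.Icc 0 T) := by
    have hder : ∀ t ∈ Set.Ioo 0 T, ∃ φ', HasDerivAt Φ φ' t ∧ φ' ≤ 0 := by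
      intro t ht
      obtain ⟨y', h1, h2⟩ := hy' t ht
      refine ⟨_, (((hA' t).neg.exp).mul h1).add (hI t), ?_⟩
      have : Real.exp (-A t) * -α t * y t + Real.exp (-A t) * y' +
          Real.exp (-A t) * (D t - β t) = Real.exp (-A t) * (y' + D t - (α t * y t + β t)) := by
        ring
      refine this.trans_le ?_
      exact mul_nonpos_of_nonneg_of_nonpos (Real.exp_pos _).le (by linarith)
    apply antitoneOn_of_deriv_nonpos (convex_Icc 0 T)
    · refine Continuous.continuousOn ?_
      exact (hE.mul hy).add (continuous_iff_continuousAt.2 fun t => (hI t).continuousAt)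
    · rw [interior_Icc]
      intro t ht
      obtain ⟨_, h1, _⟩ := hder t ht
      exact h1.differentiableAt.differentiableWithinAt
    · rw [interior_Icc]
      intro t ht
      obtain ⟨_, h1, h2⟩ := hder t ht
      rwa [h1.deriv]
  have h0T : (0 : ℝ) ∈ Set.Icc 0 T := ⟨le_rfl, ht.1.trans ht.2⟩
  have hmain := hanti h0T ht ht.1
  have hA0 : A 0 = 0 := by simp [hA]
  simp only [hΦ, intervalIntegral.integral_same, hA0, neg_zero, Real.exp_zero, one_mul,
    add_zero] at hmain
  have hAmono : ∀ s ∈ Set.Icc 0 t, A s ≤ A t ∧ 0 ≤ A s := by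
    intro s hs
    have i1 : ∀ a b : ℝ, IntervalIntegrable α volume a b := fun a b => hα.intervalIntegrable _ _
    refine ⟨?_, intervalIntegral.integral_nonneg hs.1 fun x _ => hα0 x⟩
    have := intervalIntegral.integral_add_adjacent_intervals (i1 0 s) (i1 s t)
    have h2 : 0 ≤ ∫ x in s..t, α x := intervalIntegral.integral_nonneg hs.2 fun x _ => hα0 x
    simp only [hA]; linarith
  have hsplit : ∫ s in (0 : ℝ)..t, Real.exp (-A s) * (D s - β s) =
      (∫ s in (0 : ℝ)..t, Real.exp (-A s) * D s) - ∫ s in (0 : ℝ)..t, Real.exp (-A s) * β s := by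
    have e := intervalIntegral.integral_sub (μ := volume) (a := 0) (b := t)
      (f := fun s => Real.exp (-A s) * D s) (g := fun s => Real.exp (-A s) * β s)
      ((hE.mul hD).intervalIntegrable _ _) ((hE.mul hβ).intervalIntegrable _ _)
    rw [← e]
    congr 1; ext s; ring
  have h1 : Real.exp (-A t) * ∫ s in (0 : ℝ)..t, D s ≤ ∫ s in (0 : ℝ)..t, Real.exp (-A s) * D s := by
    rw [← intervalIntegral.integral_const_mul]
    apply intervalIntegral.integral_mono_on ht.1 ((continuous_const.mul hD).intervalIntegrable _ _)
      ((hE.mul hD).intervalIntegrable _ _)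
    intro s hs
    exact mul_le_mul_of_nonneg_right (Real.exp_le_exp.2 (by linarith [(hAmono s hs).1])) (hD0 s)
  have h2 : ∫ s in (0 : ℝ)..t, Real.exp (-A s) * β s ≤ ∫ s in (0 : ℝ)..t, β s := by
    apply intervalIntegral.integral_mono_on ht.1 ((hE.mul hβ).intervalIntegrable _ _)
      (hβ.intervalIntegrable _ _)
    intro s hs
    exact mul_le_of_le_one_left (hβ0 s) (Real.exp_le_one_iff.2 (by linarith [(hAmono s hs).2]))
  have h3 : Real.exp (-A t) * (y t + ∫ s in (0 : ℝ)..t, D s) ≤ y 0 + ∫ s in (0 : ℝ)..t, β s := by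
    rw [mul_add]; linarith
  have h4 := mul_le_mul_of_nonneg_left h3 (Real.exp_pos (A t)).le
  rwa [← mul_assoc, ← Real.exp_add, add_neg_cancel, Real.exp_zero, one_mul] at h4

lemma hasDerivAt_fsum {K : Finset Idx} (r : ℝ) {w : ℝ → Coeff} {w' : Coeff} {t : ℝ}
    (h : ∀ k ∈ K, HasDerivAt (fun s => w s k) (w' k) t) :
    HasDerivAt (fun s => fsum K r (w s))
      (2 * ∑ k ∈ K, len k.1 ^ (2 * r) * (w' k * conj (w t k)).re) t := by
  unfold fsum
  rw [Finset.mul_sum]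
  apply HasDerivAt.fun_sum
  intro k hk
  have h1 := ((h k hk).norm_sq).const_mul (len k.1 ^ (2 * r))
  rw [Complex.inner] at h1
  have e : 2 * (len k.1 ^ (2 * r) * (w' k * conj (w t k)).re) =
      len k.1 ^ (2 * r) * (2 * (w' k * conj (w t k)).re) := by ring
  rw [e]
  exact h1

lemma fsum_deriv_eq {K : Finset Idx} (r θ : ℝ) {w f : Coeff} :
    2 * ∑ k ∈ K, len k.1 ^ (2 * r) *
        ((θ : ℂ) * (-((len k.1 ^ 2 : ℝ) : ℂ) * w k + f k) * conj (w k)).re =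
      θ * (-2 * fsum K (r + 1) w + 2 * ∑ k ∈ K, len k.1 ^ (2 * r) * (f k * conj (w k)).re) := by
  unfold fsum
  simp only [Finset.mul_sum]
  rw [← Finset.sum_add_distrib, Finset.mul_sum]
  refine Finset.sum_congr rfl fun k _ => ?_
  have e1 : ((θ : ℂ) * (-((len k.1 ^ 2 : ℝ) : ℂ) * w k + f k) * conj (w k)) =
      (θ : ℂ) * (-((len k.1 ^ 2 : ℝ) : ℂ) * (w k * conj (w k)) + f k * conj (w k)) := by ring
  have e2 : len k.1 ^ (2 * (r + 1)) = len k.1 ^ (2 * r) * len k.1 ^ 2 := by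
    rw [← Real.rpow_natCast, ← Real.rpow_add (len_pos k)]; congr 1; push_cast; ring
  rw [e1, Complex.mul_conj, e2, Complex.re_ofReal_mul, Complex.add_re, ← Complex.ofReal_neg,
    ← Complex.ofReal_mul, Complex.ofReal_re, Complex.normSq_eq_norm_sq]
  ring

/-- The duality between H^{r−1} and H^{r+1} around H^r, with Young's inequality: the δ part is to be
absorbed by the dissipation. -/
lemma two_mul_sum_re_le (K : Finset Idx) (r : ℝ) {δ : ℝ} (hδ : 0 < δ) (f w : Coeff) :
    |2 * ∑ k ∈ K, len k.1 ^ (2 * r) * (f k * conj (w k)).re| ≤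
      δ * fsum K (r + 1) w + δ⁻¹ * fsum K (r - 1) f := by
  unfold fsum
  simp only [Finset.mul_sum]
  rw [← Finset.sum_add_distrib]
  refine (Finset.abs_sum_le_sum_abs _ _).trans (Finset.sum_le_sum fun k _ => ?_)
  have h1 : |(f k * conj (w k)).re| ≤ ‖f k‖ * ‖w k‖ := by
    refine (Complex.abs_re_le_norm _).trans (by simp)
  have hp := Real.rpow_pos_of_pos (len_pos k) (2 * r)
  have e2 : len k.1 ^ (2 * (r + 1)) = len k.1 ^ (2 * r) * len k.1 ^ 2 := by
    rw [← Real.rpow_natCast, ← Real.rpow_add (len_pos k)]; congr 1; push_cast; ring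
  have e3 : len k.1 ^ (2 * (r - 1)) = len k.1 ^ (2 * r) * (len k.1 ^ 2)⁻¹ := by
    rw [← Real.rpow_natCast, ← Real.rpow_neg (len_nonneg _), ← Real.rpow_add (len_pos k)]
    congr 1; push_cast; ring
  rw [e2, e3, abs_mul, abs_mul, abs_of_pos hp, abs_two]
  have hl := len_pos k
  have key : 2 * (‖f k‖ * ‖w k‖) ≤ δ * (len k.1 ^ 2 * ‖w k‖ ^ 2) +
      δ⁻¹ * ((len k.1 ^ 2)⁻¹ * ‖f k‖ ^ 2) := by
    have h0 : δ * (len k.1 ^ 2 * ‖w k‖ ^ 2) + δ⁻¹ * ((len k.1 ^ 2)⁻¹ * ‖f k‖ ^ 2) -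
        2 * (‖f k‖ * ‖w k‖) = δ * (len k.1 * ‖w k‖ - δ⁻¹ * ((len k.1)⁻¹ * ‖f k‖)) ^ 2 := by
      field_simp; ring
    have : 0 ≤ δ * (len k.1 * ‖w k‖ - δ⁻¹ * ((len k.1)⁻¹ * ‖f k‖)) ^ 2 := by positivity
    linarith
  calc 2 * (len k.1 ^ (2 * r) * |(f k * conj (w k)).re|)
      ≤ len k.1 ^ (2 * r) * (2 * (‖f k‖ * ‖w k‖)) := by nlinarith
    _ ≤ len k.1 ^ (2 * r) * (δ * (len k.1 ^ 2 * ‖w k‖ ^ 2) +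
      δ⁻¹ * ((len k.1 ^ 2)⁻¹ * ‖f k‖ ^ 2)) := by gcongr
    _ = _ := by ring

/-! ### Galerkin approximations: definition and bilinear bounds -/

/-- `u` solves on `[0,T]` the Galerkin system `u' = θ (A u - P_K B(u + z, u + z))` with the modes of
the finite set `K`; the factor `θ` is a truncation. -/
structure IsGalerkin (K : Finset Idx) (T : ℝ) (θ : ℝ → ℝ) (z u : ℝ → Coeff) : Prop where
  supp : ∀ t, ∀ k ∉ K, u t k = 0
  real : ∀ t, IsReal (u t)
  cont : ∀ k, Continuous fun t => u t k
  deriv : ∀ t ∈ Set.Ioo 0 T, ∀ k ∈ K, HasDerivAt (fun s => u s k)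
    ((θ t : ℂ) * (-((len k.1 ^ 2 : ℝ) : ℂ) * u t k + (-bil (u t + z t) (u t + z t)) k)) t

lemma le_toReal_mul {C : ℝ≥0∞} (hC : C ≠ ∞) {s x : ℝ} (hx : 0 ≤ x)
    (h : ENNReal.ofReal s ≤ C * ENNReal.ofReal x) : s ≤ C.toReal * x := by
  rw [← ENNReal.ofReal_toReal hC, ← ENNReal.ofReal_mul ENNReal.toReal_nonneg] at h
  exact (ENNReal.ofReal_le_ofReal_iff (by positivity)).1 h

/-- A path of coefficients supported in `K`. -/
def SuppIn (K : Finset Idx) (u : Coeff) : Prop := ∀ k ∉ K, u k = 0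

lemma SuppIn.normSq_ne_top {K : Finset Idx} {u : Coeff} (h : SuppIn K u) (r : ℝ) :
    normSq r u ≠ ∞ := by rw [normSq_eq_fsum h]; exact ENNReal.ofReal_ne_top

/-- The symmetric choice a = a' = 1/2, made so that both arguments can be interpolated between
consecutive integer-spaced norms. -/
lemma exists_fsum_bil_le {σ : ℝ} (h0 : 0 ≤ σ) (h1 : σ ≤ 1) :
    ∃ C : ℝ, 0 ≤ C ∧ ∀ (K : Finset Idx) (u v : Coeff), SuppIn K u → SuppIn K v →
      fsum K (σ - 1) (bil u v) ≤ C * (fsum K (σ + 1 / 2) u * fsum K (1 / 2) v +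
        fsum K (1 / 2) u * fsum K (σ + 1 / 2) v) := by
  obtain ⟨C, hC, h⟩ := normSq_bil_le (r := σ) (a := 1 / 2) (a' := 1 / 2) h0 h1
    (by norm_num) (by norm_num) (by norm_num) (by norm_num)
  refine ⟨C.toReal, ENNReal.toReal_nonneg, fun K u v hu hv => ?_⟩
  have p := fsum_nonneg K
  apply le_toReal_mul hC (by have := p (σ + 1 / 2) u; have := p (1 / 2) v
                             have := p (1 / 2) u; have := p (σ + 1 / 2) v; positivity)
  refine (ofReal_fsum_le _ _ _).trans ((h u v).trans (le_of_eq ?_))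
  norm_num only [normSq_eq_fsum hu, normSq_eq_fsum hv]
  rw [← ENNReal.ofReal_mul (p _ _), ← ENNReal.ofReal_mul (p _ _),
    ← ENNReal.ofReal_add (mul_nonneg (p _ _) (p _ _)) (mul_nonneg (p _ _) (p _ _))]

/-- If the right hand side of a bilinear estimate is controlled by one norm of `u` and one of `z`,
then so is the finite sum. -/
lemma fsum_le_of_normSq_le {C : ℝ≥0∞} (hC : C ≠ ∞) {K : Finset Idx} {r s q M : ℝ}
    {f u z : Coeff} (hM : 0 ≤ M) (hu : SuppIn K u) (hz : normSq q z ≤ ENNReal.ofReal M)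
    (h : normSq r f ≤ C * (normSq s u * normSq q z)) :
    fsum K r f ≤ C.toReal * (M * fsum K s u) := by
  have p := fsum_nonneg K s u
  apply le_toReal_mul hC (by positivity)
  refine (ofReal_fsum_le _ _ _).trans (h.trans ?_)
  rw [mul_comm M, ENNReal.ofReal_mul p, ← normSq_eq_fsum hu]
  gcongr

lemma add_le_two_mul_of_le {C X Y Z : ℝ≥0∞} (hX : X ≤ Z) (hY : Y ≤ Z) :
    C * (X + Y) ≤ (2 * C) * Z := by
  calc C * (X + Y) ≤ C * (Z + Z) := by gcongr
    _ = _ := by ring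

/-- The exponents are chosen so that u enters only through H^1, which the energy estimate already
controls: a = 1−σ, a' = 1−ε for B(u,z), and a = ε, a' = σ for B(z,u). -/
lemma exists_normSq_bil_mixed_le {σ ε : ℝ} (hε : 0 < ε) (hεσ : ε ≤ σ) (hσ : σ + 2 * ε < 1) :
    ∃ C : ℝ≥0∞, C ≠ ∞ ∧ ∀ u z : Coeff,
      normSq (σ - 1) (bil u z) ≤ C * (normSq 1 u * normSq (σ + 2 * ε) z) ∧
      normSq (σ - 1) (bil z u) ≤ C * (normSq 1 u * normSq (σ + 2 * ε) z) := by
  obtain ⟨C₁, hC₁, h₁⟩ := normSq_bil_le (r := σ) (a := 1 - σ) (a' := 1 - ε) (by linarith)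
    (by linarith) (by linarith) (by linarith) (by linarith) (by linarith)
  obtain ⟨C₂, hC₂, h₂⟩ := normSq_bil_le (r := σ) (a := ε) (a' := σ) (by linarith)
    (by linarith) (by linarith) (by linarith) (by linarith) (by linarith)
  refine ⟨2 * C₁ + 2 * C₂, by finiteness, fun u z => ⟨?_, ?_⟩⟩
  · refine (h₁ u z).trans ?_
    refine (add_le_two_mul_of_le (Z := normSq 1 u * normSq (σ + 2 * ε) z) ?_ ?_).trans ?_
    · exact mul_le_mul' (normSq_mono (by linarith) _) (normSq_mono (by linarith) _)
    · exact mul_le_mul' (normSq_mono (by linarith) _) (normSq_mono (by linarith) _)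
    · exact mul_le_mul' le_self_add le_rfl
  · refine (h₂ z u).trans ?_
    refine (add_le_two_mul_of_le (Z := normSq 1 u * normSq (σ + 2 * ε) z) ?_ ?_).trans ?_
    · rw [mul_comm]
      exact mul_le_mul' (normSq_mono (by linarith) _) (normSq_mono (by linarith) _)
    · rw [mul_comm]
      exact mul_le_mul' (normSq_mono (by linarith) _) (normSq_mono (by linarith) _)
    · exact mul_le_mul' le_add_self le_rfl

/-- The ε extra derivatives of B give the convergence rate. The worst terms pair ‖u‖_{1−ε} with
‖z‖_{σ+2ε}, which is why z needs 2ε more derivatives than u. -/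
lemma exists_normSq_bil_gain_le {σ ε : ℝ} (hε : 0 < ε) (hεσ : ε ≤ σ) (hσ : σ + 2 * ε < 1) :
    ∃ C : ℝ≥0∞, C ≠ ∞ ∧
      (∀ u v : Coeff, normSq (σ + ε - 1) (bil u v) ≤
        C * (normSq (σ + 1) u * normSq σ v + normSq σ u * normSq (σ + 1) v)) ∧
      ∀ u z : Coeff,
      normSq (σ + ε - 1) (bil u z) ≤ C * (normSq (σ + 1) u * normSq (σ + 2 * ε) z) ∧
      normSq (σ + ε - 1) (bil z u) ≤ C * (normSq (σ + 1) u * normSq (σ + 2 * ε) z) := by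
  obtain ⟨C₁, hC₁, h₁⟩ := normSq_bil_le (r := σ + ε) (a := 1 - ε) (a' := 1 - ε) (by linarith)
    (by linarith) (by linarith) (by linarith) (by linarith) (by linarith)
  obtain ⟨C₂, hC₂, h₂⟩ := normSq_bil_le (r := σ + ε) (a := ε) (a' := ε) (by linarith)
    (by linarith) (by linarith) (by linarith) (by linarith) (by linarith)
  obtain ⟨C₃, hC₃, h₃⟩ := normSq_bil_le (r := σ + ε) (a := 1 - ε) (a' := ε) (by linarith)
    (by linarith) (by linarith) (by linarith) (by linarith) (by linarith)
  refine ⟨2 * C₁ + 2 * C₂ + C₃, by finiteness, fun u v => ?_, fun u z => ⟨?_, ?_⟩⟩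
  · refine (h₃ u v).trans (mul_le_mul' le_add_self (add_le_add ?_ ?_))
    · exact mul_le_mul' (normSq_mono (by linarith) _) (normSq_mono (by linarith) _)
    · exact mul_le_mul' (normSq_mono (by linarith) _) (normSq_mono (by linarith) _)
  · refine (h₁ u z).trans ?_
    refine (add_le_two_mul_of_le (Z := normSq (σ + 1) u * normSq (σ + 2 * ε) z) ?_ ?_).trans ?_
    · exact mul_le_mul' (normSq_mono (by linarith) _) (normSq_mono (by linarith) _)
    · exact mul_le_mul' (normSq_mono (by linarith) _) (normSq_mono (by linarith) _)
    · exact mul_le_mul' (le_self_add.trans le_self_add) le_rfl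
  · refine (h₂ z u).trans ?_
    refine (add_le_two_mul_of_le (Z := normSq (σ + 1) u * normSq (σ + 2 * ε) z) ?_ ?_).trans ?_
    · rw [mul_comm]
      exact mul_le_mul' (normSq_mono (by linarith) _) (normSq_mono (by linarith) _)
    · rw [mul_comm]
      exact mul_le_mul' (normSq_mono (by linarith) _) (normSq_mono (by linarith) _)
    · exact mul_le_mul' (le_add_self.trans le_self_add) le_rfl

/-- Since 1 − σ < 1, the norm of u is subcritical for the dissipation, so a large z is harmless in
the energy balance. -/
lemma exists_normSq_bil_energy_le {σ : ℝ} (h0 : 0 < σ) (h1 : σ < 1) :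
    ∃ C : ℝ≥0∞, C ≠ ∞ ∧ ∀ u z : Coeff,
      normSq (0 - 1) (bil u z) ≤ C * (normSq (1 - σ) u * normSq σ z) := by
  obtain ⟨C, hC, h⟩ := normSq_bil_le (r := 0) (a := 1 - σ) (a' := 1 - σ) le_rfl zero_le_one
    (by linarith) (by linarith) (by linarith) (by linarith)
  refine ⟨2 * C, by finiteness, fun u z => (h u z).trans (add_le_two_mul_of_le ?_ ?_)⟩ <;> simp

lemma IsGalerkin.suppIn {K : Finset Idx} {T : ℝ} {θ : ℝ → ℝ} {z u : ℝ → Coeff}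
    (h : IsGalerkin K T θ z u) (t : ℝ) : SuppIn K (u t) := h.supp t

lemma continuous_fsum {K : Finset Idx} (r : ℝ) {f : ℝ → Coeff}
    (h : ∀ k, Continuous fun t => f t k) : Continuous fun t => fsum K r (f t) := by
  unfold fsum
  exact continuous_finsetSum K fun k _ => continuous_const.mul ((h k).norm.pow 2)

lemma bracket_eq_sum {K : Finset Idx} {f g : Coeff} (hg : SuppIn K g) :
    bracket f g = ∑ k ∈ K, f k * conj (g k) :=
  tsum_eq_sum fun k hk => by simp [hg k hk]

/-! ### The energy estimate -/

/-- The projection onto K does not spoil the cancellation: u is supported in K, so the finite sum is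
the full bracket ⟨B(v,u),u⟩. -/
lemma sum_re_bil_self_eq_zero {K : Finset Idx} {σ : ℝ} (h0 : 0 < σ) (h1 : σ < 1) {u v : Coeff}
    (hu : SuppIn K u) (hur : IsReal u) (hv : normSq σ v ≠ ∞) :
    ∑ k ∈ K, (bil v u k * conj (u k)).re = 0 := by
  obtain ⟨C, hC, h⟩ := absTri_sq_le h0 h1
  have hfin : absTri v u u ≠ ∞ := by
    have h3 : absTri v u u ^ 2 ≠ ∞ := by
      refine ne_top_of_le_ne_top ?_ (h v u u)
      have h4 := hu.normSq_ne_top 1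
      have h5 := hu.normSq_ne_top (1 - σ)
      finiteness
    exact fun e => h3 (by simp [e])
  have h2 := bracket_bil_self hur hfin
  rw [bracket_eq_sum hu] at h2
  have := congrArg Complex.re h2
  simpa using this

/-- After B(u+z,u) drops out, B(u,z) is absorbed by interpolation and B(z,z) is a forcing. The
truncation θ multiplies the whole right-hand side and lies in [0,1], so the bound on ‖u‖_0 does not
depend on it; this is what allows its later removal. -/
lemma galerkin_energy {σ M : ℝ} (h0 : 0 < σ) (h1 : σ < 1) (hM : 0 ≤ M) :
    ∃ C : ℝ, 0 ≤ C ∧ ∀ (K : Finset Idx) (T : ℝ) (θ : ℝ → ℝ) (z u : ℝ → Coeff),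
      IsGalerkin K T θ z u → Continuous θ → (∀ t, 0 ≤ θ t ∧ θ t ≤ 1) → HCont 0 z →
      (∀ t, normSq σ (z t) ≤ ENNReal.ofReal M) →
      ∀ t ∈ Set.Icc 0 T, fsum K 0 (u t) + ∫ s in (0 : ℝ)..t, θ s * fsum K 1 (u s) ≤
        Real.exp (C * t) * (fsum K 0 (u 0) +
          ∫ s in (0 : ℝ)..t, 4 * fsum K (-1) (bil (z s) (z s))) := by
  obtain ⟨C₀, hC₀, hbil⟩ := exists_normSq_bil_energy_le h0 h1
  -- The term 4 C₀ M ‖u‖²_{1−σ} may use at most half of the dissipation, which fixes η.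
  obtain ⟨C₁, hC₁, hint⟩ := exists_fsum_interp (r := 0) (s := 1 - σ) (q := 1) (by linarith)
    (by linarith) (η := 1 / (8 * (C₀.toReal * M + 1))) (by positivity)
  have hc0 : 0 ≤ C₀.toReal := ENNReal.toReal_nonneg
  refine ⟨4 * (C₀.toReal * M) * C₁, by positivity, fun K T θ z u hu hθc hθ hz hzM t ht => ?_⟩
  have hzfin : ∀ t, normSq σ (z t) ≠ ∞ := fun t => ne_top_of_le_ne_top (by simp) (hzM t)
  have hmain := gronwall_dissipation (T := T) (y := fun t => fsum K 0 (u t))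
    (D := fun t => θ t * fsum K 1 (u t)) (α := fun _ => 4 * (C₀.toReal * M) * C₁)
    (β := fun t => 4 * fsum K (-1) (bil (z t) (z t)))
    (continuous_fsum 0 hu.cont) (hθc.mul (continuous_fsum 1 hu.cont)) continuous_const
    (continuous_const.mul (continuous_fsum (-1) fun k => hz.continuous_bil hz k))
    (fun t => mul_nonneg (hθ t).1 (fsum_nonneg _ _ _)) (fun _ => by positivity)
    (fun t => by have := fsum_nonneg K (-1) (bil (z t) (z t)); positivity) (fun t ht => ?_) ht
  · rwa [intervalIntegral.integral_const, sub_zero, smul_eq_mul, mul_comm t] at hmain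
  refine ⟨_, hasDerivAt_fsum 0 (hu.deriv t ht), ?_⟩
  rw [fsum_deriv_eq]
  have hu0 := (hu.suppIn t).normSq_ne_top 0
  have huz : normSq 0 (u t + z t) ≠ ∞ := normSq_add_ne_top hu0 (hz.1 t)
  have huσ : normSq σ (u t + z t) ≠ ∞ := normSq_add_ne_top ((hu.suppIn t).normSq_ne_top σ) (hzfin t)
  have hdec : bil (u t + z t) (u t + z t) =
      bil (u t + z t) (u t) + (bil (u t) (z t) + bil (z t) (z t)) := by
    rw [bil_add_right (bilConv_of_normSq huz hu0) (bilConv_of_normSq huz (hz.1 t)),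
      bil_add_left (bilConv_of_normSq hu0 (hz.1 t)) (bilConv_of_normSq (hz.1 t) (hz.1 t))]
  have hz0 := sum_re_bil_self_eq_zero h0 h1 (hu.suppIn t) (hu.real t) huσ
  have hsum : 2 * ∑ k ∈ K, len k.1 ^ (2 * (0 : ℝ)) *
      ((-bil (u t + z t) (u t + z t)) k * conj (u t k)).re =
      -(2 * ∑ k ∈ K, len k.1 ^ (2 * (0 : ℝ)) *
        ((bil (u t) (z t) + bil (z t) (z t)) k * conj (u t k)).re) := by
    rw [hdec]
    have : ∀ k, ((-(bil (u t + z t) (u t) + (bil (u t) (z t) + bil (z t) (z t)))) k *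
        conj (u t k)).re = -(bil (u t + z t) (u t) k * conj (u t k)).re -
          ((bil (u t) (z t) + bil (z t) (z t)) k * conj (u t k)).re := by
      intro k
      simp only [Pi.neg_apply, Pi.add_apply, Complex.mul_re, Complex.neg_re, Complex.neg_im,
        Complex.add_re, Complex.add_im]
      ring
    simp only [this, mul_zero, Real.rpow_zero, one_mul]
    rw [Finset.sum_sub_distrib, Finset.sum_neg_distrib, hz0]
    ring
  rw [hsum]
  have hb := two_mul_sum_re_le K 0 (δ := 1 / 2) (by norm_num)
    (bil (u t) (z t) + bil (z t) (z t)) (u t)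
  have hb1 := (abs_le.1 hb).1
  have hb2 := fsum_add_le K (0 - 1) (bil (u t) (z t)) (bil (z t) (z t))
  have hb3 := fsum_le_of_normSq_le hC₀ hM (hu.suppIn t) (hzM t) (hbil (u t) (z t))
  have hb4 := hint K (u t)
  have p1 := fsum_nonneg K 1 (u t)
  have p0 := fsum_nonneg K 0 (u t)
  have pz := fsum_nonneg K (-1) (bil (z t) (z t))
  simp only [zero_add, zero_sub] at hb1 hb2 hb3 ⊢
  have hX : 0 ≤ C₀.toReal * M := by positivity
  set X := C₀.toReal * M with hXdef
  have h5 : 4 * X * fsum K (1 - σ) (u t) ≤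
      1 / 2 * fsum K 1 (u t) + 4 * X * C₁ * fsum K 0 (u t) := by
    have h6 : 4 * X * fsum K (1 - σ) (u t) ≤
      4 * X * (1 / (8 * (X + 1)) * fsum K 1 (u t) + C₁ * fsum K 0 (u t)) := by gcongr
    have h7 : 4 * X * (1 / (8 * (X + 1))) ≤ 1 / 2 := by
      rw [mul_one_div, div_le_div_iff₀ (by positivity) (by norm_num)]; linarith
    nlinarith
  have hb3' : fsum K (-1) (bil (u t) (z t)) ≤ X * fsum K (1 - σ) (u t) := by
    rw [hXdef]; linarith
  have hθt := hθ t
  have hk : -2 * fsum K 1 (u t) +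
      -(2 * ∑ k ∈ K, len k.1 ^ (2 * (0 : ℝ)) *
        ((bil (u t) (z t) + bil (z t) (z t)) k * conj (u t k)).re) + fsum K 1 (u t) ≤
      4 * X * C₁ * fsum K 0 (u t) + 4 * fsum K (-1) (bil (z t) (z t)) := by
    norm_num at hb1 ⊢
    linarith
  have hk2 := mul_le_mul_of_nonneg_left hk hθt.1
  have hk3 : θ t * (4 * X * C₁ * fsum K 0 (u t) + 4 * fsum K (-1) (bil (z t) (z t))) ≤
      4 * X * C₁ * fsum K 0 (u t) + 4 * fsum K (-1) (bil (z t) (z t)) :=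
    mul_le_of_le_one_left (by positivity) hθt.2
  linarith

/-! ### Estimates in `H^σ` -/

/-- Young's inequality for interpolated quantities: if `x² ≤ y z` then `c x ≤ δ z + c² y / (4 δ)`. -/
lemma mul_le_of_sq_le {x y z c δ : ℝ} (hy : 0 ≤ y) (hz : 0 ≤ z) (hδ : 0 < δ)
    (h : x ^ 2 ≤ y * z) : c * x ≤ δ * z + c ^ 2 / (4 * δ) * y := by
  have h1 : 0 ≤ δ * z + c ^ 2 / (4 * δ) * y := by positivity
  apply le_of_sq_le_sq _ h1
  have h2 : (c * x) ^ 2 ≤ c ^ 2 * (y * z) := by rw [mul_pow]; gcongr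
  have h3 : (δ * z + c ^ 2 / (4 * δ) * y) ^ 2 - c ^ 2 * (y * z) =
      (δ * z - c ^ 2 / (4 * δ) * y) ^ 2 := by field_simp; ring
  nlinarith [sq_nonneg (δ * z - c ^ 2 / (4 * δ) * y)]

lemma fsum_add_four_le (K : Finset Idx) (r : ℝ) (a b c d : Coeff) :
    fsum K r (a + b + c + d) ≤ 8 * (fsum K r a + fsum K r b + fsum K r c + fsum K r d) := by
  have h1 := fsum_add_le K r (a + b + c) d
  have h2 := fsum_add_le K r (a + b) c
  have h3 := fsum_add_le K r a b
  have := fsum_nonneg K r c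
  have := fsum_nonneg K r d
  linarith

lemma energy_ineq {K : Finset Idx} {r : ℝ} {w : ℝ → Coeff} {f : Coeff} {t : ℝ}
    (h : ∀ k ∈ K, HasDerivAt (fun s => w s k)
      (-((len k.1 ^ 2 : ℝ) : ℂ) * w t k + f k) t) :
    ∃ y', HasDerivAt (fun s => fsum K r (w s)) y' t ∧
      y' + fsum K (r + 1) (w t) ≤ fsum K (r - 1) f := by
  refine ⟨_, hasDerivAt_fsum r h, ?_⟩
  have h1 := fsum_deriv_eq (K := K) r 1 (w := w t) (f := f)
  simp only [Complex.ofReal_one, one_mul] at h1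
  rw [h1]
  have h2 := (abs_le.1 (two_mul_sum_re_le K r one_pos f (w t))).2
  simp only [inv_one, one_mul] at h2
  linarith

lemma IsGalerkin.deriv_one {K : Finset Idx} {T : ℝ} {z u : ℝ → Coeff}
    (h : IsGalerkin K T (fun _ => 1) z u) {t : ℝ} (ht : t ∈ Set.Ioo 0 T) {k : Idx} (hk : k ∈ K) :
    HasDerivAt (fun s => u s k)
      (-((len k.1 ^ 2 : ℝ) : ℂ) * u t k + (-bil (u t + z t) (u t + z t)) k) t := by
  simpa using h.deriv t ht k hk

/-- The term ‖u‖²_{1/2} ‖u‖²_{σ+1/2} from B(u,u) is interpolated twice: ‖u‖⁴_{σ+1/2} ≤ ‖u‖²_σ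
‖u‖²_{σ+1} feeds the dissipation, and ‖u‖⁴_{1/2} ≤ ‖u‖²_0 ‖u‖²_1 becomes the Gronwall rate, as in
the classical two-dimensional theory. The terms mixed with z are forcings of size ‖u‖²_1. -/
lemma galerkin_energy_smooth {σ ε M : ℝ} (hε : 0 < ε) (hεσ : ε ≤ σ) (hσ : σ + 2 * ε < 1)
    (hM : 0 ≤ M) :
    ∃ C : ℝ, 0 ≤ C ∧ ∀ (K : Finset Idx) (T : ℝ) (z u : ℝ → Coeff),
      IsGalerkin K T (fun _ => 1) z u → HCont 0 z →
      (∀ t, normSq (σ + 2 * ε) (z t) ≤ ENNReal.ofReal M) →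
      ∀ t ∈ Set.Icc 0 T, fsum K σ (u t) + ∫ s in (0 : ℝ)..t, 1 / 2 * fsum K (σ + 1) (u s) ≤
        Real.exp (∫ s in (0 : ℝ)..t, C * (fsum K 0 (u s) * fsum K 1 (u s))) * (fsum K σ (u 0) +
          ∫ s in (0 : ℝ)..t, (C * fsum K 1 (u s) + 8 * fsum K (σ - 1) (bil (z s) (z s)))) := by
  obtain ⟨C₀, hC₀, hbil⟩ := exists_fsum_bil_le (σ := σ) (by linarith) (by linarith)
  obtain ⟨C₁, hC₁, hmix⟩ := exists_normSq_bil_mixed_le hε hεσ hσ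
  have hc1 : 0 ≤ C₁.toReal := ENNReal.toReal_nonneg
  refine ⟨128 * C₀ ^ 2 + 16 * (C₁.toReal * M), by positivity, fun K T z u hu hz hzM t ht => ?_⟩
  set C := 128 * C₀ ^ 2 + 16 * (C₁.toReal * M) with hC
  have hCpos : 0 ≤ C := by positivity
  have p := fsum_nonneg K
  have c := fun r => continuous_fsum (K := K) r hu.cont
  have cz := continuous_fsum (K := K) (σ - 1) fun k => hz.continuous_bil hz k
  refine gronwall_dissipation (T := T) (y := fun t => fsum K σ (u t))
    (D := fun t => 1 / 2 * fsum K (σ + 1) (u t))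
    (α := fun s => C * (fsum K 0 (u s) * fsum K 1 (u s)))
    (β := fun s => C * fsum K 1 (u s) + 8 * fsum K (σ - 1) (bil (z s) (z s)))
    (c σ) (continuous_const.mul (c _)) (continuous_const.mul ((c _).mul (c _)))
    ((continuous_const.mul (c _)).add (continuous_const.mul cz))
    (fun t => by have := p (σ + 1) (u t); positivity)
    (fun t => by have := p 0 (u t); have := p 1 (u t); positivity)
    (fun t => by have := p 1 (u t); have := p (σ - 1) (bil (z t) (z t)); positivity)
    (fun t ht => ?_) ht
  obtain ⟨y', hy', hle⟩ := energy_ineq (r := σ) fun k hk => hu.deriv_one ht hk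
  refine ⟨y', hy', ?_⟩
  have hu0 := (hu.suppIn t).normSq_ne_top 0
  rw [fsum_neg, bil_add_add hu0 (hz.1 t)] at hle
  have h4 := fsum_add_four_le K (σ - 1) (bil (u t) (u t)) (bil (u t) (z t)) (bil (z t) (u t))
    (bil (z t) (z t))
  have b1 := hbil K (u t) (u t) (hu.suppIn t) (hu.suppIn t)
  have b2 := fsum_le_of_normSq_le hC₁ hM (hu.suppIn t) (hzM t) (hmix (u t) (z t)).1
  have b3 := fsum_le_of_normSq_le hC₁ hM (hu.suppIn t) (hzM t) (hmix (u t) (z t)).2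
  have i1 := fsum_half_sq_le K σ (u t)
  have i2 := fsum_half_sq_le K 0 (u t)
  simp only [zero_add] at i2
  have y1 := mul_le_of_sq_le (c := 16 * C₀ * fsum K (1 / 2) (u t)) (δ := 1 / 2)
    (p σ (u t)) (p (σ + 1) (u t)) (by norm_num) i1
  have y2 : (16 * C₀ * fsum K (1 / 2) (u t)) ^ 2 / (4 * (1 / 2)) * fsum K σ (u t) ≤
      128 * C₀ ^ 2 * (fsum K 0 (u t) * fsum K 1 (u t)) * fsum K σ (u t) := by
    refine mul_le_mul_of_nonneg_right ?_ (p _ _)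
    have : (16 * C₀ * fsum K (1 / 2) (u t)) ^ 2 / (4 * (1 / 2)) =
      128 * C₀ ^ 2 * fsum K (1 / 2) (u t) ^ 2 := by ring
    rw [this]
    gcongr
  have y3 : 128 * C₀ ^ 2 * (fsum K 0 (u t) * fsum K 1 (u t)) * fsum K σ (u t) ≤
      C * (fsum K 0 (u t) * fsum K 1 (u t)) * fsum K σ (u t) := by
    have := p 0 (u t); have := p 1 (u t); have := p σ (u t)
    gcongr
    rw [hC]; linarith [show 0 ≤ 16 * (C₁.toReal * M) by positivity]
  have y4 : 16 * (C₁.toReal * M) * fsum K 1 (u t) ≤ C * fsum K 1 (u t) := by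
    have := p 1 (u t)
    gcongr
    rw [hC]; linarith [show 0 ≤ 128 * C₀ ^ 2 by positivity]
  have b1' : 8 * fsum K (σ - 1) (bil (u t) (u t)) ≤
      16 * C₀ * fsum K (1 / 2) (u t) * fsum K (σ + 1 / 2) (u t) := by linarith
  have b2' : 8 * fsum K (σ - 1) (bil (u t) (z t)) + 8 * fsum K (σ - 1) (bil (z t) (u t)) ≤
      16 * (C₁.toReal * M) * fsum K 1 (u t) := by linarith
  linarith

lemma integral_le_of_Icc {f : ℝ → ℝ} (hf : Continuous f) (h0 : ∀ s, 0 ≤ f s) {t T : ℝ}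
    (ht : t ∈ Set.Icc 0 T) : ∫ s in (0 : ℝ)..t, f s ≤ ∫ s in (0 : ℝ)..T, f s := by
  rw [← intervalIntegral.integral_add_adjacent_intervals (hf.intervalIntegrable 0 t)
    (hf.intervalIntegrable t T)]
  linarith [intervalIntegral.integral_nonneg (μ := volume) ht.2 fun s _ => h0 s]

/-- The Galerkin approximations are bounded in `C([0,T]; H^σ) ∩ L²(0,T; H^{1+σ})`. -/
lemma galerkin_bound {σ ε M : ℝ} (hε : 0 < ε) (hεσ : ε ≤ σ) (hσ : σ + 2 * ε < 1)
    (hM : 0 ≤ M) {T A G : ℝ} (hA : 0 ≤ A) (hG : 0 ≤ G) :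
    ∃ R : ℝ, 0 ≤ R ∧ ∀ (K : Finset Idx) (z u : ℝ → Coeff),
      IsGalerkin K T (fun _ => 1) z u → HCont 0 z →
      (∀ t, normSq (σ + 2 * ε) (z t) ≤ ENNReal.ofReal M) → fsum K σ (u 0) ≤ A →
      ∫ s in (0 : ℝ)..T, fsum K (σ - 1) (bil (z s) (z s)) ≤ G →
      ∀ t ∈ Set.Icc 0 T, fsum K σ (u t) ≤ R ∧ ∫ s in (0 : ℝ)..t, fsum K (σ + 1) (u s) ≤ R := by
  have hσ0 : 0 < σ := by linarith
  obtain ⟨C₀, hC₀, hen⟩ := galerkin_energy (σ := σ) hσ0 (by linarith) hM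
  obtain ⟨C₁, hC₁, hsm⟩ := galerkin_energy_smooth hε hεσ hσ hM
  set R₀ := Real.exp (C₀ * T) * (A + 4 * G) with hR₀
  have hR₀0 : 0 ≤ R₀ := by positivity
  -- The factor 2 undoes the 1/2 left in front of the dissipation.
  set R := 2 * (Real.exp (C₁ * (R₀ * R₀)) * (A + (C₁ * R₀ + 8 * G))) with hR
  refine ⟨R, by positivity, fun K z u hu hz hzM h0 hGb t ht => ?_⟩
  have p := fsum_nonneg K
  have c := fun r => continuous_fsum (K := K) r hu.cont
  have cz := fun r => continuous_fsum (K := K) r fun k => hz.continuous_bil hz k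
  have hGt : ∀ t ∈ Set.Icc 0 T, ∫ s in (0 : ℝ)..t, fsum K (σ - 1) (bil (z s) (z s)) ≤ G :=
    fun t ht => (integral_le_of_Icc (cz _) (fun s => p _ _) ht).trans hGb
  have hE : ∀ t ∈ Set.Icc 0 T, fsum K 0 (u t) ≤ R₀ ∧ ∫ s in (0 : ℝ)..t, fsum K 1 (u s) ≤ R₀ := by
    intro t ht
    have h1 := hen K T (fun _ => 1) z u hu continuous_const (fun _ => ⟨zero_le_one, le_rfl⟩) hz
      (fun t => (normSq_mono (by linarith) _).trans (hzM t)) t ht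
    simp only [one_mul] at h1
    have h2 : ∫ s in (0 : ℝ)..t, 4 * fsum K (-1) (bil (z s) (z s)) ≤ 4 * G := by
      rw [intervalIntegral.integral_const_mul]
      refine mul_le_mul_of_nonneg_left (le_trans ?_ (hGt t ht)) (by norm_num)
      exact intervalIntegral.integral_mono_on ht.1 ((cz _).intervalIntegrable _ _)
        ((cz _).intervalIntegrable _ _) fun s _ => fsum_mono (by linarith) _ _
    have h3 : fsum K 0 (u 0) ≤ A := (fsum_mono hσ0.le _ _).trans h0
    have h4 : 0 ≤ ∫ s in (0 : ℝ)..t, 4 * fsum K (-1) (bil (z s) (z s)) :=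
      intervalIntegral.integral_nonneg ht.1 fun s _ => by
        have := p (-1) (bil (z s) (z s)); positivity
    have h5 : Real.exp (C₀ * t) * (fsum K 0 (u 0) +
        ∫ s in (0 : ℝ)..t, 4 * fsum K (-1) (bil (z s) (z s))) ≤ R₀ := by
      have := p 0 (u 0)
      rw [hR₀]
      gcongr
      exact ht.2
    have h6 : 0 ≤ ∫ s in (0 : ℝ)..t, fsum K 1 (u s) :=
      intervalIntegral.integral_nonneg ht.1 fun s _ => p _ _
    have h7 := p 0 (u t)
    constructor <;> linarith
  have h1 := hsm K T z u hu hz hzM t ht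
  have h2 : ∫ s in (0 : ℝ)..t, C₁ * (fsum K 0 (u s) * fsum K 1 (u s)) ≤ C₁ * (R₀ * R₀) := by
    rw [intervalIntegral.integral_const_mul]
    refine mul_le_mul_of_nonneg_left ?_ hC₁
    calc ∫ s in (0 : ℝ)..t, fsum K 0 (u s) * fsum K 1 (u s)
        ≤ ∫ s in (0 : ℝ)..t, R₀ * fsum K 1 (u s) := by
          apply intervalIntegral.integral_mono_on ht.1 (((c _).mul (c _)).intervalIntegrable _ _)
            ((continuous_const.mul (c _)).intervalIntegrable _ _)
          intro s hs
          exact mul_le_mul_of_nonneg_right (hE s ⟨hs.1, hs.2.trans ht.2⟩).1 (p _ _)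
      _ ≤ _ := by
          rw [intervalIntegral.integral_const_mul]
          exact mul_le_mul_of_nonneg_left (hE t ht).2 hR₀0
  have h3 : ∫ s in (0 : ℝ)..t, (C₁ * fsum K 1 (u s) + 8 * fsum K (σ - 1) (bil (z s) (z s))) ≤
      C₁ * R₀ + 8 * G := by
    rw [intervalIntegral.integral_add (((c _).intervalIntegrable _ _).const_mul _)
      (((cz _).intervalIntegrable _ _).const_mul _), intervalIntegral.integral_const_mul,
      intervalIntegral.integral_const_mul]
    gcongr
    · exact (hE t ht).2
    · exact hGt t ht
  have h4 : 0 ≤ ∫ s in (0 : ℝ)..t, (C₁ * fsum K 1 (u s) + 8 * fsum K (σ - 1) (bil (z s) (z s))) :=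
    intervalIntegral.integral_nonneg ht.1 fun s _ => by
      have := p 1 (u s); have := p (σ - 1) (bil (z s) (z s)); positivity
  have h5 : Real.exp (∫ s in (0 : ℝ)..t, C₁ * (fsum K 0 (u s) * fsum K 1 (u s))) *
      (fsum K σ (u 0) + ∫ s in (0 : ℝ)..t,
        (C₁ * fsum K 1 (u s) + 8 * fsum K (σ - 1) (bil (z s) (z s)))) ≤ R / 2 := by
    have := p σ (u 0)
    rw [hR, mul_div_cancel_left₀ _ (by norm_num)]
    gcongr
  rw [intervalIntegral.integral_const_mul] at h1
  have h6 : 0 ≤ ∫ s in (0 : ℝ)..t, fsum K (σ + 1) (u s) :=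
    intervalIntegral.integral_nonneg ht.1 fun s _ => p _ _
  have h7 := p σ (u t)
  constructor <;> linarith

/-! ### The difference of two Galerkin approximations -/

lemma SuppIn.mono {K K' : Finset Idx} (h : K ⊆ K') {u : Coeff} (hu : SuppIn K u) : SuppIn K' u :=
  fun k hk => hu k fun hk' => hk (h hk')

lemma SuppIn.sub {K : Finset Idx} {u v : Coeff} (hu : SuppIn K u) (hv : SuppIn K v) :
    SuppIn K (u - v) := fun k hk => by simp [hu k hk, hv k hk]

/-- The forcing in the equation of the difference of two Galerkin approximations. -/
def diffForce (K : Finset Idx) (v v' : Coeff) : Coeff := fun k =>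
  open Classical in if k ∈ K then -(bil v v - bil v' v') k else bil v' v' k

/-- On K the forcing is a difference, small with u − u'. On K' \ K it is the full B(v',v'), but
there |k| ≥ N and ε derivatives are exchanged for N^{−2ε}. -/
lemma fsum_diffForce_le {K K' : Finset Idx} {σ ε N : ℝ} (hε : 0 ≤ ε) (hN : 0 < N)
    (hKN : ∀ k ∈ K', k ∉ K → N ≤ len k.1) (v v' : Coeff) :
    fsum K' (σ - 1) (diffForce K v v') ≤ fsum K' (σ - 1) (bil v v - bil v' v') +
      N ^ (-(2 * ε)) * fsum K' (σ + ε - 1) (bil v' v') := by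
  unfold fsum
  rw [Finset.mul_sum, ← Finset.sum_add_distrib]
  refine Finset.sum_le_sum fun k hk => ?_
  have hp : ∀ s : ℝ, 0 ≤ len k.1 ^ s := fun s => Real.rpow_nonneg (len_nonneg _) _
  have hNp : 0 ≤ N ^ (-(2 * ε)) := Real.rpow_nonneg hN.le _
  unfold diffForce
  split_ifs with h
  · rw [norm_neg]
    have : 0 ≤ N ^ (-(2 * ε)) * (len k.1 ^ (2 * (σ + ε - 1)) * ‖bil v' v' k‖ ^ 2) := by
      have := hp (2 * (σ + ε - 1)); positivity
    linarith
  · have h1 : len k.1 ^ (2 * (σ - 1)) ≤ N ^ (-(2 * ε)) * len k.1 ^ (2 * (σ + ε - 1)) := by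
      have e : len k.1 ^ (2 * (σ - 1)) = len k.1 ^ (-(2 * ε)) * len k.1 ^ (2 * (σ + ε - 1)) := by
        rw [← Real.rpow_add (len_pos k)]; ring_nf
      rw [e]
      have := hp (2 * (σ + ε - 1))
      exact mul_le_mul_of_nonneg_right
        (Real.rpow_le_rpow_of_nonpos hN (hKN k hk h) (by linarith)) this
    have h2 : 0 ≤ len k.1 ^ (2 * (σ - 1)) * ‖(bil v v - bil v' v') k‖ ^ 2 := by
      have := hp (2 * (σ - 1)); positivity
    have h3 := mul_le_mul_of_nonneg_right h1 (sq_nonneg ‖bil v' v' k‖)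
    linarith

/-- The right side is integrable in time by the uniform bounds. B(z,z) is left as it stands, since
its regularity is not deterministic. -/
lemma exists_fsum_bil_gain_le {σ ε M : ℝ} (hε : 0 < ε) (hεσ : ε ≤ σ) (hσ : σ + 2 * ε < 1)
    (hM : 0 ≤ M) :
    ∃ C : ℝ, 0 ≤ C ∧ ∀ (K : Finset Idx) (u z : Coeff), SuppIn K u →
      normSq (σ + 2 * ε) z ≤ ENNReal.ofReal M →
      fsum K (σ + ε - 1) (bil (u + z) (u + z)) ≤
        C * (fsum K σ u + 1) * fsum K (σ + 1) u + 8 * fsum K (σ + ε - 1) (bil z z) := by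
  obtain ⟨C, hC, h1, h2⟩ := exists_normSq_bil_gain_le hε hεσ hσ
  have hc := C.toReal_nonneg
  refine ⟨16 * C.toReal + 16 * (C.toReal * M), by positivity, fun K u z hu hz => ?_⟩
  have p := fsum_nonneg K
  have hu0 := hu.normSq_ne_top 0
  have hz0 : normSq 0 z ≠ ∞ := ne_top_of_le_ne_top ENNReal.ofReal_ne_top
    ((normSq_mono (by linarith) z).trans hz)
  rw [bil_add_add hu0 hz0]
  have b0 := fsum_add_four_le K (σ + ε - 1) (bil u u) (bil u z) (bil z u) (bil z z)
  have b2 := fsum_le_of_normSq_le hC hM hu hz (h2 u z).1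
  have b3 := fsum_le_of_normSq_le hC hM hu hz (h2 u z).2
  have b1 : fsum K (σ + ε - 1) (bil u u) ≤ C.toReal * (2 * (fsum K σ u * fsum K (σ + 1) u)) := by
    have := p σ u; have := p (σ + 1) u
    apply le_toReal_mul hC (by positivity)
    refine (ofReal_fsum_le _ _ _).trans ((h1 u u).trans (le_of_eq ?_))
    rw [normSq_eq_fsum hu, normSq_eq_fsum hu, ENNReal.ofReal_mul (by norm_num),
      ENNReal.ofReal_mul (p _ _)]
    simp; ring
  have q1 : 0 ≤ C.toReal * (fsum K (σ + 1) u) := mul_nonneg hc (p _ _)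
  have q2 : 0 ≤ C.toReal * M * (fsum K σ u * fsum K (σ + 1) u) :=
    mul_nonneg (by positivity) (mul_nonneg (p _ _) (p _ _))
  nlinarith

lemma galerkin_diff_deriv {K K' : Finset Idx} {T : ℝ} {z u u' : ℝ → Coeff}
    (hu : IsGalerkin K T (fun _ => 1) z u) (hu' : IsGalerkin K' T (fun _ => 1) z u')
    {t : ℝ} (ht : t ∈ Set.Ioo 0 T) {k : Idx} (hk : k ∈ K') :
    HasDerivAt (fun s => (u s - u' s) k)
      (-((len k.1 ^ 2 : ℝ) : ℂ) * (u t - u' t) k + diffForce K (u t + z t) (u' t + z t) k) t := by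
  have h2 := hu'.deriv_one ht hk
  unfold diffForce
  split_ifs with h
  · refine ((hu.deriv_one ht h).sub h2).congr_deriv ?_
    simp only [Pi.sub_apply, Pi.neg_apply]; ring
  · have e : (fun s => (u s - u' s) k) = fun s => -(u' s k) := by
      ext s; simp [hu.supp s k h]
    rw [e]
    refine h2.neg.congr_deriv ?_
    simp only [Pi.sub_apply, Pi.neg_apply, hu.supp t k h]; ring

/-- Two Galerkin approximations over `K ⊆ K'` are close if the modes of `K' \ K` are large. -/
lemma galerkin_diff {σ ε M : ℝ} (hε : 0 < ε) (hεσ : ε ≤ σ) (hσ : σ + 2 * ε < 1)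
    (hM : 0 ≤ M) {T G R : ℝ} (hT : 0 ≤ T) (hG : 0 ≤ G) (hR : 0 ≤ R) :
    ∃ C : ℝ, 0 ≤ C ∧ ∀ (K K' : Finset Idx) (N : ℝ) (z u u' : ℝ → Coeff),
      K ⊆ K' → 0 < N → (∀ k ∈ K', k ∉ K → N ≤ len k.1) →
      IsGalerkin K T (fun _ => 1) z u → IsGalerkin K' T (fun _ => 1) z u' → HCont 0 z →
      (∀ t, normSq (σ + 2 * ε) (z t) ≤ ENNReal.ofReal M) →
      (∀ t ∈ Set.Icc 0 T, fsum K σ (u t) ≤ R ∧ ∫ s in (0 : ℝ)..t, fsum K (σ + 1) (u s) ≤ R) →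
      (∀ t ∈ Set.Icc 0 T, fsum K' σ (u' t) ≤ R ∧ ∫ s in (0 : ℝ)..t, fsum K' (σ + 1) (u' s) ≤ R) →
      ∫ s in (0 : ℝ)..T, fsum K' (σ + ε - 1) (bil (z s) (z s)) ≤ G →
      ∀ t ∈ Set.Icc 0 T, fsum K' σ (u t - u' t) +
        ∫ s in (0 : ℝ)..t, fsum K' (σ + 1) (u s - u' s) ≤
        C * (fsum K' σ (u 0 - u' 0) + N ^ (-(2 * ε))) := by
  obtain ⟨C₀, hC₀, hbil⟩ := exists_fsum_bil_le (σ := σ) (by linarith) (by linarith)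
  obtain ⟨C₁, hC₁, hmix⟩ := exists_normSq_bil_mixed_le hε hεσ hσ
  have hc1 : 0 ≤ C₁.toReal := ENNReal.toReal_nonneg
  obtain ⟨C₂, hC₂, hgain⟩ := exists_fsum_bil_gain_le hε hεσ hσ hM
  set X := C₁.toReal * M with hX
  have hX0 : 0 ≤ X := by positivity
  -- Sharing out the dissipation of the difference: 1/4 for the terms linear in z through this η,
  -- 1/8 for each of the two terms with u and u', and 1/4 is kept; the factor 4 in the final
  -- constant undoes the latter.
  obtain ⟨C₃, hC₃, hint⟩ := exists_fsum_interp (r := σ) (s := 1) (q := σ + 1) (by linarith)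
    (by linarith) (η := 1 / (64 * (X + 1))) (by positivity)
  set a₁ := 16 * X * C₃ with ha₁
  set a₂ := 512 * C₀ ^ 2 * R with ha₂
  set I := a₁ * T + a₂ * (2 * R) with hI
  set B := C₂ * (R + 1) * R + 8 * G with hB
  have ha10 : 0 ≤ a₁ := by positivity
  have ha20 : 0 ≤ a₂ := by positivity
  have hI0 : 0 ≤ I := by positivity
  have hB0 : 0 ≤ B := by positivity
  refine ⟨4 * (Real.exp I * (1 + B)), by positivity,
    fun K K' N z u u' hK hN hKN hu hu' hz hzM hbu hbu' hGb t ht => ?_⟩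
  have p := fsum_nonneg K'
  have hNp : 0 ≤ N ^ (-(2 * ε)) := Real.rpow_nonneg hN.le _
  have hwc : ∀ k, Continuous fun t => (u t - u' t) k := fun k => (hu.cont k).sub (hu'.cont k)
  have cw := fun r => continuous_fsum (K := K') r hwc
  have cu := fun r => continuous_fsum (K := K') r hu.cont
  have cu' := fun r => continuous_fsum (K := K') r hu'.cont
  have hfin : ∀ s, normSq 0 (u s + z s) ≠ ∞ := fun s =>
    normSq_add_ne_top ((hu.suppIn s).normSq_ne_top 0) (hz.1 s)
  have hfin' : ∀ s, normSq 0 (u' s + z s) ≠ ∞ := fun s =>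
    normSq_add_ne_top ((hu'.suppIn s).normSq_ne_top 0) (hz.1 s)
  have cz := fun r => continuous_fsum (K := K') r fun k => hz.continuous_bil hz k
  have hKK : ∀ r s, fsum K' r (u s) = fsum K r (u s) := fun r s =>
    (Finset.sum_subset hK fun k _ hk => by simp [hu.supp s k hk]).symm
  have hbuK : ∀ t ∈ Set.Icc 0 T, fsum K' σ (u t) ≤ R ∧
      ∫ s in (0 : ℝ)..t, fsum K' (σ + 1) (u s) ≤ R := by simpa only [hKK] using hbu
  set α : ℝ → ℝ := fun s => a₁ + a₂ * (fsum K' (σ + 1) (u s) + fsum K' (σ + 1) (u' s)) with hα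
  set β : ℝ → ℝ := fun s => N ^ (-(2 * ε)) * (C₂ * (R + 1) * fsum K' (σ + 1) (u' s) +
    8 * fsum K' (σ + ε - 1) (bil (z s) (z s))) with hβ
  have cα : Continuous α := continuous_const.add (continuous_const.mul ((cu _).add (cu' _)))
  have cβ : Continuous β :=
    continuous_const.mul ((continuous_const.mul (cu' _)).add (continuous_const.mul (cz _)))
  have hα0 : ∀ s, 0 ≤ α s := fun s => by
    have := p (σ + 1) (u s); have := p (σ + 1) (u' s); positivity
  have hβ0 : ∀ s, 0 ≤ β s := fun s => by
    have := p (σ + 1) (u' s); have := p (σ + ε - 1) (bil (z s) (z s)); positivity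
  have hmain := gronwall_dissipation (T := T) (y := fun t => fsum K' σ (u t - u' t))
    (D := fun t => 1 / 4 * fsum K' (σ + 1) (u t - u' t)) (α := α) (β := β)
    (cw σ) (continuous_const.mul (cw _)) cα cβ
    (fun t => by have := p (σ + 1) (u t - u' t); positivity) hα0 hβ0 (fun t ht => ?_) ht
  · have h1 : ∫ s in (0 : ℝ)..t, α s ≤ I := by
      refine (integral_le_of_Icc cα hα0 ht).trans ?_
      have hTT : T ∈ Set.Icc 0 T := ⟨hT, le_rfl⟩
      have e : ∫ s in (0 : ℝ)..T, α s = a₁ * T +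
          a₂ * ((∫ s in (0 : ℝ)..T, fsum K' (σ + 1) (u s)) +
            ∫ s in (0 : ℝ)..T, fsum K' (σ + 1) (u' s)) := by
        simp only [hα]
        rw [intervalIntegral.integral_add (continuous_const.intervalIntegrable _ _)
          ((((cu _).intervalIntegrable _ _).add ((cu' _).intervalIntegrable _ _)).const_mul _),
          intervalIntegral.integral_const_mul a₂,
          intervalIntegral.integral_add ((cu _).intervalIntegrable _ _)
            ((cu' _).intervalIntegrable _ _), intervalIntegral.integral_const, smul_eq_mul,
          sub_zero, mul_comm T]
      rw [e, hI]
      have := (hbuK T hTT).2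
      have := (hbu' T hTT).2
      gcongr
      linarith
    have h2 : ∫ s in (0 : ℝ)..t, β s ≤ N ^ (-(2 * ε)) * B := by
      refine (integral_le_of_Icc cβ hβ0 ht).trans ?_
      have hTT : T ∈ Set.Icc 0 T := ⟨hT, le_rfl⟩
      rw [hβ, intervalIntegral.integral_const_mul,
        intervalIntegral.integral_add (((cu' _).intervalIntegrable _ _).const_mul _)
          (((cz _).intervalIntegrable _ _).const_mul _),
        intervalIntegral.integral_const_mul, intervalIntegral.integral_const_mul, hB]
      have := (hbu' T hTT).2
      gcongr
    have h3 : 0 ≤ ∫ s in (0 : ℝ)..t, β s := intervalIntegral.integral_nonneg ht.1 fun s _ => hβ0 s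
    have h4 : Real.exp (∫ s in (0 : ℝ)..t, α s) * (fsum K' σ (u 0 - u' 0) +
        ∫ s in (0 : ℝ)..t, β s) ≤
        Real.exp I * ((1 + B) * (fsum K' σ (u 0 - u' 0) + N ^ (-(2 * ε)))) := by
      have := p σ (u 0 - u' 0)
      gcongr
      have q1 := mul_nonneg hB0 this
      nlinarith
    rw [intervalIntegral.integral_const_mul] at hmain
    have h5 := p σ (u t - u' t)
    nlinarith
  · have hder := fun k hk => galerkin_diff_deriv hu hu' ht (k := k) hk
    obtain ⟨y', hy', hle⟩ := energy_ineq (w := fun s => u s - u' s) (r := σ) hder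
    refine ⟨y', hy', ?_⟩
    have hIcc : t ∈ Set.Icc 0 T := ⟨ht.1.le, ht.2.le⟩
    set w := u t - u' t with hw
    have hwS : SuppIn K' w := ((hu.suppIn t).mono hK).sub (hu'.suppIn t)
    have f1 := fsum_diffForce_le hε.le hN hKN (σ := σ) (u t + z t) (u' t + z t)
    have f2 := hgain K' (u' t) (z t) (hu'.suppIn t) (hzM t)
    have hdec : bil (u t + z t) (u t + z t) - bil (u' t + z t) (u' t + z t) =
        bil w (u t) + bil w (z t) + bil (u' t) w + bil (z t) w := by
      rw [bil_sub_bil (hfin t) (hfin' t)]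
      have e : u t + z t - (u' t + z t) = w := by rw [hw]; abel
      have hw0 := hwS.normSq_ne_top 0
      have hu0 := (hu.suppIn t).normSq_ne_top 0
      have hu0' := (hu'.suppIn t).normSq_ne_top 0
      rw [e, bil_add_right (bilConv_of_normSq hw0 hu0) (bilConv_of_normSq hw0 (hz.1 t)),
        bil_add_left (bilConv_of_normSq hu0' hw0) (bilConv_of_normSq (hz.1 t) hw0)]
      abel
    rw [hdec] at f1
    have f3 := fsum_add_four_le K' (σ - 1) (bil w (u t)) (bil w (z t)) (bil (u' t) w) (bil (z t) w)
    have b1 := hbil K' w (u t) hwS ((hu.suppIn t).mono hK)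
    have b2 := hbil K' (u' t) w (hu'.suppIn t) hwS
    have b3 := fsum_le_of_normSq_le hC₁ hM hwS (hzM t) (hmix w (z t)).1
    have b4 := fsum_le_of_normSq_le hC₁ hM hwS (hzM t) (hmix w (z t)).2
    have b5 := hint K' w
    have mono : ∀ v : Coeff, fsum K' (1 / 2) v ≤ fsum K' (σ + 1 / 2) v := fun v =>
      fsum_mono (by linarith) _ _
    -- One factor ‖v‖_σ is bounded by R, so the coefficient of ‖w‖²_σ is a multiple of ‖v‖²_{σ+1},
    -- an integrable Gronwall rate.
    have Y : ∀ v : Coeff, fsum K' σ v ≤ R → 16 * C₀ * fsum K' (σ + 1 / 2) v *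
        fsum K' (σ + 1 / 2) w ≤ 1 / 8 * fsum K' (σ + 1) w +
          a₂ * fsum K' (σ + 1) v * fsum K' σ w := by
      intro v hv
      refine (mul_le_of_sq_le (δ := 1 / 8) (p σ w) (p (σ + 1) w) (by norm_num)
        (fsum_half_sq_le K' σ w)).trans ?_
      gcongr
      · exact p _ _
      have hv2 : fsum K' (σ + 1 / 2) v ^ 2 ≤ R * fsum K' (σ + 1) v :=
        (fsum_half_sq_le K' σ v).trans (mul_le_mul_of_nonneg_right hv (p _ _))
      have e : (16 * C₀ * fsum K' (σ + 1 / 2) v) ^ 2 / (4 * (1 / 8)) =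
        512 * C₀ ^ 2 * fsum K' (σ + 1 / 2) v ^ 2 := by ring
      rw [e, ha₂, mul_assoc (512 * C₀ ^ 2)]
      gcongr
    have Y1 := Y (u t) (hbuK t hIcc).1
    have Y2 := Y (u' t) (hbu' t hIcc).1
    have p1 := p (σ + 1 / 2) w
    have B1 : 8 * fsum K' (σ - 1) (bil w (u t)) ≤
        16 * C₀ * fsum K' (σ + 1 / 2) (u t) * fsum K' (σ + 1 / 2) w := by
      have h1 : fsum K' (σ + 1 / 2) w * fsum K' (1 / 2) (u t) ≤
        fsum K' (σ + 1 / 2) w * fsum K' (σ + 1 / 2) (u t) := mul_le_mul_of_nonneg_left (mono _) p1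
      have h2 : fsum K' (1 / 2) w * fsum K' (σ + 1 / 2) (u t) ≤
        fsum K' (σ + 1 / 2) w * fsum K' (σ + 1 / 2) (u t) :=
        mul_le_mul_of_nonneg_right (mono _) (p _ _)
      have h3 := mul_le_mul_of_nonneg_left (add_le_add h1 h2) hC₀
      linarith
    have B2 : 8 * fsum K' (σ - 1) (bil (u' t) w) ≤
        16 * C₀ * fsum K' (σ + 1 / 2) (u' t) * fsum K' (σ + 1 / 2) w := by
      have h1 : fsum K' (σ + 1 / 2) (u' t) * fsum K' (1 / 2) w ≤
        fsum K' (σ + 1 / 2) (u' t) * fsum K' (σ + 1 / 2) w :=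
        mul_le_mul_of_nonneg_left (mono _) (p _ _)
      have h2 : fsum K' (1 / 2) (u' t) * fsum K' (σ + 1 / 2) w ≤
        fsum K' (σ + 1 / 2) (u' t) * fsum K' (σ + 1 / 2) w :=
        mul_le_mul_of_nonneg_right (mono _) p1
      have h3 := mul_le_mul_of_nonneg_left (add_le_add h1 h2) hC₀
      linarith
    have B3 : 8 * fsum K' (σ - 1) (bil w (z t)) + 8 * fsum K' (σ - 1) (bil (z t) w) ≤
        16 * X * fsum K' 1 w := by rw [hX]; linarith
    have B4 : 16 * X * fsum K' 1 w ≤ 1 / 4 * fsum K' (σ + 1) w + a₁ * fsum K' σ w := by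
      have h6 : 16 * X * fsum K' 1 w ≤
        16 * X * (1 / (64 * (X + 1)) * fsum K' (σ + 1) w + C₃ * fsum K' σ w) := by gcongr
      have h7 : 16 * X * (1 / (64 * (X + 1))) ≤ 1 / 4 := by
        rw [mul_one_div, div_le_div_iff₀ (by positivity) (by norm_num)]; linarith
      have h8 := mul_le_mul_of_nonneg_right h7 (p (σ + 1) w)
      rw [ha₁]; linarith
    have B5 : N ^ (-(2 * ε)) * fsum K' (σ + ε - 1) (bil (u' t + z t) (u' t + z t)) ≤ β t := by
      rw [hβ]
      refine mul_le_mul_of_nonneg_left (f2.trans ?_) hNp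
      have := (hbu' t hIcc).1
      have := p (σ + 1) (u' t)
      gcongr
    have pw := p (σ + 1) w
    have e : α t * fsum K' σ w = a₁ * fsum K' σ w + a₂ * fsum K' (σ + 1) (u t) * fsum K' σ w +
      a₂ * fsum K' (σ + 1) (u' t) * fsum K' σ w := by rw [hα]; ring
    rw [e]
    linarith

/-! ### Ordinary differential equations with a bounded Lipschitz field -/

/-- The Picard iterates of `x' = F(t,x)`, `x(0) = x₀`. -/
def picIter {E : Type*} [NormedAddCommGroup E] [NormedSpace ℝ E] (F : ℝ → E → E) (x₀ : E) :
    ℕ → ℝ → E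
  | 0 => fun _ => x₀
  | j + 1 => fun t => x₀ + ∫ s in (0 : ℝ)..t, F s (picIter F x₀ j s)

section ODE

variable {E : Type*} [NormedAddCommGroup E]

/-- The radial cutoff: `1` on the ball of radius `R`, and `0` outside of the ball of radius `2 R`. -/
def cutoff (R : ℝ) (x : E) : ℝ := max 0 (min 1 (2 - ‖x‖ / R))

lemma cutoff_nonneg (R : ℝ) (x : E) : 0 ≤ cutoff R x := le_max_left _ _

lemma cutoff_le_one (R : ℝ) (x : E) : cutoff R x ≤ 1 := max_le zero_le_one (min_le_left _ _)

lemma cutoff_eq_one {R : ℝ} (hR : 0 < R) {x : E} (h : ‖x‖ ≤ R) : cutoff R x = 1 := by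
  have : ‖x‖ / R ≤ 1 := (div_le_one hR).2 h
  unfold cutoff
  rw [min_eq_left (by linarith), max_eq_right zero_le_one]

lemma cutoff_eq_zero {R : ℝ} (hR : 0 < R) {x : E} (h : 2 * R ≤ ‖x‖) : cutoff R x = 0 := by
  have : 2 ≤ ‖x‖ / R := (le_div_iff₀ hR).2 h
  unfold cutoff
  exact max_eq_left ((min_le_right _ _).trans (by linarith))

lemma abs_cutoff_sub_le {R : ℝ} (hR : 0 < R) (x y : E) :
    |cutoff R x - cutoff R y| ≤ ‖x - y‖ / R := by
  have h1 : |(2 - ‖x‖ / R) - (2 - ‖y‖ / R)| ≤ ‖x - y‖ / R := by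
    rw [show (2 - ‖x‖ / R) - (2 - ‖y‖ / R) = (‖y‖ - ‖x‖) / R by ring, abs_div, abs_of_pos hR]
    gcongr
    rw [abs_sub_comm]
    exact abs_norm_sub_norm_le x y
  unfold cutoff
  rw [max_comm 0, max_comm 0, min_comm 1, min_comm 1]
  exact (abs_max_sub_max_le_abs _ _ _).trans ((abs_min_sub_min_le_max _ _ _ _).trans
    (max_le h1 (by simp; positivity)))

/-- The assumptions of the global existence theorem: a bounded field, continuous in time and
Lipschitz in space. -/
structure IsTameField (F : ℝ → E → E) (L B : NNReal) : Prop where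
  cont : ∀ x, Continuous fun t => F t x
  lip : ∀ t, LipschitzWith L (F t)
  bound : ∀ t x, ‖F t x‖ ≤ B

lemma IsTameField.continuous_comp {F : ℝ → E → E} {L B : NNReal} (hF : IsTameField F L B)
    {X : ℝ → E} (hX : Continuous X) : Continuous fun t => F t (X t) := by
  have h : Continuous fun p : E × ℝ => F p.2 p.1 :=
    continuous_prod_of_continuous_lipschitzWith _ L hF.cont hF.lip
  exact h.comp (hX.prodMk continuous_id)

variable [NormedSpace ℝ E]

lemma IsTameField.continuous_picIter {F : ℝ → E → E} {L B : NNReal} (hF : IsTameField F L B)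
    (x₀ : E) (j : ℕ) : Continuous (picIter F x₀ j) := by
  induction j with
  | zero => exact continuous_const
  | succ j ih =>
    refine continuous_const.add ?_
    exact intervalIntegral.continuous_primitive
      (fun a b => (hF.continuous_comp ih).intervalIntegrable a b) 0

/-- The projection of the real line onto `[0,T]`. -/
def clamp (T t : ℝ) : ℝ := max 0 (min T t)

lemma continuous_clamp (T : ℝ) : Continuous (clamp T) := by unfold clamp; fun_prop

lemma clamp_mem {T : ℝ} (hT : 0 ≤ T) (t : ℝ) : clamp T t ∈ Set.Icc 0 T :=
  ⟨le_max_left _ _, max_le hT (min_le_left _ _)⟩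

lemma clamp_of_mem {T t : ℝ} (ht : t ∈ Set.Icc 0 T) : clamp T t = t := by
  unfold clamp; rw [min_eq_right ht.2, max_eq_right ht.1]

/-- A field bounded by B cannot leave the ball of radius B T before T, so Picard–Lindelöf gives the
whole interval at once. The convergence of the explicit iterates is recorded as well: measurability
in ω and the reality condition are proved for the iterates and passed to the limit. -/
lemma IsTameField.exists_solution [CompleteSpace E] {F : ℝ → E → E} {L B : NNReal}
    (hF : IsTameField F L B) (x₀ : E) {T : ℝ} (hT : 0 ≤ T) :
    ∃ X : ℝ → E, Continuous X ∧ X 0 = x₀ ∧ (∀ t, X t = X (clamp T t)) ∧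
      (∀ t ∈ Set.Ioo 0 T, HasDerivAt X (F t (X t)) t) ∧
      ∀ t ∈ Set.Icc 0 T, Tendsto (fun j => picIter F x₀ j t) atTop (𝓝 (X t)) := by
  have h0 : (0 : ℝ) ∈ Set.Icc 0 T := ⟨le_rfl, hT⟩
  have hPL : IsPicardLindelof F (⟨0, h0⟩ : Set.Icc 0 T) x₀ (B * T.toNNReal) 0 B L :=
    { lipschitzOnWith := fun t _ => (hF.lip t).lipschitzOnWith
      continuousOn := fun x _ => (hF.cont x).continuousOn
      norm_le := fun t _ x _ => hF.bound t x
      mul_max_le := by simp [hT] }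
  obtain ⟨α, hα0, hα⟩ := hPL.exists_eq_forall_mem_Icc_hasDerivWithinAt₀
  have hαc : ContinuousOn α (Set.Icc 0 T) := fun t ht => (hα t ht).continuousWithinAt
  set X : ℝ → E := fun t => α (clamp T t) with hX
  have hXc : Continuous X := hαc.comp_continuous (continuous_clamp T) (clamp_mem hT)
  have hXα : ∀ t ∈ Set.Icc 0 T, X t = α t := fun t ht => by simp only [hX, clamp_of_mem ht]
  have hder : ∀ t ∈ Set.Ioo 0 T, HasDerivAt X (F t (X t)) t := by
    intro t ht
    have hI : t ∈ Set.Icc 0 T := ⟨ht.1.le, ht.2.le⟩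
    have h1 := (hα t hI).hasDerivAt (Icc_mem_nhds ht.1 ht.2)
    rw [hXα t hI]
    refine h1.congr_of_eventuallyEq ?_
    filter_upwards [Icc_mem_nhds ht.1 ht.2] with s hs using hXα s hs
  have hX0 : X 0 = x₀ := (hXα 0 h0).trans hα0
  have hFX := hF.continuous_comp hXc
  have hint : ∀ t ∈ Set.Icc 0 T, X t = x₀ + ∫ s in (0 : ℝ)..t, F s (X s) := by
    intro t ht
    have := intervalIntegral.integral_eq_sub_of_hasDerivAt_of_le ht.1 hXc.continuousOn
      (fun s hs => hder s ⟨hs.1, hs.2.trans_le ht.2⟩) (hFX.intervalIntegrable 0 t)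
    rw [this, hX0]; abel
  refine ⟨X, hXc, hX0, fun t => ?_, hder, fun t ht => ?_⟩
  · simp only [hX]; rw [clamp_of_mem (clamp_mem hT t)]
  -- Each iteration integrates the previous error against L, which produces the factorial.
  have herr : ∀ j, ∀ t ∈ Set.Icc 0 T,
      ‖picIter F x₀ j t - X t‖ ≤ (B * T) * ((L * t) ^ j / j.factorial) := by
    intro j
    induction j with
    | zero =>
      intro t ht
      simp only [picIter, pow_zero, Nat.factorial_zero, Nat.cast_one, div_one, mul_one]
      rw [hint t ht, sub_add_cancel_left, norm_neg]
      refine (intervalIntegral.norm_integral_le_of_norm_le_const (C := B)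
        fun s _ => hF.bound s _).trans ?_
      rw [sub_zero, abs_of_nonneg ht.1]
      exact mul_le_mul_of_nonneg_left ht.2 B.2
    | succ j ih =>
      intro t ht
      have hc := hF.continuous_comp (hF.continuous_picIter x₀ j)
      simp only [picIter]
      rw [hint t ht, add_sub_add_left_eq_sub,
        ← intervalIntegral.integral_sub (hc.intervalIntegrable _ _) (hFX.intervalIntegrable _ _)]
      have hstep : ∀ s ∈ Set.Icc 0 t, ‖F s (picIter F x₀ j s) - F s (X s)‖ ≤
          L * ((B * T) * ((L * s) ^ j / j.factorial)) := fun s hs => by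
        have h1 := (hF.lip s).norm_sub_le (picIter F x₀ j s) (X s)
        exact h1.trans (mul_le_mul_of_nonneg_left (ih s ⟨hs.1, hs.2.trans ht.2⟩) L.2)
      have hpoly : Continuous fun s : ℝ => (L : ℝ) * ((B * T) * ((L * s) ^ j / j.factorial)) := by
        fun_prop
      calc _ ≤ ∫ s in (0 : ℝ)..t, ‖F s (picIter F x₀ j s) - F s (X s)‖ :=
            intervalIntegral.norm_integral_le_integral_norm ht.1
        _ ≤ ∫ s in (0 : ℝ)..t, (L : ℝ) * ((B * T) * ((L * s) ^ j / j.factorial)) :=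
            intervalIntegral.integral_mono_on ht.1 ((hc.sub hFX).norm.intervalIntegrable _ _)
              (hpoly.intervalIntegrable _ _) hstep
        _ = _ := by
            have e : ∀ s : ℝ, (L : ℝ) * ((B * T) * ((L * s) ^ j / j.factorial)) =
              ((L : ℝ) ^ (j + 1) * (B * T) / j.factorial) * s ^ j := fun s => by
              rw [mul_pow]; ring
            simp only [e]
            rw [intervalIntegral.integral_const_mul, integral_pow, Nat.factorial_succ]
            have : (j.factorial : ℝ) ≠ 0 := by positivity
            push_cast
            field_simp
            simp only [ne_eq, Nat.add_eq_zero_iff, one_ne_zero, and_false, not_false_eq_true,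
              zero_pow, sub_zero]
            rw [mul_pow]; ring
  rw [tendsto_iff_norm_sub_tendsto_zero]
  refine squeeze_zero (fun _ => norm_nonneg _) (fun j => herr j t ht) ?_
  have := (FloorSemiring.tendsto_pow_div_factorial_atTop (L * t : ℝ)).const_mul (B * T : ℝ)
  simpa using this

/-- A continuous linear map commutes with the integral, so the fixed space of J, if invariant under
the field, contains every iterate. It is used with the reflection whose fixed points are the real
fields. -/
lemma IsTameField.solution_fixed [CompleteSpace E] {F : ℝ → E → E} {L B : NNReal}
    (hF : IsTameField F L B) {x₀ : E} (J : E →L[ℝ] E) (hJF : ∀ t x, J x = x → J (F t x) = F t x)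
    (hJ : J x₀ = x₀) (j : ℕ) (t : ℝ) : J (picIter F x₀ j t) = picIter F x₀ j t := by
  induction j generalizing t with
  | zero => exact hJ
  | succ j ih =>
    have hc := hF.continuous_comp (hF.continuous_picIter x₀ j)
    simp only [picIter]
    rw [map_add, hJ, ← J.intervalIntegral_comp_comm (hc.intervalIntegrable _ _)]
    congr 2; ext s
    exact hJF s _ (ih s)

/-- Continuity in time and measurability in ω give joint measurability of an iterate, and
integration in time preserves measurability in ω. -/
lemma measurable_picIter [SecondCountableTopology E] [MeasurableSpace E] [BorelSpace E]
    {Ω : Type*} [MeasurableSpace Ω] {F : Ω → ℝ → E → E} {L B : Ω → NNReal}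
    (hF : ∀ ω, IsTameField (F ω) (L ω) (B ω))
    (hFm : Measurable fun p : (Ω × ℝ) × E => F p.1.1 p.1.2 p.2) {x₀ : Ω → E}
    (hx₀ : Measurable x₀) (j : ℕ) (t : ℝ) : Measurable fun ω => picIter (F ω) (x₀ ω) j t := by
  induction j generalizing t with
  | zero => exact hx₀
  | succ j ih =>
    have hjoint : Measurable fun p : Ω × ℝ => picIter (F p.1) (x₀ p.1) j p.2 := by
      have := measurable_uncurry_of_continuous_of_measurable
        (u := fun (t : ℝ) (ω : Ω) => picIter (F ω) (x₀ ω) j t)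
        (fun ω => (hF ω).continuous_picIter (x₀ ω) j) ih
      exact this.comp measurable_swap
    have h2 : Measurable fun p : Ω × ℝ => F p.1 p.2 (picIter (F p.1) (x₀ p.1) j p.2) :=
      hFm.comp (measurable_id.prodMk hjoint)
    have h3 : ∀ s : Set ℝ, Measurable fun ω =>
        ∫ r in s, F ω r (picIter (F ω) (x₀ ω) j r) := fun s =>
      (StronglyMeasurable.integral_prod_right
        (f := fun ω r => F ω r (picIter (F ω) (x₀ ω) j r)) h2.stronglyMeasurable).measurable
    simp only [picIter, intervalIntegral]
    exact hx₀.add ((h3 _).sub (h3 _))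

/-- A field Lipschitz on the ball of radius 2R becomes globally Lipschitz: if one point lies outside
the ball its term vanishes, and the Lipschitz constant 1/R of the cutoff times the bound B covers
the rest. -/
lemma isTameField_cutoff {G : ℝ → E → E} {R : ℝ} (hR : 0 < R) {L B : NNReal}
    (hc : ∀ x, Continuous fun t => G t x)
    (hL : ∀ t x y, ‖x‖ ≤ 2 * R → ‖y‖ ≤ 2 * R → ‖G t x - G t y‖ ≤ L * ‖x - y‖)
    (hB : ∀ t x, ‖x‖ ≤ 2 * R → ‖G t x‖ ≤ B) :
    IsTameField (fun t x => cutoff R x • G t x) (L + B / R.toNNReal) B := by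
  have hcoe : ((L + B / R.toNNReal : NNReal) : ℝ) = L + B / R := by
    push_cast; rw [Real.coe_toNNReal _ hR.le]
  refine ⟨fun x => (hc x).const_smul _, fun t => ?_, fun t x => ?_⟩
  · apply LipschitzWith.of_dist_le_mul
    intro x y
    rw [dist_eq_norm, dist_eq_norm, hcoe]
    have key : ∀ x y : E, ‖x‖ ≤ 2 * R →
        ‖cutoff R x • G t x - cutoff R y • G t y‖ ≤ (L + B / R) * ‖x - y‖ := by
      intro x y hx
      have h1 : ‖(cutoff R x - cutoff R y) • G t x‖ ≤ B / R * ‖x - y‖ := by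
        rw [norm_smul, Real.norm_eq_abs]
        calc _ ≤ ‖x - y‖ / R * B := mul_le_mul (abs_cutoff_sub_le hR x y) (hB t x hx)
              (norm_nonneg _) (by positivity)
          _ = _ := by ring
      rcases le_total ‖y‖ (2 * R) with hy | hy
      · have h2 : ‖cutoff R y • (G t x - G t y)‖ ≤ L * ‖x - y‖ := by
          rw [norm_smul, Real.norm_eq_abs, abs_of_nonneg (cutoff_nonneg R y)]
          exact (mul_le_of_le_one_left (norm_nonneg _) (cutoff_le_one R y)).trans (hL t x y hx hy)
        have e : cutoff R x • G t x - cutoff R y • G t y =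
            (cutoff R x - cutoff R y) • G t x + cutoff R y • (G t x - G t y) := by
          rw [sub_smul, smul_sub]; abel
        rw [e]
        refine (norm_add_le _ _).trans ?_
        linarith
      · have hy0 := cutoff_eq_zero hR hy
        rw [hy0] at h1 ⊢
        rw [zero_smul, sub_zero]
        rw [sub_zero] at h1
        have : 0 ≤ (L : ℝ) * ‖x - y‖ := by positivity
        linarith
    rcases le_total ‖x‖ (2 * R) with hx | hx
    · exact key x y hx
    · rcases le_total ‖y‖ (2 * R) with hy | hy
      · have := key y x hy
        rwa [norm_sub_rev, norm_sub_rev y x] at this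
      · rw [cutoff_eq_zero hR hx, cutoff_eq_zero hR hy]
        simp; positivity
  · rw [norm_smul, Real.norm_eq_abs, abs_of_nonneg (cutoff_nonneg R x)]
    rcases le_total ‖x‖ (2 * R) with hx | hx
    · exact (mul_le_of_le_one_left (norm_nonneg _) (cutoff_le_one R x)).trans (hB t x hx)
    · rw [cutoff_eq_zero hR hx]; simp

end ODE

/-! ### Existence of the Galerkin approximations -/

section Galerkin

variable {K : Finset Idx}

/-- The extension by zero of coefficients given on `K`. -/
def extK (x : K → ℂ) : Coeff := fun k => open Classical in if h : k ∈ K then x ⟨k, h⟩ else 0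

lemma extK_apply (x : K → ℂ) (k : K) : extK x k.1 = x k := by simp [extK]

lemma extK_suppIn (x : K → ℂ) : SuppIn K (extK x) := fun k hk => by simp [extK, hk]

lemma extK_sub (x y : K → ℂ) : extK x - extK y = extK (x - y) := by
  ext k; by_cases h : k ∈ K <;> simp [extK, h]

lemma fsum_extK_le (x : K → ℂ) : fsum K 0 (extK x) ≤ K.card * ‖x‖ ^ 2 := by
  unfold fsum
  rw [← nsmul_eq_mul]
  refine Finset.sum_le_card_nsmul _ _ _ fun k hk => ?_
  simp only [mul_zero, Real.rpow_zero, one_mul]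
  have : extK x k = x ⟨k, hk⟩ := extK_apply x ⟨k, hk⟩
  rw [this]
  gcongr
  exact norm_le_pi_norm x _

lemma norm_sq_le_fsum (x : K → ℂ) : ‖x‖ ^ 2 ≤ fsum K 0 (extK x) := by
  have h : ‖x‖ ≤ Real.sqrt (fsum K 0 (extK x)) := by
    rw [pi_norm_le_iff_of_nonneg (Real.sqrt_nonneg _)]
    intro k
    apply Real.le_sqrt_of_sq_le
    unfold fsum
    rw [← extK_apply x k]
    refine le_trans (le_of_eq (by simp)) (Finset.single_le_sum
      (f := fun k : Idx => len k.1 ^ (2 * (0 : ℝ)) * ‖extK x k‖ ^ 2)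
      (fun k _ => mul_nonneg (Real.rpow_nonneg (len_nonneg _) _) (sq_nonneg _)) k.2)
  calc ‖x‖ ^ 2 ≤ Real.sqrt (fsum K 0 (extK x)) ^ 2 := by gcongr
    _ = _ := Real.sq_sqrt (fsum_nonneg _ _ _)

/-- The field of the Galerkin system. -/
def galField (z : ℝ → Coeff) (t : ℝ) (x : K → ℂ) : K → ℂ := fun k =>
  -((len k.1.1 ^ 2 : ℝ) : ℂ) * x k + (-bil (extK x + z t) (extK x + z t)) k.1

lemma hcont_const {u : Coeff} (hu : normSq 0 u ≠ ∞) : HCont 0 fun _ => u :=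
  ⟨fun _ => hu, fun t => by simp [normSq]⟩

lemma continuous_galField {z : ℝ → Coeff} (hz : HCont 0 z) (x : K → ℂ) :
    Continuous fun t => galField z t x := by
  refine continuous_pi fun k => continuous_const.add ?_
  have h := (hcont_const ((extK_suppIn x).normSq_ne_top 0)).add hz
  exact (h.continuous_bil h k.1).neg

lemma exists_lipschitz_galField {z : ℝ → Coeff} (hz : HCont 0 z) {M : ℝ} (hM : 0 ≤ M)
    (hzM : ∀ t, normSq 0 (z t) ≤ ENNReal.ofReal M) {r : ℝ} :
    ∃ L : NNReal, ∀ t (x y : K → ℂ), ‖x‖ ≤ r → ‖y‖ ≤ r →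
      ‖galField z t x - galField z t y‖ ≤ L * ‖x - y‖ := by
  set Q : ℝ := 2 * (K.card * r ^ 2 + M) with hQ
  have hQ0 : 0 ≤ Q := by positivity
  have hv : ∀ t (x : K → ℂ), ‖x‖ ≤ r → normSq 0 (extK x + z t) ≤ ENNReal.ofReal Q := by
    intro t x hx
    refine (normSq_add_le _ _ _).trans ?_
    rw [hQ, ENNReal.ofReal_mul (by norm_num), ENNReal.ofReal_add (by positivity) hM,
      ENNReal.ofReal_ofNat]
    gcongr
    · rw [normSq_eq_fsum (extK_suppIn x)]
      apply ENNReal.ofReal_le_ofReal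
      refine (fsum_extK_le x).trans ?_
      gcongr
    · exact hzM t
  set A : K → ℝ := fun k => 2 * len k.1.1 ^ 2 * (2 * Q * K.card) with hA
  set S : ℝ := ∑ k : K, (len k.1.1 ^ 2 + Real.sqrt (A k)) with hS
  have hS0 : 0 ≤ S := Finset.sum_nonneg fun k _ => by positivity
  refine ⟨S.toNNReal, fun t x y hx hy => ?_⟩
  rw [Real.coe_toNNReal _ hS0, pi_norm_le_iff_of_nonneg (by positivity)]
  intro k
  have hSk : len k.1.1 ^ 2 + Real.sqrt (A k) ≤ S :=
    Finset.single_le_sum (f := fun k : K => len k.1.1 ^ 2 + Real.sqrt (A k))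
      (fun k _ => by positivity) (Finset.mem_univ k)
  have hAk : 0 ≤ A k := by positivity
  have hb : ‖bil (extK x + z t) (extK x + z t) k.1 - bil (extK y + z t) (extK y + z t) k.1‖ ≤
      Real.sqrt (A k) * ‖x - y‖ := by
    have hfx : normSq 0 (extK x + z t) ≠ ∞ :=
      normSq_add_ne_top ((extK_suppIn x).normSq_ne_top 0) (hz.1 t)
    have hfy : normSq 0 (extK y + z t) ≠ ∞ :=
      normSq_add_ne_top ((extK_suppIn y).normSq_ne_top 0) (hz.1 t)
    have h1 := enorm_bil_sub_bil_sq_le hfx hfx hfy hfy k.1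
    have e : extK x + z t - (extK y + z t) = extK (x - y) := by rw [← extK_sub]; abel
    rw [e] at h1
    have hd : normSq 0 (extK (x - y)) ≤ ENNReal.ofReal (K.card * ‖x - y‖ ^ 2) := by
      rw [normSq_eq_fsum (extK_suppIn _)]
      exact ENNReal.ofReal_le_ofReal (fsum_extK_le _)
    have h2 : ‖bil (extK x + z t) (extK x + z t) k.1 -
        bil (extK y + z t) (extK y + z t) k.1‖ₑ ^ 2 ≤ ENNReal.ofReal (A k * ‖x - y‖ ^ 2) := by
      refine h1.trans ?_
      calc _ ≤ 2 * wt 1 k.1 * (ENNReal.ofReal (K.card * ‖x - y‖ ^ 2) * ENNReal.ofReal Q +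
            ENNReal.ofReal Q * ENNReal.ofReal (K.card * ‖x - y‖ ^ 2)) := by
            gcongr
            · exact hv t x hx
            · exact hv t y hy
        _ = _ := by
            rw [wt_one, ← ENNReal.ofReal_pow (len_nonneg _), ← ENNReal.ofReal_mul (by positivity),
              ← ENNReal.ofReal_mul hQ0, ← ENNReal.ofReal_add (by positivity) (by positivity),
              ← ENNReal.ofReal_ofNat 2, ← ENNReal.ofReal_mul (by norm_num),
              ← ENNReal.ofReal_mul (by positivity)]
            congr 1
            rw [hA]; ring
    rw [← ofReal_norm, ← ENNReal.ofReal_pow (norm_nonneg _),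
      ENNReal.ofReal_le_ofReal_iff (by positivity)] at h2
    apply le_of_sq_le_sq _ (by positivity)
    rw [mul_pow, Real.sq_sqrt hAk]
    exact h2
  have e : (galField z t x - galField z t y) k = -((len k.1.1 ^ 2 : ℝ) : ℂ) * (x - y) k -
      (bil (extK x + z t) (extK x + z t) k.1 - bil (extK y + z t) (extK y + z t) k.1) := by
    simp only [galField, Pi.sub_apply, Pi.neg_apply]; ring
  rw [e]
  refine (norm_sub_le _ _).trans ?_
  have h3 : ‖-((len k.1.1 ^ 2 : ℝ) : ℂ) * (x - y) k‖ ≤ len k.1.1 ^ 2 * ‖x - y‖ := by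
    rw [norm_mul, norm_neg, Complex.norm_real, Real.norm_of_nonneg (by positivity)]
    gcongr
    exact norm_le_pi_norm (x - y) k
  have h4 := mul_le_mul_of_nonneg_right hSk (norm_nonneg (x - y))
  change _ ≤ S * ‖x - y‖
  linarith

lemma exists_bound_galField {z : ℝ → Coeff} {M : ℝ} (hM : 0 ≤ M)
    (hzM : ∀ t, normSq 0 (z t) ≤ ENNReal.ofReal M) :
    ∃ B : NNReal, ∀ t, ‖galField z t (0 : K → ℂ)‖ ≤ B := by
  set S : ℝ := ∑ k : K, len k.1.1 * M with hS
  have hp : ∀ k : K, 0 ≤ len k.1.1 * M := fun k => mul_nonneg (len_nonneg _) hM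
  have hS0 : 0 ≤ S := Finset.sum_nonneg fun k _ => hp k
  refine ⟨S.toNNReal, fun t => ?_⟩
  rw [Real.coe_toNNReal _ hS0, pi_norm_le_iff_of_nonneg hS0]
  intro k
  have hSk : len k.1.1 * M ≤ S :=
    Finset.single_le_sum (f := fun k : K => len k.1.1 * M) (fun k _ => hp k) (Finset.mem_univ k)
  have e0 : extK (0 : K → ℂ) = 0 := by ext k; by_cases h : k ∈ K <;> simp [extK, h]
  have e : galField z t (0 : K → ℂ) k = -bil (z t) (z t) k.1 := by simp [galField, e0]
  rw [e, norm_neg]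
  refine le_trans ?_ hSk
  have h1 : ‖bil (z t) (z t) k.1‖ₑ ^ 2 ≤ ENNReal.ofReal ((len k.1.1 * M) ^ 2) := by
    refine (enorm_bil_sq_le _ _ _).trans ?_
    rw [mul_pow, ENNReal.ofReal_mul (by positivity), wt_one, ENNReal.ofReal_pow (len_nonneg _),
      ENNReal.ofReal_pow hM, sq (ENNReal.ofReal M)]
    gcongr <;> exact hzM t
  rw [← ofReal_norm, ← ENNReal.ofReal_pow (norm_nonneg _),
    ENNReal.ofReal_le_ofReal_iff (by positivity)] at h1
  exact le_of_sq_le_sq h1 (hp k)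

lemma exists_isTameField_galField {z : ℝ → Coeff} (hz : HCont 0 z) {M : ℝ} (hM : 0 ≤ M)
    (hzM : ∀ t, normSq 0 (z t) ≤ ENNReal.ofReal M) {R : ℝ} (hR : 0 < R) :
    ∃ L B : NNReal, IsTameField (fun t (x : K → ℂ) => cutoff R x • galField z t x) L B := by
  obtain ⟨L, hL⟩ := exists_lipschitz_galField (K := K) hz hM hzM (r := 2 * R)
  obtain ⟨B, hB⟩ := exists_bound_galField (K := K) hM hzM
  refine ⟨_, L * (2 * R).toNNReal + B, isTameField_cutoff hR (continuous_galField hz) hL ?_⟩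
  intro t x hx
  have h1 := hL t x 0 hx (by simp; positivity)
  rw [sub_zero] at h1
  have h2 := norm_le_norm_sub_add (galField z t x) (galField z t 0)
  have h3 := hB t
  have h4 : (L : ℝ) * ‖x‖ ≤ L * (2 * R) := mul_le_mul_of_nonneg_left hx L.2
  push_cast
  rw [Real.coe_toNNReal _ (by positivity)]
  linarith

/-- The reflection whose fixed points are the real fields. -/
def reflK (hK : ∀ k ∈ K, k.opp ∈ K) : (K → ℂ) →L[ℝ] (K → ℂ) :=
  LinearMap.toContinuousLinearMap
    { toFun := fun x k => -conj (x ⟨k.1.opp, hK k.1 k.2⟩)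
      map_add' := fun x y => by ext k; simp; ring
      map_smul' := fun c x => by ext k; simp }

lemma reflK_apply (hK : ∀ k ∈ K, k.opp ∈ K) (x : K → ℂ) (k : K) :
    reflK hK x k = -conj (x ⟨k.1.opp, hK k.1 k.2⟩) := rfl

lemma isReal_extK_iff (hK : ∀ k ∈ K, k.opp ∈ K) (x : K → ℂ) :
    IsReal (extK x) ↔ reflK hK x = x := by
  constructor
  · intro h
    ext k
    rw [reflK_apply, ← extK_apply x ⟨k.1.opp, hK k.1 k.2⟩, h k.1, extK_apply]
    simp
  · intro h k
    by_cases hk : k ∈ K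
    · have h1 := congrFun h ⟨k.opp, hK k hk⟩
      rw [reflK_apply] at h1
      have h2 : extK x k.opp = x ⟨k.opp, hK k hk⟩ := extK_apply x ⟨k.opp, hK k hk⟩
      have h3 : extK x k = x ⟨k, hk⟩ := extK_apply x ⟨k, hk⟩
      rw [h2, h3, ← h1]
      congr 3
      exact Subtype.ext (Idx.opp_opp k)
    · have hk' : k.opp ∉ K := fun h' => hk (by have := hK _ h'; rwa [Idx.opp_opp] at this)
      rw [extK_suppIn x k hk, extK_suppIn x _ hk']; simp

lemma reflK_galField (hK : ∀ k ∈ K, k.opp ∈ K) {z : ℝ → Coeff} (hz : ∀ t, IsReal (z t)) (R t : ℝ)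
    (x : K → ℂ) (hx : reflK hK x = x) :
    reflK hK (cutoff R x • galField z t x) = cutoff R x • galField z t x := by
  rw [map_smul]
  congr 1
  have hr := ((isReal_extK_iff hK x).2 hx).add (hz t)
  have hb := IsReal.bil hr hr
  ext k
  have h1 := congrFun hx k
  rw [reflK_apply] at h1 ⊢
  unfold galField
  simp only [Pi.neg_apply, hb k.1, map_add, map_mul, map_neg, Complex.conj_ofReal, neg_neg,
    Complex.conj_conj, len_opp]
  rw [← h1]; ring

lemma measurable_bil_apply (k : Idx) : Measurable fun v : Coeff => bil v v k := by
  unfold bil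
  refine measurable_const.mul (Measurable.tsum fun h => ?_)
  unfold bilTerm
  exact (measurable_const.mul (measurable_pi_apply _)).mul (measurable_pi_apply _)

lemma measurable_galField {Ω : Type*} [MeasurableSpace Ω] {z : ℝ → Ω → Coeff}
    (hz : Measurable fun p : Ω × ℝ => z p.2 p.1) (R : ℝ) :
    Measurable fun p : (Ω × ℝ) × (K → ℂ) =>
      cutoff R p.2 • galField (fun t => z t p.1.1) p.1.2 p.2 := by
  have hcut : Measurable fun p : (Ω × ℝ) × (K → ℂ) => cutoff R p.2 := by
    unfold cutoff
    exact measurable_const.max (measurable_const.min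
      (measurable_const.sub (measurable_snd.norm.div_const R)))
  refine hcut.smul (measurable_pi_lambda _ fun k => ?_)
  unfold galField
  have hext : Measurable fun p : (Ω × ℝ) × (K → ℂ) => extK p.2 + z p.1.2 p.1.1 := by
    refine Measurable.add ?_ (hz.comp measurable_fst)
    refine measurable_pi_lambda _ fun k => ?_
    by_cases h : k ∈ K
    · simp only [extK, h, dif_pos]
      exact (measurable_pi_apply _).comp measurable_snd
    · simp only [extK, h, dif_neg, not_false_eq_true]; exact measurable_const
  refine Measurable.add (measurable_const.mul ((measurable_pi_apply k).comp measurable_snd)) ?_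
  exact ((measurable_bil_apply k.1).comp hext).neg

end Galerkin

/-- Existence of the Galerkin approximations, with measurable dependence on a parameter. -/
theorem exists_galerkin {Ω : Type*} [MeasurableSpace Ω] {K : Finset Idx}
    (hK : ∀ k ∈ K, k.opp ∈ K) {T σ : ℝ} (hT : 0 ≤ T) (h0 : 0 < σ) (h1 : σ < 1)
    {z : ℝ → Ω → Coeff} (hzm : Measurable fun p : Ω × ℝ => z p.2 p.1)
    (hzc : ∀ ω, HCont 0 fun t => z t ω) (hzr : ∀ t ω, IsReal (z t ω))
    (hzM : ∀ ω, ∃ M : ℝ, 0 ≤ M ∧ ∀ t, normSq σ (z t ω) ≤ ENNReal.ofReal M)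
    {x₀ : Ω → Coeff} (hx₀ : Measurable x₀) (hx₀r : ∀ ω, IsReal (x₀ ω)) :
    ∃ u : ℝ → Ω → Coeff, (∀ t, Measurable (u t)) ∧ ∀ ω,
      IsGalerkin K T (fun _ => 1) (fun t => z t ω) (fun t => u t ω) ∧
      ∀ k ∈ K, u 0 ω k = x₀ ω k := by
  choose M hM hzM using hzM
  have hzM0 : ∀ ω t, normSq 0 (z t ω) ≤ ENNReal.ofReal (M ω) := fun ω t =>
    (normSq_mono h0.le _).trans (hzM ω t)
  set y₀ : Ω → (K → ℂ) := fun ω k => x₀ ω k.1 with hy₀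
  have hy₀m : Measurable y₀ := measurable_pi_lambda _ fun k => (measurable_pi_apply k.1).comp hx₀
  have hy₀J : ∀ ω, reflK hK (y₀ ω) = y₀ ω := fun ω => by
    ext k; rw [reflK_apply]; simp only [hy₀]; rw [hx₀r ω k.1]; simp
  choose L B hF using fun (R : ℕ) ω => exists_isTameField_galField (K := K) (hzc ω) (hM ω) (hzM0 ω)
    (R := (R : ℝ) + 1) (by positivity)
  choose X hXc hX0 hXcl hXd hXlim using fun (R : ℕ) ω => (hF R ω).exists_solution (y₀ ω) hT
  have hXm : ∀ (R : ℕ) t, Measurable fun ω => X R ω t := by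
    intro R t
    have e : (fun ω => X R ω t) = fun ω => X R ω (clamp T t) := by ext ω; rw [← hXcl]
    rw [e]
    exact measurable_of_tendsto_metrizable
      (fun j => measurable_picIter (hF R) (measurable_galField hzm _) hy₀m j (clamp T t))
      (tendsto_pi_nhds.2 fun ω => hXlim R ω _ (clamp_mem hT t))
  have hXr : ∀ (R : ℕ) ω t, IsReal (extK (X R ω t)) := by
    intro R ω t
    rw [isReal_extK_iff hK, hXcl]
    have hl := hXlim R ω _ (clamp_mem hT t)
    refine tendsto_nhds_unique (((reflK hK).continuous.tendsto _).comp hl) ?_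
    refine hl.congr fun j => ((hF R ω).solution_fixed (reflK hK) ?_ (hy₀J ω) j _).symm
    exact fun t x hx => reflK_galField hK (fun t => hzr t ω) _ t x hx
  have hGal : ∀ (R : ℕ) ω, IsGalerkin K T (fun t => cutoff ((R : ℝ) + 1) (X R ω t)) (fun t => z t ω)
      (fun t => extK (X R ω t)) := by
    intro R ω
    refine ⟨fun t => extK_suppIn _, fun t => hXr R ω t, fun k => ?_, fun t ht k hk => ?_⟩
    · by_cases h : k ∈ K
      · simp only [extK, h, dif_pos]
        exact (continuous_apply _).comp (hXc R ω)
      · simp only [extK, h, dif_neg, not_false_eq_true]; exact continuous_const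
    · have h1 := (hasDerivAt_pi.1 (hXd R ω t ht)) ⟨k, hk⟩
      have e : (fun s => extK (X R ω s) k) = fun s => X R ω s ⟨k, hk⟩ := by
        ext s; exact extK_apply _ ⟨k, hk⟩
      rw [e, show extK (X R ω t) k = X R ω t ⟨k, hk⟩ from extK_apply _ ⟨k, hk⟩]
      exact h1
  -- The truncation acts as the factor θ of `galerkin_energy`, so this bound is the same for all
  -- radii.
  have hbd : ∀ ω, ∃ Q : ℝ, ∀ (R : ℕ) t, ‖X R ω t‖ ^ 2 ≤ Q := by
    intro ω
    obtain ⟨C, hC, hen⟩ := galerkin_energy h0 h1 (hM ω)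
    have cz := continuous_fsum (K := K) (-1) fun k => (hzc ω).continuous_bil (hzc ω) k
    refine ⟨Real.exp (C * T) * (fsum K 0 (extK (y₀ ω)) +
      ∫ s in (0 : ℝ)..T, 4 * fsum K (-1) (bil (z s ω) (z s ω))), fun R t => ?_⟩
    rw [hXcl]
    have hmem := clamp_mem hT t
    set τ := clamp T t
    have hcut : Continuous fun t => cutoff ((R : ℝ) + 1) (X R ω t) := by
      have := (hXc R ω).norm
      unfold cutoff; fun_prop
    have h2 := hen K T _ _ _ (hGal R ω) hcut (fun t => ⟨cutoff_nonneg _ _, cutoff_le_one _ _⟩)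
      (hzc ω) (hzM ω) τ hmem
    simp only [hX0] at h2
    have h3 : 0 ≤ ∫ s in (0 : ℝ)..τ, cutoff ((R : ℝ) + 1) (X R ω s) * fsum K 1 (extK (X R ω s)) :=
      intervalIntegral.integral_nonneg hmem.1 fun s _ =>
        mul_nonneg (cutoff_nonneg _ _) (fsum_nonneg _ _ _)
    have h4 := norm_sq_le_fsum (X R ω τ)
    have hpos : ∀ s, 0 ≤ 4 * fsum K (-1) (bil (z s ω) (z s ω)) := fun s =>
      mul_nonneg (by norm_num) (fsum_nonneg _ _ _)
    have h5 := integral_le_of_Icc (continuous_const.mul cz) hpos hmem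
    have h6 : 0 ≤ ∫ s in (0 : ℝ)..τ, 4 * fsum K (-1) (bil (z s ω) (z s ω)) :=
      intervalIntegral.integral_nonneg hmem.1 fun s _ => hpos s
    have h7 := fsum_nonneg K 0 (extK (y₀ ω))
    calc ‖X R ω τ‖ ^ 2 ≤ Real.exp (C * τ) * (fsum K 0 (extK (y₀ ω)) +
        ∫ s in (0 : ℝ)..τ, 4 * fsum K (-1) (bil (z s ω) (z s ω))) := by linarith
      _ ≤ _ := by
        gcongr
        · exact hmem.2
        · exact h5
  classical
  -- The radius must depend on ω measurably. Testing rational times makes the defining sets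
  -- measurable, and continuity extends the bound to all times.
  have hex : ∀ ω, ∃ R : ℕ, ∀ q : ℚ, ‖X R ω q‖ ≤ (R : ℝ) + 1 := by
    intro ω
    obtain ⟨Q, hQ⟩ := hbd ω
    obtain ⟨R, hR⟩ := exists_nat_ge (Real.sqrt Q)
    refine ⟨R, fun q => ?_⟩
    have := Real.le_sqrt_of_sq_le (hQ R q)
    linarith
  have hmeas : ∀ R : ℕ, MeasurableSet {ω | ∀ q : ℚ, ‖X R ω q‖ ≤ (R : ℝ) + 1} := by
    intro R
    rw [Set.ofPred_forall]
    exact MeasurableSet.iInter fun q => measurableSet_le (hXm R q).norm measurable_const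
  set ρ : Ω → ℕ := fun ω => Nat.find (hex ω) with hρ
  have hρm : Measurable ρ := measurable_find hex hmeas
  have hρs : ∀ ω t, ‖X (ρ ω) ω t‖ ≤ (ρ ω : ℝ) + 1 := by
    intro ω t
    have hd : ∀ q : ℚ, ‖X (ρ ω) ω q‖ ≤ (ρ ω : ℝ) + 1 := Nat.find_spec (hex ω)
    have hcl : IsClosed {t : ℝ | ‖X (ρ ω) ω t‖ ≤ (ρ ω : ℝ) + 1} :=
      isClosed_le (hXc _ _).norm continuous_const
    have hsub : Set.range ((↑) : ℚ → ℝ) ⊆ {t : ℝ | ‖X (ρ ω) ω t‖ ≤ (ρ ω : ℝ) + 1} := by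
      rintro _ ⟨q, rfl⟩; exact hd q
    have := hcl.closure_subset_iff.2 hsub
    exact this (Rat.denseRange_cast t)
  refine ⟨fun t ω => extK (X (ρ ω) ω t), fun t => ?_, fun ω => ⟨?_, fun k hk => ?_⟩⟩
  · have h2 : Measurable fun p : ℕ × Ω => X p.1 p.2 t :=
      measurable_from_prod_countable_right fun R => hXm R t
    have h3 : Measurable fun ω => X (ρ ω) ω t := h2.comp (hρm.prodMk measurable_id)
    refine measurable_pi_lambda _ fun k => ?_
    by_cases h : k ∈ K
    · simp only [extK, h, dif_pos]
      exact (measurable_pi_apply _).comp h3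
    · simp only [extK, h, dif_neg, not_false_eq_true]; exact measurable_const
  -- With the selected radius the path never meets the cutoff, so the truncated system is the true
  -- one.
  · have e : (fun t => cutoff ((ρ ω : ℝ) + 1) (X (ρ ω) ω t)) = fun _ => 1 := by
      ext t; exact cutoff_eq_one (by positivity) (hρs ω t)
    have := hGal (ρ ω) ω
    rwa [e] at this
  · simp only [hX0]
    exact extK_apply _ ⟨k, hk⟩

/-! ### The limit of the Galerkin approximations -/

/-- The nonzero wave vectors in a centred square. -/
def box (n : ℕ) : Finset Idx :=
  Finset.subtype (fun k => k ≠ 0) 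
    (Finset.Icc (-((n : ℤ) + 1), -((n : ℤ) + 1)) ((n : ℤ) + 1, (n : ℤ) + 1))

lemma mem_box {n : ℕ} {k : Idx} : k ∈ box n ↔ |k.1.1| ≤ n + 1 ∧ |k.1.2| ≤ n + 1 := by
  simp only [box, Finset.mem_subtype, Finset.mem_Icc, Prod.le_def, abs_le]
  tauto

lemma opp_mem_box {n : ℕ} (k : Idx) (hk : k ∈ box n) : k.opp ∈ box n := by
  rw [mem_box] at hk ⊢
  simpa [Idx.opp] using hk

lemma box_mono {n m : ℕ} (h : n ≤ m) : box n ⊆ box m := fun k hk => by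
  rw [mem_box] at hk ⊢
  omega

lemma tendsto_box : Tendsto box atTop atTop := by
  refine tendsto_atTop_finset_of_monotone (fun _ _ h => box_mono h) fun k => ?_
  refine ⟨k.1.1.natAbs + k.1.2.natAbs, ?_⟩
  rw [mem_box, Int.abs_eq_natAbs, Int.abs_eq_natAbs]
  omega

/-- The box has half side n + 1, so this lower bound is positive also for n = 0, as required of the
frequency N in `galerkin_diff`. -/
lemma le_len_of_not_mem_box {n : ℕ} {k : Idx} (hk : k ∉ box n) : (n : ℝ) + 1 ≤ len k.1 := by
  have h : (n : ℤ) + 1 ≤ |k.1.1| ∨ (n : ℤ) + 1 ≤ |k.1.2| := by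
    rw [mem_box] at hk; omega
  have key : ∀ a b : ℤ, (n : ℤ) + 1 ≤ |a| → ((n : ℝ) + 1) ^ 2 ≤ (a : ℝ) * a + b * b := by
    intro a b h
    have h' : (n : ℝ) + 1 ≤ |(a : ℝ)| := by exact_mod_cast h
    have : ((n : ℝ) + 1) ^ 2 ≤ |(a : ℝ)| ^ 2 := by gcongr
    rw [sq_abs] at this
    nlinarith [mul_self_nonneg (b : ℝ)]
  apply Real.le_sqrt_of_sq_le
  unfold dot
  rcases h with h | h
  · exact key _ _ h
  · exact (key _ _ h).trans (add_comm _ _).le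

lemma normSq_eq_lintegral (r : ℝ) (u : Coeff) :
    normSq r u = ∫⁻ k, ENNReal.ofReal (len k.1 ^ (2 * r) * ‖u k‖ ^ 2) ∂(Measure.count : Measure Idx) :=
  (lintegral_count _).symm

/-- Lower semicontinuity of the norm under convergence of the coefficients. -/
lemma normSq_le_liminf (r : ℝ) {f : ℕ → Coeff} {g : Coeff}
    (h : ∀ k, Tendsto (fun n => f n k) atTop (𝓝 (g k))) :
    normSq r g ≤ liminf (fun n => normSq r (f n)) atTop := by
  simp only [normSq_eq_lintegral]
  refine le_trans (le_of_eq ?_) (lintegral_liminf_le fun n => Measurable.of_discrete)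
  refine lintegral_congr fun k => ?_
  refine (Tendsto.liminf_eq ?_).symm
  exact ENNReal.tendsto_ofReal (((h k).norm.pow 2).const_mul _)

lemma normSq_le_of_tendsto (r : ℝ) {f : ℕ → Coeff} {g : Coeff}
    (h : ∀ k, Tendsto (fun n => f n k) atTop (𝓝 (g k))) {B : ℝ≥0∞}
    (hB : ∀ᶠ n in atTop, normSq r (f n) ≤ B) : normSq r g ≤ B := by
  refine (normSq_le_liminf r h).trans ?_
  refine (liminf_le_liminf hB).trans ?_
  simp

lemma measurable_normSq (r : ℝ) : Measurable (normSq r) := by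
  unfold normSq
  refine Measurable.tsum fun k => ?_
  exact (measurable_const.mul ((measurable_pi_apply k).norm.pow_const 2)).ennreal_ofReal

lemma lintegral_normSq_le_of_tendsto (r : ℝ) {μ : Measure ℝ} {f : ℕ → ℝ → Coeff} {g : ℝ → Coeff}
    (hf : ∀ n, Measurable (f n)) (h : ∀ᵐ t ∂μ, ∀ k, Tendsto (fun n => f n t k) atTop (𝓝 (g t k)))
    {B : ℝ≥0∞} (hB : ∀ n, ∫⁻ t, normSq r (f n t) ∂μ ≤ B) : ∫⁻ t, normSq r (g t) ∂μ ≤ B := by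
  calc _ ≤ ∫⁻ t, liminf (fun n => normSq r (f n t)) atTop ∂μ :=
        lintegral_mono_ae (h.mono fun t ht => normSq_le_liminf r ht)
    _ ≤ liminf (fun n => ∫⁻ t, normSq r (f n t) ∂μ) atTop :=
        lintegral_liminf_le fun n => (measurable_normSq r).comp (hf n)
    _ ≤ B := by
        refine (liminf_le_liminf (Eventually.of_forall hB)).trans ?_
        simp

/-- The modes outside `K`. -/
def tail (K : Finset Idx) (x : Coeff) : Coeff := open Classical in fun k => if k ∈ K then 0 else x k

lemma tendsto_normSq_tail {r : ℝ} {x : Coeff} (hx : normSq r x ≠ ∞) :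
    Tendsto (fun n => normSq r (tail (box n) x)) atTop (𝓝 0) := by
  have h := (ENNReal.tendsto_tsum_compl_atTop_zero hx).comp tendsto_box
  refine h.congr fun n => ?_
  simp only [Function.comp]
  refine (tsum_subtype {k : Idx | k ∉ box n}
    (fun k : Idx => ENNReal.ofReal (len k.1 ^ (2 * r) * ‖x k‖ ^ 2))).trans ?_
  unfold normSq
  congr 1; ext k
  by_cases hk : k ∈ box n <;> simp [tail, hk]

lemma ofReal_integral_fsum_le {K : Finset Idx} {r T : ℝ} (hT : 0 ≤ T) {f : ℝ → Coeff}
    (hf : ∀ k, Continuous fun t => f t k) :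
    ENNReal.ofReal (∫ s in (0 : ℝ)..T, fsum K r (f s)) = ∫⁻ s in Set.Icc 0 T,
      ENNReal.ofReal (fsum K r (f s)) := by
  have hc := continuous_fsum (K := K) r hf
  rw [intervalIntegral.integral_of_le hT, ← integral_Icc_eq_integral_Ioc]
  exact ofReal_integral_eq_lintegral_ofReal (hc.integrableOn_Icc)
    (Eventually.of_forall fun s => fsum_nonneg _ _ _)

lemma integral_fsum_le_toReal {K : Finset Idx} {r r' T : ℝ} (hr : r ≤ r') (hT : 0 ≤ T)
    {f : ℝ → Coeff} (hf : ∀ k, Continuous fun t => f t k)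
    (hfin : ∫⁻ s in Set.Icc 0 T, normSq r' (f s) ≠ ∞) :
    ∫ s in (0 : ℝ)..T, fsum K r (f s) ≤ (∫⁻ s in Set.Icc 0 T, normSq r' (f s)).toReal := by
  apply (ENNReal.ofReal_le_iff_le_toReal hfin).1
  rw [ofReal_integral_fsum_le hT hf]
  exact lintegral_mono fun s => (ofReal_fsum_le _ _ _).trans (normSq_mono hr _)

lemma IsGalerkin.hcont {K : Finset Idx} {T : ℝ} {θ : ℝ → ℝ} {z u : ℝ → Coeff}
    (hu : IsGalerkin K T θ z u) (r : ℝ) : HCont r u := by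
  refine ⟨fun t => SuppIn.normSq_ne_top (hu.supp t) r, fun t => ?_⟩
  have e : ∀ s, normSq r (u s - u t) = ENNReal.ofReal (fsum K r (u s - u t)) := fun s =>
    normSq_eq_fsum (fun k hk => by simp [hu.supp _ k hk]) r
  simp only [e]
  have hc : Continuous fun s => fsum K r (u s - u t) :=
    continuous_fsum r (f := fun s => u s - u t) fun k => (hu.cont k).sub continuous_const
  have := (ENNReal.continuous_ofReal.comp hc).tendsto t
  simpa [Function.comp_def, fsum] using this

lemma IsGalerkin.integral_eq {K : Finset Idx} {T : ℝ} {z u : ℝ → Coeff}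
    (hu : IsGalerkin K T (fun _ => 1) z u) (hz : HCont 0 z) {t : ℝ} (ht : t ∈ Set.Icc 0 T)
    {k : Idx} (hk : k ∈ K) :
    ∫ s in (0 : ℝ)..t, (-((len k.1 ^ 2 : ℝ) : ℂ) * u s k - bil (u s + z s) (u s + z s) k) =
      u t k - u 0 k := by
  have hv := (hu.hcont 0).add hz
  have hc : Continuous fun s => -((len k.1 ^ 2 : ℝ) : ℂ) * u s k - bil (u s + z s) (u s + z s) k :=
    (continuous_const.mul (hu.cont k)).sub (hv.continuous_bil hv k)
  refine intervalIntegral.integral_eq_sub_of_hasDerivAt_of_le ht.1 (hu.cont k).continuousOn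
    (fun s hs => ?_) (hc.intervalIntegrable _ _)
  refine (hu.deriv s ⟨hs.1, hs.2.trans_le ht.2⟩ k hk).congr_deriv ?_
  simp [sub_eq_add_neg]

lemma hcont_comp_clamp {r T : ℝ} {f : ℝ → Coeff} (hf : HCont r f) :
    HCont r fun t => f (clamp T t) :=
  ⟨fun _ => hf.1 _, fun t => (hf.2 (clamp T t)).comp ((continuous_clamp T).tendsto t)⟩

/-- A uniform limit of continuous paths is continuous. -/
lemma hcont_of_uniform {r : ℝ} {f : ℕ → ℝ → Coeff} {g : ℝ → Coeff} (hf : ∀ n, HCont r (f n))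
    {E : ℕ → ℝ≥0∞} (hE : Tendsto E atTop (𝓝 0)) (h : ∀ n t, normSq r (f n t - g t) ≤ E n) :
    HCont r g := by
  refine ⟨fun t => ?_, fun t => ?_⟩
  · obtain ⟨n, hn⟩ := (hE.eventually (gt_mem_nhds (zero_lt_one' ℝ≥0∞))).exists
    have h1 := ne_top_of_le_ne_top (hn.trans ENNReal.one_lt_top).ne (h n t)
    have e : g t = f n t - (f n t - g t) := by abel
    rw [e]
    exact ne_top_of_le_ne_top (by have := (hf n).1 t; finiteness) (normSq_sub_le r _ _)
  · rw [ENNReal.tendsto_nhds_zero]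
    intro ε hε
    have hE' := ENNReal.Tendsto.const_mul (a := 8) hE (Or.inr (by simp))
    rw [mul_zero] at hE'
    obtain ⟨n, hn⟩ := ((ENNReal.tendsto_nhds_zero.1 hE') (ε / 2) (ENNReal.half_pos hε.ne')).exists
    have h2 := ENNReal.Tendsto.const_mul (a := 4) ((hf n).2 t) (Or.inr (by simp))
    rw [mul_zero] at h2
    filter_upwards [(ENNReal.tendsto_nhds_zero.1 h2) (ε / 2) (ENNReal.half_pos hε.ne')] with s hs
    have e : g s - g t = (f n s - f n t) + ((f n t - g t) - (f n s - g s)) := by abel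
    rw [e]
    calc _ ≤ 2 * (normSq r (f n s - f n t) + 2 * (E n + E n)) := by
          refine (normSq_add_le _ _ _).trans ?_
          gcongr
          refine (normSq_sub_le _ _ _).trans ?_
          gcongr <;> exact h n _
      _ ≤ 4 * normSq r (f n s - f n t) + 8 * E n := by
          have e2 : 2 * (normSq r (f n s - f n t) + 2 * (E n + E n)) =
            2 * normSq r (f n s - f n t) + 8 * E n := by ring
          rw [e2]; gcongr; norm_num
      _ ≤ ε / 2 + ε / 2 := add_le_add hs hn
      _ = ε := ENNReal.add_halves ε

/-- The Galerkin approximations over the boxes converge, uniformly in time, and the limit solves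
the equation coefficient by coefficient. -/
theorem exists_galerkin_limit {σ ε T : ℝ} (hε : 0 < ε) (hεσ : ε ≤ σ) (hσ : σ + 2 * ε < 1)
    (hT : 0 ≤ T) {z : ℝ → Coeff} (hz : HCont 0 z) {M : ℝ} (hM : 0 ≤ M)
    (hzM : ∀ t, normSq (σ + 2 * ε) (z t) ≤ ENNReal.ofReal M)
    (hzz : ∫⁻ s in Set.Icc 0 T, normSq (σ + ε - 1) (bil (z s) (z s)) ≠ ∞)
    {x : Coeff} (hx : normSq σ x ≠ ∞) {u : ℕ → ℝ → Coeff}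
    (hu : ∀ n, IsGalerkin (box n) T (fun _ => 1) z (u n)) (hu0 : ∀ n, ∀ k ∈ box n, u n 0 k = x k) :
    ∃ U : ℝ → Coeff, (∀ t k, Tendsto (fun n => u n (clamp T t) k) atTop (𝓝 (U t k))) ∧
      HCont σ U ∧ (∀ t, IsReal (U t)) ∧ ∫⁻ t in Set.Icc 0 T, normSq (1 + σ) (U t) ≠ ∞ ∧
      U 0 = x ∧ ∀ t ∈ Set.Icc 0 T, ∀ k, U t k - x k =
        ∫ s in (0 : ℝ)..t, (-((len k.1 ^ 2 : ℝ) : ℂ) * U s k - bil (U s + z s) (U s + z s) k) := by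
  have hσ0 : 0 < σ := by linarith
  have hzk := fun k => hz.continuous_bil hz k
  set G := (∫⁻ s in Set.Icc 0 T, normSq (σ + ε - 1) (bil (z s) (z s))).toReal with hG
  set A := (normSq σ x).toReal with hA
  have hfx : ∀ n r, fsum (box n) r (u n 0) = fsum (box n) r x := fun n r =>
    Finset.sum_congr rfl fun k hk => by rw [hu0 n k hk]
  obtain ⟨R, hR, hbd⟩ := galerkin_bound hε hεσ hσ hM (T := T) (A := A) (G := G)
    ENNReal.toReal_nonneg ENNReal.toReal_nonneg
  have hb : ∀ n, ∀ t ∈ Set.Icc 0 T, fsum (box n) σ (u n t) ≤ R ∧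
      ∫ s in (0 : ℝ)..t, fsum (box n) (σ + 1) (u n s) ≤ R := fun n =>
    hbd (box n) z (u n) (hu n) hz hzM
      (by rw [hfx]; exact (ENNReal.ofReal_le_iff_le_toReal hx).1 (ofReal_fsum_le _ _ _))
      (integral_fsum_le_toReal (by linarith) hT hzk hzz)
  obtain ⟨C, hC, hdiff⟩ := galerkin_diff hε hεσ hσ hM hT (G := G) ENNReal.toReal_nonneg hR
  -- The two sources of error: the initial modes outside the box and the truncation of the nonlinear
  -- term with N = n + 1.
  set E : ℕ → ℝ≥0∞ := fun n => ENNReal.ofReal C *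
    (normSq σ (tail (box n) x) + ENNReal.ofReal (((n : ℝ) + 1) ^ (-(2 * ε)))) with hEdef
  have hE : Tendsto E atTop (𝓝 0) := by
    have h1 : Tendsto (fun n : ℕ => ((n : ℝ) + 1) ^ (-(2 * ε))) atTop (𝓝 0) :=
      (tendsto_rpow_neg_atTop (by positivity)).comp
        (tendsto_atTop_add_const_right _ _ tendsto_natCast_atTop_atTop)
    have h2 := (tendsto_normSq_tail hx).add (ENNReal.tendsto_ofReal h1)
    have h3 := ENNReal.Tendsto.const_mul (a := ENNReal.ofReal C) h2 (Or.inr ENNReal.ofReal_ne_top)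
    simpa using h3
  have hcau : ∀ n m, n ≤ m → ∀ t ∈ Set.Icc 0 T, normSq σ (u n t - u m t) ≤ E n := by
    intro n m hnm t ht
    have h := hdiff (box n) (box m) ((n : ℝ) + 1) z (u n) (u m) (box_mono hnm) (by positivity)
      (fun k _ hk => le_len_of_not_mem_box hk) (hu n) (hu m) hz hzM (hb n) (hb m)
      (integral_fsum_le_toReal le_rfl hT hzk hzz) t ht
    have h0 : 0 ≤ ∫ s in (0 : ℝ)..t, fsum (box m) (σ + 1) (u n s - u m s) :=
      intervalIntegral.integral_nonneg ht.1 fun s _ => fsum_nonneg _ _ _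
    have hsup : ∀ t, ∀ k ∉ box m, (u n t - u m t) k = 0 := fun t k hk => by
      simp [(hu m).supp t k hk, (hu n).supp t k fun h => hk (box_mono hnm h)]
    rw [normSq_eq_fsum (hsup t)]
    calc _ ≤ ENNReal.ofReal (C * (fsum (box m) σ (u n 0 - u m 0) + ((n : ℝ) + 1) ^ (-(2 * ε)))) :=
          ENNReal.ofReal_le_ofReal (by linarith)
      _ ≤ E n := by
          simp only [hEdef]
          rw [ENNReal.ofReal_mul hC, ENNReal.ofReal_add (fsum_nonneg _ _ _) (by positivity)]
          gcongr
          -- The initial values agree on the smaller box, so their difference consists of modes of x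
          -- outside it.
          rw [← normSq_eq_fsum (hsup 0)]
          refine ENNReal.tsum_le_tsum fun k => ENNReal.ofReal_le_ofReal ?_
          refine mul_le_mul_of_nonneg_left ?_ (Real.rpow_nonneg (len_nonneg _) _)
          refine pow_le_pow_left₀ (norm_nonneg _) ?_ 2
          by_cases hk : k ∈ box n
          · simp [hu0 n k hk, hu0 m k (box_mono hnm hk)]
          · by_cases hk' : k ∈ box m
            · simp [tail, hk, (hu n).supp 0 k hk, hu0 m k hk']
            · simp [(hu n).supp 0 k hk, (hu m).supp 0 k hk']
  have hlim : ∀ t k, ∃ y, Tendsto (fun n => u n (clamp T t) k) atTop (𝓝 y) := by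
    intro t k
    refine cauchySeq_tendsto_of_complete ?_
    have hEr : ∀ n, E n ≠ ∞ := fun n => by
      have h1 : normSq σ (tail (box n) x) ≤ normSq σ x := by
        refine ENNReal.tsum_le_tsum fun k => ENNReal.ofReal_le_ofReal ?_
        refine mul_le_mul_of_nonneg_left ?_ (Real.rpow_nonneg (len_nonneg _) _)
        by_cases hk : k ∈ box n <;> simp [tail, hk]
      have h2 := ne_top_of_le_ne_top hx h1
      rw [hEdef]; finiteness
    refine cauchySeq_of_le_tendsto_0' (fun n => Real.sqrt (E n).toReal) (fun n m hnm => ?_) ?_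
    · have h1 := (enorm_sq_le_normSq_zero (u n (clamp T t) - u m (clamp T t)) k).trans
        ((normSq_mono hσ0.le _).trans (hcau n m hnm _ (clamp_mem hT t)))
      rw [← ofReal_norm, ← ENNReal.ofReal_pow (norm_nonneg _),
        ENNReal.ofReal_le_iff_le_toReal (hEr n)] at h1
      rw [dist_eq_norm]
      exact Real.le_sqrt_of_sq_le h1
    · have h1 := (ENNReal.tendsto_toReal ENNReal.zero_ne_top).comp hE
      have h2 := (Real.continuous_sqrt.tendsto _).comp h1
      simpa [Function.comp_def] using h2
  choose U hU using hlim
  have hUT : ∀ t ∈ Set.Icc 0 T, ∀ k, Tendsto (fun n => u n t k) atTop (𝓝 (U t k)) := fun t ht k => by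
    have := hU t k; rwa [clamp_of_mem ht] at this
  have hunif : ∀ n t, normSq σ (u n (clamp T t) - U t) ≤ E n := fun n t =>
    normSq_le_of_tendsto σ (f := fun m => u n (clamp T t) - u m (clamp T t))
      (fun k => tendsto_const_nhds.sub (hU t k))
      ((eventually_ge_atTop n).mono fun m hm => hcau n m hm _ (clamp_mem hT t))
  have hUc : HCont σ U := hcont_of_uniform (fun n => hcont_comp_clamp ((hu n).hcont σ)) hE hunif
  have h0T : (0 : ℝ) ∈ Set.Icc 0 T := ⟨le_rfl, hT⟩
  have hU0 : U 0 = x := by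
    ext k
    refine tendsto_nhds_unique (hUT 0 h0T k) (tendsto_const_nhds.congr' ?_)
    filter_upwards [tendsto_box.eventually (eventually_ge_atTop {k})] with n hn
    exact (hu0 n k (hn (by simp))).symm
  refine ⟨U, hU, hUc, fun t k => ?_, ?_, hU0, fun t ht k => ?_⟩
  · refine tendsto_nhds_unique (hU t k.opp) ?_
    refine ((Complex.continuous_conj.tendsto _).comp (hU t k)).neg.congr fun n => ?_
    exact ((hu n).real _ k).symm
  · refine ne_top_of_le_ne_top (ENNReal.ofReal_ne_top (r := R)) ?_
    refine lintegral_normSq_le_of_tendsto (1 + σ) (f := u)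
      (fun n => measurable_pi_lambda _ fun k => ((hu n).cont k).measurable) ?_ fun n => ?_
    · exact (ae_restrict_iff' measurableSet_Icc).2 (Eventually.of_forall hUT)
    · have e : ∀ s, normSq (1 + σ) (u n s) = ENNReal.ofReal (fsum (box n) (σ + 1) (u n s)) :=
        fun s => by rw [add_comm, normSq_eq_fsum ((hu n).supp s)]
      simp only [e]
      rw [← ofReal_integral_fsum_le hT (hu n).cont]
      exact ENNReal.ofReal_le_ofReal (hb n T ⟨hT, le_rfl⟩).2
  -- The mode k is fixed and belongs to every large box. The integrated equation then has two
  -- limits, one from the endpoints and one from dominated convergence.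
  · have hL : Tendsto (fun n => ∫ s in (0 : ℝ)..t, (-((len k.1 ^ 2 : ℝ) : ℂ) * u n s k -
        bil (u n s + z s) (u n s + z s) k)) atTop (𝓝 (U t k - x k)) := by
      have h1 := (hUT t ht k).sub (hUT 0 h0T k)
      rw [hU0] at h1
      refine h1.congr' ?_
      filter_upwards [tendsto_box.eventually (eventually_ge_atTop {k})] with n hn
      exact ((hu n).integral_eq hz ht (hn (by simp))).symm
    refine tendsto_nhds_unique hL ?_
    set B := 2 * (R + M) with hB
    have hB0 : 0 ≤ B := by positivity
    have hv : ∀ n, ∀ s ∈ Set.Icc 0 T, normSq 0 (u n s + z s) ≤ ENNReal.ofReal B := by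
      intro n s hs
      refine (normSq_add_le _ _ _).trans ?_
      rw [hB, ENNReal.ofReal_mul (by norm_num), ENNReal.ofReal_add hR hM, ENNReal.ofReal_ofNat]
      gcongr
      · rw [normSq_eq_fsum ((hu n).supp s)]
        exact ENNReal.ofReal_le_ofReal ((fsum_mono hσ0.le _ _).trans (hb n s hs).1)
      · exact (normSq_mono (by linarith) _).trans (hzM s)
    have hsub : ∀ s, s ∈ Set.uIoc 0 t → s ∈ Set.Icc 0 T := fun s hs => by
      rw [Set.uIoc_of_le ht.1] at hs
      exact ⟨hs.1.le, hs.2.trans ht.2⟩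
    have hvc : ∀ n, HCont 0 fun s => u n s + z s := fun n => ((hu n).hcont 0).add hz
    refine intervalIntegral.tendsto_integral_filter_of_dominated_convergence
      (fun _ => len k.1 ^ 2 * Real.sqrt R + len k.1 * B) (Eventually.of_forall fun n => ?_)
      (Eventually.of_forall fun n => Eventually.of_forall fun s hs => ?_)
      intervalIntegrable_const (Eventually.of_forall fun s hs => ?_)
    · exact ((continuous_const.mul ((hu n).cont k)).sub
        ((hvc n).continuous_bil (hvc n) k)).aestronglyMeasurable
    · have hs' := hsub s hs
      refine (norm_sub_le _ _).trans (add_le_add ?_ ?_)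
      · rw [norm_mul, norm_neg, Complex.norm_real, Real.norm_of_nonneg (by positivity)]
        gcongr
        apply Real.le_sqrt_of_sq_le
        have h1 := enorm_sq_le_normSq_zero (u n s) k
        rw [normSq_eq_fsum ((hu n).supp s), ← ofReal_norm, ← ENNReal.ofReal_pow (norm_nonneg _),
          ENNReal.ofReal_le_ofReal_iff (fsum_nonneg _ _ _)] at h1
        exact h1.trans ((fsum_mono hσ0.le _ _).trans (hb n s hs').1)
      · have h1 : ‖bil (u n s + z s) (u n s + z s) k‖ₑ ^ 2 ≤ ENNReal.ofReal ((len k.1 * B) ^ 2) := by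
          refine (enorm_bil_sq_le _ _ _).trans ?_
          rw [mul_pow, ENNReal.ofReal_mul (by positivity), wt_one, ENNReal.ofReal_pow (len_nonneg _),
            ENNReal.ofReal_pow hB0, sq (ENNReal.ofReal B)]
          gcongr <;> exact hv n s hs'
        rw [← ofReal_norm, ← ENNReal.ofReal_pow (norm_nonneg _),
          ENNReal.ofReal_le_ofReal_iff (by positivity)] at h1
        exact le_of_sq_le_sq h1 (mul_nonneg (len_nonneg _) hB0)
    · have hs' := hsub s hs
      refine (tendsto_const_nhds.mul (hUT s hs' k)).sub ?_
      apply tendsto_of_enorm_sq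
      have hUf : normSq 0 (U s + z s) ≠ ∞ :=
        normSq_add_ne_top ((hUc.mono hσ0.le).1 s) (hz.1 s)
      have hle : ∀ n, ‖bil (u n s + z s) (u n s + z s) k - bil (U s + z s) (U s + z s) k‖ₑ ^ 2 ≤
          2 * wt 1 k * (E n * ENNReal.ofReal B + normSq 0 (U s + z s) * E n) := by
        intro n
        refine (enorm_bil_sub_bil_sq_le ((hvc n).1 s) ((hvc n).1 s) hUf hUf k).trans ?_
        have e : u n s + z s - (U s + z s) = u n s - U s := by abel
        have h1 := (normSq_mono hσ0.le _).trans (hunif n s)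
        rw [clamp_of_mem hs'] at h1
        rw [e]
        gcongr
        exact hv n s hs'
      refine tendsto_of_tendsto_of_tendsto_of_le_of_le tendsto_const_nhds ?_ (fun _ => zero_le) hle
      have h1 := (ENNReal.Tendsto.mul_const (b := ENNReal.ofReal B) hE (Or.inr ENNReal.ofReal_ne_top)).add
        (ENNReal.Tendsto.const_mul (a := normSq 0 (U s + z s)) hE (Or.inr hUf))
      have h2 := ENNReal.Tendsto.const_mul (a := 2 * wt 1 k) h1
        (Or.inr (ENNReal.mul_ne_top (by simp) (wt_ne_top _ _)))
      simpa using h2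

/-! ### The weak formulations -/

lemma ENNReal_le_one_add_sq (x : ℝ≥0∞) : x ≤ 1 + x ^ 2 := by
  rcases le_total x 1 with h | h
  · exact h.trans le_self_add
  · exact (le_self_pow₀ h two_ne_zero).trans le_add_self

/-- The pairing of a path of coefficients with a fixed field can be integrated term by term. -/
lemma bracket_integral {T : ℝ} {F : ℝ → Coeff} {φ : Coeff} (hF : ∀ k, Continuous fun s => F s k)
    (h : ∫⁻ s in Set.Icc 0 T, ∑' k, ‖F s k‖ₑ * ‖φ k‖ₑ ≠ ∞) {t : ℝ} (ht : t ∈ Set.Icc 0 T) :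
    IntervalIntegrable (fun s => bracket (F s) φ) volume 0 t ∧
      HasSum (fun k => (∫ s in (0 : ℝ)..t, F s k) * conj (φ k))
        (∫ s in (0 : ℝ)..t, bracket (F s) φ) := by
  set μ : Measure ℝ := volume.restrict (Set.Ioc 0 t) with hμ
  have hm : ∀ k, Continuous fun s => F s k * conj (φ k) := fun k => (hF k).mul continuous_const
  have e : ∀ s k, ‖F s k * conj (φ k)‖ₑ = ‖F s k‖ₑ * ‖φ k‖ₑ := fun s k => by
    rw [enorm_mul, RCLike.enorm_conj]
  have hfin : ∫⁻ s, ∑' k, ‖F s k * conj (φ k)‖ₑ ∂μ ≠ ∞ := by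
    refine ne_top_of_le_ne_top h ?_
    simp only [e]
    exact lintegral_mono' (Measure.restrict_mono
      (show Set.Ioc 0 t ⊆ Set.Icc 0 T from fun s hs => ⟨hs.1.le, hs.2.trans ht.2⟩) le_rfl)
      le_rfl
  have hfin' : ∑' k, ∫⁻ s, ‖F s k * conj (φ k)‖ₑ ∂μ ≠ ∞ := by
    rwa [← lintegral_tsum fun k => (hm k).measurable.enorm.aemeasurable]
  have hint := integral_tsum (fun k => (hm k).aestronglyMeasurable (μ := μ)) hfin'
  constructor
  · rw [intervalIntegrable_iff, Set.uIoc_of_le ht.1]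
    refine ⟨(Measurable.tsum fun k => (hm k).measurable).aestronglyMeasurable, ?_⟩
    refine lt_of_le_of_lt (lintegral_mono fun s => enorm_tsum_le_tsum_enorm) hfin.lt_top
  · have hk : ∀ k, (∫ s in (0 : ℝ)..t, F s k) * conj (φ k) = ∫ s, F s k * conj (φ k) ∂μ := fun k => by
      rw [integral_mul_const, intervalIntegral.integral_of_le ht.1]
    simp only [hk]
    rw [intervalIntegral.integral_of_le ht.1]
    unfold bracket
    rw [hint]
    refine (summable_of_tsum_enorm_ne_top (ne_top_of_le_ne_top hfin' ?_)).hasSum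
    exact ENNReal.tsum_le_tsum fun k => enorm_integral_le_lintegral_enorm _

/-- Cauchy–Schwarz bounds the square of the pairing; x ≤ 1 + x² and the finite length of [0,T] turn
this into an integrable bound. -/
lemma lintegral_pairing_ne_top {T r : ℝ} {F : ℝ → Coeff} {φ : Coeff}
    (hF : ∫⁻ s in Set.Icc 0 T, normSq (-r) (F s) ≠ ∞) (hφ : normSq r φ ≠ ∞) :
    ∫⁻ s in Set.Icc 0 T, ∑' k, ‖F s k‖ₑ * ‖φ k‖ₑ ≠ ∞ := by
  have h : ∫⁻ s in Set.Icc 0 T, ∑' k, ‖F s k‖ₑ * ‖φ k‖ₑ ≤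
      ∫⁻ s in Set.Icc 0 T, (1 + normSq (-r) (F s) * normSq r φ) :=
    lintegral_mono fun s => (ENNReal_le_one_add_sq _).trans
      (add_le_add le_rfl (tsum_enorm_mul_sq_le r _ _))
  refine ne_top_of_le_ne_top ?_ h
  rw [lintegral_add_left measurable_const, lintegral_mul_const' _ _ hφ]
  simp only [lintegral_const, Measure.restrict_apply_univ, Real.volume_Icc]
  finiteness

lemma normSq_stokesA (r : ℝ) (u : Coeff) : normSq r (stokesA u) = normSq (r + 2) u := by
  unfold normSq stokesA
  congr 1; ext k
  congr 1
  rw [norm_mul, norm_neg, Complex.norm_real, Real.norm_of_nonneg (by positivity), mul_pow, mul_add,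
    Real.rpow_add (len_pos k), ← mul_assoc]
  congr 2
  rw [show 2 * (2 : ℝ) = ((4 : ℕ) : ℝ) by norm_num, Real.rpow_natCast]; ring

lemma exists_normSq_bil_neg_one_le {s : ℝ} (hs0 : 0 < s) (hs : s < 1) :
    ∃ C : ℝ≥0∞, C ≠ ∞ ∧ ∀ a c : Coeff,
      normSq (-1) (bil a c) ≤ C * (normSq s a * normSq (1 - s) c) := by
  obtain ⟨C, hC, h⟩ := normSq_bil_le (r := 0) le_rfl zero_le_one hs0 hs hs0 hs
  refine ⟨2 * C, by finiteness, fun a c => ?_⟩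
  have := h a c
  simp only [zero_add, zero_sub] at this
  exact this.trans (le_of_eq (by ring))

lemma HCont.exists_bound {r T : ℝ} {f : ℝ → Coeff} (hf : HCont r f) :
    ∃ B : ℝ≥0∞, B ≠ ∞ ∧ ∀ t ∈ Set.Icc 0 T, normSq r (f t) ≤ B := by
  refine (isCompact_Icc (a := (0 : ℝ)) (b := T)).induction_on
    (p := fun S => ∃ B : ℝ≥0∞, B ≠ ∞ ∧ ∀ t ∈ S, normSq r (f t) ≤ B) ⟨0, by simp, by simp⟩ ?_ ?_ ?_
  · rintro S S' hS ⟨B, hB, h⟩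
    exact ⟨B, hB, fun t ht => h t (hS ht)⟩
  · rintro S S' ⟨B, hB, h⟩ ⟨B', hB', h'⟩
    refine ⟨B + B', by finiteness, fun t ht => ?_⟩
    rcases ht with ht | ht
    · exact (h t ht).trans le_self_add
    · exact (h' t ht).trans le_add_self
  · intro t _
    refine ⟨{s | normSq r (f s - f t) ≤ 1}, mem_nhdsWithin_of_mem_nhds
      (ENNReal.tendsto_nhds_zero.1 (hf.2 t) 1 one_pos), 2 * (1 + normSq r (f t)), ?_, fun s hs => ?_⟩
    · have := hf.1 t; finiteness
    · have e : f s = (f s - f t) + f t := by abel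
      rw [e]
      refine (normSq_add_le _ _ _).trans ?_
      gcongr
      exact hs

lemma absTri_ne_top {s : ℝ} (hs0 : 0 < s) (hs : s < 1) {a c φ : Coeff} (ha : normSq s a ≠ ∞)
    (hc : normSq (1 - s) c ≠ ∞) (hφ : normSq 1 φ ≠ ∞) : absTri a c φ ≠ ∞ := by
  obtain ⟨C, hC, h⟩ := absTri_sq_le hs0 hs
  have h1 := ne_top_of_le_ne_top (by finiteness) (h a c φ)
  exact fun h2 => h1 (by simp [h2])

lemma triConv_of_absTri {a c φ : Coeff} (hc : IsReal c) (hφ : IsReal φ) (ha0 : normSq 0 a ≠ ∞)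
    (hφ0 : normSq 0 φ ≠ ∞) (h : absTri a c φ ≠ ∞) : TriConv a φ c :=
  ⟨bilConv_of_normSq ha0 hφ0, bracketConv_of_absTri (by rwa [← absTri_comm a hc hφ])⟩

lemma lintegral_normSq_bil_ne_top {s T : ℝ} (hs0 : 0 < s) (hs : s < 1) {a c : ℝ → Coeff}
    (h : (∃ B : ℝ≥0∞, B ≠ ∞ ∧ ∀ t ∈ Set.Icc 0 T, normSq s (a t) ≤ B) ∧
        ∫⁻ t in Set.Icc 0 T, normSq (1 - s) (c t) ≠ ∞ ∨
      (∃ B : ℝ≥0∞, B ≠ ∞ ∧ ∀ t ∈ Set.Icc 0 T, normSq (1 - s) (c t) ≤ B) ∧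
        ∫⁻ t in Set.Icc 0 T, normSq s (a t) ≠ ∞) :
    ∫⁻ t in Set.Icc 0 T, normSq (-1) (bil (a t) (c t)) ≠ ∞ := by
  obtain ⟨C, hC, hbil⟩ := exists_normSq_bil_neg_one_le hs0 hs
  rcases h with ⟨⟨B, hB, hb⟩, hi⟩ | ⟨⟨B, hB, hb⟩, hi⟩
  · refine ne_top_of_le_ne_top ?_ (setLIntegral_mono_ae' (g := fun t => C * B * normSq (1 - s) (c t))
      measurableSet_Icc (Eventually.of_forall fun t ht => ?_))
    · rw [lintegral_const_mul' _ _ (by finiteness)]; finiteness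
    · refine (hbil _ _).trans ?_
      rw [mul_assoc]; gcongr; exact hb t ht
  · refine ne_top_of_le_ne_top ?_ (setLIntegral_mono_ae' (g := fun t => C * B * normSq s (a t))
      measurableSet_Icc (Eventually.of_forall fun t ht => ?_))
    · rw [lintegral_const_mul' _ _ (by finiteness)]; finiteness
    · refine (hbil _ _).trans ?_
      rw [mul_assoc, mul_comm (normSq s _)]; gcongr; exact hb t ht

lemma intervalIntegral_congr_ae_Icc {T t : ℝ} (ht : t ∈ Set.Icc 0 T) {f g : ℝ → ℂ}
    (h : ∀ᵐ s ∂(volume.restrict (Set.Icc 0 T)), f s = g s) :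
    f =ᵐ[volume.restrict (Set.uIoc 0 t)] g := by
  rw [Set.uIoc_of_le ht.1]
  exact ae_restrict_of_ae_restrict_of_subset
    (show Set.Ioc 0 t ⊆ Set.Icc 0 T from fun s hs => ⟨hs.1.le, hs.2.trans ht.2⟩) h

/-- The equation for the coefficients implies the weak form of the auxiliary equation. -/
theorem isWeakSolAux_of_coeff {σ T : ℝ} (h0 : 0 < σ) (h1 : σ < 1) (hT : 0 ≤ T) {z u : ℝ → Coeff}
    (hz : HCont σ z) (hzr : ∀ t, IsReal (z t)) (hu : HCont σ u) (hur : ∀ t, IsReal (u t))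
    (hL2 : ∫⁻ t in Set.Icc 0 T, normSq (1 + σ) (u t) ≠ ∞)
    (hzz : ∫⁻ t in Set.Icc 0 T, normSq (-1) (bil (z t) (z t)) ≠ ∞)
    (heq : ∀ t ∈ Set.Icc 0 T, ∀ k, u t k - u 0 k =
      ∫ s in (0 : ℝ)..t, (-((len k.1 ^ 2 : ℝ) : ℂ) * u s k - bil (u s + z s) (u s + z s) k)) :
    IsWeakSolAux T z u := by
  rintro φ ⟨hφr, hφ⟩
  have hφ := hφ.ne
  have hφ0 : normSq 0 φ ≠ ∞ := ne_top_of_le_ne_top hφ (normSq_mono zero_le_one _)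
  have hz0 : HCont 0 z := hz.mono h0.le
  have hu0 : HCont 0 u := hu.mono h0.le
  have hlow : ∀ s ≤ 1 + σ, ∫⁻ t in Set.Icc 0 T, normSq s (u t) ≠ ∞ := fun s hs =>
    ne_top_of_le_ne_top hL2 (lintegral_mono fun t => normSq_mono hs _)
  have hum : Measurable u := measurable_pi_lambda _ fun k => (hu0.continuous_apply k).measurable
  have hbm : Measurable fun t => bil (z t) (z t) :=
    measurable_pi_lambda _ fun k => (hz0.continuous_bil hz0 k).measurable
  have huae : ∀ᵐ t ∂(volume.restrict (Set.Icc 0 T)), normSq (1 + σ) (u t) < ∞ :=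
    ae_lt_top ((measurable_normSq _).comp hum) hL2
  have hzae : ∀ᵐ t ∂(volume.restrict (Set.Icc 0 T)), normSq (-1) (bil (z t) (z t)) < ∞ :=
    ae_lt_top ((measurable_normSq _).comp hbm) hzz
  have hs' : 1 - (1 - σ) = σ := by ring
  have iA : ∫⁻ t in Set.Icc 0 T, normSq (-1) (stokesA (u t)) ≠ ∞ := by
    simp only [normSq_stokesA]; exact hlow _ (by linarith)
  have iuu : ∫⁻ t in Set.Icc 0 T, normSq (-1) (bil (u t) (u t)) ≠ ∞ :=
    lintegral_normSq_bil_ne_top h0 h1 (Or.inl ⟨hu.exists_bound, hlow _ (by linarith)⟩)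
  have iuz : ∫⁻ t in Set.Icc 0 T, normSq (-1) (bil (u t) (z t)) ≠ ∞ :=
    lintegral_normSq_bil_ne_top (s := 1 - σ) (by linarith) (by linarith)
      (Or.inr ⟨by rw [hs']; exact hz.exists_bound, hlow _ (by linarith)⟩)
  have izu : ∫⁻ t in Set.Icc 0 T, normSq (-1) (bil (z t) (u t)) ≠ ∞ :=
    lintegral_normSq_bil_ne_top h0 h1 (Or.inl ⟨hz.exists_bound, hlow _ (by linarith)⟩)
  have bA := fun t ht => bracket_integral (t := t) (F := fun t => stokesA (u t)) (φ := φ)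
    (fun k => continuous_const.mul (hu0.continuous_apply k)) (lintegral_pairing_ne_top iA hφ) ht
  have buu := fun t ht => bracket_integral (t := t) (F := fun t => bil (u t) (u t)) (φ := φ)
    (hu0.continuous_bil hu0) (lintegral_pairing_ne_top iuu hφ) ht
  have buz := fun t ht => bracket_integral (t := t) (F := fun t => bil (u t) (z t)) (φ := φ)
    (hu0.continuous_bil hz0) (lintegral_pairing_ne_top iuz hφ) ht
  have bzu := fun t ht => bracket_integral (t := t) (F := fun t => bil (z t) (u t)) (φ := φ)
    (hz0.continuous_bil hu0) (lintegral_pairing_ne_top izu hφ) ht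
  have bzz := fun t ht => bracket_integral (t := t) (F := fun t => bil (z t) (z t)) (φ := φ)
    (hz0.continuous_bil hz0) (lintegral_pairing_ne_top hzz hφ) ht
  -- At almost every time u is in H^{1+σ}, so in each form one factor offers σ derivatives and a
  -- u-factor 1−σ: the one derivative needed for absolute convergence.
  have htri : ∀ᵐ s ∂(volume.restrict (Set.Icc 0 T)), absTri (u s) (u s) φ ≠ ∞ ∧
      absTri (u s) (z s) φ ≠ ∞ ∧ absTri (z s) (u s) φ ≠ ∞ := by
    filter_upwards [huae] with s hs
    have hl : normSq (1 - σ) (u s) ≠ ∞ := ne_top_of_le_ne_top hs.ne (normSq_mono (by linarith) _)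
    exact ⟨absTri_ne_top h0 h1 (hu.1 s) hl hφ,
      absTri_ne_top (s := 1 - σ) (by linarith) (by linarith) hl (by rw [hs']; exact hz.1 s) hφ,
      absTri_ne_top h0 h1 (hz.1 s) hl hφ⟩
  have auu : ∀ᵐ s ∂(volume.restrict (Set.Icc 0 T)),
      -bracket (bil (u s) (u s)) φ = bracket (bil (u s) φ) (u s) :=
    htri.mono fun s hs => by rw [bracket_bil_antisymm (hur s) hφr hs.1, neg_neg]
  have auz : ∀ᵐ s ∂(volume.restrict (Set.Icc 0 T)),
      -bracket (bil (u s) (z s)) φ = bracket (bil (u s) φ) (z s) :=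
    htri.mono fun s hs => by rw [bracket_bil_antisymm (hzr s) hφr hs.2.1, neg_neg]
  have azu : ∀ᵐ s ∂(volume.restrict (Set.Icc 0 T)),
      -bracket (bil (z s) (u s)) φ = bracket (bil (z s) φ) (u s) :=
    htri.mono fun s hs => by rw [bracket_bil_antisymm (hur s) hφr hs.2.2, neg_neg]
  have hTT : T ∈ Set.Icc 0 T := ⟨hT, le_rfl⟩
  refine ⟨?_, (bA T hTT).1, (buu T hTT).1.neg.congr_ae (intervalIntegral_congr_ae_Icc hTT auu),
    (buz T hTT).1.neg.congr_ae (intervalIntegral_congr_ae_Icc hTT auz),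
    (bzu T hTT).1.neg.congr_ae (intervalIntegral_congr_ae_Icc hTT azu), (bzz T hTT).1,
    fun t ht => ?_⟩
  · filter_upwards [huae, hzae, htri] with s hs hzs ht
    refine ⟨bracketConv_of_normSq 1 ?_ hφ, triConv_of_absTri (hur s) hφr (hu0.1 s) hφ0 ht.1,
      triConv_of_absTri (hzr s) hφr (hu0.1 s) hφ0 ht.2.1,
      triConv_of_absTri (hur s) hφr (hz0.1 s) hφ0 ht.2.2, bilConv_of_normSq (hz0.1 s) (hz0.1 s),
      bracketConv_of_normSq 1 hzs.ne hφ⟩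
    rw [normSq_stokesA]
    exact ne_top_of_le_ne_top hs.ne (normSq_mono (by linarith) _)
  · have hsum := ((((bA t ht).2.sub (buu t ht).2).sub (buz t ht).2).sub (bzu t ht).2).sub
      (bzz t ht).2
    have hcoef : ∀ k, (u t - u 0) k = (∫ s in (0 : ℝ)..t, stokesA (u s) k) -
        (∫ s in (0 : ℝ)..t, bil (u s) (u s) k) - (∫ s in (0 : ℝ)..t, bil (u s) (z s) k) -
        (∫ s in (0 : ℝ)..t, bil (z s) (u s) k) - ∫ s in (0 : ℝ)..t, bil (z s) (z s) k := by
      intro k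
      have cA : Continuous fun s => stokesA (u s) k := continuous_const.mul (hu0.continuous_apply k)
      have c1 := hu0.continuous_bil hu0 k
      have c2 := hu0.continuous_bil hz0 k
      have c3 := hz0.continuous_bil hu0 k
      have c4 := hz0.continuous_bil hz0 k
      have i := fun {f : ℝ → ℂ} (hf : Continuous f) => hf.intervalIntegrable (μ := volume) 0 t
      have d1 : Continuous fun s => stokesA (u s) k - bil (u s) (u s) k := cA.sub c1
      have d2 : Continuous fun s => stokesA (u s) k - bil (u s) (u s) k - bil (u s) (z s) k :=
        d1.sub c2
      have d3 : Continuous fun s => stokesA (u s) k - bil (u s) (u s) k - bil (u s) (z s) k -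
        bil (z s) (u s) k := d2.sub c3
      rw [Pi.sub_apply, heq t ht k, ← intervalIntegral.integral_sub (i cA) (i c1),
        ← intervalIntegral.integral_sub (i d1) (i c2), ← intervalIntegral.integral_sub (i d2) (i c3),
        ← intervalIntegral.integral_sub (i d3) (i c4)]
      congr 1; ext s
      rw [bil_add_add (hu0.1 s) (hz0.1 s)]
      simp only [stokesA, Pi.add_apply]
      ring
    have hsum' : HasSum (fun k => (u t - u 0) k * conj (φ k))
        ((∫ s in (0 : ℝ)..t, bracket (stokesA (u s)) φ) -
        (∫ s in (0 : ℝ)..t, bracket (bil (u s) (u s)) φ) -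
        (∫ s in (0 : ℝ)..t, bracket (bil (u s) (z s)) φ) -
        (∫ s in (0 : ℝ)..t, bracket (bil (z s) (u s)) φ) -
        ∫ s in (0 : ℝ)..t, bracket (bil (z s) (z s)) φ) := by
      refine (congrArg (fun f => HasSum f _) (funext fun k => ?_)).mpr hsum
      rw [hcoef k]; ring
    refine ⟨hsum'.summable, ?_⟩
    have hneg : ∀ {f g : ℝ → ℂ}, (∀ᵐ s ∂(volume.restrict (Set.Icc 0 T)), -f s = g s) →
        ∫ s in (0 : ℝ)..t, g s = -∫ s in (0 : ℝ)..t, f s := fun {f g} hfg => by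
      rw [← intervalIntegral.integral_neg]
      exact (intervalIntegral.integral_congr_ae_restrict
        (intervalIntegral_congr_ae_Icc ht hfg)).symm
    rw [show bracket (u t - u 0) φ = _ from hsum'.tsum_eq, hneg auu, hneg auz, hneg azu]
    ring

/-- The equation for the coefficients implies the weak form of the stochastic equation. -/
theorem isWeakSolNS_of_coeff {σ T : ℝ} (h0 : 0 < σ) (h1 : σ < 1) (hT : 0 ≤ T) {w v : ℝ → Coeff}
    (hv : HCont σ v) (hvr : ∀ t, IsReal (v t))
    (heq : ∀ t ∈ Set.Icc 0 T, ∀ k, w t k = v t k - v 0 k -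
      ∫ s in (0 : ℝ)..t, (-((len k.1 ^ 2 : ℝ) : ℂ) * v s k - bil (v s) (v s) k)) :
    IsWeakSolNS σ T w v := by
  rintro φ ⟨hφr, hφ⟩
  have hφ := hφ.ne
  have hφ0 : normSq 0 φ ≠ ∞ := ne_top_of_le_ne_top hφ (normSq_mono (by linarith) _)
  have hv0 : HCont 0 v := hv.mono h0.le
  -- Here the form must converge at every time, when v is only in H^σ; the smoother φ in H^{2−σ}
  -- takes the derivatives instead.
  obtain ⟨C, hC, habs⟩ := absTri_sq_le_smooth h0 h1
  obtain ⟨B, hB, hvB⟩ := hv.exists_bound (T := T)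
  have htri : ∀ s, absTri (v s) (v s) φ ≠ ∞ := fun s h => by
    have h2 := habs (v s) (v s) φ (hvr s) hφr
    have := hv.1 s
    have := hv0.1 s
    exact ne_top_of_le_ne_top (by finiteness) h2 (by simp [h])
  have hA : ∀ s, normSq (-(2 - σ)) (stokesA (v s)) = normSq σ (v s) := fun s => by
    rw [normSq_stokesA]; ring_nf
  have bA := fun t ht => bracket_integral (T := T) (t := t) (F := fun t => stokesA (v t)) (φ := φ)
    (fun k => continuous_const.mul (hv0.continuous_apply k)) (lintegral_pairing_ne_top (r := 2 - σ) (by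
      simp only [hA]
      refine ne_top_of_le_ne_top ?_ (setLIntegral_mono_ae' (g := fun _ => B) measurableSet_Icc
        (Eventually.of_forall fun t ht => hvB t ht))
      simp only [lintegral_const, Measure.restrict_apply_univ, Real.volume_Icc]
      finiteness) hφ) ht
  have bvv := fun t ht => bracket_integral (T := T) (t := t) (F := fun t => bil (v t) (v t)) (φ := φ)
    (hv0.continuous_bil hv0) (by
      refine ne_top_of_le_ne_top ?_ (setLIntegral_mono_ae'
        (g := fun _ => 1 + C * (B * B * normSq (2 - σ) φ)) measurableSet_Icc
        (Eventually.of_forall fun t ht => ?_))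
      · simp only [lintegral_const, Measure.restrict_apply_univ, Real.volume_Icc]
        finiteness
      · have h2 : ∑' k, ‖bil (v t) (v t) k‖ₑ * ‖φ k‖ₑ ≤ absTri (v t) (v t) φ := by
          rw [absTri_eq]
          exact ENNReal.tsum_le_tsum fun k => mul_le_mul' (enorm_bil_le_tsum _ _ _) le_rfl
        refine h2.trans ((ENNReal_le_one_add_sq _).trans ?_)
        gcongr
        refine (habs (v t) (v t) φ (hvr t) hφr).trans ?_
        gcongr
        · exact hvB t ht
        · exact (normSq_mono h0.le _).trans (hvB t ht)) ht
  have hTT : T ∈ Set.Icc 0 T := ⟨hT, le_rfl⟩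
  have avv : ∀ s, bracket (bil (v s) φ) (v s) = -bracket (bil (v s) (v s)) φ := fun s => by
    rw [bracket_bil_antisymm (hvr s) hφr (htri s), neg_neg]
  refine ⟨fun s _ => ⟨bracketConv_of_normSq (2 - σ) (by rw [hA]; exact hv.1 s) hφ,
    triConv_of_absTri (hvr s) hφr (hv0.1 s) hφ0 (htri s)⟩, (bA T hTT).1, ?_, fun t ht => ?_⟩
  · simp only [avv]; exact (bvv T hTT).1.neg
  · have hfin : normSq σ (v t - v 0) ≠ ∞ := by
      have h1 := hv.1 t
      have h2 := hv.1 0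
      exact ne_top_of_le_ne_top (by finiteness) (normSq_sub_le σ _ _)
    have hd : BracketConv (v t - v 0) φ := bracketConv_of_normSq (2 - σ)
      (ne_top_of_le_ne_top hfin (normSq_mono (by linarith) _)) hφ
    -- The noise is not estimated in any space: its bracket converges because its coefficients are a
    -- combination of three series already known to be summable.
    have hsum := ((Summable.hasSum hd).sub (bA t ht).2).add (bvv t ht).2
    have hsum' : HasSum (fun k => w t k * conj (φ k)) (bracket (v t - v 0) φ -
        (∫ s in (0 : ℝ)..t, bracket (stokesA (v s)) φ) +
        ∫ s in (0 : ℝ)..t, bracket (bil (v s) (v s)) φ) := by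
      refine (congrArg (fun f => HasSum f _) (funext fun k => ?_)).mpr hsum
      have cA : Continuous fun s => stokesA (v s) k := continuous_const.mul (hv0.continuous_apply k)
      have c1 := hv0.continuous_bil hv0 k
      have e : w t k = v t k - v 0 k - ((∫ s in (0 : ℝ)..t, stokesA (v s) k) -
          ∫ s in (0 : ℝ)..t, bil (v s) (v s) k) := by
        rw [heq t ht k, ← intervalIntegral.integral_sub (cA.intervalIntegrable _ _)
          (c1.intervalIntegrable _ _)]
        rfl
      rw [e, Pi.sub_apply]; ring
    refine ⟨hd, hsum'.summable, ?_⟩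
    rw [show bracket (w t) φ = _ from hsum'.tsum_eq]
    simp only [avv, intervalIntegral.integral_neg]
    ring

/-- The weak form sees the paths only on [0,T]. This transfers it from the regularized version of z
to the Stokes process itself. -/
lemma IsWeakSolAux.congr {T : ℝ} {z z' u u' : ℝ → Coeff} (h : IsWeakSolAux T z u) (hT : 0 ≤ T)
    (hz : ∀ t ∈ Set.Icc 0 T, z t = z' t) (hu : ∀ t ∈ Set.Icc 0 T, u t = u' t) :
    IsWeakSolAux T z' u' := by
  intro φ hφ
  obtain ⟨h1, h2, h3, h4, h5, h6, h7⟩ := h φ hφ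
  have hI : ∀ {f g : ℝ → ℂ}, (∀ s ∈ Set.Icc 0 T, f s = g s) → ∀ t ∈ Set.Icc 0 T,
      f =ᵐ[volume.restrict (Set.uIoc 0 t)] g := fun {f g} hfg t ht =>
    intervalIntegral_congr_ae_Icc ht
      ((ae_restrict_iff' measurableSet_Icc).2 (Eventually.of_forall hfg))
  have hTT : T ∈ Set.Icc 0 T := ⟨hT, le_rfl⟩
  have g2 : ∀ s ∈ Set.Icc 0 T, bracket (stokesA (u s)) φ = bracket (stokesA (u' s)) φ :=
    fun s hs => by rw [hu s hs]
  have g3 : ∀ s ∈ Set.Icc 0 T, bracket (bil (u s) φ) (u s) = bracket (bil (u' s) φ) (u' s) :=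
    fun s hs => by rw [hu s hs]
  have g4 : ∀ s ∈ Set.Icc 0 T, bracket (bil (u s) φ) (z s) = bracket (bil (u' s) φ) (z' s) :=
    fun s hs => by rw [hu s hs, hz s hs]
  have g5 : ∀ s ∈ Set.Icc 0 T, bracket (bil (z s) φ) (u s) = bracket (bil (z' s) φ) (u' s) :=
    fun s hs => by rw [hu s hs, hz s hs]
  have g6 : ∀ s ∈ Set.Icc 0 T, bracket (bil (z s) (z s)) φ = bracket (bil (z' s) (z' s)) φ :=
    fun s hs => by rw [hz s hs]
  refine ⟨?_, h2.congr_ae (hI g2 T hTT), h3.congr_ae (hI g3 T hTT), h4.congr_ae (hI g4 T hTT),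
    h5.congr_ae (hI g5 T hTT), h6.congr_ae (hI g6 T hTT), fun t ht => ?_⟩
  · filter_upwards [h1, ae_restrict_mem measurableSet_Icc] with s hs hs'
    rwa [← hz s hs', ← hu s hs']
  · obtain ⟨h8, h9⟩ := h7 t ht
    have i := fun {f g : ℝ → ℂ} (hfg : ∀ s ∈ Set.Icc 0 T, f s = g s) =>
      intervalIntegral.integral_congr_ae_restrict (hI hfg t ht)
    rw [← hu t ht, ← hu 0 ⟨le_rfl, hT⟩, ← i g2, ← i g3, ← i g4, ← i g5, ← i g6]
    exact ⟨h8, h9⟩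

/-! ### Riemann–Stieltjes integrals and the exponential convolution -/

lemma partition_mem {p : ℕ → ℝ} {n : ℕ} (hp : ∀ i < n, p i ≤ p (i + 1)) {i : ℕ} (hi : i ≤ n) :
    p 0 ≤ p i ∧ p i ≤ p n := by
  have key : ∀ i j, i ≤ j → j ≤ n → p i ≤ p j := by
    intro i j hij
    induction j, hij using Nat.le_induction with
    | base => intro _; exact le_rfl
    | succ j _ ih => intro hj; exact (ih (by omega)).trans (hp j (by omega))
  exact ⟨key 0 i (Nat.zero_le _) hi, key i n hi le_rfl⟩

/-- Integration by parts: a continuous integrator has a Riemann–Stieltjes integral against a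
continuously differentiable function. -/
lemma hasRSIntegral_of_hasDerivAt {f f' : ℝ → ℝ} (hf : ∀ s, HasDerivAt f (f' s) s)
    (hf' : Continuous f') {g : ℝ → ℂ} (hg : Continuous g) {a c : ℝ} (hac : a ≤ c) :
    HasRSIntegral f g a c (f c * g c - f a * g a - ∫ s in a..c, (f' s : ℂ) * g s) := by
  intro ε hε
  obtain ⟨L, hL⟩ := (isCompact_Icc (a := a) (b := c)).exists_bound_of_continuousOn
    hf'.continuousOn
  have hL0 : 0 ≤ L := (norm_nonneg _).trans (hL a ⟨le_rfl, hac⟩)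
  -- The total error is L η (c−a); the added 1 keeps the denominator positive in the degenerate
  -- cases.
  set η := ε / (L * (c - a) + 1) with hη
  have hden : 0 < L * (c - a) + 1 := by nlinarith
  have hη0 : 0 < η := by positivity
  obtain ⟨δ, hδ, hunif⟩ := Metric.uniformContinuousOn_iff.1
    ((isCompact_Icc (a := a) (b := c)).uniformContinuousOn_of_continuous hg.continuousOn) η hη0
  refine ⟨δ, hδ, fun n p ξ hp0 hpn hp => ?_⟩
  have hmem : ∀ i ≤ n, a ≤ p i ∧ p i ≤ c := fun i hi => by
    have := partition_mem (fun i hi => (hp i hi).1.trans (hp i hi).2.1) hi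
    rwa [hp0, hpn] at this
  have hfc : Continuous fun s => (f' s : ℂ) * g s := (Complex.continuous_ofReal.comp hf').mul hg
  have hi := fun x y => hfc.intervalIntegrable (μ := volume) x y
  set Φ : ℝ → ℂ := fun s => f s * g s with hΦ
  have hsum : (f c * g c - f a * g a - ∫ s in a..c, (f' s : ℂ) * g s) =
      ∑ i ∈ Finset.range n, (Φ (p (i + 1)) - Φ (p i) -
        ∫ s in (p i)..(p (i + 1)), (f' s : ℂ) * g s) := by
    rw [Finset.sum_sub_distrib, Finset.sum_range_sub (fun i => Φ (p i)),
      intervalIntegral.sum_integral_adjacent_intervals fun i _ => hi _ _, hp0, hpn]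
  rw [hsum, ← Finset.sum_sub_distrib]
  refine (norm_sum_le _ _).trans ?_
  have hpart : ∀ x y, x ∈ Set.Icc a c → y ∈ Set.Icc a c → ∀ w, (∀ s ∈ Set.uIoc x y, ‖g s - w‖ ≤ η) →
      ‖(∫ s in x..y, (f' s : ℂ) * g s) - ((f y - f x : ℝ) : ℂ) * w‖ ≤ L * η * |y - x| := by
    intro x y hx hy w hw
    have e : ((f y - f x : ℝ) : ℂ) * w = ∫ s in x..y, (f' s : ℂ) * w := by
      rw [intervalIntegral.integral_mul_const, intervalIntegral.integral_ofReal,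
        intervalIntegral.integral_eq_sub_of_hasDerivAt (fun s _ => hf s)
          (hf'.intervalIntegrable _ _)]
    have hw' : Continuous fun s => (f' s : ℂ) * w :=
      (Complex.continuous_ofReal.comp hf').mul continuous_const
    rw [e, ← intervalIntegral.integral_sub (hi _ _) (hw'.intervalIntegrable _ _)]
    refine intervalIntegral.norm_integral_le_of_norm_le_const fun s hs => ?_
    rw [← mul_sub, norm_mul, Complex.norm_real]
    have hs' : s ∈ Set.Icc a c := by
      have h := Set.uIoc_subset_uIcc hs
      exact Set.uIcc_subset_Icc hx hy h
    exact mul_le_mul (hL s hs') (hw s hs) (norm_nonneg _) hL0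
  calc _ ≤ ∑ i ∈ Finset.range n, L * η * (p (i + 1) - p i) := by
        refine Finset.sum_le_sum fun i hir => ?_
        have hin := Finset.mem_range.1 hir
        obtain ⟨h1, h2, h3⟩ := hp i hin
        have m1 : p i ∈ Set.Icc a c := hmem i hin.le
        have m2 : p (i + 1) ∈ Set.Icc a c := hmem (i + 1) hin
        have mξ : ξ i ∈ Set.Icc a c := ⟨m1.1.trans h1, h2.trans m2.2⟩
        have g1 : ∀ s ∈ Set.uIoc (p i) (ξ i), ‖g s - g (p i)‖ ≤ η := fun s hs => by
          rw [Set.uIoc_of_le h1] at hs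
          have hd := hunif s ⟨m1.1.trans hs.1.le, hs.2.trans mξ.2⟩ (p i) m1
            (by rw [Real.dist_eq, abs_of_nonneg (by linarith [hs.1])]; linarith [hs.2])
          rw [← dist_eq_norm]; exact hd.le
        have g2 : ∀ s ∈ Set.uIoc (ξ i) (p (i + 1)), ‖g s - g (p (i + 1))‖ ≤ η := fun s hs => by
          rw [Set.uIoc_of_le h2] at hs
          have hd := hunif s ⟨mξ.1.trans hs.1.le, hs.2.trans m2.2⟩ (p (i + 1)) m2
            (by rw [Real.dist_eq, abs_of_nonpos (by linarith [hs.2])]; linarith [hs.1])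
          rw [← dist_eq_norm]; exact hd.le
        have b1 := hpart _ _ m1 mξ _ g1
        have b2 := hpart _ _ mξ m2 _ g2
        rw [abs_of_nonneg (by linarith)] at b1 b2
        rw [← intervalIntegral.integral_add_adjacent_intervals (hi (p i) (ξ i)) (hi _ (p (i + 1)))]
        -- Splitting the interval at the tag: to the left of ξ the integrator is compared with its
        -- left endpoint value, to the right with its right endpoint value.
        have e : (f (ξ i) : ℂ) * (g (p (i + 1)) - g (p i)) - (Φ (p (i + 1)) - Φ (p i) -
            ((∫ s in (p i)..(ξ i), (f' s : ℂ) * g s) +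
              ∫ s in (ξ i)..(p (i + 1)), (f' s : ℂ) * g s)) =
            ((∫ s in (p i)..(ξ i), (f' s : ℂ) * g s) - ((f (ξ i) - f (p i) : ℝ) : ℂ) * g (p i)) +
            ((∫ s in (ξ i)..(p (i + 1)), (f' s : ℂ) * g s) -
              ((f (p (i + 1)) - f (ξ i) : ℝ) : ℂ) * g (p (i + 1))) := by
          rw [hΦ]; push_cast; ring
        rw [e]
        refine (norm_add_le _ _).trans ((add_le_add b1 b2).trans (le_of_eq (by ring)))
    _ = L * η * (c - a) := by
        rw [← Finset.mul_sum, Finset.sum_range_sub p, hp0, hpn]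
    _ ≤ ε := by
        have h : η * (L * (c - a) + 1) = ε := by rw [hη]; field_simp
        nlinarith

/-- The points of the uniform partition of `[a, c]` into `n + 1` intervals. -/
def uniformPt (a c : ℝ) (n i : ℕ) : ℝ := a + i * ((c - a) / (n + 1))

/-- An explicit sequence of sums reaching the integral gives uniqueness, and exhibits the integral
as a measurable functional of the path. -/
lemma tendsto_uniform_of_hasRSIntegral {f : ℝ → ℝ} {g : ℝ → ℂ} {a c : ℝ} (hac : a ≤ c) {I : ℂ}
    (h : HasRSIntegral f g a c I) :
    Tendsto (fun n => ∑ i ∈ Finset.range (n + 1), (f (uniformPt a c n i) : ℂ) *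
      (g (uniformPt a c n (i + 1)) - g (uniformPt a c n i))) atTop (𝓝 I) := by
  rw [Metric.tendsto_atTop]
  intro ε hε
  obtain ⟨δ, hδ, hI⟩ := h (ε / 2) (by positivity)
  obtain ⟨N, hN⟩ := exists_nat_gt ((c - a) / δ)
  refine ⟨N, fun n hn => ?_⟩
  have hpos : (0 : ℝ) < n + 1 := by positivity
  have hstep : ∀ i : ℕ, uniformPt a c n (i + 1) - uniformPt a c n i = (c - a) / (n + 1) := fun i => by
    unfold uniformPt; push_cast; ring
  have hs0 : 0 ≤ (c - a) / (n + 1) := div_nonneg (by linarith) hpos.le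
  have hsδ : (c - a) / (n + 1) < δ := by
    rw [div_lt_iff₀ hpos]
    rw [div_lt_iff₀ hδ] at hN
    have : (N : ℝ) ≤ n := by exact_mod_cast hn
    nlinarith
  rw [dist_eq_norm]
  refine lt_of_le_of_lt (hI (n + 1) (uniformPt a c n) (uniformPt a c n) (by simp [uniformPt]) ?_ ?_)
    (by linarith)
  · unfold uniformPt; push_cast; field_simp; ring
  · intro i _
    have := hstep i
    exact ⟨le_rfl, by linarith, by linarith⟩

lemma HasRSIntegral.unique {f : ℝ → ℝ} {g : ℝ → ℂ} {a c : ℝ} (hac : a ≤ c) {I I' : ℂ}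
    (h : HasRSIntegral f g a c I) (h' : HasRSIntegral f g a c I') : I = I' :=
  tendsto_nhds_unique (tendsto_uniform_of_hasRSIntegral hac h)
    (tendsto_uniform_of_hasRSIntegral hac h')

lemma HasExpConv.unique {lam : ℝ} {g : ℝ → ℂ} {t : ℝ} {I I' : ℂ} (h : HasExpConv lam g t I)
    (h' : HasExpConv lam g t I') : I = I' := by
  obtain ⟨J, hJ, hI⟩ := h
  obtain ⟨J', hJ', hI'⟩ := h'
  refine tendsto_nhds_unique hI (hI'.congr' ?_)
  filter_upwards [eventually_le_atBot t] with a ha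
  exact (hJ' a ha).unique ha (hJ a ha)

lemma HasExpConv.expConv_eq {lam : ℝ} {g : ℝ → ℂ} {t : ℝ} {I : ℂ} (h : HasExpConv lam g t I) :
    expConv lam g t = I := by
  have hex : ∃ I, HasExpConv lam g t I := ⟨I, h⟩
  unfold expConv
  rw [dif_pos hex]
  exact hex.choose_spec.unique h

/-- Hölder continuity with a quadratically growing constant. -/
def HolderGrowth (β κ : ℝ) (g : ℝ → ℂ) : Prop :=
  ∀ s t, ‖g t - g s‖ ≤ κ * ((2 + |t| + |s|) ^ 2 * |t - s| ^ β)

/-- The exponential convolution in terms of increments,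
`∫_0^∞ lam exp(-lam r) (g(t) - g(t-r)) dr`. -/
def convPath (lam : ℝ) (g : ℝ → ℂ) (t : ℝ) : ℂ :=
  ∫ r in Set.Ioi (0 : ℝ), ((lam * Real.exp (-(lam * r)) : ℝ) : ℂ) * (g t - g (t - r))

/-- The weight that dominates the convolution integral. -/
def expWeight (β q : ℝ) : ℝ := Real.exp (-q) * ((1 + q) ^ 2 * q ^ β)

/-- Expanding (1+q)² gives three Gamma integrals. -/
lemma integrableOn_expWeight {β : ℝ} (hβ : 0 < β) : IntegrableOn (expWeight β) (Set.Ioi 0) := by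
  have h := fun (j : ℕ) => Real.GammaIntegral_convergent (s := β + j + 1) (by positivity)
  have h2 := ((h 0).add ((h 1).const_mul 2)).add (h 2)
  refine h2.congr_fun (fun q hq => ?_) measurableSet_Ioi
  have hq0 : (0 : ℝ) < q := hq
  have e : ∀ j : ℕ, q ^ (β + j + 1 - 1) = q ^ β * q ^ j := fun j => by
    rw [add_sub_cancel_right, Real.rpow_add hq0, Real.rpow_natCast]
  simp only [Pi.add_apply, e, expWeight]; ring

lemma expWeight_nonneg {β q : ℝ} (hq : 0 ≤ q) : 0 ≤ expWeight β q := by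
  unfold expWeight; positivity

/-- With q = lam r the Hölder factor r^β becomes lam^{−β} q^β. The quadratic growth in time is
absorbed in (1+q)² because lam ≥ 1 implies r ≤ q. -/
lemma HolderGrowth.norm_integrand_le {β κ lam T t r : ℝ} {g : ℝ → ℂ} (h : HolderGrowth β κ g)
    (hκ : 0 ≤ κ) (hlam : 1 ≤ lam) (ht : |t| ≤ T) (hr : 0 < r) :
    ‖((lam * Real.exp (-(lam * r)) : ℝ) : ℂ) * (g t - g (t - r))‖ ≤
      κ * (2 + 2 * T) ^ 2 * lam ^ (-β) * (lam * expWeight β (lam * r)) := by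
  have hlam0 : 0 < lam := by linarith
  have hT : 0 ≤ T := (abs_nonneg _).trans ht
  rw [norm_mul, Complex.norm_real, Real.norm_of_nonneg (by positivity)]
  have h1 := h (t - r) t
  rw [sub_sub_cancel, abs_of_pos hr] at h1
  have h2 : 2 + |t| + |t - r| ≤ (2 + 2 * T) * (1 + lam * r) := by
    have h3 : |t - r| ≤ T + r := by
      refine (abs_sub _ _).trans ?_
      rw [abs_of_pos hr]; linarith
    have h4 : r ≤ lam * r := by nlinarith
    have h5 : 0 ≤ T * (lam * r) := by positivity
    nlinarith
  have h3 : (2 + |t| + |t - r|) ^ 2 ≤ ((2 + 2 * T) * (1 + lam * r)) ^ 2 := by gcongr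
  have e : r ^ β = lam ^ (-β) * (lam * r) ^ β := by
    rw [Real.mul_rpow hlam0.le hr.le, ← mul_assoc, ← Real.rpow_add hlam0]; simp
  calc _ ≤ lam * Real.exp (-(lam * r)) * (κ * (((2 + 2 * T) * (1 + lam * r)) ^ 2 * r ^ β)) := by
        refine mul_le_mul_of_nonneg_left (h1.trans ?_) (by positivity)
        gcongr
    _ = _ := by unfold expWeight; rw [e]; ring

lemma integrableOn_expWeight_mul {β lam : ℝ} (hβ : 0 < β) (hlam : 0 < lam) :
    IntegrableOn (fun r => lam * expWeight β (lam * r)) (Set.Ioi 0) := by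
  refine Integrable.const_mul ?_ lam
  have := (integrableOn_Ioi_comp_mul_left_iff (expWeight β) 0 hlam).2
  rw [mul_zero] at this
  exact this (integrableOn_expWeight hβ)

lemma integral_expWeight_mul {β lam : ℝ} (hlam : 0 < lam) :
    ∫ r in Set.Ioi (0 : ℝ), lam * expWeight β (lam * r) = ∫ q in Set.Ioi (0 : ℝ), expWeight β q := by
  rw [integral_const_mul, integral_comp_mul_left_Ioi (expWeight β) 0 hlam, mul_zero, smul_eq_mul,
    ← mul_assoc, mul_inv_cancel₀ hlam.ne', one_mul]

lemma HolderGrowth.integrableOn {β κ lam : ℝ} {g : ℝ → ℂ} (h : HolderGrowth β κ g)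
    (hκ : 0 ≤ κ) (hβ : 0 < β) (hlam : 1 ≤ lam) (hg : Continuous g) (t : ℝ) :
    IntegrableOn (fun r => ((lam * Real.exp (-(lam * r)) : ℝ) : ℂ) * (g t - g (t - r)))
      (Set.Ioi 0) := by
  refine Integrable.mono' ((integrableOn_expWeight_mul hβ (by linarith : 0 < lam)).const_mul
    (κ * (2 + 2 * |t|) ^ 2 * lam ^ (-β))) ?_ ?_
  · have : Continuous fun r => ((lam * Real.exp (-(lam * r)) : ℝ) : ℂ) * (g t - g (t - r)) := by
      fun_prop
    exact this.aestronglyMeasurable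
  · exact (ae_restrict_iff' measurableSet_Ioi).2 (Eventually.of_forall fun r hr =>
      h.norm_integrand_le hκ hlam le_rfl hr)

/-- The factor lam^{−β} is the smoothing of the Stokes semigroup; for lam = |k|² it amounts to
|k|^{−2β}. -/
lemma exists_norm_convPath_le {β : ℝ} (hβ : 0 < β) {T : ℝ} (hT : 0 ≤ T) :
    ∃ C : ℝ, 0 ≤ C ∧ ∀ (lam κ : ℝ) (g : ℝ → ℂ), 1 ≤ lam → 0 ≤ κ → HolderGrowth β κ g →
      ∀ t ∈ Set.Icc 0 T, ‖convPath lam g t‖ ≤ C * κ * lam ^ (-β) := by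
  refine ⟨(2 + 2 * T) ^ 2 * ∫ q in Set.Ioi (0 : ℝ), expWeight β q,
    mul_nonneg (by positivity) (setIntegral_nonneg measurableSet_Ioi fun q hq =>
      expWeight_nonneg (le_of_lt hq)), fun lam κ g hlam hκ h t ht => ?_⟩
  unfold convPath
  refine (norm_integral_le_of_norm_le ((integrableOn_expWeight_mul hβ (by linarith : 0 < lam)).const_mul
    (κ * (2 + 2 * T) ^ 2 * lam ^ (-β))) ((ae_restrict_iff' measurableSet_Ioi).2
    (Eventually.of_forall fun r hr => h.norm_integrand_le hκ hlam
      (by rw [abs_of_nonneg ht.1]; exact ht.2) hr))).trans ?_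
  rw [integral_const_mul, integral_expWeight_mul (by linarith)]
  exact le_of_eq (by ring)

/-- The value of the Riemann–Stieltjes integral `∫_a^t exp(-lam (t-s)) dg(s)`. -/
def truncConv (lam : ℝ) (g : ℝ → ℂ) (t a : ℝ) : ℂ :=
  g t - (Real.exp (-lam * (t - a)) : ℂ) * g a -
    ∫ s in a..t, ((lam * Real.exp (-lam * (t - s)) : ℝ) : ℂ) * g s

lemma hasRSIntegral_truncConv {g : ℝ → ℂ} (hg : Continuous g) (lam : ℝ) {a t : ℝ} (hat : a ≤ t) :
    HasRSIntegral (fun s => Real.exp (-lam * (t - s))) g a t (truncConv lam g t a) := by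
  have hd : ∀ s, HasDerivAt (fun s => Real.exp (-lam * (t - s))) (lam * Real.exp (-lam * (t - s))) s :=
    fun s => by
      have h1 : HasDerivAt (fun s => -lam * (t - s)) lam s := by
        have := ((hasDerivAt_id s).const_sub t).const_mul (-lam)
        simpa using this
      exact h1.exp.congr_deriv (mul_comm _ _)
  have h := hasRSIntegral_of_hasDerivAt hd (by fun_prop) hg hat
  simp only [sub_self, mul_zero, Real.exp_zero, Complex.ofReal_one, one_mul] at h
  exact h

/-- The value g(t) is inserted using that lam e^{−lam r} has integral 1 − e^{−lam(t−a)} on [0, t−a].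
Only increments remain, so the limit a → −∞ becomes visible. -/
lemma truncConv_eq {g : ℝ → ℂ} (hg : Continuous g) (lam t a : ℝ) :
    truncConv lam g t a = (Real.exp (-lam * (t - a)) : ℂ) * (g t - g a) +
      ∫ r in (0 : ℝ)..(t - a), ((lam * Real.exp (-(lam * r)) : ℝ) : ℂ) * (g t - g (t - r)) := by
  have h1 : ∫ s in a..t, ((lam * Real.exp (-lam * (t - s)) : ℝ) : ℂ) * g s =
      ∫ r in (0 : ℝ)..(t - a), ((lam * Real.exp (-(lam * r)) : ℝ) : ℂ) * g (t - r) := by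
    have := intervalIntegral.integral_comp_sub_left (a := 0) (b := t - a)
      (fun s => ((lam * Real.exp (-lam * (t - s)) : ℝ) : ℂ) * g s) t
    simp only [sub_sub_cancel, sub_zero, neg_mul] at this
    simp only [neg_mul]
    exact this.symm
  have h2 : ∫ r in (0 : ℝ)..(t - a), ((lam * Real.exp (-(lam * r)) : ℝ) : ℂ) =
      1 - (Real.exp (-lam * (t - a)) : ℂ) := by
    have hd : ∀ r ∈ Set.uIcc 0 (t - a), HasDerivAt (fun r => -Real.exp (-(lam * r)))
        (lam * Real.exp (-(lam * r))) r := fun r _ => by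
      have h1 : HasDerivAt (fun r => -(lam * r)) (-lam) r := by
        exact ((hasDerivAt_id' r).const_mul lam).fun_neg.congr_deriv (by simp)
      exact h1.exp.neg.congr_deriv (by ring)
    rw [intervalIntegral.integral_ofReal, intervalIntegral.integral_eq_sub_of_hasDerivAt hd
      (Continuous.intervalIntegrable (by fun_prop) _ _)]
    push_cast; simp; ring
  have c1 : Continuous fun r => ((lam * Real.exp (-(lam * r)) : ℝ) : ℂ) * g t := by fun_prop
  have c2 : Continuous fun r => ((lam * Real.exp (-(lam * r)) : ℝ) : ℂ) * g (t - r) := by fun_prop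
  unfold truncConv
  rw [h1]
  simp only [mul_sub]
  rw [intervalIntegral.integral_sub (c1.intervalIntegrable _ _) (c2.intervalIntegrable _ _),
    intervalIntegral.integral_mul_const, h2]
  ring_nf

lemma tendsto_truncConv {β κ lam : ℝ} {g : ℝ → ℂ} (h : HolderGrowth β κ g)
    (hκ : 0 ≤ κ) (hβ : 0 < β) (hlam : 1 ≤ lam) (hg : Continuous g) (t : ℝ) :
    Tendsto (truncConv lam g t) atBot (𝓝 (convPath lam g t)) := by
  have hlam0 : 0 < lam := by linarith
  have hta : Tendsto (fun a => t - a) atBot atTop :=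
    tendsto_atTop_add_const_left _ t tendsto_neg_atBot_atTop
  have h1 := (intervalIntegral_tendsto_integral_Ioi 0 (h.integrableOn hκ hβ hlam hg t)
    tendsto_id).comp hta
  have h2 : Tendsto (fun r => ((lam * Real.exp (-(lam * r)) : ℝ) : ℂ) * (g t - g (t - r))) atTop
      (𝓝 0) := by
    rw [tendsto_zero_iff_norm_tendsto_zero]
    have hw : Tendsto (fun q => expWeight β q) atTop (𝓝 0) := by
      have k := fun j : ℕ => tendsto_rpow_mul_exp_neg_mul_atTop_nhds_zero (β + j) 1 one_pos
      have k2 := ((k 0).add ((k 1).const_mul 2)).add (k 2)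
      simp only [mul_zero, add_zero] at k2
      refine k2.congr' ?_
      filter_upwards [eventually_gt_atTop 0] with q hq
      simp only [Real.rpow_add hq, Real.rpow_natCast, expWeight, neg_mul, one_mul]
      ring
    have hw2 := (hw.comp (tendsto_id.const_mul_atTop hlam0)).const_mul
      (κ * (2 + 2 * |t|) ^ 2 * lam ^ (-β) * lam)
    rw [mul_zero] at hw2
    refine tendsto_of_tendsto_of_tendsto_of_le_of_le' tendsto_const_nhds hw2
      (Eventually.of_forall fun _ => norm_nonneg _) ?_
    filter_upwards [eventually_gt_atTop 0] with r hr
    refine (h.norm_integrand_le hκ hlam le_rfl hr).trans (le_of_eq ?_)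
    simp only [Function.comp, id]; ring
  -- The boundary term is lam^{−1} times the integrand at r = t − a, hence vanishes by the same
  -- domination.
  have h3 := (h2.comp hta).const_mul ((lam : ℂ)⁻¹)
  have h4 := h3.add h1
  rw [mul_zero, zero_add] at h4
  refine h4.congr fun a => ?_
  rw [truncConv_eq hg]
  simp only [Function.comp, id, sub_sub_cancel]
  congr 1
  have : (lam : ℂ) ≠ 0 := by exact_mod_cast hlam0.ne'
  push_cast
  rw [← mul_assoc, ← mul_assoc, inv_mul_cancel₀ this, one_mul]
  simp

lemma hasExpConv_convPath {β κ lam : ℝ} {g : ℝ → ℂ} (h : HolderGrowth β κ g)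
    (hκ : 0 ≤ κ) (hβ : 0 < β) (hlam : 1 ≤ lam) (hg : Continuous g) (t : ℝ) :
    HasExpConv lam g t (convPath lam g t) :=
  ⟨truncConv lam g t, fun _ ha => hasRSIntegral_truncConv hg lam ha,
    tendsto_truncConv h hκ hβ hlam hg t⟩

/-- Variation of constants: g − z satisfies y' = lam (g − y). The right side is explicit in t, so
continuity and the differential equation follow although g is not differentiable. -/
lemma convPath_formula {β κ lam : ℝ} {g : ℝ → ℂ} (h : HolderGrowth β κ g)
    (hκ : 0 ≤ κ) (hβ : 0 < β) (hlam : 1 ≤ lam) (hg : Continuous g) (t : ℝ) :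
    g t - convPath lam g t = (Real.exp (-(lam * t)) : ℂ) * ((g 0 - convPath lam g 0) +
      ∫ s in (0 : ℝ)..t, ((lam * Real.exp (lam * s) : ℝ) : ℂ) * g s) := by
  have hc : Continuous fun s => ((lam * Real.exp (lam * s) : ℝ) : ℂ) * g s := by fun_prop
  have hJ : ∀ t a, g t - truncConv lam g t a = (Real.exp (-(lam * t)) : ℂ) *
      ((Real.exp (lam * a) : ℂ) * g a + ∫ s in a..t, ((lam * Real.exp (lam * s) : ℝ) : ℂ) * g s) := by
    intro t a
    have e : ∀ s, Real.exp (-lam * (t - s)) = Real.exp (-(lam * t)) * Real.exp (lam * s) := fun s => by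
      rw [← Real.exp_add]; congr 1; ring
    unfold truncConv
    rw [mul_add, ← intervalIntegral.integral_const_mul]
    simp only [e]
    have e2 : ∀ s, ((lam * (Real.exp (-(lam * t)) * Real.exp (lam * s)) : ℝ) : ℂ) * g s =
      (Real.exp (-(lam * t)) : ℂ) * (((lam * Real.exp (lam * s) : ℝ) : ℂ) * g s) := fun s => by
        push_cast; ring
    simp only [e2]
    push_cast; ring
  have h1 := (tendsto_const_nhds (x := g t)).sub (tendsto_truncConv h hκ hβ hlam hg t)
  have h2 := (((tendsto_const_nhds (x := g 0)).sub (tendsto_truncConv h hκ hβ hlam hg 0)).add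
    (tendsto_const_nhds (x := ∫ s in (0 : ℝ)..t, ((lam * Real.exp (lam * s) : ℝ) : ℂ) * g s))).const_mul
    (Real.exp (-(lam * t)) : ℂ)
  refine tendsto_nhds_unique h1 (h2.congr fun a => ?_)
  rw [hJ, hJ, ← intervalIntegral.integral_add_adjacent_intervals (hc.intervalIntegrable a 0)
    (hc.intervalIntegrable 0 t)]
  simp
  ring

lemma continuous_convPath {β κ lam : ℝ} {g : ℝ → ℂ} (h : HolderGrowth β κ g)
    (hκ : 0 ≤ κ) (hβ : 0 < β) (hlam : 1 ≤ lam) (hg : Continuous g) : Continuous (convPath lam g) := by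
  have hc : Continuous fun s => ((lam * Real.exp (lam * s) : ℝ) : ℂ) * g s := by fun_prop
  have hI : Continuous fun t => ∫ s in (0 : ℝ)..t, ((lam * Real.exp (lam * s) : ℝ) : ℂ) * g s :=
    intervalIntegral.continuous_primitive (fun a b => hc.intervalIntegrable a b) 0
  have e : convPath lam g = fun t => g t - (Real.exp (-(lam * t)) : ℂ) * ((g 0 - convPath lam g 0) +
      ∫ s in (0 : ℝ)..t, ((lam * Real.exp (lam * s) : ℝ) : ℂ) * g s) := by
    ext t; rw [← convPath_formula h hκ hβ hlam hg]; ring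
  rw [e]
  fun_prop

/-- The exponential convolution solves `dz = -lam z dt + dg`. -/
lemma convPath_equation {β κ lam : ℝ} {g : ℝ → ℂ} (h : HolderGrowth β κ g)
    (hκ : 0 ≤ κ) (hβ : 0 < β) (hlam : 1 ≤ lam) (hg : Continuous g) (t : ℝ) :
    convPath lam g t - convPath lam g 0 = -(lam : ℂ) * (∫ s in (0 : ℝ)..t, convPath lam g s) +
      (g t - g 0) := by
  have hc : Continuous fun s => ((lam * Real.exp (lam * s) : ℝ) : ℂ) * g s := by fun_prop
  have hd : ∀ s ∈ Set.uIcc 0 t, HasDerivAt (fun s => g s - convPath lam g s)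
      ((lam : ℂ) * convPath lam g s) s := by
    intro s _
    have hI := (hc.integral_hasStrictDerivAt 0 s).hasDerivAt
    have hE : HasDerivAt (fun s : ℝ => (Real.exp (-(lam * s)) : ℂ))
        ((Real.exp (-(lam * s)) * -lam : ℝ) : ℂ) s := by
      have h1 : HasDerivAt (fun r => -(lam * r)) (-lam) s := by
        exact ((hasDerivAt_id' s).const_mul lam).fun_neg.congr_deriv (by simp)
      exact h1.exp.ofReal_comp
    have h2 := hE.mul (hI.const_add (g 0 - convPath lam g 0))
    have e : (fun s => g s - convPath lam g s) = fun s => (Real.exp (-(lam * s)) : ℂ) *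
      ((g 0 - convPath lam g 0) + ∫ s in (0 : ℝ)..s, ((lam * Real.exp (lam * s) : ℝ) : ℂ) * g s) :=
      funext fun s => convPath_formula h hκ hβ hlam hg s
    rw [e]
    refine h2.congr_deriv ?_
    have f1 := convPath_formula h hκ hβ hlam hg s
    have f2 : (Real.exp (-(lam * s)) : ℂ) * (Real.exp (lam * s) : ℂ) = 1 := by
      rw [← Complex.ofReal_mul, ← Real.exp_add]; simp
    have f3 : convPath lam g s = g s - (g s - convPath lam g s) := by ring
    rw [f3, f1]
    push_cast at f2 ⊢
    linear_combination (lam : ℂ) * g s * f2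
  have hcz := continuous_convPath h hκ hβ hlam hg
  have := intervalIntegral.integral_eq_sub_of_hasDerivAt hd
    ((continuous_const.mul hcz).intervalIntegrable _ _)
  rw [intervalIntegral.integral_const_mul] at this
  linear_combination this

/-! ### Moments of the increments and the Hölder constant -/

section Moments

variable {Ω : Type*} [MeasurableSpace Ω] {P : Measure Ω}

lemma IsFBM.variance_sub [IsProbabilityMeasure P] {H : ℝ} (hH : 0 < H) {X : ℝ → Ω → ℝ}
    (hX : IsFBM H X P) (s t : ℝ) : Var[X t - X s; P] = |t - s| ^ (2 * H) := by
  have hm := fun t => (hX.gaussian.hasGaussianLaw_eval t).memLp_two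
  have hv : ∀ t, Var[X t; P] = |t| ^ (2 * H) := fun t => by
    rw [← covariance_self (hX.gaussian.aemeasurable t), hX.covariance]
    rw [sub_self, abs_zero, Real.zero_rpow (by positivity)]; ring
  rw [ProbabilityTheory.variance_sub (hm t) (hm s), hv, hv, hX.covariance]; ring

lemma IsFBM.map_sub [IsProbabilityMeasure P] {H : ℝ} (hH : 0 < H) {X : ℝ → Ω → ℝ}
    (hX : IsFBM H X P) (s t : ℝ) :
    P.map (X t - X s) = (gaussianReal 0 1).map fun x => |t - s| ^ H * x := by
  rw [hX.gaussian.hasGaussianLaw_sub.map_eq_gaussianReal, gaussianReal_map_const_mul,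
    hX.variance_sub hH]
  congr 1
  · have hi := fun t => (hX.gaussian.hasGaussianLaw_eval t).integrable
    simp only [Pi.sub_apply]
    rw [integral_sub (hi t) (hi s), hX.centered, hX.centered]; simp
  · ext
    rw [Real.coe_toNNReal _ (by positivity)]
    simp only [mul_one, NNReal.coe_mk]
    rw [mul_comm, Real.rpow_mul (abs_nonneg _), Real.rpow_two]

/-- The absolute moment of order `p` of the standard Gaussian law. -/
def gaussMoment (p : ℕ) : ℝ≥0∞ := ∫⁻ x, ‖x‖ₑ ^ p ∂(gaussianReal 0 1)

lemma gaussMoment_ne_top {p : ℕ} (hp : p ≠ 0) : gaussMoment p ≠ ∞ := by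
  have h := (memLp_id_gaussianReal (μ := 0) (v := 1) p).eLpNorm_ne_top
  have h2 := lintegral_rpow_enorm_lt_top_of_eLpNorm_lt_top (p := ((p : NNReal) : ℝ≥0∞))
    (by simpa using hp) (by simp) h.lt_top
  simpa [gaussMoment] using h2.ne

lemma IsFBM.lintegral_increment [IsProbabilityMeasure P] {H : ℝ} (hH : 0 < H) {X : ℝ → Ω → ℝ}
    (hX : IsFBM H X P) (p : ℕ) (s t : ℝ) :
    ∫⁻ ω, ‖X t ω - X s ω‖ₑ ^ p ∂P = gaussMoment p * ENNReal.ofReal (|t - s| ^ (H * p)) := by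
  have hm : AEMeasurable (X t - X s) P := (hX.gaussian.aemeasurable t).sub (hX.gaussian.aemeasurable s)
  have hf : Measurable fun x : ℝ => ‖x‖ₑ ^ p := measurable_id.enorm.pow_const p
  have h1 : ∫⁻ ω, ‖X t ω - X s ω‖ₑ ^ p ∂P = ∫⁻ x, ‖x‖ₑ ^ p ∂(P.map (X t - X s)) :=
    (lintegral_map' hf.aemeasurable hm).symm
  rw [h1, hX.map_sub hH, lintegral_map hf (measurable_const_mul _)]
  simp only [enorm_mul, mul_pow]
  rw [lintegral_const_mul _ hf, mul_comm, gaussMoment]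
  congr 1
  rw [Real.enorm_of_nonneg (by positivity), ← ENNReal.ofReal_pow (by positivity),
    Real.rpow_mul (abs_nonneg _), Real.rpow_natCast]

lemma summable_int_weight : Summable fun i : ℤ => ((1 + |(i : ℝ)|) ^ 2)⁻¹ := by
  have h : Summable fun n : ℕ => ((1 + (n : ℝ)) ^ 2)⁻¹ := by
    have := (summable_nat_add_iff 1).2 (Real.summable_nat_pow_inv.2 (one_lt_two))
    refine this.congr fun n => ?_
    push_cast; rw [add_comm]
  refine Summable.of_nat_of_neg ?_ ?_
  · simpa using h
  · simpa using h

/-- A weighted sum of the dyadic increments of a path. -/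
def dyadSum (α : ℝ) (p : ℕ) (x : ℝ → ℝ) : ℝ≥0∞ :=
  ∑' j : ℕ, ∑' i : ℤ, ENNReal.ofReal (((2 : ℝ) ^ (α * p)) ^ j) *
    ENNReal.ofReal ((1 + |(i : ℝ)|) ^ 2)⁻¹ * ‖x ((i + 1) / 2 ^ j) - x (i / 2 ^ j)‖ₑ ^ p

/-- An increment at level j has p-th moment of order 2^{−jHp}; the weight 2^{jαp} leaves a geometric
series as α < H. The weight (1+|i|)^{−2} makes the sum over all of ℤ finite, at the price of growth
in time. The bound depends on the law only, hence is uniform over the coefficients. -/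
lemma IsFBM.exists_lintegral_dyadSum_le {α H : ℝ} (hH : 0 < H) (hα : α < H) {p : ℕ} (hp : p ≠ 0) :
    ∃ m : ℝ≥0∞, m ≠ ∞ ∧ ∀ {Ω : Type _} [MeasurableSpace Ω] (P : Measure Ω) [IsProbabilityMeasure P]
      (X : ℝ → Ω → ℝ), IsFBM H X P → (∀ t, Measurable (X t)) →
        ∫⁻ ω, dyadSum α p (fun t => X t ω) ∂P ≤ m := by
  set q : ℝ := (2 : ℝ) ^ ((α - H) * p) with hq
  have hp' : (0 : ℝ) < p := by positivity
  have hq1 : q < 1 := Real.rpow_lt_one_of_one_lt_of_neg one_lt_two (by nlinarith)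
  have hq0 : 0 ≤ q := by positivity
  set W : ℝ≥0∞ := ∑' i : ℤ, ENNReal.ofReal ((1 + |(i : ℝ)|) ^ 2)⁻¹ with hW
  have hWt : W ≠ ∞ := summable_int_weight.tsum_ofReal_ne_top
  have hG : ∑' j : ℕ, ENNReal.ofReal (q ^ j) ≠ ∞ :=
    (summable_geometric_of_lt_one hq0 hq1).tsum_ofReal_ne_top
  have hM := gaussMoment_ne_top hp
  refine ⟨gaussMoment p * W * ∑' j : ℕ, ENNReal.ofReal (q ^ j), by finiteness, ?_⟩
  intro Ω _ P _ X hX hXm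
  have hmeas : ∀ (j : ℕ) (i : ℤ), Measurable fun ω => ‖X ((i + 1) / 2 ^ j) ω - X (i / 2 ^ j) ω‖ₑ ^ p :=
    fun j i => ((hXm _).sub (hXm _)).enorm.pow_const p
  unfold dyadSum
  rw [lintegral_tsum fun j => (Measurable.tsum fun i => (hmeas j i).const_mul _).aemeasurable,
    ← ENNReal.tsum_mul_left]
  refine ENNReal.tsum_le_tsum fun j => ?_
  rw [lintegral_tsum fun i => ((hmeas j i).const_mul _).aemeasurable, hW, ← ENNReal.tsum_mul_left,
    ← ENNReal.tsum_mul_right]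
  refine ENNReal.tsum_le_tsum fun i => le_of_eq ?_
  rw [lintegral_const_mul _ (hmeas j i), hX.lintegral_increment hH]
  have e : ENNReal.ofReal (q ^ j) = ENNReal.ofReal (((2 : ℝ) ^ (α * p)) ^ j) *
      ENNReal.ofReal (|((i : ℝ) + 1) / 2 ^ j - i / 2 ^ j| ^ (H * p)) := by
    rw [← ENNReal.ofReal_mul (by positivity)]
    congr 1
    have e1 : |((i : ℝ) + 1) / 2 ^ j - i / 2 ^ j| = ((2 : ℝ) ^ j)⁻¹ := by
      rw [← sub_div, add_sub_cancel_left, one_div, abs_of_pos (by positivity)]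
    rw [e1, Real.inv_rpow (by positivity), hq, ← Real.rpow_natCast, ← Real.rpow_natCast,
      ← Real.rpow_natCast, ← Real.rpow_mul (by norm_num), ← Real.rpow_mul (by norm_num),
      ← Real.rpow_mul (by norm_num), ← Real.rpow_neg (by norm_num), ← Real.rpow_add (by norm_num)]
    congr 1; ring
  rw [e]; ring

end Moments

/-! ### Dyadic chaining -/

section Chaining

variable {g : ℝ → ℂ} {α β q κ : ℝ}

/-- The dyadic approximation of `t` from below. -/
def dyad (j : ℕ) (t : ℝ) : ℝ := (⌊2 ^ j * t⌋ : ℝ) / 2 ^ j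

lemma tendsto_dyad (t : ℝ) : Tendsto (fun j => dyad j t) atTop (𝓝 t) := by
  have h : Tendsto (fun j : ℕ => t - (1 / 2 : ℝ) ^ j) atTop (𝓝 (t - 0)) :=
    tendsto_const_nhds.sub (tendsto_pow_atTop_nhds_zero_of_lt_one (by norm_num) (by norm_num))
  rw [sub_zero] at h
  refine tendsto_of_tendsto_of_tendsto_of_le_of_le h tendsto_const_nhds (fun j => ?_) fun j => ?_
  · have h1 := (Int.sub_one_lt_floor (2 ^ j * t)).le
    have h2 : (0 : ℝ) < 2 ^ j := by positivity
    simp only [dyad, one_div, inv_pow]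
    rw [le_div_iff₀ h2, sub_mul, inv_mul_cancel₀ h2.ne']
    linarith
  · have h1 := Int.floor_le ((2 : ℝ) ^ j * t)
    have h2 : (0 : ℝ) < 2 ^ j := by positivity
    simp only [dyad]
    rw [div_le_iff₀ h2]; linarith

/-- At level j the index i is of size 2^j times the time, so the growth factor (1+|i|)^q costs
2^{jq}: the exponent α drops to β = α − q. -/
lemma chain_weight_le (hq0 : 0 ≤ q) (hq1 : q ≤ 1) (hβ : β = α - q) (hκ : 0 ≤ κ) {j : ℕ} {x y : ℝ}
    (hx : 0 ≤ x) (hxy : x ≤ 2 ^ j * y) (hy : 1 ≤ y) :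
    κ * (((2 : ℝ) ^ (-α)) ^ j * x ^ q) ≤ κ * (y * ((2 : ℝ) ^ (-β)) ^ j) := by
  refine mul_le_mul_of_nonneg_left ?_ hκ
  have h1 : x ^ q ≤ ((2 : ℝ) ^ j) ^ q * y := by
    calc x ^ q ≤ (2 ^ j * y) ^ q := Real.rpow_le_rpow hx hxy hq0
      _ = ((2 : ℝ) ^ j) ^ q * y ^ q := Real.mul_rpow (by positivity) (by linarith)
      _ ≤ ((2 : ℝ) ^ j) ^ q * y := by
          gcongr
          calc y ^ q ≤ y ^ (1 : ℝ) := Real.rpow_le_rpow_of_exponent_le hy hq1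
            _ = y := Real.rpow_one y
  have e : ((2 : ℝ) ^ (-α)) ^ j * ((2 : ℝ) ^ j) ^ q = ((2 : ℝ) ^ (-β)) ^ j := by
    simp only [← Real.rpow_natCast, ← Real.rpow_mul (show (0 : ℝ) ≤ 2 by norm_num)]
    rw [← Real.rpow_add (by norm_num), hβ]; congr 1; ring
  calc _ ≤ ((2 : ℝ) ^ (-α)) ^ j * (((2 : ℝ) ^ j) ^ q * y) := by gcongr
    _ = y * ((2 : ℝ) ^ (-β)) ^ j := by rw [← mul_assoc, e, mul_comm]

lemma abs_floor_le (x : ℝ) : |(⌊x⌋ : ℝ)| ≤ |x| + 1 := by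
  have h1 := Int.floor_le x
  have h2 := (Int.sub_one_lt_floor x).le
  rw [abs_le]
  constructor
  · linarith [neg_abs_le x]
  · linarith [le_abs_self x]

/-- With m the floor of 2^j t, the next floor is 2m or 2m + 1, so refinement moves by at most one
dyadic increment. -/
lemma norm_dyad_succ_sub_le
    (hinc : ∀ (j : ℕ) (i : ℤ), ‖g ((i + 1) / 2 ^ j) - g (i / 2 ^ j)‖ ≤
      κ * (((2 : ℝ) ^ (-α)) ^ j * (1 + |(i : ℝ)|) ^ q))
    (hq0 : 0 ≤ q) (hq1 : q ≤ 1) (hβ : β = α - q) (hκ : 0 ≤ κ) (j : ℕ) (t : ℝ) :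
    ‖g (dyad (j + 1) t) - g (dyad j t)‖ ≤ κ * ((2 + |t|) * ((2 : ℝ) ^ (-β)) ^ (j + 1)) := by
  set m := ⌊(2 : ℝ) ^ j * t⌋ with hm
  have h1 := Int.floor_le ((2 : ℝ) ^ j * t)
  have h2 := Int.lt_floor_add_one ((2 : ℝ) ^ j * t)
  have hcase : ⌊(2 : ℝ) ^ (j + 1) * t⌋ = 2 * m ∨ ⌊(2 : ℝ) ^ (j + 1) * t⌋ = 2 * m + 1 := by
    have h3 : 2 * m ≤ ⌊(2 : ℝ) ^ (j + 1) * t⌋ := by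
      rw [Int.le_floor]; push_cast; rw [pow_succ]; linarith
    have h4 : ⌊(2 : ℝ) ^ (j + 1) * t⌋ < 2 * m + 2 := by
      rw [Int.floor_lt]; push_cast; rw [pow_succ]; linarith
    omega
  have e0 : dyad j t = ((2 * m : ℤ) : ℝ) / 2 ^ (j + 1) := by
    simp only [dyad, ← hm]; push_cast; rw [pow_succ]; field_simp
  rcases hcase with h | h
  · have e1 : dyad (j + 1) t = dyad j t := by rw [e0]; simp only [dyad, h]
    rw [e1, sub_self, norm_zero]; positivity
  · have e1 : dyad (j + 1) t = (((2 * m : ℤ) : ℝ) + 1) / 2 ^ (j + 1) := by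
      simp only [dyad, h]; push_cast; ring
    rw [e0, e1]
    refine (hinc (j + 1) (2 * m)).trans (chain_weight_le hq0 hq1 hβ hκ (by positivity) ?_ (by
      have := abs_nonneg t; linarith))
    have h3 := abs_floor_le ((2 : ℝ) ^ j * t)
    rw [← hm, abs_mul, abs_of_pos (by positivity : (0 : ℝ) < 2 ^ j)] at h3
    push_cast
    rw [abs_mul, abs_two, pow_succ]
    have h4 : (1 : ℝ) ≤ 2 ^ j := one_le_pow₀ (by norm_num)
    nlinarith

/-- The refinements telescope into a geometric series, and continuity of g closes the limit. -/
lemma norm_sub_dyad_le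
    (hinc : ∀ (j : ℕ) (i : ℤ), ‖g ((i + 1) / 2 ^ j) - g (i / 2 ^ j)‖ ≤
      κ * (((2 : ℝ) ^ (-α)) ^ j * (1 + |(i : ℝ)|) ^ q))
    (hq0 : 0 ≤ q) (hq1 : q ≤ 1) (hβ : β = α - q) (hβ0 : 0 < β) (hκ : 0 ≤ κ)
    (hg : Continuous g) (J : ℕ) (t : ℝ) :
    ‖g t - g (dyad J t)‖ ≤ κ * ((2 + |t|) * (((2 : ℝ) ^ (-β) / (1 - (2 : ℝ) ^ (-β))) *
      ((2 : ℝ) ^ (-β)) ^ J)) := by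
  set θ : ℝ := (2 : ℝ) ^ (-β) with hθ
  have hθ0 : 0 < θ := by positivity
  have hθ1 : θ < 1 := Real.rpow_lt_one_of_one_lt_of_neg one_lt_two (by linarith)
  have h1θ : 0 < 1 - θ := by linarith
  set A := θ / (1 - θ) with hA
  have hA0 : 0 < A := by positivity
  have hAeq : A * (1 - θ) = θ := by rw [hA]; field_simp
  have hfin : ∀ n, J ≤ n → ‖g (dyad n t) - g (dyad J t)‖ ≤
      κ * ((2 + |t|) * (A * (θ ^ J - θ ^ n))) := by
    intro n hn
    induction n, hn using Nat.le_induction with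
    | base => simp
    | succ n _ ih =>
      have h1 := norm_dyad_succ_sub_le hinc hq0 hq1 hβ hκ n t
      rw [← hθ] at h1
      have h2 := norm_sub_le_norm_sub_add_norm_sub (g (dyad (n + 1) t)) (g (dyad n t)) (g (dyad J t))
      have e : κ * ((2 + |t|) * (A * (θ ^ J - θ ^ (n + 1)))) =
          κ * ((2 + |t|) * θ ^ (n + 1)) + κ * ((2 + |t|) * (A * (θ ^ J - θ ^ n))) := by
        have : A * (θ ^ J - θ ^ (n + 1)) = θ ^ n * (A * (1 - θ)) + A * (θ ^ J - θ ^ n) := by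
          rw [pow_succ]; ring
        rw [this, hAeq, pow_succ]; ring
      linarith
  have hlim := (((hg.tendsto t).comp (tendsto_dyad t)).sub_const (g (dyad J t))).norm
  refine le_of_tendsto hlim ?_
  filter_upwards [eventually_ge_atTop J] with n hn
  refine (hfin n hn).trans ?_
  have := abs_nonneg t
  have : 0 ≤ θ ^ n := by positivity
  gcongr
  linarith

/-- If t − s ≤ 2^{−J}, the level-J approximations of s and t coincide or are neighbours: two tails
and at most one increment remain. -/
lemma norm_sub_le_of_le_pow
    (hinc : ∀ (j : ℕ) (i : ℤ), ‖g ((i + 1) / 2 ^ j) - g (i / 2 ^ j)‖ ≤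
      κ * (((2 : ℝ) ^ (-α)) ^ j * (1 + |(i : ℝ)|) ^ q))
    (hq0 : 0 ≤ q) (hq1 : q ≤ 1) (hβ : β = α - q) (hβ0 : 0 < β) (hκ : 0 ≤ κ)
    (hg : Continuous g) {J : ℕ} {s t : ℝ} (hst : s ≤ t) (h : t - s ≤ (1 / 2) ^ J) :
    ‖g t - g s‖ ≤ κ * ((2 + |t| + |s|) * ((2 * ((2 : ℝ) ^ (-β) / (1 - (2 : ℝ) ^ (-β))) + 1) *
      ((2 : ℝ) ^ (-β)) ^ J)) := by
  have ht := norm_sub_dyad_le hinc hq0 hq1 hβ hβ0 hκ hg J t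
  have hs := norm_sub_dyad_le hinc hq0 hq1 hβ hβ0 hκ hg J s
  set θ : ℝ := (2 : ℝ) ^ (-β) with hθ
  have hθ0 : 0 < θ := by positivity
  have hθ1 : θ < 1 := Real.rpow_lt_one_of_one_lt_of_neg one_lt_two (by linarith)
  have h1θ : 0 < 1 - θ := by linarith
  set A := θ / (1 - θ) with hA
  have hA0 : 0 < A := by positivity
  have hmid : ‖g (dyad J t) - g (dyad J s)‖ ≤ κ * ((2 + |s|) * θ ^ J) := by
    set m := ⌊(2 : ℝ) ^ J * s⌋ with hm
    have h2J : (0 : ℝ) < 2 ^ J := by positivity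
    have h1 := Int.floor_le ((2 : ℝ) ^ J * s)
    have h2 := Int.lt_floor_add_one ((2 : ℝ) ^ J * s)
    have h3 : (2 : ℝ) ^ J * t ≤ 2 ^ J * s + 1 := by
      have := mul_le_mul_of_nonneg_left h h2J.le
      rw [← mul_pow] at this; norm_num at this; linarith
    have hcase : ⌊(2 : ℝ) ^ J * t⌋ = m ∨ ⌊(2 : ℝ) ^ J * t⌋ = m + 1 := by
      have h4 : m ≤ ⌊(2 : ℝ) ^ J * t⌋ := Int.floor_le_floor (by gcongr)
      have h5 : ⌊(2 : ℝ) ^ J * t⌋ < m + 2 := by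
        rw [Int.floor_lt]; push_cast; linarith
      omega
    rcases hcase with h6 | h6
    · have e : dyad J t = dyad J s := by simp only [dyad, h6, ← hm]
      rw [e, sub_self, norm_zero]; positivity
    · have e : dyad J t = ((m : ℝ) + 1) / 2 ^ J := by simp only [dyad, h6]; push_cast; ring
      have e' : dyad J s = (m : ℝ) / 2 ^ J := by simp only [dyad, ← hm]
      rw [e, e']
      refine (hinc J m).trans (chain_weight_le hq0 hq1 hβ hκ (by positivity) ?_ (by
        have := abs_nonneg s; linarith))
      have h7 := abs_floor_le ((2 : ℝ) ^ J * s)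
      rw [← hm, abs_mul, abs_of_pos h2J] at h7
      have h8 : (1 : ℝ) ≤ 2 ^ J := one_le_pow₀ (by norm_num)
      nlinarith
  have h1 := norm_sub_le_norm_sub_add_norm_sub (g t) (g (dyad J t)) (g s)
  have h2 := norm_sub_le_norm_sub_add_norm_sub (g (dyad J t)) (g (dyad J s)) (g s)
  rw [norm_sub_rev (g (dyad J s)) (g s)] at h2
  have hB : 0 ≤ A * θ ^ J := by positivity
  have hC : 0 ≤ θ ^ J := by positivity
  have h3 : κ * ((2 + |t|) * (A * θ ^ J)) ≤ κ * ((2 + |t| + |s|) * (A * θ ^ J)) := by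
    exact mul_le_mul_of_nonneg_left
      (mul_le_mul_of_nonneg_right (by linarith [abs_nonneg s]) hB) hκ
  have h4 : κ * ((2 + |s|) * (A * θ ^ J)) ≤ κ * ((2 + |t| + |s|) * (A * θ ^ J)) := by
    exact mul_le_mul_of_nonneg_left
      (mul_le_mul_of_nonneg_right (by linarith [abs_nonneg t]) hB) hκ
  have h5 : κ * ((2 + |s|) * θ ^ J) ≤ κ * ((2 + |t| + |s|) * θ ^ J) := by
    exact mul_le_mul_of_nonneg_left
      (mul_le_mul_of_nonneg_right (by linarith [abs_nonneg t]) hC) hκ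
  have e : κ * ((2 + |t| + |s|) * ((2 * A + 1) * θ ^ J)) = κ * ((2 + |t| + |s|) * (A * θ ^ J)) +
    (κ * ((2 + |t| + |s|) * θ ^ J) + κ * ((2 + |t| + |s|) * (A * θ ^ J))) := by ring
  rw [e]; linarith

end Chaining

/-- A continuous path with bounded weighted dyadic increments is Hölder continuous. -/
lemma exists_holderGrowth {α β q : ℝ} (hq0 : 0 ≤ q) (hq1 : q ≤ 1) (hβ : β = α - q) (hβ0 : 0 < β) :
    ∃ C : ℝ, 0 ≤ C ∧ ∀ (g : ℝ → ℂ) (κ : ℝ), 0 ≤ κ → Continuous g →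
      (∀ (j : ℕ) (i : ℤ), ‖g ((i + 1) / 2 ^ j) - g (i / 2 ^ j)‖ ≤
        κ * (((2 : ℝ) ^ (-α)) ^ j * (1 + |(i : ℝ)|) ^ q)) → HolderGrowth β (C * κ) g := by
  set θ : ℝ := (2 : ℝ) ^ (-β) with hθ
  have hθ0 : 0 < θ := by positivity
  have hθ1 : θ < 1 := Real.rpow_lt_one_of_one_lt_of_neg one_lt_two (by linarith)
  have h1θ : 0 < 1 - θ := by linarith
  -- The level J is only known to satisfy 2^{−(J+1)} < t − s, so one factor θ has to be given back.
  set D := (2 * (θ / (1 - θ)) + 1) / θ with hD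
  have hD0 : 0 < D := by positivity
  refine ⟨2 * D, by positivity, fun g κ hκ hg hinc => ?_⟩
  have hshort : ∀ s t, s ≤ t → t - s ≤ 1 →
      ‖g t - g s‖ ≤ κ * D * ((2 + |t| + |s|) * (t - s) ^ β) := by
    intro s t hst h1
    rcases hst.eq_or_lt with rfl | hlt
    · simp [Real.zero_rpow hβ0.ne']
    obtain ⟨J, hJ1, hJ2⟩ := exists_nat_pow_near_of_lt_one (sub_pos.2 hlt) h1
      (by norm_num : (0 : ℝ) < 1 / 2) (by norm_num)
    refine (norm_sub_le_of_le_pow hinc hq0 hq1 hβ hβ0 hκ hg hst hJ2).trans ?_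
    rw [← hθ]
    have e : θ ^ (J + 1) = ((1 / 2 : ℝ) ^ (J + 1)) ^ β := by
      rw [hθ, one_div, inv_pow, Real.inv_rpow (by positivity), ← Real.rpow_natCast,
        ← Real.rpow_natCast, ← Real.rpow_mul (by norm_num), ← Real.rpow_mul (by norm_num),
        ← Real.rpow_neg (by norm_num)]
      congr 1; ring
    have h2 : θ ^ (J + 1) ≤ (t - s) ^ β := by
      rw [e]; exact Real.rpow_le_rpow (by positivity) hJ1.le hβ0.le
    have h3 : (2 * (θ / (1 - θ)) + 1) * θ ^ J = D * θ ^ (J + 1) := by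
      rw [hD, pow_succ]; field_simp
    rw [h3]
    calc _ = κ * D * ((2 + |t| + |s|) * θ ^ (J + 1)) := by ring
      _ ≤ _ := by gcongr
  have hord : ∀ s t, s ≤ t → ‖g t - g s‖ ≤ 2 * D * κ * ((2 + |t| + |s|) ^ 2 * (t - s) ^ β) := by
    intro s t hst
    have hR : 0 ≤ |t| + |s| := by positivity
    rcases le_or_gt (t - s) 1 with h1 | h1
    · refine (hshort s t hst h1).trans ?_
      have h2 : 2 + |t| + |s| ≤ (2 + |t| + |s|) ^ 2 := by nlinarith
      have h3 : 0 ≤ (t - s) ^ β := Real.rpow_nonneg (by linarith) _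
      calc _ ≤ κ * D * ((2 + |t| + |s|) ^ 2 * (t - s) ^ β) := by gcongr
        _ ≤ 2 * D * κ * ((2 + |t| + |s|) ^ 2 * (t - s) ^ β) := by
            refine mul_le_mul_of_nonneg_right ?_ (by positivity)
            nlinarith [mul_nonneg hκ hD0.le]
    -- A long interval is cut into pieces of length at most one. Their number is at most 2 + |t| +
    -- |s|, which is the source of the square in `HolderGrowth`.
    · set n := ⌈t - s⌉₊ with hn
      have hn1 : t - s ≤ n := Nat.le_ceil _
      have hn2 : (n : ℝ) < t - s + 1 := Nat.ceil_lt_add_one (by linarith)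
      have hn0 : (0 : ℝ) < n := by linarith
      set x : ℕ → ℝ := fun i => s + i * ((t - s) / n) with hx
      have hstep : ∀ i, x (i + 1) - x i = (t - s) / n := fun i => by simp only [hx]; push_cast; ring
      have hd1 : (t - s) / n ≤ 1 := by rw [div_le_one hn0]; exact hn1
      have hd0 : 0 ≤ (t - s) / n := div_nonneg (by linarith) hn0.le
      have hxn : x n = t := by simp only [hx]; field_simp; ring
      have hx0 : x 0 = s := by simp [hx]
      have hmem : ∀ i ≤ n, |x i| ≤ |t| + |s| := fun i hi => by
        have h2 : (i : ℝ) ≤ n := by exact_mod_cast hi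
        have h3 : x i ≤ t := by
          rw [← hxn]; simp only [hx]; gcongr
        have h4 : s ≤ x i := by simp only [hx]; linarith [mul_nonneg (Nat.cast_nonneg (α := ℝ) i) hd0]
        rw [abs_le]
        exact ⟨by linarith [neg_abs_le s, abs_nonneg t], by linarith [le_abs_self t, abs_nonneg s]⟩
      have hsum : g t - g s = ∑ i ∈ Finset.range n, (g (x (i + 1)) - g (x i)) := by
        rw [Finset.sum_range_sub (fun i => g (x i)), hxn, hx0]
      rw [hsum]
      refine (norm_sum_le _ _).trans ?_
      have hterm : ∀ i ∈ Finset.range n, ‖g (x (i + 1)) - g (x i)‖ ≤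
          κ * D * (2 * (2 + |t| + |s|)) := by
        intro i hi
        have hi' := Finset.mem_range.1 hi
        refine (hshort (x i) (x (i + 1)) (by linarith [hstep i]) (by linarith [hstep i])).trans ?_
        have h2 := hmem i hi'.le
        have h3 := hmem (i + 1) hi'
        have h4 : (x (i + 1) - x i) ^ β ≤ 1 := by
          rw [hstep]; exact Real.rpow_le_one hd0 hd1 hβ0.le
        have h5 : 0 ≤ (x (i + 1) - x i) ^ β := by rw [hstep]; positivity
        have h6 := abs_nonneg (x i)
        have h7 := abs_nonneg (x (i + 1))
        refine mul_le_mul_of_nonneg_left ?_ (by positivity)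
        nlinarith
      refine (Finset.sum_le_card_nsmul _ _ _ hterm).trans ?_
      rw [Finset.card_range, nsmul_eq_mul]
      have h2 : 1 ≤ (t - s) ^ β := Real.one_le_rpow h1.le hβ0.le
      have h3 : (n : ℝ) ≤ 2 + |t| + |s| := by linarith [le_abs_self t, neg_abs_le s]
      calc (n : ℝ) * (κ * D * (2 * (2 + |t| + |s|))) ≤
            (2 + |t| + |s|) * (κ * D * (2 * (2 + |t| + |s|))) := by gcongr
        _ = 2 * D * κ * ((2 + |t| + |s|) ^ 2 * 1) := by ring
        _ ≤ _ := by gcongr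
  intro s t
  rcases le_total s t with h | h
  · rw [abs_of_nonneg (by linarith : 0 ≤ t - s)]; exact hord s t h
  · rw [abs_sub_comm, abs_of_nonneg (by linarith : 0 ≤ s - t), norm_sub_rev]
    have := hord t s h
    rwa [show 2 + |t| + |s| = 2 + |s| + |t| by ring]

/-- The dyadic sum of the real and of the imaginary part of a complex path. -/
def dyadSumC (α : ℝ) (p : ℕ) (g : ℝ → ℂ) : ℝ≥0∞ :=
  dyadSum α p (fun t => (g t).re) + dyadSum α p (fun t => (g t).im)

/-- Each term is at most the sum; the p-th root turns the weight (1+|i|)² into the power 2/p, the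
loss of Hölder exponent. -/
lemma le_of_dyadSum {α : ℝ} {p : ℕ} (hp : p ≠ 0) {x : ℝ → ℝ} {S : ℝ≥0∞} (hS : S ≠ ∞)
    (h : dyadSum α p x ≤ S) (j : ℕ) (i : ℤ) : |x ((i + 1) / 2 ^ j) - x (i / 2 ^ j)| ≤
      S.toReal ^ (1 / (p : ℝ)) * (((2 : ℝ) ^ (-α)) ^ j * (1 + |(i : ℝ)|) ^ (2 / (p : ℝ))) := by
  have hp' : (0 : ℝ) < p := by positivity
  set Δ := |x ((i + 1) / 2 ^ j) - x (i / 2 ^ j)| with hΔ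
  have h1 : ENNReal.ofReal (((2 : ℝ) ^ (α * p)) ^ j) * ENNReal.ofReal ((1 + |(i : ℝ)|) ^ 2)⁻¹ *
      ‖x ((i + 1) / 2 ^ j) - x (i / 2 ^ j)‖ₑ ^ p ≤ S :=
    le_trans ((ENNReal.le_tsum i).trans (ENNReal.le_tsum (f := fun j : ℕ => ∑' i : ℤ,
      ENNReal.ofReal (((2 : ℝ) ^ (α * p)) ^ j) * ENNReal.ofReal ((1 + |(i : ℝ)|) ^ 2)⁻¹ *
      ‖x ((i + 1) / 2 ^ j) - x (i / 2 ^ j)‖ₑ ^ p) j)) h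
  rw [← ofReal_norm, Real.norm_eq_abs, ← hΔ, ← ENNReal.ofReal_pow (abs_nonneg _),
    ← ENNReal.ofReal_mul (by positivity), ← ENNReal.ofReal_mul (by positivity),
    ENNReal.ofReal_le_iff_le_toReal hS] at h1
  set w := (1 + |(i : ℝ)|) with hw
  have hw0 : 0 < w := by positivity
  have hΔ0 : 0 ≤ Δ := abs_nonneg _
  have h2 : Δ ^ p ≤ S.toReal * ((((2 : ℝ) ^ (-α)) ^ j) ^ p * w ^ 2) := by
    have e : (((2 : ℝ) ^ (-α)) ^ j) ^ p = (((2 : ℝ) ^ (α * p)) ^ j)⁻¹ := by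
      simp only [← Real.rpow_natCast, ← Real.rpow_mul (show (0 : ℝ) ≤ 2 by norm_num)]
      rw [← Real.rpow_neg (by norm_num)]; congr 1; ring
    rw [e]
    set Y := ((2 : ℝ) ^ (α * p)) ^ j with hY
    have hY0 : 0 < Y := by positivity
    calc Δ ^ p = (Y * (w ^ 2)⁻¹ * Δ ^ p) * (Y⁻¹ * w ^ 2) := by field_simp
      _ ≤ _ := by gcongr
  have h3 := Real.rpow_le_rpow (by positivity) h2 (by positivity : 0 ≤ 1 / (p : ℝ))
  rw [Real.mul_rpow ENNReal.toReal_nonneg (by positivity), Real.mul_rpow (by positivity) (by positivity),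
    ← Real.rpow_natCast Δ, ← Real.rpow_natCast _ p, ← Real.rpow_natCast w, ← Real.rpow_mul hΔ0,
    ← Real.rpow_mul (by positivity), ← Real.rpow_mul hw0.le, mul_one_div_cancel hp'.ne',
    Real.rpow_one, Real.rpow_one] at h3
  convert h3 using 4
  push_cast; ring

/-- The Hölder constant of a path is controlled by its dyadic sum. -/
lemma exists_holderGrowth_dyadSumC {α : ℝ} {p : ℕ} (hp : 2 ≤ p) (hα : 2 / (p : ℝ) < α) :
    ∃ C : ℝ, 0 ≤ C ∧ ∀ g : ℝ → ℂ, Continuous g → dyadSumC α p g ≠ ∞ →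
      HolderGrowth (α - 2 / p) (C * (dyadSumC α p g).toReal ^ (1 / (p : ℝ))) g := by
  have hp' : (2 : ℝ) ≤ p := by exact_mod_cast hp
  obtain ⟨C, hC, h⟩ := exists_holderGrowth (α := α) (q := 2 / p) (by positivity)
    (by rw [div_le_one (by linarith)]; exact hp') rfl (by linarith)
  refine ⟨C * 2, by positivity, fun g hg hS => ?_⟩
  rw [mul_assoc]
  refine h g _ (by positivity) hg fun j i => ?_
  have h1 := le_of_dyadSum (by omega : p ≠ 0) hS
    (show dyadSum α p (fun t => (g t).re) ≤ dyadSumC α p g from le_self_add) j i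
  have h2 := le_of_dyadSum (by omega : p ≠ 0) hS
    (show dyadSum α p (fun t => (g t).im) ≤ dyadSumC α p g from le_add_self) j i
  have h3 := Complex.norm_le_abs_re_add_abs_im (g ((i + 1) / 2 ^ j) - g (i / 2 ^ j))
  rw [Complex.sub_re, Complex.sub_im] at h3
  linarith

/-! ### The regularized noise and the Stokes process -/

lemma Idx.isPlus_or (k : Idx) : k.IsPlus ∨ k.opp.IsPlus := by
  obtain ⟨⟨x, y⟩, hk⟩ := k
  have h : ¬(x = 0 ∧ y = 0) := fun h => hk (by rw [h.1, h.2]; rfl)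
  simp only [Idx.IsPlus, Idx.opp, Prod.neg_mk, Left.neg_pos_iff, neg_eq_zero]
  omega

lemma dyadSum_neg (α : ℝ) (p : ℕ) (x : ℝ → ℝ) : dyadSum α p (fun t => -x t) = dyadSum α p x := by
  unfold dyadSum
  have e : ∀ a c : ℝ, ‖-a - -c‖ₑ = ‖a - c‖ₑ := fun a c => by
    rw [← neg_sub', enorm_neg]
  simp only [e]

lemma dyadSumC_neg_conj (α : ℝ) (p : ℕ) (g : ℝ → ℂ) :
    dyadSumC α p (fun t => -conj (g t)) = dyadSumC α p g := by
  unfold dyadSumC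
  simp only [Complex.neg_re, Complex.conj_re, Complex.neg_im, Complex.conj_im, neg_neg, dyadSum_neg]

lemma eq_realParts {Ω : Type*} (b : Idx → ℝ → Ω → ℂ) (k : {k : Idx // k.IsPlus}) (t : ℝ) (ω : Ω) :
    b k.1 t ω = (realParts b (k, true) ω t : ℂ) + (realParts b (k, false) ω t : ℂ) * Complex.I := by
  simp [realParts, Complex.re_add_im]

/-! ### Measurability, continuity and dyadic moments of the coefficients of the noise. -/

section Cylindrical

variable {Ω : Type*} [MeasurableSpace Ω] {P : Measure Ω} {H : ℝ} {b : Idx → ℝ → Ω → ℂ}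

lemma IsCylFBM.reflect_all (hb : IsCylFBM H b P) (k : Idx) (t : ℝ) (ω : Ω) :
    b k.opp t ω = -conj (b k t ω) := by
  rcases k.isPlus_or with h | h
  · exact hb.reflect k h t ω
  · have := hb.reflect k.opp h t ω
    rw [Idx.opp_opp] at this
    rw [this]; simp

/-- A Gaussian process is only almost everywhere measurable; completeness of the probability space
upgrades this. -/
lemma IsCylFBM.measurable_realParts [P.IsComplete] (hb : IsCylFBM H b P)
    (p : {k : Idx // k.IsPlus} × Bool) (t : ℝ) : Measurable fun ω => realParts b p ω t := by
  have h := (hb.fbm p).gaussian.aemeasurable t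
  exact h.measurable_mk.congr_ae h.ae_eq_mk.symm

/-- A property of complex paths that is stable under `g ↦ -conj g` holds for all coefficients of the
noise if it holds for those in the half plane. -/
lemma IsCylFBM.forall_of_isPlus (hb : IsCylFBM H b P) {Q : (ℝ → Ω → ℂ) → Prop}
    (hQ : ∀ g, Q g → Q fun t ω => -conj (g t ω)) (h : ∀ k : Idx, k.IsPlus → Q (b k)) (k : Idx) :
    Q (b k) := by
  rcases k.isPlus_or with hk | hk
  · exact h k hk
  · have := hQ _ (h _ hk)
    simp only [← hb.reflect_all, Idx.opp_opp] at this
    exact this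

lemma IsCylFBM.measurable [P.IsComplete] (hb : IsCylFBM H b P) (k : Idx) (t : ℝ) :
    Measurable (b k t) := by
  refine hb.forall_of_isPlus (Q := fun g => Measurable (g t)) (fun g hg => ?_) (fun k hk => ?_) k
  · exact (Complex.continuous_conj.measurable.comp hg).neg
  · have e : b k t = fun ω => (realParts b (⟨k, hk⟩, true) ω t : ℂ) +
        (realParts b (⟨k, hk⟩, false) ω t : ℂ) * Complex.I :=
      funext fun ω => eq_realParts b ⟨k, hk⟩ t ω
    rw [e]
    exact (Complex.measurable_ofReal.comp (hb.measurable_realParts _ t)).add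
      ((Complex.measurable_ofReal.comp (hb.measurable_realParts _ t)).mul_const _)

lemma IsCylFBM.ae_continuous (hb : IsCylFBM H b P) : ∀ᵐ ω ∂P, ∀ k, Continuous fun t => b k t ω := by
  rw [ae_all_iff]
  refine hb.forall_of_isPlus (Q := fun g => ∀ᵐ ω ∂P, Continuous fun t => g t ω) (fun g hg => ?_)
    fun k hk => ?_
  · exact hg.mono fun ω h => (Complex.continuous_conj.comp h).neg
  · filter_upwards [(hb.fbm (⟨k, hk⟩, true)).continuous, (hb.fbm (⟨k, hk⟩, false)).continuous]
      with ω h1 h2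
    have e : (fun t => b k t ω) = fun t => (realParts b (⟨k, hk⟩, true) ω t : ℂ) +
        (realParts b (⟨k, hk⟩, false) ω t : ℂ) * Complex.I :=
      funext fun t => eq_realParts b ⟨k, hk⟩ t ω
    rw [e]
    exact (Complex.continuous_ofReal.comp h1).add
      ((Complex.continuous_ofReal.comp h2).mul continuous_const)

lemma IsFBM.ae_zero [IsProbabilityMeasure P] (hH : 0 < H) {X : ℝ → Ω → ℝ} (hX : IsFBM H X P) :
    ∀ᵐ ω ∂P, X 0 ω = 0 := by
  have hm := (hX.gaussian.hasGaussianLaw_eval 0).memLp_two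
  have hv : Var[X 0; P] = 0 := by
    rw [← covariance_self (hX.gaussian.aemeasurable 0), hX.covariance]
    simp [Real.zero_rpow (by positivity : 2 * H ≠ 0)]
  have hev : evariance (X 0) P = 0 := by
    rw [← hm.ofReal_variance_eq, hv, ENNReal.ofReal_zero]
  have := (evariance_eq_zero_iff hm.1.aemeasurable).1 hev
  filter_upwards [this] with ω h
  rw [h, hX.centered]

lemma IsCylFBM.ae_zero [IsProbabilityMeasure P] (hH : 0 < H) (hb : IsCylFBM H b P) :
    ∀ᵐ ω ∂P, ∀ k, b k 0 ω = 0 := by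
  rw [ae_all_iff]
  refine hb.forall_of_isPlus (Q := fun g => ∀ᵐ ω ∂P, g 0 ω = 0) (fun g hg => ?_) fun k hk => ?_
  · exact hg.mono fun ω h => by simp [h]
  · filter_upwards [(hb.fbm (⟨k, hk⟩, true)).ae_zero hH, (hb.fbm (⟨k, hk⟩, false)).ae_zero hH]
      with ω h1 h2
    rw [eq_realParts b ⟨k, hk⟩, h1, h2]; simp

lemma measurable_dyadSumC {g : ℝ → Ω → ℂ} (hg : ∀ t, Measurable (g t)) (α : ℝ) (p : ℕ) :
    Measurable fun ω => dyadSumC α p fun t => g t ω := by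
  unfold dyadSumC dyadSum
  have hre : ∀ t, Measurable fun ω => (g t ω).re := fun t => Complex.measurable_re.comp (hg t)
  have him : ∀ t, Measurable fun ω => (g t ω).im := fun t => Complex.measurable_im.comp (hg t)
  exact (Measurable.tsum fun j => Measurable.tsum fun i =>
    (((hre _).sub (hre _)).enorm.pow_const p).const_mul _).add
    (Measurable.tsum fun j => Measurable.tsum fun i =>
    (((him _).sub (him _)).enorm.pow_const p).const_mul _)

lemma IsCylFBM.exists_lintegral_dyadSumC_le [IsProbabilityMeasure P] [P.IsComplete]
    (hb : IsCylFBM H b P) {α : ℝ} (hH : 0 < H) (hα : α < H) {p : ℕ} (hp : p ≠ 0) :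
    ∃ m : ℝ≥0∞, m ≠ ∞ ∧ ∀ k, ∫⁻ ω, dyadSumC α p (fun t => b k t ω) ∂P ≤ m := by
  obtain ⟨m, hm, h⟩ := IsFBM.exists_lintegral_dyadSum_le hH hα hp
  refine ⟨m + m, by finiteness, hb.forall_of_isPlus
    (Q := fun g => ∫⁻ ω, dyadSumC α p (fun t => g t ω) ∂P ≤ m + m) (fun g hg => ?_) fun k hk => ?_⟩
  · simpa only [dyadSumC_neg_conj] using hg
  · have h1 := h P _ (hb.fbm (⟨k, hk⟩, true)) (hb.measurable_realParts _)
    have h2 := h P _ (hb.fbm (⟨k, hk⟩, false)) (hb.measurable_realParts _)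
    unfold dyadSumC
    rw [lintegral_add_left]
    · exact add_le_add h1 h2
    · unfold dyadSum
      have hre : ∀ t, Measurable fun ω => (b k t ω).re := fun t =>
        Complex.measurable_re.comp (hb.measurable k t)
      exact Measurable.tsum fun j => Measurable.tsum fun i =>
        (((hre _).sub (hre _)).enorm.pow_const p).const_mul _

end Cylindrical

/-- A noise all of whose paths are Hölder continuous with square summable constants. -/
structure IsTame {Ω : Type*} [MeasurableSpace Ω] (β ρ : ℝ) (κ : Idx → Ω → ℝ)
    (b : Idx → ℝ → Ω → ℂ) : Prop where
  meas : ∀ k t, Measurable (b k t)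
  cont : ∀ k ω, Continuous fun t => b k t ω
  refl : ∀ k t ω, b k.opp t ω = -conj (b k t ω)
  zero : ∀ k ω, b k 0 ω = 0
  nonneg : ∀ k ω, 0 ≤ κ k ω
  meas_const : ∀ k, Measurable (κ k)
  growth : ∀ k ω, HolderGrowth β (κ k ω) fun t => b k t ω
  sum : ∀ ω, ∑' k, wt (ρ - 2 * β) k * ENNReal.ofReal (κ k ω ^ 2) ≠ ∞

lemma rpow_le_one_add {x a : ℝ} (hx : 0 ≤ x) (ha0 : 0 ≤ a) (ha1 : a ≤ 1) : x ^ a ≤ 1 + x := by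
  rcases le_total x 1 with h | h
  · have := Real.rpow_le_one hx h ha0; linarith
  · calc x ^ a ≤ x ^ (1 : ℝ) := Real.rpow_le_rpow_of_exponent_le h ha1
      _ ≤ 1 + x := by rw [Real.rpow_one]; linarith

/-- A cylindrical fractional Brownian motion has a version that is tame on the whole sample space,
whose Hölder constants have uniformly bounded fourth moments. -/
theorem IsCylFBM.exists_isTame {Ω : Type*} [MeasurableSpace Ω] {P : Measure Ω}
    [IsProbabilityMeasure P] [P.IsComplete] {H : ℝ} {b : Idx → ℝ → Ω → ℂ} (hb : IsCylFBM H b P)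
    {α ρ : ℝ} (hH : 0 < H) (hα : α < H) {p : ℕ} (hp : 4 ≤ p) (hpα : 2 / (p : ℝ) < α)
    (hρ : ρ + 1 < 2 * (α - 2 / p)) :
    ∃ (b' : Idx → ℝ → Ω → ℂ) (κ : Idx → Ω → ℝ) (m : ℝ≥0∞), IsTame (α - 2 / p) ρ κ b' ∧
      (∀ᵐ ω ∂P, ∀ k t, b' k t ω = b k t ω) ∧ m ≠ ∞ ∧
      ∀ k, ∫⁻ ω, ENNReal.ofReal (κ k ω ^ 4) ∂P ≤ m := by
  classical
  obtain ⟨C, hC, hgrow⟩ := exists_holderGrowth_dyadSumC (by omega : 2 ≤ p) hpα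
  obtain ⟨m, hm, hmom⟩ := hb.exists_lintegral_dyadSumC_le hH hα (by omega : p ≠ 0)
  set β := α - 2 / p with hβ
  have hp' : (4 : ℝ) ≤ p := by exact_mod_cast hp
  set S : Idx → Ω → ℝ≥0∞ := fun k ω => dyadSumC α p fun t => b k t ω with hS
  have hSm : ∀ k, Measurable (S k) := fun k => measurable_dyadSumC (hb.measurable k) α p
  set κ₀ : Idx → Ω → ℝ := fun k ω => C * (S k ω).toReal ^ (1 / (p : ℝ)) with hκ₀
  have hκm : ∀ k, Measurable (κ₀ k) := fun k => ((hSm k).ennreal_toReal.pow_const _).const_mul C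
  have hκ0 : ∀ k ω, 0 ≤ κ₀ k ω := fun k ω => by positivity
  -- κ⁴ is a power 4/p ≤ 1 of the dyadic sum, hence at most linear in it; this is the role of p ≥ 4.
  have h4 : ∀ k ω, ENNReal.ofReal (κ₀ k ω ^ 4) ≤ ENNReal.ofReal (C ^ 4) * (1 + S k ω) := by
    intro k ω
    rw [hκ₀]
    simp only [mul_pow]
    rw [ENNReal.ofReal_mul (by positivity)]
    gcongr
    rcases eq_or_ne (S k ω) ∞ with h | h
    · simp [h]
    · refine (ENNReal.ofReal_le_ofReal (?_ : _ ≤ 1 + (S k ω).toReal)).trans ?_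
      · rw [← Real.rpow_natCast, ← Real.rpow_mul ENNReal.toReal_nonneg]
        refine rpow_le_one_add ENNReal.toReal_nonneg (by positivity) ?_
        rw [one_div, inv_mul_le_iff₀ (by linarith), mul_one]
        exact_mod_cast hp
      · rw [ENNReal.ofReal_add (by norm_num) ENNReal.toReal_nonneg, ENNReal.ofReal_one,
          ENNReal.ofReal_toReal h]
  set m' := ENNReal.ofReal (C ^ 4) * (1 + m) with hm'
  have hm't : m' ≠ ∞ := by finiteness
  have hmom4 : ∀ k, ∫⁻ ω, ENNReal.ofReal (κ₀ k ω ^ 4) ∂P ≤ m' := by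
    intro k
    refine (lintegral_mono (h4 k)).trans ?_
    rw [lintegral_const_mul' _ _ ENNReal.ofReal_ne_top, lintegral_add_left measurable_const]
    simp only [lintegral_const, measure_univ, mul_one]
    rw [hm']
    gcongr
    exact hmom k
  have hmom2 : ∀ k, ∫⁻ ω, ENNReal.ofReal (κ₀ k ω ^ 2) ∂P ≤ 1 + m' := by
    intro k
    have h2 : ∀ ω, ENNReal.ofReal (κ₀ k ω ^ 2) ≤ 1 + ENNReal.ofReal (κ₀ k ω ^ 4) := fun ω => by
      have := ENNReal_le_one_add_sq (ENNReal.ofReal (κ₀ k ω ^ 2))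
      rwa [← ENNReal.ofReal_pow (by positivity), ← pow_mul] at this
    refine (lintegral_mono h2).trans ?_
    rw [lintegral_add_left measurable_const]
    simp only [lintegral_const, measure_univ, mul_one]
    gcongr
    exact hmom4 k
  have hsum : ∀ᵐ ω ∂P, ∑' k, wt (ρ - 2 * β) k * ENNReal.ofReal (κ₀ k ω ^ 2) < ∞ := by
    have hmk : ∀ k, Measurable fun ω => wt (ρ - 2 * β) k * ENNReal.ofReal (κ₀ k ω ^ 2) := fun k =>
      (((hκm k).pow_const 2).ennreal_ofReal).const_mul _
    refine ae_lt_top (Measurable.tsum hmk) ?_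
    rw [lintegral_tsum fun k => (hmk k).aemeasurable]
    have hle : ∀ k, ∫⁻ ω, wt (ρ - 2 * β) k * ENNReal.ofReal (κ₀ k ω ^ 2) ∂P ≤
        wt (ρ - 2 * β) k * (1 + m') := fun k => by
      rw [lintegral_const_mul _ (((hκm k).pow_const 2).ennreal_ofReal)]
      gcongr
      exact hmom2 k
    refine ne_top_of_le_ne_top ?_ (ENNReal.tsum_le_tsum hle)
    rw [ENNReal.tsum_mul_right]
    -- The two-dimensional lattice sum of |k|^{−2(2β−ρ)} converges because ρ + 1 < 2β.
    have ht : ∑' k, wt (ρ - 2 * β) k ≠ ∞ := by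
      have := tsum_len_ne_top (s := 2 * β - ρ) (by linarith)
      have e : ∀ k : Idx, wt (ρ - 2 * β) k = ENNReal.ofReal (len k.1 ^ (-(2 * (2 * β - ρ)))) :=
        fun k => by unfold wt; congr 2; ring
      simpa only [e] using this
    finiteness
  have hSfin : ∀ᵐ ω ∂P, ∀ k, S k ω < ∞ := by
    rw [ae_all_iff]
    exact fun k => ae_lt_top (hSm k) (ne_top_of_le_ne_top hm (hmom k))
  have hgood : ∀ᵐ ω ∂P, (∀ k, Continuous fun t => b k t ω) ∧ (∀ k, b k 0 ω = 0) ∧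
      (∀ k, S k ω < ∞) ∧ ∑' k, wt (ρ - 2 * β) k * ENNReal.ofReal (κ₀ k ω ^ 2) < ∞ := by
    filter_upwards [hb.ae_continuous, hb.ae_zero hH, hSfin, hsum] with ω h1 h2 h3 h4
    exact ⟨h1, h2, h3, h4⟩
  -- On a measurable null set the noise and its constants are replaced by zero, so that all
  -- properties hold at every ω without losing measurability.
  obtain ⟨N, hN, hNm, hN0⟩ := exists_measurable_superset_of_null (ae_iff.1 hgood)
  have hG : ∀ ω ∉ N, (∀ k, Continuous fun t => b k t ω) ∧ (∀ k, b k 0 ω = 0) ∧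
      (∀ k, S k ω < ∞) ∧ ∑' k, wt (ρ - 2 * β) k * ENNReal.ofReal (κ₀ k ω ^ 2) < ∞ := fun ω hω => by
    by_contra h
    exact hω (hN h)
  refine ⟨fun k t ω => if ω ∈ N then 0 else b k t ω, fun k ω => if ω ∈ N then 0 else κ₀ k ω, m',
    ⟨fun k t => ?_, fun k ω => ?_, fun k t ω => ?_, fun k ω => ?_, fun k ω => ?_, fun k => ?_,
      fun k ω => ?_, fun ω => ?_⟩, ?_, hm't, fun k => ?_⟩
  · exact Measurable.ite hNm measurable_const (hb.measurable k t)
  · by_cases h : ω ∈ N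
    · simp only [h, if_true]; exact continuous_const
    · simp only [h, if_false]; exact (hG ω h).1 k
  · by_cases h : ω ∈ N
    · simp [h]
    · simp only [h, if_false]; exact hb.reflect_all k t ω
  · by_cases h : ω ∈ N
    · simp [h]
    · simp only [h, if_false]; exact (hG ω h).2.1 k
  · by_cases h : ω ∈ N
    · simp [h]
    · simp only [h, if_false]; exact hκ0 k ω
  · exact Measurable.ite hNm measurable_const (hκm k)
  · by_cases h : ω ∈ N
    · simp only [h, if_true]; intro s t; simp
    · simp only [h, if_false]; exact hgrow _ ((hG ω h).1 k) ((hG ω h).2.2.1 k).ne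
  · by_cases h : ω ∈ N
    · simp [h]
    · simp only [h, if_false]; exact (hG ω h).2.2.2.ne
  · filter_upwards [measure_eq_zero_iff_ae_notMem.1 hN0] with ω h k t
    simp [h]
  · refine le_trans (lintegral_mono fun ω => ENNReal.ofReal_le_ofReal ?_) (hmom4 k)
    by_cases h : ω ∈ N
    · simp only [h, if_true]
      simpa using pow_nonneg (hκ0 k ω) 4
    · simp [h]

/-- Coordinatewise continuity and a summable bound give continuity in `H^r`. -/
lemma hcont_of_dominated {r : ℝ} {f : ℝ → Coeff} (hf : ∀ k, Continuous fun t => f t k)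
    {a : Idx → ℝ} (ha : ∀ k t, ‖f t k‖ ^ 2 ≤ a k)
    (hsum : ∑' k, wt r k * ENNReal.ofReal (a k) ≠ ∞) : HCont r f := by
  have hterm : ∀ (k : Idx) (x : ℂ) (y : ℝ), ‖x‖ ^ 2 ≤ y →
      ENNReal.ofReal (len k.1 ^ (2 * r) * ‖x‖ ^ 2) ≤ wt r k * ENNReal.ofReal y := fun k x y h => by
    unfold wt
    rw [← ENNReal.ofReal_mul (Real.rpow_nonneg (len_nonneg _) _)]
    exact ENNReal.ofReal_le_ofReal (mul_le_mul_of_nonneg_left h (Real.rpow_nonneg (len_nonneg _) _))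
  refine ⟨fun t => ne_top_of_le_ne_top hsum (ENNReal.tsum_le_tsum fun k => hterm k _ _ (ha k t)),
    fun t => ?_⟩
  have h0 : (0 : ℝ≥0∞) = ∫⁻ _ : Idx, 0 ∂(Measure.count : Measure Idx) := by simp
  simp only [normSq_eq_lintegral]
  rw [h0]
  refine tendsto_lintegral_filter_of_dominated_convergence
    (fun k => wt r k * ENNReal.ofReal (4 * a k)) (Eventually.of_forall fun s => Measurable.of_discrete)
    (Eventually.of_forall fun s => Eventually.of_forall fun k => hterm k _ _ ?_) ?_
    (Eventually.of_forall fun k => ?_)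
  · have h1 := norm_sub_le (f s k) (f t k)
    have h2 := ha k s
    have h3 := ha k t
    have h4 := norm_nonneg (f s k - f t k)
    rw [Pi.sub_apply]
    nlinarith [sq_nonneg (‖f s k‖ - ‖f t k‖)]
  · rw [lintegral_count]
    have e : ∀ k, wt r k * ENNReal.ofReal (4 * a k) = 4 * (wt r k * ENNReal.ofReal (a k)) := fun k => by
      rw [ENNReal.ofReal_mul (by norm_num), ENNReal.ofReal_ofNat]; ring
    simp only [e]
    rw [ENNReal.tsum_mul_left]
    finiteness
  · have h1 : Continuous fun s => ENNReal.ofReal (len k.1 ^ (2 * r) * ‖(f s - f t) k‖ ^ 2) := by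
      have := hf k
      refine ENNReal.continuous_ofReal.comp (continuous_const.mul ?_)
      exact ((this.sub continuous_const).norm).pow 2
    have h2 := h1.tendsto t
    simpa using h2

/-! ### The Stokes process of a tame noise: measurability, regularity and equation. -/

section Stokes

variable {Ω : Type*} [MeasurableSpace Ω] {β ρ : ℝ} {κ : Idx → Ω → ℝ} {b : Idx → ℝ → Ω → ℂ}

/-- The Stokes process of a tame noise. -/
def convZ (b : Idx → ℝ → Ω → ℂ) (t : ℝ) (ω : Ω) : Coeff :=
  fun k => convPath (len k.1 ^ 2) (fun s => b k s ω) t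

lemma one_le_len_sq (k : Idx) : 1 ≤ len k.1 ^ 2 := one_le_pow₀ (one_le_len k)

lemma IsTame.hasExpConv (h : IsTame β ρ κ b) (hβ : 0 < β) (k : Idx) (t : ℝ) (ω : Ω) :
    HasExpConv (len k.1 ^ 2) (fun s => b k s ω) t (convZ b t ω k) :=
  hasExpConv_convPath (h.growth k ω) (h.nonneg k ω) hβ (one_le_len_sq k) (h.cont k ω) t

lemma IsTame.isReal_convZ (h : IsTame β ρ κ b) (t : ℝ) (ω : Ω) : IsReal (convZ b t ω) := by
  intro k
  unfold convZ convPath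
  rw [← integral_conj, ← integral_neg]
  refine integral_congr_ae (Eventually.of_forall fun r => ?_)
  simp only [h.refl, map_mul, map_sub, Complex.conj_ofReal,
    show k.opp.1 = -k.1 from rfl, len_neg]
  ring

lemma IsTame.continuous_convZ (h : IsTame β ρ κ b) (hβ : 0 < β) (k : Idx) (ω : Ω) :
    Continuous fun t => convZ b t ω k :=
  continuous_convPath (h.growth k ω) (h.nonneg k ω) hβ (one_le_len_sq k) (h.cont k ω)

lemma IsTame.measurable_convZ (h : IsTame β ρ κ b) (t : ℝ) : Measurable (convZ b t) := by
  refine measurable_pi_lambda _ fun k => ?_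
  have hj : Measurable (Function.uncurry fun s ω => b k s ω) :=
    measurable_uncurry_of_continuous_of_measurable (h.cont k) (h.meas k)
  have hm : Measurable fun p : Ω × ℝ => ((len k.1 ^ 2 * Real.exp (-(len k.1 ^ 2 * p.2)) : ℝ) : ℂ) *
      (b k t p.1 - b k (t - p.2) p.1) := by
    refine Measurable.mul ?_ (((h.meas k t).comp measurable_fst).sub ?_)
    · have : Continuous fun r : ℝ => ((len k.1 ^ 2 * Real.exp (-(len k.1 ^ 2 * r)) : ℝ) : ℂ) := by
        fun_prop
      exact this.measurable.comp measurable_snd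
    · exact hj.comp ((measurable_const.sub measurable_snd).prodMk measurable_fst)
  exact (hm.stronglyMeasurable.integral_prod_right (ν := volume.restrict (Set.Ioi (0 : ℝ)))).measurable

lemma IsTame.measurable_uncurry_convZ (h : IsTame β ρ κ b) (hβ : 0 < β) :
    Measurable fun p : Ω × ℝ => convZ b p.2 p.1 := by
  refine measurable_pi_lambda _ fun k => ?_
  have := measurable_uncurry_of_continuous_of_measurable (u := fun t ω => convZ b t ω k)
    (h.continuous_convZ hβ k) fun t => (measurable_pi_apply k).comp (h.measurable_convZ t)
  exact this.comp measurable_swap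

lemma IsTame.exists_norm_convZ_le (h : IsTame β ρ κ b) (hβ : 0 < β) {T : ℝ} (hT : 0 ≤ T) :
    ∃ C : ℝ, 0 ≤ C ∧ ∀ k ω, ∀ t ∈ Set.Icc 0 T,
      ‖convZ b t ω k‖ ≤ C * κ k ω * len k.1 ^ (-(2 * β)) := by
  obtain ⟨C, hC, hle⟩ := exists_norm_convPath_le hβ hT
  refine ⟨C, hC, fun k ω t ht => (hle _ _ _ (one_le_len_sq k) (h.nonneg k ω) (h.growth k ω) t ht).trans
    (le_of_eq ?_)⟩
  rw [← Real.rpow_natCast, ← Real.rpow_mul (len_nonneg _)]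
  push_cast
  ring_nf

/-- The termwise bound C κ_k |k|^{−2β} is square summable against |k|^{2ρ} by the definition of a
tame noise. It holds on [0,T] only, hence the clamped time. -/
lemma IsTame.hcont_convZ (h : IsTame β ρ κ b) (hβ : 0 < β) {T : ℝ} (hT : 0 ≤ T) (ω : Ω) :
    (HCont ρ fun t => convZ b (clamp T t) ω) ∧
      ∃ M : ℝ, 0 ≤ M ∧ ∀ t, normSq ρ (convZ b (clamp T t) ω) ≤ ENNReal.ofReal M := by
  obtain ⟨C, hC, hle⟩ := h.exists_norm_convZ_le hβ hT
  set a : Idx → ℝ := fun k => (C * κ k ω * len k.1 ^ (-(2 * β))) ^ 2 with ha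
  have hak : ∀ k t, ‖convZ b (clamp T t) ω k‖ ^ 2 ≤ a k := fun k t =>
    pow_le_pow_left₀ (norm_nonneg _) (hle k ω _ (clamp_mem hT t)) 2
  have e : ∀ k, wt ρ k * ENNReal.ofReal (a k) =
      ENNReal.ofReal (C ^ 2) * (wt (ρ - 2 * β) k * ENNReal.ofReal (κ k ω ^ 2)) := fun k => by
    rw [ha]
    simp only [mul_pow]
    rw [ENNReal.ofReal_mul (by positivity), ENNReal.ofReal_mul (by positivity), sub_eq_add_neg, wt_add]
    have : ENNReal.ofReal ((len k.1 ^ (-(2 * β))) ^ 2) = wt (-(2 * β)) k := by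
      unfold wt
      rw [← Real.rpow_natCast, ← Real.rpow_mul (len_nonneg _)]
      congr 2; push_cast; ring
    rw [this]; ring
  have hsum : ∑' k, wt ρ k * ENNReal.ofReal (a k) ≠ ∞ := by
    simp only [e]
    rw [ENNReal.tsum_mul_left]
    have := h.sum ω
    finiteness
  refine ⟨hcont_of_dominated (fun k => (h.continuous_convZ hβ k ω).comp (continuous_clamp T)) hak hsum,
    (∑' k, wt ρ k * ENNReal.ofReal (a k)).toReal, ENNReal.toReal_nonneg, fun t => ?_⟩
  rw [ENNReal.ofReal_toReal hsum]
  refine ENNReal.tsum_le_tsum fun k => ?_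
  unfold wt
  rw [← ENNReal.ofReal_mul (Real.rpow_nonneg (len_nonneg _) _)]
  exact ENNReal.ofReal_le_ofReal
    (mul_le_mul_of_nonneg_left (hak k t) (Real.rpow_nonneg (len_nonneg _) _))

lemma IsTame.convZ_equation (h : IsTame β ρ κ b) (hβ : 0 < β) (k : Idx) (t : ℝ) (ω : Ω) :
    convZ b t ω k - convZ b 0 ω k =
      -((len k.1 ^ 2 : ℝ) : ℂ) * (∫ s in (0 : ℝ)..t, convZ b s ω k) + b k t ω := by
  have := convPath_equation (h.growth k ω) (h.nonneg k ω) hβ (one_le_len_sq k) (h.cont k ω) t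
  rwa [h.zero, sub_zero] at this

end Stokes

/-! ### Orthogonality of the products of the coefficients -/

/-- The representative of `k` or `-k` in the half plane. -/
def cls (k : Idx) : {k : Idx // k.IsPlus} := open Classical in
  if h : k.IsPlus then ⟨k, h⟩ else ⟨k.opp, k.isPlus_or.resolve_left h⟩

lemma cls_eq_or (k : Idx) : (cls k).1 = k ∨ (cls k).1 = k.opp := by
  unfold cls; split_ifs <;> simp

lemma eq_or_eq_opp_of_cls_eq {x y : Idx} (h : cls x = cls y) : x = y ∨ x = y.opp := by
  have h' := congrArg Subtype.val h
  rcases cls_eq_or x with hx | hx <;> rcases cls_eq_or y with hy | hy <;> rw [hx, hy] at h'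
  · exact Or.inl h'
  · exact Or.inr h'
  · right; rw [← h', Idx.opp_opp]
  · left; rw [← Idx.opp_opp x, h', Idx.opp_opp]

/-- The limit of the uniform Riemann–Stieltjes sums of `exp(-lam (t-s))`, as a function of the
path. -/
def rsLim (lam t : ℝ) (x : ℝ → ℝ) : ℝ :=
  limsup (fun m : ℕ => limsup (fun n : ℕ => ∑ i ∈ Finset.range (n + 1),
    Real.exp (-lam * (t - uniformPt (t - m) t n i)) *
      (x (uniformPt (t - m) t n (i + 1)) - x (uniformPt (t - m) t n i))) atTop) atTop

lemma measurable_rsLim (lam t : ℝ) : Measurable (rsLim lam t) := by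
  refine Measurable.limsup fun m => Measurable.limsup fun n => ?_
  refine Finset.measurable_sum _ fun i _ => ?_
  have h : ∀ a c : ℝ, Measurable fun x : ℝ → ℝ => x a - x c := fun a c =>
    (measurable_pi_apply a).sub (measurable_pi_apply c)
  exact (h _ _).const_mul _

/-- Presents z_k(t) as a measurable functional of the path of b_k alone, through countably many
sums. Independence of the paths b_k then passes to the coefficients of z. -/
lemma HasExpConv.rsLim_eq {lam t : ℝ} {g : ℝ → ℂ} {I : ℂ} (h : HasExpConv lam g t I) :
    rsLim lam t (fun s => (g s).re) = I.re ∧ rsLim lam t (fun s => (g s).im) = I.im := by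
  obtain ⟨J, hJ, hI⟩ := h
  have hm : Tendsto (fun m : ℕ => t - (m : ℝ)) atTop atBot :=
    tendsto_atBot_add_const_left _ t (tendsto_neg_atTop_atBot.comp tendsto_natCast_atTop_atTop)
  have hs := fun m : ℕ => tendsto_uniform_of_hasRSIntegral (a := t - m)
    (sub_le_self t (Nat.cast_nonneg m)) (hJ (t - m) (sub_le_self t (Nat.cast_nonneg m)))
  constructor
  · unfold rsLim
    have e : ∀ m : ℕ, limsup (fun n : ℕ => ∑ i ∈ Finset.range (n + 1),
        Real.exp (-lam * (t - uniformPt (t - m) t n i)) *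
        ((g (uniformPt (t - m) t n (i + 1))).re - (g (uniformPt (t - m) t n i)).re)) atTop =
        (J (t - m)).re := fun m => by
      refine Tendsto.limsup_eq (((Complex.continuous_re.tendsto _).comp (hs m)).congr fun n => ?_)
      simp only [Function.comp, Complex.re_sum, Complex.re_ofReal_mul, Complex.sub_re]
    simp only [e]
    exact Tendsto.limsup_eq ((Complex.continuous_re.tendsto _).comp (hI.comp hm))
  · unfold rsLim
    have e : ∀ m : ℕ, limsup (fun n : ℕ => ∑ i ∈ Finset.range (n + 1),
        Real.exp (-lam * (t - uniformPt (t - m) t n i)) *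
        ((g (uniformPt (t - m) t n (i + 1))).im - (g (uniformPt (t - m) t n i)).im)) atTop =
        (J (t - m)).im := fun m => by
      refine Tendsto.limsup_eq (((Complex.continuous_im.tendsto _).comp (hs m)).congr fun n => ?_)
      simp only [Function.comp, Complex.im_sum, Complex.im_ofReal_mul, Complex.sub_im]
    simp only [e]
    exact Tendsto.limsup_eq ((Complex.continuous_im.tendsto _).comp (hI.comp hm))

/-- The σ-algebra generated by the coefficients of the noise in a set of classes. -/
abbrev clsAlg {Ω : Type*} (b : Idx → ℝ → Ω → ℂ) (A : Set {k : Idx // k.IsPlus}) : MeasurableSpace Ω :=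
  ⨆ p ∈ {p : {k : Idx // k.IsPlus} × Bool | p.1 ∈ A},
    MeasurableSpace.comap (realParts b p) MeasurableSpace.pi

lemma clsAlg_mono {Ω : Type*} {b : Idx → ℝ → Ω → ℂ} {A B : Set {k : Idx // k.IsPlus}} (h : A ⊆ B) :
    clsAlg b A ≤ clsAlg b B :=
  biSup_mono fun _ hp => h hp

/-! ### Independence and vanishing mean of the coefficients of z. -/

section Independence

variable {Ω : Type*} [mΩ : MeasurableSpace Ω] {P : Measure Ω} {H : ℝ} {b : Idx → ℝ → Ω → ℂ}

/-- `f` is a.s. equal to a function of the coefficients of the noise in the classes of `A`. -/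
def ClsMeas (b : Idx → ℝ → Ω → ℂ) (P : Measure Ω) (A : Set {k : Idx // k.IsPlus}) (f : Ω → ℂ) :
    Prop :=
  ∃ ζ : Ω → ℂ, Measurable[clsAlg b A] ζ ∧ ζ =ᵐ[P] f

lemma ClsMeas.mono {A B : Set {k : Idx // k.IsPlus}} (h : A ⊆ B) {f : Ω → ℂ}
    (hf : ClsMeas b P A f) : ClsMeas b P B f := by
  obtain ⟨ζ, h1, h2⟩ := hf
  exact ⟨ζ, h1.mono (clsAlg_mono h) le_rfl, h2⟩

lemma ClsMeas.conj {A : Set {k : Idx // k.IsPlus}} {f : Ω → ℂ} (hf : ClsMeas b P A f) :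
    ClsMeas b P A fun ω => conj (f ω) := by
  obtain ⟨ζ, h1, h2⟩ := hf
  exact ⟨fun ω => (starRingEnd ℂ) (ζ ω), Complex.continuous_conj.measurable.comp h1,
    h2.mono fun ω h => by simp only [h]⟩

lemma ClsMeas.mul {A : Set {k : Idx // k.IsPlus}} {f g : Ω → ℂ} (hf : ClsMeas b P A f)
    (hg : ClsMeas b P A g) : ClsMeas b P A fun ω => f ω * g ω := by
  obtain ⟨ζ, h1, h2⟩ := hf
  obtain ⟨η, h3, h4⟩ := hg
  exact ⟨fun ω => ζ ω * η ω, h1.mul h3, by filter_upwards [h2, h4] with ω h h'; rw [h, h']⟩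

/-- Disjoint sets of classes generate independent σ-algebras, so the expectation factorizes and the
centred factor kills it. -/
lemma IsCylFBM.integral_mul_eq_zero [P.IsComplete] (hb : IsCylFBM H b P)
    {A B : Set {k : Idx // k.IsPlus}} (hAB : Disjoint A B) {X W : Ω → ℂ} (hX : ClsMeas b P A X)
    (hW : ClsMeas b P B W) (h0 : ∫ ω, X ω ∂P = 0) : ∫ ω, X ω * W ω ∂P = 0 := by
  obtain ⟨ζ, h1, h2⟩ := hX
  obtain ⟨η, h3, h4⟩ := hW
  have hle : ∀ p, MeasurableSpace.comap (realParts b p) MeasurableSpace.pi ≤ mΩ := fun p =>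
    (measurable_pi_lambda _ fun t => hb.measurable_realParts p t).comap_le
  have hleA : ∀ A, clsAlg b A ≤ mΩ := fun A => iSup₂_le fun p _ => hle p
  have hind : Indep (clsAlg b A) (clsAlg b B) P :=
    indep_iSup_of_disjoint hle ((iIndepFun_iff_iIndep _ _ _).1 hb.indep)
      (Set.disjoint_left.2 fun p hp hp' => Set.disjoint_left.1 hAB hp hp')
  have hif : IndepFun ζ η P := by
    rw [IndepFun_iff_Indep]
    exact indep_of_indep_of_le_right (indep_of_indep_of_le_left hind h1.comap_le) h3.comap_le
  have e : ∫ ω, X ω * W ω ∂P = ∫ ω, ζ ω * η ω ∂P :=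
    integral_congr_ae (by filter_upwards [h2, h4] with ω h h'; rw [h, h'])
  rw [e, hif.integral_fun_mul_eq_mul_integral
    (h1.mono (hleA A) le_rfl).aestronglyMeasurable (h3.mono (hleA B) le_rfl).aestronglyMeasurable,
    integral_congr_ae h2, h0, zero_mul]

variable {β ρ : ℝ} {κ : Idx → Ω → ℝ} {b' : Idx → ℝ → Ω → ℂ}

/-- Since b' and b agree almost surely, z built from b' is almost surely a functional of b in the
class of k; outside the half plane the reflection is applied. -/
lemma IsTame.clsMeas_convZ (h : IsTame β ρ κ b') (hβ : 0 < β)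
    (hbb : ∀ᵐ ω ∂P, ∀ k t, b' k t ω = b k t ω) (k : Idx) (t : ℝ) :
    ClsMeas b P {cls k} fun ω => convZ b' t ω k := by
  have hplus : ∀ c : {k : Idx // k.IsPlus}, ClsMeas b P {c} fun ω => convZ b' t ω c.1 := by
    intro c
    have hm : ∀ s : Bool, Measurable[clsAlg b {c}] fun ω =>
        rsLim (len c.1.1 ^ 2) t (realParts b (c, s) ω) := fun s => by
      have h1 : Measurable[MeasurableSpace.comap (realParts b (c, s)) MeasurableSpace.pi] fun ω =>
          rsLim (len c.1.1 ^ 2) t (realParts b (c, s) ω) :=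
        (measurable_rsLim _ _).comp (comap_measurable _)
      refine h1.mono ?_ le_rfl
      exact le_iSup₂ (f := fun (p : {k : Idx // k.IsPlus} × Bool)
        (_ : p ∈ {p : {k : Idx // k.IsPlus} × Bool | p.1 ∈ ({c} : Set {k : Idx // k.IsPlus})}) =>
        MeasurableSpace.comap (realParts b p) MeasurableSpace.pi) (c, s) rfl
    refine ⟨fun ω => (rsLim (len c.1.1 ^ 2) t (realParts b (c, true) ω) : ℂ) +
      (rsLim (len c.1.1 ^ 2) t (realParts b (c, false) ω) : ℂ) * Complex.I,
      (Complex.measurable_ofReal.comp (hm true)).add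
        ((Complex.measurable_ofReal.comp (hm false)).mul_const _), ?_⟩
    filter_upwards [hbb] with ω hω
    obtain ⟨e1, e2⟩ := (h.hasExpConv hβ c.1 t ω).rsLim_eq
    have r1 : realParts b (c, true) ω = fun s => (b' c.1 s ω).re := by
      ext s; simp [realParts, hω]
    have r2 : realParts b (c, false) ω = fun s => (b' c.1 s ω).im := by
      ext s; simp [realParts, hω]
    rw [r1, r2, e1, e2]
    exact Complex.re_add_im _
  rcases cls_eq_or k with hk | hk
  · have := hplus (cls k)
    rwa [hk] at this
  · obtain ⟨ζ, h1, h2⟩ := hplus (cls k)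
    refine ⟨fun ω => -conj (ζ ω), (Complex.continuous_conj.measurable.comp h1).neg, ?_⟩
    filter_upwards [h2] with ω hω
    have := h.isReal_convZ t ω (cls k).1
    have e : (cls k).1.opp = k := by rw [hk, Idx.opp_opp]
    rw [e] at this
    rw [this, hω]

lemma IsCylFBM.integral_eq_zero (hb : IsCylFBM H b P) (k : Idx) (t : ℝ) : ∫ ω, b k t ω ∂P = 0 := by
  refine hb.forall_of_isPlus (Q := fun g => ∫ ω, g t ω ∂P = 0) (fun g hg => ?_) (fun k hk => ?_) k
  · rw [integral_neg, integral_conj, hg]; simp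
  · simp only [eq_realParts b ⟨k, hk⟩]
    have h1 := ((hb.fbm (⟨k, hk⟩, true)).gaussian.hasGaussianLaw_eval t).integrable
    have h2 := ((hb.fbm (⟨k, hk⟩, false)).gaussian.hasGaussianLaw_eval t).integrable
    have e : ∀ f : Ω → ℝ, ∫ ω, (f ω : ℂ) ∂P = ((∫ ω, f ω ∂P : ℝ) : ℂ) := fun f => integral_ofReal
    rw [integral_add h1.ofReal (h2.ofReal.mul_const _), integral_mul_const, e, e,
      (hb.fbm (⟨k, hk⟩, true)).centered, (hb.fbm (⟨k, hk⟩, false)).centered]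
    simp

lemma IsTame.integrable_holderConst [IsProbabilityMeasure P] (h : IsTame β ρ κ b') {m : ℝ≥0∞} (hm : m ≠ ∞)
    (hmom : ∀ k, ∫⁻ ω, ENNReal.ofReal (κ k ω ^ 4) ∂P ≤ m) (k : Idx) :
    Integrable (fun ω => κ k ω ^ 4) P ∧ Integrable (κ k) P := by
  have h4 : Integrable (fun ω => κ k ω ^ 4) P := by
    refine ⟨((h.meas_const k).pow_const 4).aestronglyMeasurable, ?_⟩
    rw [hasFiniteIntegral_iff_ofReal (Eventually.of_forall fun ω => by positivity)]
    exact lt_of_le_of_lt (hmom k) hm.lt_top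
  refine ⟨h4, ((integrable_const (1 : ℝ)).add h4).mono' (h.meas_const k).aestronglyMeasurable
    (Eventually.of_forall fun ω => ?_)⟩
  have h0 := h.nonneg k ω
  rw [Real.norm_of_nonneg h0, Pi.add_apply]
  nlinarith [sq_nonneg (κ k ω ^ 2 - 1 / 2), sq_nonneg (κ k ω - 1 / 2)]

/-- Fubini: increments of the noise are centred, and the integrable Hölder constant times the
exponential weight dominates. -/
lemma IsTame.integral_convZ_eq_zero [IsProbabilityMeasure P] (h : IsTame β ρ κ b') (hβ : 0 < β)
    (hb : IsCylFBM H b P) (hbb : ∀ᵐ ω ∂P, ∀ k t, b' k t ω = b k t ω) {m : ℝ≥0∞} (hm : m ≠ ∞)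
    (hmom : ∀ k, ∫⁻ ω, ENNReal.ofReal (κ k ω ^ 4) ∂P ≤ m) (k : Idx) (t : ℝ) :
    ∫ ω, convZ b' t ω k ∂P = 0 := by
  have hlam := one_le_len_sq k
  set lam := len k.1 ^ 2 with hl
  have hκ := (h.integrable_holderConst hm hmom k).2
  have hj : Measurable (Function.uncurry fun s ω => b' k s ω) :=
    measurable_uncurry_of_continuous_of_measurable (h.cont k) (h.meas k)
  have hF : Measurable fun p : Ω × ℝ => ((lam * Real.exp (-(lam * p.2)) : ℝ) : ℂ) *
      (b' k t p.1 - b' k (t - p.2) p.1) := by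
    refine Measurable.mul ?_ (((h.meas k t).comp measurable_fst).sub ?_)
    · have : Continuous fun r : ℝ => ((lam * Real.exp (-(lam * r)) : ℝ) : ℂ) := by fun_prop
      exact this.measurable.comp measurable_snd
    · exact hj.comp ((measurable_const.sub measurable_snd).prodMk measurable_fst)
  have hint : Integrable (Function.uncurry fun ω r => ((lam * Real.exp (-(lam * r)) : ℝ) : ℂ) *
      (b' k t ω - b' k (t - r) ω)) (P.prod (volume.restrict (Set.Ioi (0 : ℝ)))) := by
    refine (hκ.mul_prod ((integrableOn_expWeight_mul hβ (by linarith : 0 < lam)).const_mul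
      ((2 + 2 * |t|) ^ 2 * lam ^ (-β)))).mono' hF.aestronglyMeasurable ?_
    have hs : ∀ᵐ p ∂(P.prod (volume.restrict (Set.Ioi (0 : ℝ)))), p.2 ∈ Set.Ioi (0 : ℝ) :=
      Measure.quasiMeasurePreserving_snd.ae (ae_restrict_mem measurableSet_Ioi)
    filter_upwards [hs] with p hp
    refine ((h.growth k p.1).norm_integrand_le (h.nonneg k p.1) hlam (le_refl |t|) hp).trans
      (le_of_eq ?_)
    ring
  have hz : ∀ s, ∫ ω, b' k s ω ∂P = 0 := fun s => by
    rw [← hb.integral_eq_zero k s]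
    exact integral_congr_ae (hbb.mono fun ω hω => hω k s)
  have hi : ∀ s, Integrable (b' k s) P := fun s => by
    refine (hκ.mul_const ((2 + |s| + |0|) ^ 2 * |s - 0| ^ β)).mono' (h.meas k s).aestronglyMeasurable
      (Eventually.of_forall fun ω => ?_)
    have := h.growth k ω 0 s
    simpa only [h.zero, sub_zero] using this
  unfold convZ convPath
  rw [integral_integral_swap hint]
  refine integral_eq_zero_of_ae (Eventually.of_forall fun r => ?_)
  simp only [integral_const_mul]
  rw [integral_sub (hi _) (hi _), hz, hz]
  simp

end Independence

/-- Two different pairs with the same nonzero sum: if h = l, then h' is unmatched unless h' = −h,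
and in that case l' = 3h is. If h ≠ l, then h is unmatched unless h' or l' equals −h, and in that
case l is. Nonzero sum excludes l = −h and h' = −l'. -/
lemma exists_unmatched {h l h' l' : ℤ × ℤ} (hs : h + l = h' + l') (hk : h + l ≠ 0) (h0 : h ≠ 0)
    (h1 : h' ≠ h) (h2 : h' ≠ l) :
    ((h ≠ l ∧ h ≠ -l) ∧ (h ≠ h' ∧ h ≠ -h') ∧ h ≠ l' ∧ h ≠ -l') ∨
    ((l ≠ h ∧ l ≠ -h) ∧ (l ≠ h' ∧ l ≠ -h') ∧ l ≠ l' ∧ l ≠ -l') ∨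
    ((h' ≠ h ∧ h' ≠ -h) ∧ (h' ≠ l ∧ h' ≠ -l) ∧ h' ≠ l' ∧ h' ≠ -l') ∨
    ((l' ≠ h ∧ l' ≠ -h) ∧ (l' ≠ l ∧ l' ≠ -l) ∧ l' ≠ h' ∧ l' ≠ -h') := by
  have e : l' = h + l - h' := by rw [hs]; abel
  subst e
  obtain ⟨a, c⟩ := h
  obtain ⟨a1, c1⟩ := l
  obtain ⟨a2, c2⟩ := h'
  simp only [Prod.mk_add_mk, Prod.mk_sub_mk, Prod.neg_mk, ne_eq, Prod.mk.injEq, Prod.mk_eq_zero]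
    at *
  by_cases A : a = a1 ∧ c = c1
  · obtain ⟨rfl, rfl⟩ := A
    by_cases B : a2 = -a ∧ c2 = -c
    · obtain ⟨rfl, rfl⟩ := B
      refine Or.inr (Or.inr (Or.inr ⟨⟨?_, ?_⟩, ⟨?_, ?_⟩, ?_, ?_⟩)) <;> rintro ⟨h3, h4⟩ <;> omega
    · refine Or.inr (Or.inr (Or.inl ⟨⟨?_, ?_⟩, ⟨?_, ?_⟩, ?_, ?_⟩)) <;> rintro ⟨h3, h4⟩ <;> omega
  · by_cases B : a2 = -a ∧ c2 = -c
    · obtain ⟨rfl, rfl⟩ := B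
      refine Or.inr (Or.inl ⟨⟨?_, ?_⟩, ⟨?_, ?_⟩, ?_, ?_⟩) <;> rintro ⟨h3, h4⟩ <;> omega
    · by_cases D : a + a1 - a2 = -a ∧ c + c1 - c2 = -c
      · refine Or.inr (Or.inl ⟨⟨?_, ?_⟩, ⟨?_, ?_⟩, ?_, ?_⟩) <;> rintro ⟨h3, h4⟩ <;> omega
      · refine Or.inl ⟨⟨?_, ?_⟩, ⟨?_, ?_⟩, ?_, ?_⟩ <;> rintro ⟨h3, h4⟩ <;> omega

/-! ### The quadratic term of the Stokes process -/

section SecondMoment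

variable {Ω : Type*} [MeasurableSpace Ω] {P : Measure Ω}

/-- The second moment of a linear combination of square integrable functions that are pairwise
orthogonal up to the identification `y (τ h) = y h`. -/
lemma lintegral_enorm_sum_sq_le {ι : Type*} [DecidableEq ι] {y : ι → Ω → ℂ} {τ : ι → ι}
    (hy : ∀ h h', Integrable (fun ω => y h ω * conj (y h' ω)) P) (hτ : ∀ h, y (τ h) = y h)
    (ho : ∀ h h', h' ≠ h → h' ≠ τ h → ∫ ω, y h ω * conj (y h' ω) ∂P = 0)
    {c : ι → ℝ} {K : ℝ} (hc : ∀ h, |c h| ≤ K) (F : Finset ι) :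
    ∫⁻ ω, ‖∑ h ∈ F, (c h : ℂ) * y h ω‖ₑ ^ 2 ∂P ≤
      ENNReal.ofReal (2 * K ^ 2) * ∑ h ∈ F, ∫⁻ ω, ‖y h ω‖ₑ ^ 2 ∂P := by
  have hsq : ∀ w : ℂ, ‖w‖ₑ ^ 2 = ENNReal.ofReal (‖w‖ ^ 2) := fun w => by
    rw [← ofReal_norm, ENNReal.ofReal_pow (norm_nonneg _)]
  have hre : ∀ w : ℂ, ‖w‖ ^ 2 = (w * conj w).re := fun w => by
    rw [Complex.mul_conj, Complex.ofReal_re, Complex.normSq_eq_norm_sq]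
  have hV : ∀ h, Integrable (fun ω => ‖y h ω‖ ^ 2) P := fun h => by
    simp only [hre]; exact (hy h h).re
  have hexp : ∀ ω, (∑ h ∈ F, (c h : ℂ) * y h ω) * conj (∑ h ∈ F, (c h : ℂ) * y h ω) =
      ∑ h ∈ F, ∑ h' ∈ F, ((c h * c h' : ℝ) : ℂ) * (y h ω * conj (y h' ω)) := fun ω => by
    rw [map_sum, Finset.sum_mul_sum]
    refine Finset.sum_congr rfl fun h _ => Finset.sum_congr rfl fun h' _ => ?_
    rw [map_mul, Complex.conj_ofReal]; push_cast; ring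
  have hint : Integrable (fun ω => (∑ h ∈ F, (c h : ℂ) * y h ω) *
      conj (∑ h ∈ F, (c h : ℂ) * y h ω)) P := by
    simp only [hexp]
    exact integrable_finsetSum _ fun h _ => integrable_finsetSum _ fun h' _ =>
      (hy h h').const_mul _
  -- Each row of the Gram matrix has at most two nonzero entries, both equal to the second moment;
  -- this is the factor 2 in the conclusion.
  have hpair : ∀ h h', ‖∫ ω, y h ω * conj (y h' ω) ∂P‖ ≤
      (if h' = h then ∫ ω, ‖y h ω‖ ^ 2 ∂P else 0) +
      (if h' = τ h then ∫ ω, ‖y h ω‖ ^ 2 ∂P else 0) := by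
    intro h h'
    have h0 : 0 ≤ ∫ ω, ‖y h ω‖ ^ 2 ∂P := integral_nonneg fun ω => by positivity
    have hb : y h' = y h → ‖∫ ω, y h ω * conj (y h' ω) ∂P‖ ≤ ∫ ω, ‖y h ω‖ ^ 2 ∂P := fun e => by
      rw [e]
      refine (norm_integral_le_integral_norm _).trans (le_of_eq ?_)
      refine integral_congr_ae (Eventually.of_forall fun ω => ?_)
      simp only [norm_mul, RCLike.norm_conj]; ring
    by_cases h1 : h' = h
    · rw [if_pos h1]
      exact (hb (by rw [h1])).trans (le_add_of_nonneg_right (by split_ifs <;> simp [h0]))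
    by_cases h2 : h' = τ h
    · rw [if_neg h1, if_pos h2, zero_add]
      exact hb (by rw [h2, hτ])
    · rw [ho h h' h1 h2, if_neg h1, if_neg h2]; simp
  have hrow : ∀ h, ∑ h' ∈ F, ‖∫ ω, y h ω * conj (y h' ω) ∂P‖ ≤ 2 * ∫ ω, ‖y h ω‖ ^ 2 ∂P := by
    intro h
    have h0 : 0 ≤ ∫ ω, ‖y h ω‖ ^ 2 ∂P := integral_nonneg fun ω => by positivity
    refine (Finset.sum_le_sum fun h' _ => hpair h h').trans ?_
    rw [Finset.sum_add_distrib, Finset.sum_ite_eq', Finset.sum_ite_eq', two_mul]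
    exact add_le_add (by split_ifs <;> simp [h0]) (by split_ifs <;> simp [h0])
  have hmain : ∫ ω, ‖∑ h ∈ F, (c h : ℂ) * y h ω‖ ^ 2 ∂P ≤
      2 * K ^ 2 * ∑ h ∈ F, ∫ ω, ‖y h ω‖ ^ 2 ∂P := by
    have e : ∫ ω, ‖∑ h ∈ F, (c h : ℂ) * y h ω‖ ^ 2 ∂P = (∫ ω, (∑ h ∈ F, (c h : ℂ) * y h ω) *
        conj (∑ h ∈ F, (c h : ℂ) * y h ω) ∂P).re := by
      simp only [hre]
      exact integral_re hint
    rw [e]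
    refine (Complex.re_le_norm _).trans ?_
    simp only [hexp]
    rw [integral_finsetSum _ fun h _ => integrable_finsetSum _ fun h' _ =>
      (hy h h').const_mul _]
    refine (norm_sum_le _ _).trans ?_
    rw [Finset.mul_sum]
    refine Finset.sum_le_sum fun h _ => ?_
    rw [integral_finsetSum _ fun h' _ => (hy h h').const_mul _]
    refine (norm_sum_le _ _).trans ?_
    calc ∑ h' ∈ F, ‖∫ ω, ((c h * c h' : ℝ) : ℂ) * (y h ω * conj (y h' ω)) ∂P‖
        ≤ ∑ h' ∈ F, K ^ 2 * ‖∫ ω, y h ω * conj (y h' ω) ∂P‖ := by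
          refine Finset.sum_le_sum fun h' _ => ?_
          rw [integral_const_mul, norm_mul, Complex.norm_real, Real.norm_eq_abs, abs_mul, sq]
          gcongr
          · exact (abs_nonneg _).trans (hc h)
          · exact hc h
          · exact hc h'
      _ = K ^ 2 * ∑ h' ∈ F, ‖∫ ω, y h ω * conj (y h' ω) ∂P‖ := by rw [Finset.mul_sum]
      _ ≤ K ^ 2 * (2 * ∫ ω, ‖y h ω‖ ^ 2 ∂P) := by gcongr; exact hrow h
      _ = _ := by ring
  have hS : Integrable (fun ω => ‖∑ h ∈ F, (c h : ℂ) * y h ω‖ ^ 2) P := by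
    simp only [hre]; exact hint.re
  simp only [hsq]
  rw [← ofReal_integral_eq_lintegral_ofReal hS (Eventually.of_forall fun ω => by positivity)]
  simp only [← ofReal_integral_eq_lintegral_ofReal (hV _)
    (Eventually.of_forall fun ω => sq_nonneg ‖y _ ω‖)]
  rw [← ENNReal.ofReal_sum_of_nonneg fun h _ => integral_nonneg fun ω => by positivity,
    ← ENNReal.ofReal_mul (by positivity)]
  exact ENNReal.ofReal_le_ofReal hmain

end SecondMoment

/-! ### Second moment and regularity of B(z,z). -/

section Quadratic

variable {Ω : Type*} [mΩ : MeasurableSpace Ω] {P : Measure Ω} {H : ℝ} {b b' : Idx → ℝ → Ω → ℂ}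
  {β ρ : ℝ} {κ : Idx → Ω → ℝ} {m : ℝ≥0∞}

lemma ClsMeas.integral_mul_three_eq_zero [P.IsComplete] (hb : IsCylFBM H b P) {x a c d : Idx}
    {X U V W : Ω → ℂ} (hX : ClsMeas b P {cls x} X) (hU : ClsMeas b P {cls a} U)
    (hV : ClsMeas b P {cls c} V) (hW : ClsMeas b P {cls d} W)
    (ha : x.1 ≠ a.1 ∧ x.1 ≠ -a.1) (hc : x.1 ≠ c.1 ∧ x.1 ≠ -c.1) (hd : x.1 ≠ d.1 ∧ x.1 ≠ -d.1)
    (h0 : ∫ ω, X ω ∂P = 0) : ∫ ω, X ω * (U ω * (V ω * W ω)) ∂P = 0 := by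
  have hne : ∀ y : Idx, x.1 ≠ y.1 ∧ x.1 ≠ -y.1 → cls x ≠ cls y := fun y hy e => by
    rcases eq_or_eq_opp_of_cls_eq e with h | h
    · exact hy.1 (congrArg Subtype.val h)
    · exact hy.2 (congrArg Subtype.val h)
  refine hb.integral_mul_eq_zero (A := {cls x}) (B := {cls a, cls c, cls d}) ?_ hX
    ((hU.mono ?_).mul ((hV.mono ?_).mul (hW.mono ?_))) h0
  · simp [hne a ha, hne c hc, hne d hd]
  all_goals simp

lemma IsTame.integral_products_eq_zero [IsProbabilityMeasure P] [P.IsComplete]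
    (h : IsTame β ρ κ b') (hβ : 0 < β) (hb : IsCylFBM H b P)
    (hbb : ∀ᵐ ω ∂P, ∀ k t, b' k t ω = b k t ω) (hm : m ≠ ∞)
    (hmom : ∀ k, ∫⁻ ω, ENNReal.ofReal (κ k ω ^ 4) ∂P ≤ m) (t : ℝ) (k : Idx)
    (q q' : {h : Idx // h ≠ k}) (h1 : q' ≠ q) (h2 : q' ≠ reflEquiv k q) :
    ∫ ω, convZ b' t ω q.1 * convZ b' t ω (k.diff q) *
      conj (convZ b' t ω q'.1 * convZ b' t ω (k.diff q')) ∂P = 0 := by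
  have hz := fun x => h.clsMeas_convZ hβ hbb x t
  have h0 := fun x => h.integral_convZ_eq_zero hβ hb hbb hm hmom x t
  have h0' : ∀ x, ∫ ω, conj (convZ b' t ω x) ∂P = 0 := fun x => by
    rw [integral_conj, h0, map_zero]
  have key := exists_unmatched (h := q.1.1) (l := (k.diff q).1) (h' := q'.1.1)
    (l' := (k.diff q').1) (by simp [Idx.diff_val]) (by simpa [Idx.diff_val] using k.2) q.1.2
    (fun e => h1 (Subtype.ext (Subtype.ext e)))
    (fun e => h2 (Subtype.ext (Subtype.ext e)))
  have hcongr : ∀ g : Ω → ℂ, ∫ ω, g ω ∂P = 0 → (∀ ω, convZ b' t ω q.1 * convZ b' t ω (k.diff q) *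
      conj (convZ b' t ω q'.1 * convZ b' t ω (k.diff q')) = g ω) →
      ∫ ω, convZ b' t ω q.1 * convZ b' t ω (k.diff q) *
      conj (convZ b' t ω q'.1 * convZ b' t ω (k.diff q')) ∂P = 0 := fun g hg e => by
    simp only [e]; exact hg
  rcases key with ⟨n1, n2, n3⟩ | ⟨n1, n2, n3⟩ | ⟨n1, n2, n3⟩ | ⟨n1, n2, n3⟩
  · refine hcongr _ (ClsMeas.integral_mul_three_eq_zero hb (hz q.1) (hz (k.diff q)) (hz q'.1).conj
      (hz (k.diff q')).conj n1 n2 n3 (h0 _)) fun ω => ?_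
    rw [map_mul]; ring
  · refine hcongr _ (ClsMeas.integral_mul_three_eq_zero hb (hz (k.diff q)) (hz q.1) (hz q'.1).conj
      (hz (k.diff q')).conj n1 n2 n3 (h0 _)) fun ω => ?_
    rw [map_mul]; ring
  · refine hcongr _ (ClsMeas.integral_mul_three_eq_zero hb (hz q'.1).conj (hz q.1) (hz (k.diff q))
      (hz (k.diff q')).conj n1 n2 n3 (h0' _)) fun ω => ?_
    rw [map_mul]; ring
  · refine hcongr _ (ClsMeas.integral_mul_three_eq_zero hb (hz (k.diff q')).conj (hz q.1)
      (hz (k.diff q)) (hz q'.1).conj n1 n2 n3 (h0' _)) fun ω => ?_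
    rw [map_mul]; ring

/-- No covariance of z is computed: the pathwise bound and the fourth moments of the Hölder
constants give the right decay in both indices. -/
lemma IsTame.lintegral_product_le (h : IsTame β ρ κ b')
    (hmom : ∀ k, ∫⁻ ω, ENNReal.ofReal (κ k ω ^ 4) ∂P ≤ m) {C t : ℝ} (hC : 0 ≤ C)
    (hz : ∀ k ω, ‖convZ b' t ω k‖ ≤ C * κ k ω * len k.1 ^ (-(2 * β))) (x y : Idx) :
    ∫⁻ ω, ‖convZ b' t ω x * convZ b' t ω y‖ₑ ^ 2 ∂P ≤
      ENNReal.ofReal (C ^ 4) * m * (wt (-(2 * β)) x * wt (-(2 * β)) y) := by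
  have hpt : ∀ ω, ‖convZ b' t ω x * convZ b' t ω y‖ₑ ^ 2 ≤
      ENNReal.ofReal (C ^ 4) * (wt (-(2 * β)) x * wt (-(2 * β)) y) *
        (ENNReal.ofReal (1 / 2) *
          (ENNReal.ofReal (κ x ω ^ 4) + ENNReal.ofReal (κ y ω ^ 4))) := fun ω => by
    have hx0 := len_pos x
    have hy0 := len_pos y
    have hκx := h.nonneg x ω
    have hκy := h.nonneg y ω
    have e : ∀ k : Idx, (len k.1 ^ (-(2 * β))) ^ 2 = len k.1 ^ (2 * -(2 * β)) := fun k => by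
      rw [← Real.rpow_natCast, ← Real.rpow_mul (len_pos k).le]; congr 1; push_cast; ring
    unfold wt
    rw [← ofReal_norm, ← ENNReal.ofReal_pow (norm_nonneg _), ← ENNReal.ofReal_add
      (by positivity) (by positivity), ← ENNReal.ofReal_mul (by positivity),
      ← ENNReal.ofReal_mul (by positivity), ← ENNReal.ofReal_mul (by positivity),
      ← ENNReal.ofReal_mul (by positivity)]
    refine ENNReal.ofReal_le_ofReal ?_
    rw [norm_mul, ← e, ← e]
    calc (‖convZ b' t ω x‖ * ‖convZ b' t ω y‖) ^ 2
        ≤ ((C * κ x ω * len x.1 ^ (-(2 * β))) * (C * κ y ω * len y.1 ^ (-(2 * β)))) ^ 2 := by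
          gcongr
          · exact hz x ω
          · exact hz y ω
      _ = C ^ 4 * ((len x.1 ^ (-(2 * β))) ^ 2 * (len y.1 ^ (-(2 * β))) ^ 2) *
          (κ x ω ^ 2 * κ y ω ^ 2) := by ring
      _ ≤ _ := by
          refine mul_le_mul_of_nonneg_left ?_ (by positivity)
          nlinarith [sq_nonneg (κ x ω ^ 2 - κ y ω ^ 2)]
  refine (lintegral_mono hpt).trans ?_
  have hmk := fun k => ((h.meas_const k).pow_const 4).ennreal_ofReal
  have hmk' : Measurable fun ω => ENNReal.ofReal (κ x ω ^ 4) + ENNReal.ofReal (κ y ω ^ 4) :=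
    (hmk x).add (hmk y)
  rw [lintegral_const_mul _ (hmk'.const_mul _), lintegral_const_mul _ hmk',
    lintegral_add_left (hmk x)]
  have h2 : ENNReal.ofReal (1 / 2) * (∫⁻ ω, ENNReal.ofReal (κ x ω ^ 4) ∂P +
      ∫⁻ ω, ENNReal.ofReal (κ y ω ^ 4) ∂P) ≤ m := by
    calc _ ≤ ENNReal.ofReal (1 / 2) * (m + m) := by gcongr <;> exact hmom _
      _ = m := by
        rw [← two_mul, ← mul_assoc, show (2 : ℝ≥0∞) = ENNReal.ofReal 2 by simp,
          ← ENNReal.ofReal_mul (by norm_num)]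
        norm_num
  calc _ ≤ ENNReal.ofReal (C ^ 4) * (wt (-(2 * β)) x * wt (-(2 * β)) y) * m := by gcongr
    _ = _ := by ring

/-- Orthogonality replaces the square of a convolution by the convolution of the squares, which is
the gain over the deterministic product estimate. It is applied to finite partial sums, and Fatou
passes to the series. -/
lemma IsTame.lintegral_enorm_bil_sq_le [IsProbabilityMeasure P] [P.IsComplete]
    (h : IsTame β ρ κ b') (hβ : 0 < β) (hρ : 0 ≤ ρ) (hb : IsCylFBM H b P)
    (hbb : ∀ᵐ ω ∂P, ∀ k t, b' k t ω = b k t ω) (hm : m ≠ ∞)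
    (hmom : ∀ k, ∫⁻ ω, ENNReal.ofReal (κ k ω ^ 4) ∂P ≤ m) {C T t : ℝ} (hC : 0 ≤ C) (hT : 0 ≤ T)
    (ht : t ∈ Set.Icc 0 T)
    (hz : ∀ k ω, ‖convZ b' t ω k‖ ≤ C * κ k ω * len k.1 ^ (-(2 * β))) (k : Idx) :
    ∫⁻ ω, ‖bil (convZ b' t ω) (convZ b' t ω) k‖ₑ ^ 2 ∂P ≤
      2 * wt 1 k * (ENNReal.ofReal (C ^ 4) * m *
        conv (wt (-(2 * β))) (wt (-(2 * β))) k) := by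
  have hmz : ∀ x, Measurable fun ω => convZ b' t ω x := fun x =>
    (measurable_pi_apply x).comp (h.measurable_convZ t)
  have hprod := fun x y => h.lintegral_product_le (P := P) hmom hC hz x y
  have hlp : ∀ x y, MemLp (fun ω => convZ b' t ω x * convZ b' t ω y) 2 P := fun x y => by
    refine ⟨((hmz x).mul (hmz y)).aestronglyMeasurable, ?_⟩
    rw [eLpNorm_lt_top_iff_lintegral_rpow_enorm_lt_top (by norm_num) (by norm_num)]
    refine lt_of_le_of_lt ?_ (lt_of_le_of_lt (hprod x y) (ENNReal.mul_lt_top (ENNReal.mul_lt_top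
      ENNReal.ofReal_lt_top hm.lt_top) (ENNReal.mul_lt_top (wt_ne_top _ _).lt_top
      (wt_ne_top _ _).lt_top)))
    simp
  have hint : ∀ x y x' y', Integrable (fun ω => convZ b' t ω x * convZ b' t ω y *
      conj (convZ b' t ω x' * convZ b' t ω y')) P := fun x y x' y' =>
    (hlp x y).integrable_mul (hlp x' y').star
  let F : ℕ → Finset {h : Idx // h ≠ k} := fun n => (box n).subtype (· ≠ k)
  have hF : Tendsto F atTop atTop := by
    refine tendsto_atTop_finset_of_monotone (fun n n' hn x hx => ?_) fun x => ?_
    · simp only [F, Finset.mem_subtype] at hx ⊢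
      exact box_mono hn hx
    · obtain ⟨n, hn⟩ := (tendsto_box.eventually (eventually_ge_atTop {x.1})).exists
      exact ⟨n, by simpa [F] using hn⟩
  have hsum : ∀ n, ∫⁻ ω, ‖∑ q ∈ F n, (gam q.1.1 k.1 : ℂ) *
      (convZ b' t ω q.1 * convZ b' t ω (k.diff q))‖ₑ ^ 2 ∂P ≤ 2 * wt 1 k *
        (ENNReal.ofReal (C ^ 4) * m * conv (wt (-(2 * β))) (wt (-(2 * β))) k) := fun n => by
    refine (lintegral_enorm_sum_sq_le (τ := reflEquiv k) (fun q q' => hint _ _ _ _)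
      (fun q => funext fun ω => ?_)
      (fun q q' => h.integral_products_eq_zero hβ hb hbb hm hmom t k q q')
      (fun q => abs_gam_le _ _) (F n)).trans ?_
    · rw [reflEquiv_coe, diff_reflEquiv, mul_comm]
    · have e : ENNReal.ofReal (2 * len k.1 ^ 2) = 2 * wt 1 k := by
        rw [wt_one, ENNReal.ofReal_mul (by norm_num), ENNReal.ofReal_pow (len_nonneg _)]
        simp
      rw [e]
      gcongr
      refine (Finset.sum_le_sum fun q _ => hprod _ _).trans ?_
      rw [← Finset.mul_sum]
      gcongr
      exact ENNReal.sum_le_tsum _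
  have hlim : ∀ ω, Tendsto (fun n => ‖∑ q ∈ F n, (gam q.1.1 k.1 : ℂ) *
      (convZ b' t ω q.1 * convZ b' t ω (k.diff q))‖ₑ ^ 2) atTop
      (𝓝 (‖bil (convZ b' t ω) (convZ b' t ω) k‖ₑ ^ 2)) := fun ω => by
    have hn : normSq 0 (convZ b' t ω) ≠ ∞ := by
      have := (h.hcont_convZ hβ hT ω).1.1 t
      simp only at this
      rw [clamp_of_mem ht] at this
      exact ne_top_of_le_ne_top this (normSq_mono hρ _)
    have hs := (bilConv_of_normSq hn hn k).hasSum.comp hF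
    have e : ‖bil (convZ b' t ω) (convZ b' t ω) k‖ₑ =
        ‖∑' q, bilTerm (convZ b' t ω) (convZ b' t ω) k q‖ₑ := by
      unfold bil
      rw [enorm_mul, show ‖Complex.I‖ₑ = 1 by simp [← ofReal_norm], one_mul]
    rw [e]
    refine ((ENNReal.continuous_pow 2).tendsto _).comp (hs.enorm.congr fun n => ?_)
    simp only [Function.comp, bilTerm, mul_assoc]
  calc _ = ∫⁻ ω, liminf (fun n => ‖∑ q ∈ F n, (gam q.1.1 k.1 : ℂ) *
      (convZ b' t ω q.1 * convZ b' t ω (k.diff q))‖ₑ ^ 2) atTop ∂P :=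
        lintegral_congr fun ω => (hlim ω).liminf_eq.symm
    _ ≤ liminf (fun n => ∫⁻ ω, ‖∑ q ∈ F n, (gam q.1.1 k.1 : ℂ) *
      (convZ b' t ω q.1 * convZ b' t ω (k.diff q))‖ₑ ^ 2 ∂P) atTop := by
        refine lintegral_liminf_le fun n => ?_
        exact (Finset.measurable_sum _ fun q _ =>
          ((hmz q.1).mul (hmz (k.diff q))).const_mul _).enorm.pow_const 2
    _ ≤ _ := liminf_le_of_le (by isBoundedDefault) fun a ha => by
        obtain ⟨n, hn⟩ := ha.exists
        exact hn.trans (hsum n)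

/-- The weight is shared between the two factors, after which the double sum is a product of lattice
sums of |k|^{2r−4β} and |k|^{−4β}, finite because r + 1 < 2β. -/
lemma tsum_wt_mul_conv_ne_top {r : ℝ} (h0 : 0 ≤ r) (h1 : r ≤ 1) (hβ : r + 1 < 2 * β) :
    ∑' k, wt r k * conv (wt (-(2 * β))) (wt (-(2 * β))) k ≠ ∞ := by
  have hS : ∀ s, 0 ≤ s → s ≤ r → ∑' k, wt s k * wt (-(2 * β)) k ≠ ∞ := fun s _ hs => by
    have := tsum_len_ne_top (s := 2 * β - s) (by linarith)
    refine ne_top_of_le_ne_top this (ENNReal.tsum_le_tsum fun k => le_of_eq ?_)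
    rw [← wt_add, wt]
    congr 2; ring
  have hS0 : ∑' k, wt (-(2 * β)) k ≠ ∞ := by
    simpa only [wt_zero, one_mul] using hS 0 le_rfl h0
  have hSr := hS r h0 le_rfl
  set A := wt (-(2 * β)) with hA
  have hle : ∀ k, wt r k * conv A A k ≤ ∑' q : {q : Idx // q ≠ k},
      2 * ((wt r q.1 * A q.1) * A (k.diff q) + A q.1 * (wt r (k.diff q) * A (k.diff q))) := by
    intro k
    unfold conv
    rw [← ENNReal.tsum_mul_left]
    refine ENNReal.tsum_le_tsum fun q => ?_
    have hw : wt r k ≤ 2 * (wt r q.1 + wt r (k.diff q)) := by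
      rw [← wt_half_sq r k, ← wt_half_sq r q.1, ← wt_half_sq r (k.diff q)]
      exact (pow_le_pow_left' (wt_half_le k q h0 h1) 2).trans (add_sq_le_two_mul _ _)
    calc _ ≤ 2 * (wt r q.1 + wt r (k.diff q)) * (A q.1 * A (k.diff q)) := by gcongr
      _ = _ := by ring
  refine ne_top_of_le_ne_top ?_ ((ENNReal.tsum_le_tsum hle).trans (tsum_triad_le fun x y =>
    2 * ((wt r x * A x) * A y + A x * (wt r y * A y))))
  simp only [ENNReal.tsum_mul_left, ENNReal.tsum_add, ENNReal.tsum_mul_right]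
  refine ENNReal.mul_ne_top (by norm_num) (ENNReal.add_ne_top.2 ⟨?_, ?_⟩)
  · exact ENNReal.mul_ne_top hSr hS0
  · exact ENNReal.mul_ne_top hS0 hSr

lemma IsTame.measurable_normSq_bil (h : IsTame β ρ κ b') (hβ : 0 < β) (r : ℝ) :
    Measurable fun p : Ω × ℝ => normSq r (bil (convZ b' p.2 p.1) (convZ b' p.2 p.1)) :=
  (measurable_normSq r).comp ((measurable_pi_lambda _ measurable_bil_apply).comp
    (h.measurable_uncurry_convZ hβ))

/-- The second moments are bounded uniformly for t in [0,T], so by Tonelli the time integral has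
finite expectation. -/
theorem IsTame.ae_lintegral_normSq_bil_ne_top [IsProbabilityMeasure P] [P.IsComplete]
    (h : IsTame β ρ κ b') (hβ : 0 < β) (hρ : 0 ≤ ρ) (hb : IsCylFBM H b P)
    (hbb : ∀ᵐ ω ∂P, ∀ k t, b' k t ω = b k t ω) (hm : m ≠ ∞)
    (hmom : ∀ k, ∫⁻ ω, ENNReal.ofReal (κ k ω ^ 4) ∂P ≤ m) {r T : ℝ} (hT : 0 ≤ T)
    (h0 : 0 ≤ r) (h1 : r ≤ 1) (hr : r + 1 < 2 * β) :
    ∀ᵐ ω ∂P, ∫⁻ t in Set.Icc 0 T,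
      normSq (r - 1) (bil (convZ b' t ω) (convZ b' t ω)) ≠ ∞ := by
  obtain ⟨C, hC, hz⟩ := h.exists_norm_convZ_le hβ hT
  have hmeas := h.measurable_normSq_bil hβ (r - 1)
  set S := ∑' k, wt r k * conv (wt (-(2 * β))) (wt (-(2 * β))) k with hS
  have hbd : ∀ t ∈ Set.Icc 0 T, ∫⁻ ω, normSq (r - 1) (bil (convZ b' t ω) (convZ b' t ω)) ∂P ≤
      2 * (ENNReal.ofReal (C ^ 4) * m) * S := fun t ht => by
    have hmb : ∀ k, Measurable fun ω => ‖bil (convZ b' t ω) (convZ b' t ω) k‖ₑ ^ 2 := fun k =>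
      ((measurable_bil_apply k).comp (h.measurable_convZ t)).enorm.pow_const 2
    simp only [normSq_eq_nE, nE, modl]
    rw [lintegral_tsum fun k => ((hmb k).const_mul _).aemeasurable, hS, ← ENNReal.tsum_mul_left]
    refine ENNReal.tsum_le_tsum fun k => ?_
    rw [lintegral_const_mul _ (hmb k)]
    calc _ ≤ wt (r - 1) k * (2 * wt 1 k * (ENNReal.ofReal (C ^ 4) * m *
        conv (wt (-(2 * β))) (wt (-(2 * β))) k)) := by
          gcongr
          exact h.lintegral_enorm_bil_sq_le hβ hρ hb hbb hm hmom hC hT ht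
            (fun k ω => hz k ω t ht) k
      _ = 2 * (ENNReal.ofReal (C ^ 4) * m) * ((wt (r - 1) k * wt 1 k) *
        conv (wt (-(2 * β))) (wt (-(2 * β))) k) := by ring
      _ = _ := by rw [← wt_add, sub_add_cancel]
  have hfin : ∫⁻ ω, (∫⁻ t in Set.Icc 0 T,
      normSq (r - 1) (bil (convZ b' t ω) (convZ b' t ω))) ∂P ≠ ∞ := by
    rw [lintegral_lintegral_swap hmeas.aemeasurable]
    refine ne_top_of_le_ne_top ?_ (setLIntegral_mono' measurableSet_Icc hbd)
    rw [setLIntegral_const]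
    exact ENNReal.mul_ne_top (ENNReal.mul_ne_top (ENNReal.mul_ne_top (by norm_num)
      (ENNReal.mul_ne_top ENNReal.ofReal_ne_top hm)) (tsum_wt_mul_conv_ne_top h0 h1 hr)) (by simp)
  filter_upwards [ae_lt_top hmeas.lintegral_prod_right' hfin] with ω hω
  exact hω.ne

end Quadratic

/-! ### Global existence -/

lemma HCont.contPath {r T : ℝ} {f : ℝ → Coeff} (h : HCont r f) (hr : ∀ t, IsReal (f t)) :
    ContPath r T f :=
  ⟨fun t _ => ⟨hr t, (h.1 t).lt_top⟩, fun t _ => (h.2 t).mono_left nhdsWithin_le_nhds⟩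

lemma HCont.l2Path {r s T : ℝ} {f : ℝ → Coeff} (h : HCont s f) (hs : 0 ≤ s)
    (hr : ∀ t, IsReal (f t)) (hL2 : ∫⁻ t in Set.Icc 0 T, normSq r (f t) ≠ ∞) : L2Path r T f := by
  have hc := fun k => (h.mono hs).continuous_apply k
  have hm : Measurable fun t => normSq r (f t) :=
    (measurable_normSq r).comp (measurable_pi_lambda _ fun k => (hc k).measurable)
  exact ⟨fun k => (hc k).aemeasurable, (ae_lt_top hm hL2).mono fun t ht => ⟨hr t, ht⟩,
    hL2.lt_top⟩

/-- The random auxiliary equation has a global solution, measurable in the random parameter. -/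
theorem exists_measurable_solution {Ω : Type*} [MeasurableSpace Ω] {σ ε T : ℝ} (hε : 0 < ε)
    (hεσ : ε ≤ σ) (hσ : σ + 2 * ε < 1) (hT : 0 ≤ T) {z : ℝ → Ω → Coeff}
    (hzm : Measurable fun p : Ω × ℝ => z p.2 p.1) (hzc : ∀ ω, HCont (σ + 2 * ε) fun t => z t ω)
    (hzr : ∀ t ω, IsReal (z t ω))
    (hzM : ∀ ω, ∃ M : ℝ, 0 ≤ M ∧ ∀ t, normSq (σ + 2 * ε) (z t ω) ≤ ENNReal.ofReal M)
    (hzz : ∀ ω, ∫⁻ s in Set.Icc 0 T, normSq (σ + ε - 1) (bil (z s ω) (z s ω)) ≠ ∞)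
    {x₀ : Ω → Coeff} (hx₀ : Measurable x₀) (hx₀r : ∀ ω, IsReal (x₀ ω))
    (hx₀σ : ∀ ω, normSq σ (x₀ ω) ≠ ∞) :
    ∃ u : ℝ → Ω → Coeff, (∀ t, Measurable (u t)) ∧ ∀ ω,
      (HCont σ fun t => u t ω) ∧ (∀ t, IsReal (u t ω)) ∧
      ∫⁻ t in Set.Icc 0 T, normSq (1 + σ) (u t ω) ≠ ∞ ∧ u 0 ω = x₀ ω ∧
      ∀ t ∈ Set.Icc 0 T, ∀ k, u t ω k - x₀ ω k =
        ∫ s in (0 : ℝ)..t, (-((len k.1 ^ 2 : ℝ) : ℂ) * u s ω k -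
          bil (u s ω + z s ω) (u s ω + z s ω) k) := by
  have hz0 : ∀ ω, HCont 0 fun t => z t ω := fun ω => (hzc ω).mono (by linarith)
  have hG := fun n => exists_galerkin (K := box n) (opp_mem_box (n := n)) hT (by linarith) hσ
    hzm hz0 hzr hzM hx₀ hx₀r
  choose w hwm hw using hG
  have hU := fun ω => exists_galerkin_limit hε hεσ hσ hT (hz0 ω) (hzM ω).choose_spec.1
    (hzM ω).choose_spec.2 (hzz ω) (hx₀σ ω) (u := fun n t => w n t ω) (fun n => (hw n ω).1)
    (fun n => (hw n ω).2)
  choose U hlim hU using hU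
  refine ⟨fun t ω => U ω t, fun t => measurable_pi_lambda _ fun k => ?_, hU⟩
  -- The whole sequence converges at every ω and every mode, so the limit is measurable without any
  -- selection.
  exact measurable_of_tendsto_metrizable (fun n => (measurable_pi_apply k).comp (hwm n (clamp T t)))
    (tendsto_pi_nhds.2 fun ω => hlim ω t k)

section Main

variable {Ω : Type*} [MeasurableSpace Ω] {P : Measure Ω} {H : ℝ} {b b' : Idx → ℝ → Ω → ℂ}
  {β ρ : ℝ} {κ : Idx → Ω → ℝ} {m : ℝ≥0∞}

/-- A version of the Stokes process on `[0,T]` all of whose paths are regular. -/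
lemma IsTame.exists_regular_version [IsProbabilityMeasure P] [P.IsComplete]
    (h : IsTame β ρ κ b') (hβ : 0 < β) (hρ : 0 ≤ ρ) (hb : IsCylFBM H b P)
    (hbb : ∀ᵐ ω ∂P, ∀ k t, b' k t ω = b k t ω) (hm : m ≠ ∞)
    (hmom : ∀ k, ∫⁻ ω, ENNReal.ofReal (κ k ω ^ 4) ∂P ≤ m) {r T : ℝ} (hT : 0 ≤ T)
    (h0 : 0 ≤ r) (h1 : r ≤ 1) (hr : r + 1 < 2 * β) :
    ∃ z : ℝ → Ω → Coeff, (Measurable fun p : Ω × ℝ => z p.2 p.1) ∧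
      (∀ ω, HCont ρ fun t => z t ω) ∧ (∀ t ω, IsReal (z t ω)) ∧
      (∀ ω, ∃ M : ℝ, 0 ≤ M ∧ ∀ t, normSq ρ (z t ω) ≤ ENNReal.ofReal M) ∧
      (∀ ω, ∫⁻ t in Set.Icc 0 T, normSq (r - 1) (bil (z t ω) (z t ω)) ≠ ∞) ∧
      ∀ᵐ ω ∂P, ∀ t ∈ Set.Icc 0 T, z t ω = convZ b' t ω := by
  classical
  -- The event of full probability where B(z,z) is regular; off it z is set to zero, so that the
  -- deterministic theory applies at every ω.
  set G : Set Ω := {ω | ∫⁻ t in Set.Icc 0 T,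
    normSq (r - 1) (bil (convZ b' t ω) (convZ b' t ω)) ≠ ∞} with hGdef
  have hG : MeasurableSet G :=
    (h.measurable_normSq_bil hβ (r - 1)).lintegral_prod_right' (measurableSet_singleton ∞).compl
  have hzero : ∀ s, normSq s 0 = 0 := fun s => by simp [normSq]
  refine ⟨fun t ω => if ω ∈ G then convZ b' (clamp T t) ω else 0, ?_, fun ω => ?_, fun t ω => ?_,
    fun ω => ?_, fun ω => ?_, ?_⟩
  · exact Measurable.ite (measurable_fst hG) ((h.measurable_uncurry_convZ hβ).comp
      (measurable_fst.prodMk ((continuous_clamp T).measurable.comp measurable_snd)))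
      measurable_const
  · by_cases hω : ω ∈ G
    · simp only [if_pos hω]; exact (h.hcont_convZ hβ hT ω).1
    · simp only [if_neg hω]
      exact ⟨fun t => by simp [hzero], fun t => by simp [hzero]⟩
  · by_cases hω : ω ∈ G
    · simp only [if_pos hω]; exact h.isReal_convZ _ ω
    · simp only [if_neg hω]; intro k; simp
  · by_cases hω : ω ∈ G
    · simp only [if_pos hω]; exact (h.hcont_convZ hβ hT ω).2
    · simp only [if_neg hω]; exact ⟨0, le_rfl, fun t => by simp [hzero]⟩
  · by_cases hω : ω ∈ G
    · simp only [if_pos hω]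
      rw [setLIntegral_congr_fun measurableSet_Icc
        (g := fun t => normSq (r - 1) (bil (convZ b' t ω) (convZ b' t ω)))
        (fun t ht => by simp only [clamp_of_mem ht])]
      exact hω
    · simp only [if_neg hω]
      have : bil 0 0 = 0 := by ext k; simp [bil, bilTerm]
      simp [this, hzero]
  · filter_upwards [h.ae_lintegral_normSq_bil_ne_top hβ hρ hb hbb hm hmom hT h0 h1 hr] with ω hω
    intro t ht
    have hG : ω ∈ G := hω
    simp only [if_pos hG, clamp_of_mem ht]

lemma IsTame.stokesZ_eq (h : IsTame β ρ κ b') (hβ : 0 < β) {ω : Ω}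
    (hω : ∀ k t, b' k t ω = b k t ω) (t : ℝ) : stokesZ b t ω = convZ b' t ω := by
  ext k
  have := (h.hasExpConv hβ k t ω).expConv_eq
  simp only [hω] at this
  exact this

/-- The sum of the Stokes process and of a solution of the auxiliary equation satisfies the
equation of the coefficients of the Navier–Stokes equation. -/
lemma IsTame.noise_eq (h : IsTame β ρ κ b') (hβ : 0 < β) {ω : Ω}
    (hω : ∀ k t, b' k t ω = b k t ω) {T : ℝ} {z u : ℝ → Coeff}
    (hz : HCont 0 z) (hu : HCont 0 u) (hzT : ∀ t ∈ Set.Icc 0 T, z t = convZ b' t ω)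
    (heq : ∀ t ∈ Set.Icc 0 T, ∀ k, u t k - u 0 k =
      ∫ s in (0 : ℝ)..t, (-((len k.1 ^ 2 : ℝ) : ℂ) * u s k - bil (u s + z s) (u s + z s) k))
    {t : ℝ} (ht : t ∈ Set.Icc 0 T) (k : Idx) :
    noise b t ω k = (u t + z t) k - (u 0 + z 0) k - ∫ s in (0 : ℝ)..t,
      (-((len k.1 ^ 2 : ℝ) : ℂ) * (u s + z s) k - bil (u s + z s) (u s + z s) k) := by
  have hz0 := hzT 0 ⟨le_rfl, ht.1.trans ht.2⟩
  have e1 := h.convZ_equation hβ k t ω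
  have e2 : ∫ s in (0 : ℝ)..t, convZ b' s ω k = ∫ s in (0 : ℝ)..t, z s k := by
    refine intervalIntegral.integral_congr fun s hs => ?_
    rw [Set.uIcc_of_le ht.1] at hs
    simp only [hzT s ⟨hs.1, hs.2.trans ht.2⟩]
  have hcz := hz.continuous_apply k
  have hcu := hu.continuous_apply k
  have hcb := (hu.add hz).continuous_bil (hu.add hz) k
  have e3 : ∫ s in (0 : ℝ)..t,
      (-((len k.1 ^ 2 : ℝ) : ℂ) * (u s + z s) k - bil (u s + z s) (u s + z s) k) =
      (∫ s in (0 : ℝ)..t,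
        (-((len k.1 ^ 2 : ℝ) : ℂ) * u s k - bil (u s + z s) (u s + z s) k)) +
      -((len k.1 ^ 2 : ℝ) : ℂ) * ∫ s in (0 : ℝ)..t, z s k := by
    have hc1 : Continuous fun s => -((len k.1 ^ 2 : ℝ) : ℂ) * u s k -
        bil (u s + z s) (u s + z s) k := (continuous_const.mul hcu).sub hcb
    have hc2 : Continuous fun s => -((len k.1 ^ 2 : ℝ) : ℂ) * z s k := continuous_const.mul hcz
    rw [← intervalIntegral.integral_const_mul, ← intervalIntegral.integral_add
      (hc1.intervalIntegrable _ _) (hc2.intervalIntegrable _ _)]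
    refine intervalIntegral.integral_congr fun s _ => ?_
    simp only [Pi.add_apply]; ring
  rw [e3, ← heq t ht k, ← e2, Pi.add_apply, Pi.add_apply, hzT t ht, hz0, noise, ← hω k t]
  linear_combination -e1

end Main

/-- The margin δ = 2H − 1 − σ is shared out: δ/8 each for ε, for H − α and for 2/p. The last
inequality then reads σ + 1 + δ/4 < σ + 1 + δ/2. -/
lemma exists_exponents {H σ : ℝ} (hH : H < 1) (hσ : 0 < σ) (hσH : σ < 2 * (H - 1 / 2)) :
    ∃ (ε α : ℝ) (p : ℕ), 0 < ε ∧ ε ≤ σ ∧ σ + 2 * ε < 1 ∧ α < H ∧ 4 ≤ p ∧ 2 / (p : ℝ) < α ∧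
      σ + 2 * ε + 1 < 2 * (α - 2 / p) := by
  obtain ⟨δ, hδ⟩ : ∃ δ, δ = 2 * H - 1 - σ := ⟨_, rfl⟩
  have hδ0 : 0 < δ := by linarith
  obtain ⟨n, hn⟩ := exists_nat_gt (16 / δ)
  have hp : (2 : ℝ) / ((n + 4 : ℕ) : ℝ) ≤ δ / 8 := by
    rw [div_lt_iff₀ hδ0] at hn
    rw [div_le_iff₀ (by positivity)]
    push_cast
    nlinarith
  have hε := min_le_right σ (δ / 8)
  refine ⟨min σ (δ / 8), H - δ / 8, n + 4, lt_min hσ (by linarith), min_le_left _ _, ?_, ?_, ?_, ?_,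
    ?_⟩
  · linarith
  · linarith
  · omega
  · linarith
  · linarith

end FracNS

end

theorem mainTheorem2 {Ω : Type*} [MeasurableSpace Ω] (P : Measure Ω) [IsProbabilityMeasure P]
    [P.IsComplete] (H σ T : ℝ) (hH : 1 / 2 < H) (hH1 : H < 1) (hσ : 0 < σ)
    (hσH : σ < 2 * (H - 1 / 2)) (hT : 0 < T)
    (b : FracNS.Idx → ℝ → Ω → ℂ) (hb : FracNS.IsCylFBM H b P)
    (v₀ : FracNS.Coeff) (hv₀ : FracNS.MemH σ v₀) :
    -- the integrals that define the stationary Stokes process `z` converge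
    (∀ᵐ ω ∂P, ∀ (k : FracNS.Idx) (t : ℝ),
      FracNS.HasExpConv (FracNS.len k.1 ^ 2) (fun s => b k s ω) t (FracNS.stokesZ b t ω k)) ∧
    ∃ u v : ℝ → Ω → FracNS.Coeff,
      -- `u` solves the auxiliary equation
      (∀ t ∈ Set.Icc 0 T, Measurable (u t)) ∧
      (∀ᵐ ω ∂P,
        FracNS.ContPath σ T (fun t => u t ω) ∧
        FracNS.L2Path (1 + σ) T (fun t => u t ω) ∧
        u 0 ω = v₀ - FracNS.stokesZ b 0 ω ∧
        FracNS.IsWeakSolAux T (fun t => FracNS.stokesZ b t ω) (fun t => u t ω)) ∧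
      -- `v = z + u` solves the stochastic Navier–Stokes equation
      (∀ t ∈ Set.Icc 0 T, Measurable (v t)) ∧
      (∀ᵐ ω ∂P,
        (∀ t ∈ Set.Icc 0 T, v t ω = FracNS.stokesZ b t ω + u t ω) ∧
        FracNS.ContPath σ T (fun t => v t ω) ∧
        v 0 ω = v₀ ∧
        FracNS.IsWeakSolNS σ T (fun t => FracNS.noise b t ω) (fun t => v t ω)) := by
  obtain ⟨ε, α, p, hε, hεσ, hσ1, hα, hp, hpα, hρ⟩ := FracNS.exists_exponents hH1 hσ hσH
  obtain ⟨b', κ, m, h, hbb, hm, hmom⟩ := hb.exists_isTame (by linarith) hα hp hpα hρ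
  have hβ : 0 < α - 2 / (p : ℝ) := by linarith
  -- The value r = σ + ε gives B(z,z) the ε extra derivatives behind the convergence rate; it is
  -- admissible since σ + 2ε + 1 < 2β.
  obtain ⟨z, hzm, hzc, hzr, hzM, hzz, hzb⟩ := h.exists_regular_version hβ (by linarith) hb hbb hm
    hmom hT.le (r := σ + ε) (by linarith) (by linarith) (by linarith)
  have hzσ : ∀ ω, FracNS.HCont σ fun t => z t ω := fun ω => (hzc ω).mono (by linarith)
  have hz0m : ∀ t, Measurable (z t) := fun t => hzm.comp (measurable_id.prodMk measurable_const)
  obtain ⟨u, hum, hu⟩ := FracNS.exists_measurable_solution hε hεσ hσ1 hT.le hzm hzc hzr hzM hzz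
    (x₀ := fun ω => v₀ - z 0 ω) (measurable_const.sub (hz0m 0))
    (fun ω => FracNS.IsReal.sub hv₀.1 (hzr 0 ω)) (fun ω => ne_top_of_le_ne_top
      (ENNReal.mul_ne_top (by norm_num) (ENNReal.add_ne_top.2 ⟨hv₀.2.ne, (hzσ ω).1 0⟩))
      (FracNS.normSq_sub_le _ _ _))
  have hzst : ∀ᵐ ω ∂P, (∀ k t, b' k t ω = b k t ω) ∧
      (∀ t, FracNS.stokesZ b t ω = FracNS.convZ b' t ω) ∧
      ∀ t ∈ Set.Icc 0 T, z t ω = FracNS.convZ b' t ω := by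
    filter_upwards [hbb, hzb] with ω h1 h2
    exact ⟨h1, h.stokesZ_eq hβ h1, h2⟩
  have h0T : (0 : ℝ) ∈ Set.Icc 0 T := ⟨le_rfl, hT.le⟩
  have heq : ∀ ω, ∀ t ∈ Set.Icc 0 T, ∀ k, u t ω k - u 0 ω k = ∫ s in (0 : ℝ)..t,
      (-((FracNS.len k.1 ^ 2 : ℝ) : ℂ) * u s ω k - FracNS.bil (u s ω + z s ω) (u s ω + z s ω) k) :=
    fun ω t ht k => by
      rw [← (hu ω).2.2.2.2 t ht k, (hu ω).2.2.2.1]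
  -- The regular version of z is used in v; almost surely it coincides with the Stokes process on
  -- [0,T].
  refine ⟨?_, u, fun t ω => u t ω + z t ω, fun t _ => hum t, ?_,
    fun t _ => (hum t).add (hz0m t), ?_⟩
  · filter_upwards [hzst] with ω hω k t
    have := h.hasExpConv hβ k t ω
    simp only [hω.1] at this
    rwa [hω.2.1]
  · filter_upwards [hzst] with ω hω
    obtain ⟨huc, hur, huL, hu0, -⟩ := hu ω
    refine ⟨huc.contPath hur, huc.l2Path hσ.le hur huL, ?_, ?_⟩
    · rw [hu0, hω.2.1, hω.2.2 0 h0T]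
    · refine (FracNS.isWeakSolAux_of_coeff hσ (by linarith) hT.le (hzσ ω) (fun t => hzr t ω) huc hur
        huL
        (ne_top_of_le_ne_top (hzz ω) (lintegral_mono fun t => FracNS.normSq_mono (by linarith) _))
        (heq ω)).congr hT.le (fun t ht => ?_) fun _ _ => rfl
      rw [hω.2.1, hω.2.2 t ht]
  · filter_upwards [hzst] with ω hω
    obtain ⟨huc, hur, huL, hu0, -⟩ := hu ω
    have hvr : ∀ t, FracNS.IsReal (u t ω + z t ω) := fun t => (hur t).add (hzr t ω)
    refine ⟨fun t ht => ?_, (huc.add (hzσ ω)).contPath hvr, ?_, ?_⟩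
    · rw [hω.2.1, hω.2.2 t ht, add_comm]
    · rw [hu0, sub_add_cancel]
    · exact FracNS.isWeakSolNS_of_coeff hσ (by linarith) hT.le (huc.add (hzσ ω)) hvr fun t ht k =>
        h.noise_eq hβ hω.1 ((hzσ ω).mono hσ.le) (huc.mono hσ.le) hω.2.2 (heq ω) ht k
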